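/- **Setting.** $R$ is a finite commutative ring with $1\neq 0$; $q(R)$ is the least cardinality of a nonzero ideal of $R$ (so $q(R)=|R|$ for a field); $\lg=\log_2$. $\mathcal D_\mu$ is the distribution on $R$ that is $0$ with probability $1-\mu$ and uniform with probability $\mu$; all sampled matrices have independent entries. *Adversaries* are nonuniform: circuits over $R$ with constant, addition, subtraction, multiplication and zero-test gates; the size is the number of gates. LPN in dimension $N$ with subspace dimension $k$, noise rate $\mu$ and $t$ columns asks to distinguish $(L,LH+S)$ from $(L,U)$, where $L\in R^{N\times k}$, $H\in R^{k\times t}$, $U\in R^{N\times t}$ are uniform and $S\leftarrow\mathcal D_\mu^{N\times t}$; it has *$b$-bit security against size $s$* if every circuit of size $\le s$ has advantage $\le 2^{-b}$. The *LPN assumption* for $(R,\delta,\epsilon)$: in dimension $N$, with subspace dimension $\lceil\delta N\rceil$ and noise rate $N^{\epsilon-1}$, circuits of size $\mathrm{poly}(N)$ have negligible advantage for $\mathrm{poly}(N)$ columns. **Protocol.** Inputs: $A\in R^{m\times n}$ and online a stream $B_0,B_1,\dots\in R^{n\times l}$. Parameters: dimensions $n=n_0,n_1,\dots,n_d$, noise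 rates $\mu_1,\dots,\mu_d$, number of checks $\lambda'$. Brackets $\langle\cdot\rangle$ denote values received from the server. *Initialization.* Round 1: the client sends uniform $L_i\in R^{n_{i-1}\times n_i}$ ($1\le i\le d$) and receives claimed products $\langle L_j^\top\cdots L_1^\top L_1\cdots L_i\rangle$, $0\le i,j\le d$. It checks each claim $P_i$ against its predecessor $P_{i-1}$ by testing $P_iX=P_{i-1}(L_iX)$ for a fresh uniform $X$ with $\lambda'$ columns, and aborts if a test fails. It samples a uniform $H\in R^{m\times n_d}$ and $S_i\leftarrow\mathcal D_{\mu_i}^{m\times n_{i-1}}$, and sets $A'=H\langle L_1\cdots L_d\rangle^\top+\sum_{i=0}^{d-1}S_{i+1}\langle L_1\cdots L_i\rangle^\top$. Round 2: it sends $A_{\rm enc}=A+A'$, receives claimed products $\langle A_{\rm enc}L_1\cdots L_i\rangle$, checks them in the same way (abort on failure), and computes $AL_1\cdots L_i=\langle A_{\rm enc}L_1\cdots L_i\rangle-H\langle L_d^\top\cdots L_1^\top L_1\cdots L_i\rangle-\sum_{j<d}S_{j+1}\langle L_j^\top\cdots L_1^\top L_1\cdots L_i\rangle$. *Online step for $B$*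 (one round): the client samples a uniform $G\in R^{n_d\times l}$ and $T_i\leftarrow\mathcal D_{\mu_i}^{n_{i-1}\times l}$, sends $B_{\rm enc}=B+\langle L_1\cdots L_d\rangle G+\sum_{i<d}\langle L_1\cdots L_i\rangle T_{i+1}$, computes $AB'=(AL_1\cdots L_d)G+\sum_{i<d}(AL_1\cdots L_i)T_{i+1}$, receives $\langle A_{\rm enc}B_{\rm enc}\rangle$ and $\langle (L_1\cdots L_i)^\top B_{\rm enc}\rangle$, and returns $\langle A_{\rm enc}B_{\rm enc}\rangle-AB'-H\langle (L_1\cdots L_d)^\top B_{\rm enc}\rangle-\sum_{i<d}S_{i+1}\langle (L_1\cdots L_i)^\top B_{\rm enc}\rangle$. **Costs** are numbers of ring operations; every element sent, received or sampled costs one, and multiplication by a sparse matrix costs two operations per nonzero entry and per row or column of the other factor, plus the size of the result. $k\times k$ matrices are multiplied with $\Theta(k^\omega)$ operations, $2\le\omega\le3$, and an $a\times b$ by $b\times c$ product is computed by cutting into blocks of side $\min(a,b,c)$. Client costs are expectations, and bound the cost against any server; server costs are those of the honest server. A protocol is *$(c_c,c_s)$-efficient* if client and server spend at most $c_c$ and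 $c_s$ times what they spend in the unprotected protocol, in which the client sends the inputs and the server multiplies and returns the products. **Parameters.** Let $D=\max(1,1/\lg(1/\delta))\cdot\lg n$ (so $D=\lg n$ for $\delta\le 1/2$). For a bound $s$ on the size of the server and of the distinguisher and a bound $T$ on the number of online steps, let $s'=(n+m+Tl+\lambda+s+2)^K$ with a universal constant $K$, and let $\iota$ be the least integer $\ge1$ such that, for every $k\ge\iota$, LPN in dimension $N=\lfloor k/\delta\rfloor$ with subspace dimension $k$, noise rate $N^{\epsilon-1}$ and $m+Tl$ columns has $(\lambda+\lg D+1)$-bit security against size $s'$. Let $\nu=\max(\lambda/\lg|R|,\iota)$. The protocol is run with $n_i=\max(\lceil\delta n_{i-1}\rceil,F)$, $F=\max(\lceil\nu\rceil,\lceil4/(1-\delta)\rceil)$, up to the first $n_d\le F$, with $\mu_i=n_{i-1}^{\epsilon-1}$ and $\lambda'=\lceil(\lambda+\lg D)/\lg q(R)\rceil$. **Theorem.** There is a universal $K$ such that the following holds for all $\lambda$, $T$, $s$, all $n,m,l\ge1$ and all $\delta,\epsilon\in(0,1)$ for which the LPN assumption for $(R,\delta,\epsilon)$ holds. * $\iota$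 is well defined (the least element of a nonempty set). * ($\lambda$-bit computational zero-knowledge.) For every, possibly dishonest, server of size $\le s$, all inputs, and $T$ online steps, no distinguisher of size $\le s$ tells the view of the server from that produced by the simulator, which runs the client on zero matrices, with advantage more than $2^{-\lambda}$. * If the server is honest, the client never aborts and returns exactly $AB_0,AB_1,\dots$. Any server (of any size) that gives a wrong reply in the initialization makes the client abort, except with probability $2^{-\lambda}$. * The initialization takes two rounds and an online step takes one. Suppose moreover that $\nu\le\kappa\delta n$, where $\kappa\ge1$ (with $\kappa=1/\delta$ this is $\nu\le n$). Then, with constants in $O(\cdot)$ that depend only on $\epsilon$, $\kappa$, an upper bound $\delta_0<1$ for $\delta$, a bound for $\lg|R|/\lg q(R)$ (which is $1$ for fields), $\omega$ and the constants in $\Theta(k^\omega)$ (and below on that in $\Omega$): * initialization costs $O(n(m+n)(n^\epsilon+\nu^{\omega-2}))$ to the client and $O(n^\omega\delta^{\omega-1}+n\max(m,\delta n)\min(m,\delta n)^{\omega-2})$ to the server; * an online step costs $O((m+n)l(n^\epsilon+\nu))$ to the client and, beyond one unprotected step (one $m\times n$-by-$n\times l$ multiplication), $O(n\max(\delta n,l)\min(\delta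 n,l)^{\omega-2})$ to the server; * for $T$ online steps, the communication from the client to the server is at most $1+O(\delta n/(m+Tl))$ times the input size $mn+Tnl$, and the communication in both directions exceeds the sum of input size and output size $Tml$ by at most $O(\delta+\delta n/(m+Tl))$ times the input size. If in addition $m=\Omega(n)$, the protocol is * $(O(n^\epsilon+\nu),\,1+O(\delta^{\omega-2}))$-efficient for Matrix-Matrix (one online step) if $l=\Omega(n)$; * $(O(n^\epsilon+\nu),\,1+O(\delta^{\omega-2}+(\delta n)^{\omega-2}/T))$-efficient for Matrix-Vectors ($l=1$) amortized over $T\ge1$ steps; hence $(O(n^\epsilon+\nu),1+O(\delta^{\omega-2}))$-efficient if $T\ge n^{\omega-2}/\kappa$, and also if $T\ge\max(n^\epsilon,(\delta n)^{\omega-2})$ and $\kappa\ge1/\delta$ (that is, with constants depending on $\delta$). -/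

import Mathlib

open scoped NNReal ENNReal

noncomputable section

namespace Delegation

/-! ### Finite probability -/

/-- Independent draws, one from each `p i`. -/
def piPMF {ι : Type} [Fintype ι] [DecidableEq ι] {β : ι → Type} [∀ i, Fintype (β i)]
    (p : ∀ i, PMF (β i)) : PMF (∀ i, β i) :=
  PMF.ofFintype (fun x => ∏ i, p i (x i)) (by
    rw [← Fintype.piFinset_univ, ← Finset.prod_univ_sum]
    refine Finset.prod_eq_one fun i _ => ?_
    rw [← tsum_fintype (L := .unconditional _)]
    exact (p i).tsum_coe)

/-- A coin that shows `true` with probability `p`. -/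
def coin (p : ℝ≥0) (h : p ≤ 1) : PMF Bool :=
  PMF.ofFintype (fun b => if b then (p : ℝ≥0∞) else 1 - p) (by
    have h' : (p : ℝ≥0∞) ≤ 1 := by exact_mod_cast h
    simp [h'])

/-- The probability of the event `E`. -/
def prob {α : Type} (p : PMF α) (E : α → Prop) : ℝ := (p.toOuterMeasure {x | E x}).toReal

/-- The expectation of the natural number `f`. -/
def expect {α : Type} (p : PMF α) (f : α → ℕ) : ℝ≥0∞ := ∑' x, p x * (f x : ℝ≥0∞)

section Noise

variable (R : Type) [CommRing R] [Fintype R]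

/-- The noise distribution: `0` with probability `1 - μ`, uniform over `R` with probability `μ`. -/
def noise (μ : ℝ) : PMF R :=
  (coin (min μ.toNNReal 1) (min_le_right _ _)).bind fun b =>
    if b then PMF.uniformOfFintype R else PMF.pure 0

/-- A matrix with independent noise entries. -/
def noiseMatrix (a b : ℕ) (μ : ℝ) : PMF (Matrix (Fin a) (Fin b) R) :=
  piPMF fun _ : Fin a => piPMF fun _ : Fin b => noise R μ

def uniformMatrix (a b : ℕ) : PMF (Matrix (Fin a) (Fin b) R) :=
  PMF.uniformOfFintype (Matrix (Fin a) (Fin b) R)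

/-- The LPN distribution `(L, L H + S)` in dimension `N`, subspace dimension `k`, noise rate `μ`,
with `t` columns. -/
def lpnSample (N k t : ℕ) (μ : ℝ) :
    PMF (Matrix (Fin N) (Fin k) R × Matrix (Fin N) (Fin t) R) :=
  (uniformMatrix R N k).bind fun L => (uniformMatrix R k t).bind fun H =>
    (noiseMatrix R N t μ).bind fun S => PMF.pure (L, L * H + S)

/-- The ideal distribution `(L, U)`. -/
def idealSample (N k t : ℕ) : PMF (Matrix (Fin N) (Fin k) R × Matrix (Fin N) (Fin t) R) :=
  (uniformMatrix R N k).bind fun L => (uniformMatrix R N t).bind fun U => PMF.pure (L, U)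

/-- The least number of elements of a nonzero ideal of `R` (for a field this is `|R|`). -/
def minIdealCard : ℕ := sInf {k | ∃ I : Ideal R, I ≠ ⊥ ∧ Nat.card I = k}

end Noise

/-! ### Nonuniform computation: straight-line programs over `R` with equality tests -/

/-- A wire carries an input variable or the value of an earlier gate. -/
inductive Wire (X : Type) : Type
  | input (x : X) : Wire X
  | gate (i : ℕ) : Wire X

inductive Gate (R X : Type) : Type
  | const (r : R) : Gate R X
  | add (u v : Wire X) : Gate R X
  | sub (u v : Wire X) : Gate R X
  | mul (u v : Wire X) : Gate R X
  | isZero (u : Wire X) : Gate R X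

/-- A circuit is the list of its gates, in order of evaluation; its size is its length. -/
abbrev Circuit (R X : Type) : Type := List (Gate R X)

section Circuits

variable {R X : Type} [CommRing R]

def wireValue (x : X → R) (mem : List R) : Wire X → R
  | .input a => x a
  | .gate i => mem.getD i 0

open Classical in
def gateValue (x : X → R) (mem : List R) : Gate R X → R
  | .const r => r
  | .add u v => wireValue x mem u + wireValue x mem v
  | .sub u v => wireValue x mem u - wireValue x mem v
  | .mul u v => wireValue x mem u * wireValue x mem v
  | .isZero u => if wireValue x mem u = 0 then 1 else 0

/-- The list of all gate values on input `x`. -/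
def Circuit.run (c : Circuit R X) (x : X → R) : List R :=
  c.foldl (fun mem g => mem ++ [gateValue x mem g]) []

/-- The value on the wire `w` after the evaluation of `c` on input `x`. -/
def Circuit.read (c : Circuit R X) (x : X → R) (w : Wire X) : R := wireValue x (c.run x) w

end Circuits

/-- A distinguisher: a circuit with one designated wire; it accepts if that wire carries `1`. -/
structure Distinguisher (R X : Type) where
  circuit : Circuit R X
  out : Wire X

def Distinguisher.Accepts {R X : Type} [CommRing R] (D : Distinguisher R X) (x : X → R) : Prop :=
  D.circuit.read x D.out = 1

/-- Variables for the entries of two matrices. -/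
abbrev PairVar (a b c d : ℕ) : Type := (Fin a × Fin b) ⊕ (Fin c × Fin d)

def pairInput {R : Type} {a b c d : ℕ} (X : Matrix (Fin a) (Fin b) R)
    (Y : Matrix (Fin c) (Fin d) R) : PairVar a b c d → R :=
  Sum.elim (fun p => X p.1 p.2) (fun p => Y p.1 p.2)

/-- `k × k` matrices over `R` can be multiplied by a circuit with at most `size` gates. -/
def CanMultiply (R : Type) [CommRing R] (k size : ℕ) : Prop :=
  ∃ (c : Circuit R (PairVar k k k k)) (out : Matrix (Fin k) (Fin k) (Wire (PairVar k k k k))),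
    c.length ≤ size ∧ ∀ X Y : Matrix (Fin k) (Fin k) R, out.map (c.read (pairInput X Y)) = X * Y

/-! ### The LPN assumption -/

section LPN

variable (R : Type) [CommRing R] [Fintype R]

/-- No circuit with at most `size` gates distinguishes LPN samples from uniform ones with
advantage more than `adv`. -/
def LPNHard (N k t : ℕ) (μ : ℝ) (size : ℕ) (adv : ℝ) : Prop :=
  ∀ D : Distinguisher R (PairVar N k N t), D.circuit.length ≤ size →
    |prob (lpnSample R N k t μ) (fun x => D.Accepts (pairInput x.1 x.2)) -
      prob (idealSample R N k t) (fun x => D.Accepts (pairInput x.1 x.2))| ≤ adv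

/-- The standard assumption with parameters `δ, ε`: in dimension `N`, with subspace dimension
`δ N`, noise rate `N ^ (ε - 1)` and polynomially many columns, adversaries of polynomial size have
negligible advantage. -/
def LPNAssumption (δ ε : ℝ) : Prop :=
  ∀ c a : ℕ, ∃ N₀ : ℕ, ∀ N ≥ N₀, ∀ t ≤ N ^ c,
    LPNHard R N ⌈δ * N⌉₊ t ((N : ℝ) ^ (ε - 1)) (N ^ c) (((N : ℝ) ^ a)⁻¹)

/-- The subspace dimensions `ι` such that LPN in dimension `κ / δ` with subspace dimension `κ` has
`bits` bits of security for all `κ ≥ ι`. -/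
def secureDims (δ ε bits : ℝ) (t size : ℕ) : Set ℕ :=
  {ι | 1 ≤ ι ∧ ∀ κ ≥ ι,
    LPNHard R ⌊κ / δ⌋₊ κ t ((⌊κ / δ⌋₊ : ℝ) ^ (ε - 1)) size ((2 : ℝ) ^ (-bits))}

/-- The least such subspace dimension. -/
def iota (δ ε bits : ℝ) (t size : ℕ) : ℕ := sInf (secureDims R δ ε bits t size)

end LPN

/-! ### Costs -/

/-- Number of operations for the product of an `a × b` and a `b × c` matrix by cutting both into
square blocks of side `min a b c`; blocks of side `r` are multiplied with `sq r` operations and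
added with `r ^ 2`. -/
def mulCost (sq : ℕ → ℕ) (a b c : ℕ) : ℕ :=
  let r := min a (min b c)
  ((a + r - 1) / r) * ((b + r - 1) / r) * ((c + r - 1) / r) * (sq r + r ^ 2)

/-- Programs that count their operations. -/
class HasTick (M : Type → Type) where
  tick : ℕ → M Unit

section Primitives

variable {R : Type} [CommRing R] {M : Type → Type} [Monad M] [HasTick M]

/-- Dense matrix product. -/
def dmul (sq : ℕ → ℕ) {a b c : ℕ} (X : Matrix (Fin a) (Fin b) R) (Y : Matrix (Fin b) (Fin c) R) :
    M (Matrix (Fin a) (Fin c) R) := do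
  HasTick.tick (mulCost sq a b c)
  pure (X * Y)

/-- The number of nonzero entries. -/
def nnz {a b : ℕ} (X : Matrix (Fin a) (Fin b) R) : ℕ :=
  {p : Fin a × Fin b | X p.1 p.2 ≠ 0}.ncard

/-- Product with a sparse left factor: every nonzero entry of `S` contributes one scaled row. -/
def smulLeft {a b c : ℕ} (S : Matrix (Fin a) (Fin b) R) (Y : Matrix (Fin b) (Fin c) R) :
    M (Matrix (Fin a) (Fin c) R) := do
  HasTick.tick (2 * nnz S * c + a * c)
  pure (S * Y)

/-- Product with a sparse right factor: every nonzero entry of `S` contributes one scaled column. -/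
def smulRight {a b c : ℕ} (X : Matrix (Fin a) (Fin b) R) (S : Matrix (Fin b) (Fin c) R) :
    M (Matrix (Fin a) (Fin c) R) := do
  HasTick.tick (2 * nnz S * a + a * c)
  pure (X * S)

def madd {a b : ℕ} (X Y : Matrix (Fin a) (Fin b) R) : M (Matrix (Fin a) (Fin b) R) := do
  HasTick.tick (a * b)
  pure (X + Y)

def msub {a b : ℕ} (X Y : Matrix (Fin a) (Fin b) R) : M (Matrix (Fin a) (Fin b) R) := do
  HasTick.tick (a * b)
  pure (X - Y)

open Classical in
/-- Entrywise comparison. -/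
def meq {a b : ℕ} (X Y : Matrix (Fin a) (Fin b) R) : M Bool := do
  HasTick.tick (a * b)
  pure (decide (X = Y))

/-- `init + f 0 + f 1 + ⋯ + f (k - 1)`. -/
def accumulate {a b : ℕ} (f : ℕ → M (Matrix (Fin a) (Fin b) R))
    (init : Matrix (Fin a) (Fin b) R) : ℕ → M (Matrix (Fin a) (Fin b) R)
  | 0 => pure init
  | k + 1 => do
      let s ← accumulate f init k
      let x ← f k
      madd s x

end Primitives

/-! ### Messages, servers, and the client as an interactive probabilistic program -/

/-- Parameters of the protocol: the recursion depth `d`, the dimensions `n = n₀, n₁, …, n_d`, the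
noise rates (`rate i` is the one used in dimension `dim i`), the number of product checks, and the
cost of square matrix products. -/
structure Params where
  depth : ℕ
  dim : ℕ → ℕ
  rate : ℕ → ℝ
  checks : ℕ
  sq : ℕ → ℕ

/-- Families `X₀, …, X_{d-1}` of matrices with `X_i` of size `f i × g i`. -/
abbrev Family (R : Type) (d : ℕ) (f g : ℕ → ℕ) : Type :=
  (i : Fin d) → Matrix (Fin (f i)) (Fin (g i)) R

def extend {R : Type} [CommRing R] {d : ℕ} {f g : ℕ → ℕ} (X : Family R d f g) (i : ℕ) :
    Matrix (Fin (f i)) (Fin (g i)) R :=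
  if h : i < d then X ⟨i, h⟩ else 0

/-- The number of entries of a family. -/
def familySize (d : ℕ) (f g : ℕ → ℕ) : ℕ := ∑ i ∈ Finset.range d, f i * g i

section Protocol

variable (R : Type) (P : Params) (m l : ℕ)

/-- Messages of the client. Each one stands for a request for products:
`bases` for the products `L_jᵀ ⋯ L₁ᵀ L₁ ⋯ L_i`, `left` for `A_enc L₁ ⋯ L_i`, and `right` for
`A_enc B_enc` and `(L₁ ⋯ L_i)ᵀ B_enc`. -/
inductive Msg : Type
  | bases (L : Family R P.depth P.dim fun i => P.dim (i + 1)) : Msg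
  | left (A : Matrix (Fin m) (Fin (P.dim 0)) R) : Msg
  | right (B : Matrix (Fin (P.dim 0)) (Fin l) R) : Msg

/-- Claimed products `L_jᵀ ⋯ L₁ᵀ L₁ ⋯ L_i`: `top i` is the one for `(0, i + 1)` and `inner j i` the
one for `(j + 1, i + 1)`. The products for `(j, 0)` are transposes of those for `(0, j)`, and
the one for `(0, 0)` is the identity. -/
structure GramReply where
  top : Family R P.depth (fun _ => P.dim 0) fun i => P.dim (i + 1)
  inner : (j : Fin P.depth) → Family R P.depth (fun _ => P.dim (j + 1)) fun i => P.dim (i + 1)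

structure LeftReply where
  prods : Family R P.depth (fun _ => m) fun i => P.dim (i + 1)

structure RightReply where
  prod : Matrix (Fin m) (Fin l) R
  prods : Family R P.depth (fun i => P.dim (i + 1)) fun _ => l

variable {R P m l}

def Reply : Msg R P m l → Type
  | .bases _ => GramReply R P
  | .left _ => LeftReply R P m
  | .right _ => RightReply R P m l

/-- The number of ring elements in a message. -/
def Msg.words : Msg R P m l → ℕ
  | .bases _ => familySize P.depth P.dim fun i => P.dim (i + 1)
  | .left _ => m * P.dim 0
  | .right _ => P.dim 0 * l

/-- The number of ring elements in the reply to a message. -/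
def Msg.replyWords : Msg R P m l → ℕ
  | .bases _ => familySize P.depth (fun _ => P.dim 0) (fun i => P.dim (i + 1)) +
      ∑ j ∈ Finset.range P.depth,
        familySize P.depth (fun _ => P.dim (j + 1)) fun i => P.dim (i + 1)
  | .left _ => familySize P.depth (fun _ => m) fun i => P.dim (i + 1)
  | .right _ => m * l + familySize P.depth (fun i => P.dim (i + 1)) fun _ => l

variable (R P m l)

/-- A server answers a message, given the earlier messages; `work` is the number of operations
spent on the answer. A dishonest server may answer anything. -/
structure Server where
  reply : List (Msg R P m l) → (q : Msg R P m l) → Reply q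
  work : List (Msg R P m l) → Msg R P m l → ℕ

/-- Running costs: operations of client and server (each also pays one operation for every ring
element it sends or receives), ring elements sent to the server (`up`) and to the client (`down`),
and rounds. -/
structure Ledger where
  client : ℕ
  server : ℕ
  up : ℕ
  down : ℕ
  rounds : ℕ

/-- `view` lists the messages that the server has received so far. -/
structure RunState where
  view : List (Msg R P m l)
  ledger : Ledger

def emptyLedger : Ledger := ⟨0, 0, 0, 0, 0⟩

def startState : RunState R P m l := ⟨[], emptyLedger⟩

/-- Probabilistic interactive programs. -/
abbrev Prog : Type → Type := StateT (RunState R P m l) PMF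

instance : HasTick (Prog R P m l) where
  tick c := modify fun s => { s with ledger := { s.ledger with client := s.ledger.client + c } }

instance : HasTick (StateM ℕ) where
  tick c := modify fun s => s + c

variable {R P m l}

/-- One round: the client sends `q` and receives the reply of the server. -/
def ask (srv : Server R P m l) (q : Msg R P m l) : Prog R P m l (Reply q) := do
  let s ← get
  set ({
    view := s.view ++ [q]
    ledger := {
      client := s.ledger.client + (q.words + q.replyWords)
      server := s.ledger.server + (srv.work s.view q + (q.words + q.replyWords))
      up := s.ledger.up + q.words
      down := s.ledger.down + q.replyWords
      rounds := s.ledger.rounds + 1 } } : RunState R P m l)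
  pure (srv.reply s.view q)

/-- Sampling costs one operation per ring element. -/
def sample {α : Type} (p : PMF α) (cost : ℕ) : Prog R P m l α := do
  HasTick.tick cost
  StateT.lift p

/-- The products `X, X L₁, X L₁ L₂, …, X L₁ ⋯ L_k`, computed from left to right. -/
def chain [CommRing R] {M : Type → Type} [Monad M] [HasTick M]
    (L : (i : ℕ) → Matrix (Fin (P.dim i)) (Fin (P.dim (i + 1))) R) {a : ℕ}
    (X : Matrix (Fin a) (Fin (P.dim 0)) R) : ℕ → M ((i : ℕ) → Matrix (Fin a) (Fin (P.dim i)) R)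
  | 0 => pure (Function.update (fun _ => 0) 0 X)
  | k + 1 => do
      let t ← chain L X k
      let y ← dmul P.sq (t k) (L k)
      pure (Function.update t (k + 1) y)

/-! ### The honest server -/

section Honest

variable [CommRing R]

/-- The entry `(j, k + 1)` of the table of products, for `j ≤ k`, from the column of index `k`. -/
def gramEntry (L : (i : ℕ) → Matrix (Fin (P.dim i)) (Fin (P.dim (i + 1))) R)
    (T : (j i : ℕ) → Matrix (Fin (P.dim j)) (Fin (P.dim i)) R) :
    (j k : ℕ) → StateM ℕ (Matrix (Fin (P.dim j)) (Fin (P.dim (k + 1))) R)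
  | 0, 0 => pure (L 0)
  | j + 1, 0 => dmul P.sq (T (j + 1) 0) (L 0)
  | j, k + 1 => dmul P.sq (T j (k + 1)) (L (k + 1))

/-- The entries `(0, k + 1), …, (r - 1, k + 1)`. -/
def gramColumn (L : (i : ℕ) → Matrix (Fin (P.dim i)) (Fin (P.dim (i + 1))) R)
    (T : (j i : ℕ) → Matrix (Fin (P.dim j)) (Fin (P.dim i)) R) (k : ℕ) :
    ℕ → StateM ℕ ((j : ℕ) → Matrix (Fin (P.dim j)) (Fin (P.dim (k + 1))) R)
  | 0 => pure fun _ => 0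
  | r + 1 => do
      let col ← gramColumn L T k r
      let x ← gramEntry L T r k
      pure (Function.update col r x)

/-- The table of the products `L_jᵀ ⋯ L₁ᵀ L₁ ⋯ L_i` for `j, i ≤ k`. A new column is computed from
the preceding one, its last entry from the transpose of the one above it, and the new row by
transposition. -/
def gramTable (L : (i : ℕ) → Matrix (Fin (P.dim i)) (Fin (P.dim (i + 1))) R) :
    ℕ → StateM ℕ ((j i : ℕ) → Matrix (Fin (P.dim j)) (Fin (P.dim i)) R)
  | 0 => pure (Function.update (fun _ _ => 0) 0 (Function.update (fun _ => 0) 0 1))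
  | k + 1 => do
      let T ← gramTable L k
      let col ← gramColumn L T k (k + 1)
      let corner ← dmul P.sq (col k).transpose (L k)
      pure (Function.update (fun j => Function.update (T j) (k + 1) (col j)) (k + 1)
        (Function.update (fun i => (col i).transpose) (k + 1) corner))

/-- The products `(L₁ ⋯ L_i)ᵀ B` for `i ≤ k`. -/
def pullback (L : (i : ℕ) → Matrix (Fin (P.dim i)) (Fin (P.dim (i + 1))) R)
    (B : Matrix (Fin (P.dim 0)) (Fin l) R) :
    ℕ → StateM ℕ ((i : ℕ) → Matrix (Fin (P.dim i)) (Fin l) R)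
  | 0 => pure (Function.update (fun _ => 0) 0 B)
  | k + 1 => do
      let t ← pullback L B k
      let y ← dmul P.sq (L k).transpose (t k)
      pure (Function.update t (k + 1) y)

/-- The matrices `L_i` that were received. -/
def basesOf : List (Msg R P m l) → (i : ℕ) → Matrix (Fin (P.dim i)) (Fin (P.dim (i + 1))) R
  | .bases L :: _ => extend L
  | _ => fun _ => 0

/-- The matrix `A_enc` that was received. -/
def leftOf : List (Msg R P m l) → Matrix (Fin m) (Fin (P.dim 0)) R
  | _ :: .left A :: _ => A
  | _ => 0

def honestReply (past : List (Msg R P m l)) : (q : Msg R P m l) → StateM ℕ (Reply q)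
  | .bases L => do
      let T ← gramTable (P := P) (extend L) P.depth
      pure (GramReply.mk (fun i => T 0 (i + 1)) (fun j i => T (j + 1) (i + 1)) : GramReply R P)
  | .left A => do
      let V ← chain (P := P) (basesOf past) A P.depth
      pure (LeftReply.mk (fun i => V (i + 1)) : LeftReply R P m)
  | .right B => do
      let C ← dmul P.sq (leftOf past) B
      let Q ← pullback (P := P) (basesOf past) B P.depth
      pure (RightReply.mk C (fun i => Q (i + 1)) : RightReply R P m l)

variable (R P m l) in
def honestServer : Server R P m l where
  reply past q := ((honestReply past q).run 0).1
  work past q := ((honestReply past q).run 0).2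

end Honest

/-! ### The client -/

section Client

variable [CommRing R] [Fintype R]

def sampleUniform (a b : ℕ) : Prog R P m l (Matrix (Fin a) (Fin b) R) :=
  sample (uniformMatrix R a b) (a * b)

/-- The table `⟨L_jᵀ ⋯ L₁ᵀ L₁ ⋯ L_i⟩` as claimed by the server. -/
def GramReply.table (G : GramReply R P) :
    (j i : ℕ) → Matrix (Fin (P.dim j)) (Fin (P.dim i)) R
  | 0, 0 => 1
  | 0, i + 1 => extend G.top i
  | j + 1, 0 => (extend G.top j).transpose
  | j + 1, i + 1 => if h : j < P.depth then extend (G.inner ⟨j, h⟩) i else 0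

def LeftReply.table (V : LeftReply R P m) (X : Matrix (Fin m) (Fin (P.dim 0)) R) :
    (i : ℕ) → Matrix (Fin m) (Fin (P.dim i)) R
  | 0 => X
  | i + 1 => extend V.prods i

def RightReply.table (Q : RightReply R P m l) (B : Matrix (Fin (P.dim 0)) (Fin l) R) :
    (i : ℕ) → Matrix (Fin (P.dim i)) (Fin l) R
  | 0 => B
  | i + 1 => extend Q.prods i

/-- Checks the partial products `claim i = claim 0 * L₁ ⋯ L_i` for `i = 1, …, k`, in this order,
each with a fresh random matrix with `checks` columns. -/
def checkPartial (L : (i : ℕ) → Matrix (Fin (P.dim i)) (Fin (P.dim (i + 1))) R) {a : ℕ}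
    (claim : (i : ℕ) → Matrix (Fin a) (Fin (P.dim i)) R) : ℕ → Prog R P m l Bool
  | 0 => pure true
  | k + 1 => do
      let ok ← checkPartial L claim k
      if ok then do
        let X ← sampleUniform (P.dim (k + 1)) P.checks
        let Y ← dmul P.sq (claim (k + 1)) X
        let Z ← dmul P.sq (L k) X
        let W ← dmul P.sq (claim k) Z
        meq Y W
      else pure false

/-- Checks the rows `0, …, r - 1` of the table. -/
def checkTable (L : (i : ℕ) → Matrix (Fin (P.dim i)) (Fin (P.dim (i + 1))) R)
    (T : (j i : ℕ) → Matrix (Fin (P.dim j)) (Fin (P.dim i)) R) : ℕ → Prog R P m l Bool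
  | 0 => pure true
  | r + 1 => do
      let ok ← checkTable L T r
      if ok then checkPartial L (T r) P.depth else pure false

variable (R P m) in
/-- What the client keeps after the initialization: the claimed products `L₁ ⋯ L_i`, the products
`A L₁ ⋯ L_i`, and the randomness of the mask of `A`. -/
structure ClientState where
  bases : (i : ℕ) → Matrix (Fin (P.dim 0)) (Fin (P.dim i)) R
  lefts : (i : ℕ) → Matrix (Fin m) (Fin (P.dim i)) R
  dense : Matrix (Fin m) (Fin (P.dim P.depth)) R
  sparse : (i : ℕ) → Matrix (Fin m) (Fin (P.dim i)) R

/-- The products `A L₁ ⋯ L_i` for `i ≤ k`, from the claimed ones with `A_enc` and the table. -/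
def unmaskLefts (T : (j i : ℕ) → Matrix (Fin (P.dim j)) (Fin (P.dim i)) R)
    (V : (i : ℕ) → Matrix (Fin m) (Fin (P.dim i)) R) (A : Matrix (Fin m) (Fin (P.dim 0)) R)
    (H : Matrix (Fin m) (Fin (P.dim P.depth)) R)
    (S : (i : ℕ) → Matrix (Fin m) (Fin (P.dim i)) R) :
    ℕ → Prog R P m l ((i : ℕ) → Matrix (Fin m) (Fin (P.dim i)) R)
  | 0 => pure (Function.update (fun _ => 0) 0 A)
  | k + 1 => do
      let t ← unmaskLefts T V A H S k
      let x₀ ← dmul P.sq H (T P.depth (k + 1))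
      let x ← accumulate (fun j => smulLeft (S j) (T j (k + 1))) x₀ P.depth
      let y ← msub (V (k + 1)) x
      pure (Function.update t (k + 1) y)

/-- The initialization of the client with left matrix `A`; the result `none` means abort. -/
def clientSetup (srv : Server R P m l) (A : Matrix (Fin m) (Fin (P.dim 0)) R) :
    Prog R P m l (Option (ClientState R P m)) := do
  let Lf ← sample (PMF.uniformOfFintype (Family R P.depth P.dim fun i => P.dim (i + 1)))
    (familySize P.depth P.dim fun i => P.dim (i + 1))
  let L := extend Lf
  let rep ← ask srv (.bases Lf)
  let T := GramReply.table rep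
  let ok ← checkTable L T (P.depth + 1)
  if ok then do
    let H ← sampleUniform m (P.dim P.depth)
    let Sf ← sample (piPMF fun i : Fin P.depth => noiseMatrix R m (P.dim i) (P.rate i))
      (familySize P.depth (fun _ => m) P.dim)
    let S := extend (f := fun _ => m) (g := P.dim) Sf
    let x ← dmul P.sq H (T 0 P.depth).transpose
    let mask ← accumulate (fun i => smulLeft (S i) (T 0 i).transpose) x P.depth
    let Aenc ← madd A mask
    let rep' ← ask srv (.left Aenc)
    let V := LeftReply.table rep' Aenc
    let ok' ← checkPartial L V P.depth
    if ok' then do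
      let AL ← unmaskLefts T V A H S P.depth
      pure (some ⟨T 0, AL, H, S⟩)
    else pure none
  else pure none

/-- One online step of the client: multiplication by `B`. -/
def multiply (srv : Server R P m l) (c : ClientState R P m)
    (B : Matrix (Fin (P.dim 0)) (Fin l) R) : Prog R P m l (Matrix (Fin m) (Fin l) R) := do
  let G ← sampleUniform (P.dim P.depth) l
  let Tf ← sample (piPMF fun i : Fin P.depth => noiseMatrix R (P.dim i) l (P.rate i))
    (familySize P.depth P.dim fun _ => l)
  let T := extend (f := P.dim) (g := fun _ => l) Tf
  let x ← dmul P.sq (c.bases P.depth) G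
  let mask ← accumulate (fun i => smulRight (c.bases i) (T i)) x P.depth
  let Benc ← madd B mask
  let y ← dmul P.sq (c.lefts P.depth) G
  let AB' ← accumulate (fun i => smulRight (c.lefts i) (T i)) y P.depth
  let rep ← ask srv (.right Benc)
  let Q := RightReply.table rep Benc
  let z ← dmul P.sq c.dense (Q P.depth)
  let A'B ← accumulate (fun i => smulLeft (c.sparse i) (Q i)) z P.depth
  let w ← msub (RightReply.prod rep) AB'
  msub w A'B

/-- The first `T` online steps, on the stream `B 0, B 1, …`, with the list of their results. -/
def multiplyAll (srv : Server R P m l) (c : ClientState R P m)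
    (B : ℕ → Matrix (Fin (P.dim 0)) (Fin l) R) :
    ℕ → Prog R P m l (List (Matrix (Fin m) (Fin l) R))
  | 0 => pure []
  | T + 1 => do
      let xs ← multiplyAll srv c B T
      let x ← multiply srv c (B T)
      pure (xs ++ [x])

/-- The initialization alone. -/
def initRun (srv : Server R P m l) (A : Matrix (Fin m) (Fin (P.dim 0)) R) :
    PMF (Option (ClientState R P m) × RunState R P m l) :=
  (clientSetup srv A).run (startState R P m l)

/-- The initialization and `T` online steps. -/
def fullRun (srv : Server R P m l) (A : Matrix (Fin m) (Fin (P.dim 0)) R)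
    (B : ℕ → Matrix (Fin (P.dim 0)) (Fin l) R) (T : ℕ) :
    PMF (Option (List (Matrix (Fin m) (Fin l) R)) × RunState R P m l) :=
  StateT.run (do
    match ← clientSetup srv A with
    | none => pure none
    | some c => do
        let xs ← multiplyAll srv c B T
        pure (some xs)) (startState R P m l)

/-- The online step with index `k` in a run of the protocol; the ledger only counts this step. -/
def stepRun (srv : Server R P m l) (A : Matrix (Fin m) (Fin (P.dim 0)) R)
    (B : ℕ → Matrix (Fin (P.dim 0)) (Fin l) R) (k : ℕ) :
    PMF (Option (Matrix (Fin m) (Fin l) R) × RunState R P m l) :=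
  StateT.run (do
    match ← clientSetup srv A with
    | none => do
        modify fun s => { s with ledger := emptyLedger }
        pure none
    | some c => do
        let _ ← multiplyAll srv c B k
        modify fun s => { s with ledger := emptyLedger }
        let x ← multiply srv c (B k)
        pure (some x)) (startState R P m l)

end Client

/-! ### Adversaries and security -/

variable (R P m l) in
/-- The variables that circuits read: `sent k` tells whether a message of index `k` has been
sent, the others are the entries of the messages. -/
inductive ViewVar : Type
  | sent (k : ℕ) : ViewVar
  | base (i : Fin P.depth) (a : Fin (P.dim i)) (b : Fin (P.dim (i + 1))) : ViewVar
  | left (a : Fin m) (b : Fin (P.dim 0)) : ViewVar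
  | right (k : ℕ) (a : Fin (P.dim 0)) (b : Fin l) : ViewVar

section Adversary

variable [CommRing R]

/-- The values of the variables on the list of messages `v`; entries of messages that have not
been sent are `0`. -/
def viewValue (v : List (Msg R P m l)) : ViewVar P m l → R
  | .sent k => if k < v.length then 1 else 0
  | .base i a b => match (v[0]? : Option (Msg R P m l)) with
      | some (.bases L) => L i a b
      | _ => 0
  | .left a b => match (v[1]? : Option (Msg R P m l)) with
      | some (.left A) => A a b
      | _ => 0
  | .right k a b => match (v[k + 2]? : Option (Msg R P m l)) with
      | some (.right B) => B a b
      | _ => 0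

variable (R P m l) in
/-- A dishonest server given by circuits that read the messages received so far, one for each of
the two rounds of the initialization and one for each online step. -/
structure CircuitServer where
  setup : Circuit R (ViewVar P m l)
  top : Family (Wire (ViewVar P m l)) P.depth (fun _ => P.dim 0) fun i => P.dim (i + 1)
  inner : (j : Fin P.depth) →
    Family (Wire (ViewVar P m l)) P.depth (fun _ => P.dim (j + 1)) fun i => P.dim (i + 1)
  lefts : Circuit R (ViewVar P m l)
  leftOut : Family (Wire (ViewVar P m l)) P.depth (fun _ => m) fun i => P.dim (i + 1)
  online : ℕ → Circuit R (ViewVar P m l)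
  prodOut : ℕ → Matrix (Fin m) (Fin l) (Wire (ViewVar P m l))
  rightOut : ℕ →
    Family (Wire (ViewVar P m l)) P.depth (fun i => P.dim (i + 1)) fun _ => l

/-- The total size of the circuits used in a run with `T` online steps. -/
def CircuitServer.size (S : CircuitServer R P m l) (T : ℕ) : ℕ :=
  S.setup.length + S.lefts.length + ∑ k ∈ Finset.range T, (S.online k).length

def CircuitServer.toServer (S : CircuitServer R P m l) : Server R P m l where
  reply past
    | .bases L =>
        let x := viewValue (past ++ [.bases L])
        (GramReply.mk (fun i => (S.top i).map (S.setup.read x))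
          (fun j i => (S.inner j i).map (S.setup.read x)) : GramReply R P)
    | .left A =>
        let x := viewValue (past ++ [.left A])
        (LeftReply.mk fun i => (S.leftOut i).map (S.lefts.read x) : LeftReply R P m)
    | .right B =>
        let x := viewValue (past ++ [.right B])
        let c := S.online (past.length - 2)
        (RightReply.mk ((S.prodOut (past.length - 2)).map (c.read x))
          (fun i => (S.rightOut (past.length - 2) i).map (c.read x)) : RightReply R P m l)
  work _ _ := 0

variable [Fintype R]

/-- What the server sees in a run with inputs `A` and `B 0, …, B (T - 1)`. Its own replies are
functions of the messages. -/
def realView (srv : Server R P m l) (A : Matrix (Fin m) (Fin (P.dim 0)) R)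
    (B : ℕ → Matrix (Fin (P.dim 0)) (Fin l) R) (T : ℕ) : PMF (List (Msg R P m l)) :=
  (fullRun srv A B T).map fun o => o.2.view

/-- The simulator has no inputs except the public sizes: it plays the client on zero matrices. -/
def simulatedView (srv : Server R P m l) (T : ℕ) : PMF (List (Msg R P m l)) :=
  realView srv 0 (fun _ => 0) T

variable (R P m l) in
/-- Computational zero-knowledge, with `bits` bits of security, against servers and
distinguishers of size at most `size`, in runs with `T` online steps. -/
def ZeroKnowledge (T size : ℕ) (bits : ℝ) : Prop :=
  ∀ (S : CircuitServer R P m l) (D : Distinguisher R (ViewVar P m l)),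
    S.size T ≤ size → D.circuit.length ≤ size →
    ∀ (A : Matrix (Fin m) (Fin (P.dim 0)) R) (B : ℕ → Matrix (Fin (P.dim 0)) (Fin l) R),
      |prob (realView S.toServer A B T) (fun v => D.Accepts (viewValue v)) -
        prob (simulatedView S.toServer T) (fun v => D.Accepts (viewValue v))| ≤
          (2 : ℝ) ^ (-bits)

variable (R P m l) in
/-- If the server is honest then the client returns exactly `A B 0, A B 1, …`. -/
def ExactOutput : Prop :=
  ∀ (A : Matrix (Fin m) (Fin (P.dim 0)) R) (B : ℕ → Matrix (Fin (P.dim 0)) (Fin l) R) (T : ℕ),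
    ∀ o ∈ (fullRun (honestServer R P m l) A B T).support,
      o.1 = some ((List.range T).map fun k => A * B k)

variable (R P m l) in
/-- Whatever the server does, the probability that it gives a wrong reply in the initialization
without the client aborting is at most `2 ^ (-bits)`. -/
def SoundInitialization (bits : ℝ) : Prop :=
  ∀ (srv : Server R P m l) (A : Matrix (Fin m) (Fin (P.dim 0)) R),
    prob (initRun srv A) (fun o => o.1.isSome ∧ ∃ past q, (past ++ [q]) <+: o.2.view ∧
      srv.reply past q ≠ (honestServer R P m l).reply past q) ≤ (2 : ℝ) ^ (-bits)

variable (R P m l) in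
/-- With an honest server the initialization takes two rounds and an online step takes one. -/
def TwoPlusOneRounds : Prop :=
  ∀ (A : Matrix (Fin m) (Fin (P.dim 0)) R) (B : ℕ → Matrix (Fin (P.dim 0)) (Fin l) R),
    (∀ o ∈ (initRun (honestServer R P m l) A).support, o.2.ledger.rounds = 2) ∧
    ∀ k, ∀ o ∈ (stepRun (honestServer R P m l) A B k).support, o.2.ledger.rounds = 1

end Adversary

end Protocol

/-! ### The unprotected protocol and efficiency -/

/-- Input size: `A` and `T` matrices `B`. -/
def inputSize (n m l T : ℕ) : ℕ := m * n + T * (n * l)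

/-- Output size: `T` products. -/
def outputSize (m l T : ℕ) : ℕ := T * (m * l)

/-- Cost of the client in the unprotected protocol, in which it sends the inputs and receives the
products. -/
def naiveClient (n m l T : ℕ) : ℕ := inputSize n m l T + outputSize m l T

/-- Cost of the server for one online step of the unprotected protocol: it receives `B`, multiplies
and sends the product. -/
def naiveStep (sq : ℕ → ℕ) (n m l : ℕ) : ℕ := n * l + mulCost sq m n l + m * l

/-- Cost of the server in the unprotected protocol. -/
def naiveServer (sq : ℕ → ℕ) (n m l T : ℕ) : ℕ := m * n + T * naiveStep sq n m l

/-- `T` online steps (with the initialization) are `(cc, cs)`-efficient: whatever the inputs are,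
the expected cost of the client (against any server) and the cost of the honest server are at most
`cc` and `cs` times those in the unprotected protocol. -/
def Efficient (R : Type) [CommRing R] [Fintype R] (P : Params) (m l T : ℕ) (cc cs : ℝ) : Prop :=
  ∀ (A : Matrix (Fin m) (Fin (P.dim 0)) R) (B : ℕ → Matrix (Fin (P.dim 0)) (Fin l) R),
    (∀ srv : Server R P m l, expect (fullRun srv A B T) (fun o => o.2.ledger.client) ≤
      ENNReal.ofReal (cc * naiveClient (P.dim 0) m l T)) ∧
    ∀ o ∈ (fullRun (honestServer R P m l) A B T).support,
      (o.2.ledger.server : ℝ) ≤ cs * naiveServer P.sq (P.dim 0) m l T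

/-! ### The choice of the parameters -/

section Choice

/-- `lg n`, times `1 / lg (1 / δ)` if `δ > 1 / 2`: a bound for the recursion depth. -/
def levels (δ : ℝ) (n : ℕ) : ℝ := max 1 (1 / Real.logb 2 (1 / δ)) * Real.logb 2 n

/-- The security level asked of LPN. -/
def lpnBits (δ : ℝ) (lam n : ℕ) : ℝ := lam + Real.logb 2 (levels δ n) + 1

variable (R : Type) [CommRing R] [Fintype R]

/-- `ν = max (λ / lg |R|, ι)`, against adversaries of size `size` and for `t` columns. -/
def nu (δ ε : ℝ) (lam n t size : ℕ) : ℝ :=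
  max (lam / Real.logb 2 (Fintype.card R)) (iota R δ ε (lpnBits δ lam n) t size)

/-- The last dimension `n_d`: `ν` rounded up, and at least `4 / (1 - δ)`. -/
def lastDim (δ ε : ℝ) (lam n t size : ℕ) : ℕ :=
  max ⌈nu R δ ε lam n t size⌉₊ ⌈4 / (1 - δ)⌉₊

/-- `n₀ = n` and `n_i = δ n_{i-1}`, rounded up, and not below `last`. -/
def dims (δ : ℝ) (last n : ℕ) : ℕ → ℕ
  | 0 => n
  | i + 1 => max ⌈δ * dims δ last n i⌉₊ last

/-- The parameters of the protocol: the recursion stops when `n_i` reaches the last dimension, the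
noise rates are `n_i ^ (ε - 1)`, and the number of checks makes the error of the checks at most
`2 ^ (-λ) / levels δ n`. -/
def params (sq : ℕ → ℕ) (δ ε : ℝ) (lam n t size : ℕ) : Params where
  depth := sInf {i | dims δ (lastDim R δ ε lam n t size) n i ≤ lastDim R δ ε lam n t size}
  dim := dims δ (lastDim R δ ε lam n t size) n
  rate i := (dims δ (lastDim R δ ε lam n t size) n i : ℝ) ^ (ε - 1)
  checks := ⌈(lam + Real.logb 2 (levels δ n)) / Real.logb 2 (minIdealCard R)⌉₊
  sq := sq

end Choice

end Delegation

end

/-!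
# Secure delegation of matrix multiplication from LPN

The mask of `A` is, read from the inside out, a nested LPN sample: with `U_d = H` and
`U_{i-1} = U_i L_iᵀ + S_i`, one has `A' = U_0`, and the masks of the right matrices have the same
shape. So all inputs together are masked by one sample with `m + T l` columns.

*Zero-knowledge.* The hybrid `i` starts the recursion at a uniform `U_i`. The hybrid for `i = 0`
masks with uniform matrices, so that the inputs do not matter, and two consecutive hybrids differ by
one application of LPN in dimension `n_i`. The circuit for this application chooses the other `L_j`
and runs the server, the checks and the distinguisher. The view depends on the replies only through
the decision to abort, and a wrong first reply is accepted with small probability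
(`Ex_realView_le`), so that one may assume that the table of products is the correct one; then the
second check is a deterministic test once its randomness is fixed. `decides_testAccepts` builds the
circuit, of size polynomial in the parameters, and `zeroKnowledge_of_LPNHard` puts the parts
together. `LPNHard.shrink` passes from the dimension `⌊n_i / δ⌋` of the assumption to the smaller
dimension `n_{i-1}`: rows are dropped, and the noise is increased by adding independent noise.

*Soundness and correctness.* A wrong product fails a random linear test with one column except with
probability `1 / q(R)`, because a nonzero linear form takes its values in an ideal, uniformly. The
products with an honest server are computed in `wp_setup_honest` and `wp_multiply_honest`. Runs are
analysed by the expectation transformer `wp`, which turns the monadic programs into nested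
expectations with explicit costs.

*The number of checks.* The cost of the checks is linear in `λ`, and only an upper bound for `λ` in
terms of `n_d` makes it small. It comes from an attack on LPN (`pow_le_of_LPNHard`): if none of
`n_d + 1` noise entries of a column is nonzero, the column lies in the image of `L`, which Gaussian
elimination with zero tests detects. Over a ring that is not a field the elimination is done after
multiplication by an element whose annihilator is a maximal ideal. So the security that defines `ι`
is limited by the probability `(1 - μ) ^ (n_d + 1)`, and `λ = O(n_d ^ ε)` (`checks_le_rpow`).

*Costs.* As long as the recursion continues, `n_i` exceeds `4 / (1 - δ)`, so that
`n_{i+1} ≤ θ n_i` with `θ = (1 + 3 δ₀) / 4 < 1` despite the rounding. Sums of `n_i`, of `n_{i+1}`,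
and of `n_i ^ ε` over all levels are therefore geometric (`costBounds_params`), and every contribution
to the costs is a product of such sums. The expected number of nonzero entries of `S_i` is at most
`m n_{i-1} ^ ε`, and rectangular products cost as much as the monotone function `mm`, up to
constants.
-/

open scoped NNReal ENNReal

noncomputable section

namespace Delegation

/-! ### Expectations over discrete distributions -/

/-- The expectation of a nonnegative function. Probabilities are expectations of indicators, so that
one calculus serves for distributions, costs and almost sure statements. -/
def Ex {α : Type} (p : PMF α) (f : α → ℝ≥0∞) : ℝ≥0∞ := ∑' x, p x * f x

/-- The indicator of an event. -/
def ind (E : Prop) : ℝ≥0∞ := by classical exact if E then 1 else 0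

@[simp] lemma ind_true {E : Prop} (h : E) : ind E = 1 := by simp [ind, h]

@[simp] lemma ind_false {E : Prop} (h : ¬E) : ind E = 0 := by simp [ind, h]

lemma ind_le_one (E : Prop) : ind E ≤ 1 := by unfold ind; split_ifs <;> simp

section Ex

variable {α β : Type}

lemma Ex_pure (a : α) (f : α → ℝ≥0∞) : Ex (PMF.pure a) f = f a := by
  unfold Ex
  rw [tsum_eq_single a]
  · simp
  · intro b hb
    simp [PMF.pure_apply_of_ne _ _ hb]

lemma Ex_bind (p : PMF α) (k : α → PMF β) (f : β → ℝ≥0∞) :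
    Ex (p.bind k) f = Ex p fun a => Ex (k a) f := by
  simp only [Ex, PMF.bind_apply, ← ENNReal.tsum_mul_right, ← ENNReal.tsum_mul_left]
  rw [ENNReal.tsum_comm]
  simp only [mul_assoc]

lemma Ex_map (p : PMF α) (g : α → β) (f : β → ℝ≥0∞) : Ex (p.map g) f = Ex p fun a => f (g a) := by
  rw [← PMF.bind_pure_comp, Ex_bind]
  simp [Ex_pure]

lemma Ex_mono {p : PMF α} {f g : α → ℝ≥0∞} (h : ∀ x, f x ≤ g x) : Ex p f ≤ Ex p g :=
  ENNReal.tsum_le_tsum fun x => by gcongr; exact h x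

lemma Ex_congr {p : PMF α} {f g : α → ℝ≥0∞} (h : ∀ x, f x = g x) : Ex p f = Ex p g := by
  rw [funext h]

@[simp] lemma Ex_const (p : PMF α) (c : ℝ≥0∞) : (Ex p fun _ => c) = c := by
  simp [Ex, ENNReal.tsum_mul_right]

lemma Ex_add (p : PMF α) (f g : α → ℝ≥0∞) : (Ex p fun x => f x + g x) = Ex p f + Ex p g := by
  simp [Ex, mul_add, ENNReal.tsum_add]

lemma Ex_mul_left (p : PMF α) (c : ℝ≥0∞) (f : α → ℝ≥0∞) :
    (Ex p fun x => c * f x) = c * Ex p f := by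
  simp only [Ex, ← ENNReal.tsum_mul_left]
  refine tsum_congr fun x => ?_
  ring

lemma Ex_finset_sum {ι : Type} (p : PMF α) (s : Finset ι) (f : ι → α → ℝ≥0∞) :
    (Ex p fun x => ∑ i ∈ s, f i x) = ∑ i ∈ s, Ex p (f i) := by
  classical
  induction s using Finset.induction_on with
  | empty => simp
  | insert a s ha ih => simp only [Finset.sum_insert ha, Ex_add, ih]

lemma Ex_comm (p : PMF α) (q : PMF β) (f : α → β → ℝ≥0∞) :
    (Ex p fun x => Ex q fun y => f x y) = Ex q fun y => Ex p fun x => f x y := by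
  simp only [Ex, ← ENNReal.tsum_mul_left]
  rw [ENNReal.tsum_comm]
  refine tsum_congr fun y => tsum_congr fun x => ?_
  ring

lemma Ex_le_of_le {p : PMF α} {f : α → ℝ≥0∞} {c : ℝ≥0∞} (h : ∀ x, f x ≤ c) : Ex p f ≤ c :=
  (Ex_mono h).trans (Ex_const p c).le

/-- Averaging preserves a bound for a difference. -/
lemma Ex_le_Ex_add {p : PMF α} {f g : α → ℝ≥0∞} {c : ℝ≥0∞} (h : ∀ x, f x ≤ g x + c) :
    Ex p f ≤ Ex p g + c :=
  (Ex_mono h).trans (by rw [Ex_add, Ex_const])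

lemma pmf_ext_Ex {p q : PMF α} (h : ∀ f, Ex p f = Ex q f) : p = q := by
  classical
  refine PMF.ext fun a => ?_
  have h' := h fun x => if x = a then 1 else 0
  simpa [Ex] using h'

lemma expect_eq_Ex (p : PMF α) (f : α → ℕ) : expect p f = Ex p fun x => (f x : ℝ≥0∞) := rfl

lemma prob_eq_Ex (p : PMF α) (E : α → Prop) : prob p E = (Ex p fun x => ind (E x)).toReal := by
  classical
  unfold prob Ex ind
  rw [PMF.toOuterMeasure_apply]
  congr 1
  refine tsum_congr fun x => ?_
  by_cases hx : E x <;> simp [Set.indicator, hx]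

lemma Ex_ind_le_one (p : PMF α) (E : α → Prop) : (Ex p fun x => ind (E x)) ≤ 1 :=
  Ex_le_of_le fun _ => ind_le_one _

lemma Ex_ind_ne_top (p : PMF α) (E : α → Prop) : (Ex p fun x => ind (E x)) ≠ ∞ :=
  ne_top_of_le_ne_top ENNReal.one_ne_top (Ex_ind_le_one p E)

/-- A bound for a difference of probabilities, in terms of expectations. -/
lemma abs_prob_sub_le_iff {p : PMF α} {q : PMF β} {E : α → Prop} {F : β → Prop} {c : ℝ}
    (hc : 0 ≤ c) :
    |prob p E - prob q F| ≤ c ↔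
      (Ex p fun x => ind (E x)) ≤ (Ex q fun x => ind (F x)) + ENNReal.ofReal c ∧
      (Ex q fun x => ind (F x)) ≤ (Ex p fun x => ind (E x)) + ENNReal.ofReal c := by
  have key : ∀ a b : ℝ≥0∞, a ≠ ∞ → b ≠ ∞ →
      (a ≤ b + ENNReal.ofReal c ↔ a.toReal ≤ b.toReal + c) := by
    intro a b ha hb
    rw [← ENNReal.toReal_le_toReal ha (by simp [hb]), ENNReal.toReal_add hb (by simp),
      ENNReal.toReal_ofReal hc]
  rw [prob_eq_Ex, prob_eq_Ex, key _ _ (Ex_ind_ne_top _ _) (Ex_ind_ne_top _ _),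
    key _ _ (Ex_ind_ne_top _ _) (Ex_ind_ne_top _ _), abs_le]
  constructor
  · rintro ⟨h₁, h₂⟩
    constructor <;> linarith
  · rintro ⟨h₁, h₂⟩
    constructor <;> linarith

lemma forall_support_iff (p : PMF α) (Q : α → Prop) :
    (∀ a ∈ p.support, Q a) ↔ (Ex p fun a => ind (¬Q a)) = 0 := by
  unfold Ex
  rw [ENNReal.tsum_eq_zero]
  refine forall_congr' fun a => ?_
  rw [PMF.mem_support_iff, mul_eq_zero]
  by_cases hQ : Q a <;> simp [hQ]

lemma Ex_uniform [Fintype α] [Nonempty α] (f : α → ℝ≥0∞) :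
    Ex (PMF.uniformOfFintype α) f = (Fintype.card α : ℝ≥0∞)⁻¹ * ∑ x, f x := by
  simp [Ex, tsum_fintype, Finset.mul_sum]

lemma Ex_uniform_equiv [Fintype α] [Nonempty α] [Fintype β] [Nonempty β] (e : α ≃ β)
    (f : β → ℝ≥0∞) :
    (Ex (PMF.uniformOfFintype α) fun x => f (e x)) = Ex (PMF.uniformOfFintype β) f := by
  rw [Ex_uniform, Ex_uniform, Fintype.card_congr e, Equiv.sum_comp e f]

lemma Ex_uniform_add_left [Fintype α] [AddGroup α] (a : α) (f : α → ℝ≥0∞) :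
    (Ex (PMF.uniformOfFintype α) fun x => f (a + x)) = Ex (PMF.uniformOfFintype α) f :=
  Ex_uniform_equiv (Equiv.addLeft a) f

/-- The probability that a uniform element of a group lies in a subgroup. -/
lemma Ex_uniform_mem_addSubgroup [Fintype α] [AddCommGroup α] (H : AddSubgroup α) :
    (Ex (PMF.uniformOfFintype α) fun x => ind (x ∈ H)) = (H.index : ℝ≥0∞)⁻¹ := by
  classical
  rw [Ex_uniform]
  have h₁ : (∑ x : α, ind (x ∈ H)) = (Nat.card H : ℝ≥0∞) := by
    simp only [ind]
    rw [Finset.sum_boole, Nat.card_eq_fintype_card, Fintype.card_subtype]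
  have h₂ : Nat.card H * H.index = Fintype.card α := by
    rw [AddSubgroup.card_mul_index, Nat.card_eq_fintype_card]
  have hc : (Nat.card H : ℝ≥0∞) ≠ 0 := by
    simp [Nat.card_eq_fintype_card]
  rw [h₁, ← h₂, Nat.cast_mul, ENNReal.mul_inv (Or.inl hc) (Or.inl (by simp)), mul_comm, ← mul_assoc,
    ENNReal.mul_inv_cancel hc (by simp), one_mul]

end Ex

/-! ### Independent draws -/

section Pi

variable {ι : Type} [Fintype ι] [DecidableEq ι] {β γ : ι → Type} [∀ i, Fintype (β i)]
  [∀ i, Fintype (γ i)]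

lemma piPMF_apply (p : ∀ i, PMF (β i)) (x : ∀ i, β i) : piPMF p x = ∏ i, p i (x i) := rfl

lemma piPMF_bind (p : ∀ i, PMF (β i)) (k : ∀ i, β i → PMF (γ i)) :
    ((piPMF p).bind fun x => piPMF fun i => k i (x i)) = piPMF fun i => (p i).bind (k i) := by
  refine PMF.ext fun y => ?_
  simp only [PMF.bind_apply, piPMF_apply, tsum_fintype]
  simp_rw [← Finset.prod_mul_distrib]
  rw [Finset.prod_univ_sum, Fintype.piFinset_univ]

lemma piPMF_pure (x : ∀ i, β i) : (piPMF fun i => PMF.pure (x i)) = PMF.pure x := by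
  classical
  refine PMF.ext fun y => ?_
  rw [piPMF_apply, PMF.pure_apply]
  by_cases h : y = x
  · simp [h]
  · obtain ⟨i, hi⟩ := Function.ne_iff.mp h
    rw [if_neg h]
    exact Finset.prod_eq_zero (Finset.mem_univ i) (by simp [hi])

lemma piPMF_map (p : ∀ i, PMF (β i)) (g : ∀ i, β i → γ i) :
    (piPMF p).map (fun x i => g i (x i)) = piPMF fun i => (p i).map (g i) := by
  have h := piPMF_bind p fun i b => PMF.pure (g i b)
  simp only [piPMF_pure] at h
  exact h

/-- Drawing one coordinate anew does not change the distribution. -/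
lemma Ex_piPMF_resample (p : ∀ i, PMF (β i)) (i : ι) (f : (∀ i, β i) → ℝ≥0∞) :
    Ex (piPMF p) f = Ex (piPMF p) fun x => Ex (p i) fun y => f (Function.update x i y) := by
  classical
  have h₁ : ∀ x : ∀ i, β i, (piPMF fun j => if h : j = i then h ▸ p i else PMF.pure (x j)) =
      (p i).map (Function.update x i) := by
    intro x
    refine PMF.ext fun z => ?_
    rw [piPMF_apply, PMF.map_apply, tsum_fintype, ← Finset.mul_prod_erase _ _ (Finset.mem_univ i)]
    have h₂ : ∀ j ∈ Finset.univ.erase i,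
        (if h : j = i then h ▸ p i else PMF.pure (x j)) (z j) = if z j = x j then 1 else 0 := by
      intro j hj
      rw [dif_neg (Finset.ne_of_mem_erase hj)]
      rfl
    rw [Finset.prod_congr rfl h₂, Finset.prod_boole]
    simp only [Finset.mem_erase, Finset.mem_univ, and_true, ne_eq, dite_true]
    rw [Finset.sum_eq_single (z i)]
    · simp only [Function.eq_update_iff, true_and]
      split_ifs <;> simp_all
    · intro y _ hy
      rw [if_neg]
      intro h
      rw [h] at hy
      simp at hy
    · simp
  have h := piPMF_bind p fun j (b : β j) => if h : j = i then h ▸ p i else PMF.pure b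
  have h₃ : (fun j => (p j).bind fun b => if h : j = i then h ▸ p i else PMF.pure b) = p := by
    funext j
    by_cases hj : j = i
    · subst hj
      simp
    · simp [hj]
  rw [h₃] at h
  conv_lhs => rw [← h]
  rw [Ex_bind]
  refine Ex_congr fun x => ?_
  rw [h₁, Ex_map]

/-- A single coordinate of independent draws. -/
lemma Ex_piPMF_eval (p : ∀ i, PMF (β i)) (i : ι) (f : β i → ℝ≥0∞) :
    (Ex (piPMF p) fun x => f (x i)) = Ex (p i) f := by
  rw [Ex_piPMF_resample p i]
  simp

/-- Some of the coordinates of independent draws. -/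
lemma piPMF_comp_injective {κ B : Type} [Fintype κ] [DecidableEq κ] [Fintype B] (p : ι → PMF B)
    (φ : κ → ι) (hφ : Function.Injective φ) :
    (piPMF p).map (fun x j => x (φ j)) = piPMF fun j => p (φ j) := by
  classical
  refine PMF.ext fun y => ?_
  rw [PMF.map_apply, tsum_fintype, piPMF_apply]
  have h₁ : ∀ x : ι → B, (if y = (fun j => x (φ j)) then piPMF p x else 0) =
      ∏ i, p i (x i) * if ∀ j, φ j = i → x i = y j then 1 else 0 := by
    intro x
    rw [Finset.prod_mul_distrib, Finset.prod_boole]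
    by_cases h : y = fun j => x (φ j)
    · subst h
      simp only [if_true, piPMF_apply]
      rw [if_pos, mul_one]
      intro i _ j hj
      rw [hj]
    · rw [if_neg h, if_neg, mul_zero]
      intro h'
      exact h (funext fun j => (h' (φ j) (Finset.mem_univ _) j rfl).symm)
  refine (Finset.sum_congr rfl fun x _ => Eq.trans (by congr) (h₁ x)).trans ?_
  have h₂ := Finset.prod_univ_sum (fun _ : ι => (Finset.univ : Finset B))
    fun i b => p i b * if ∀ j, φ j = i → b = y j then 1 else 0
  rw [Fintype.piFinset_univ] at h₂
  rw [← h₂]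
  symm
  refine Fintype.prod_of_injective φ hφ _ _ ?_ ?_
  · intro i hi
    have : ∀ b : B, (∀ j, φ j = i → b = y j) := fun b j hj => absurd ⟨j, hj⟩ hi
    rw [Finset.sum_congr rfl fun b _ => by rw [if_pos (this b), mul_one]]
    rw [← tsum_fintype (L := .unconditional _)]
    exact (p i).tsum_coe
  · intro j
    rw [Finset.sum_eq_single (y j)]
    · rw [if_pos, mul_one]
      intro j' hj'
      rw [hφ hj']
    · intro b _ hb
      rw [if_neg, mul_zero]
      intro h
      exact hb (h j rfl)
    · simp

lemma piPMF_uniform [∀ i, Nonempty (β i)] :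
    (piPMF fun i => PMF.uniformOfFintype (β i)) = PMF.uniformOfFintype (∀ i, β i) := by
  refine PMF.ext fun x => ?_
  rw [piPMF_apply]
  simp only [PMF.uniformOfFintype_apply, Fintype.card_pi, Nat.cast_prod]
  rw [ENNReal.prod_inv_distrib]
  intro i _ j _ _
  simp

end Pi

/-- Independent draws for the indices below `n + 1`, the last one separately. -/
lemma Ex_piPMF_snoc {n : ℕ} {B : Type} [Fintype B] (p : PMF B)
    (f : (Fin (n + 1) → B) → ℝ≥0∞) :
    Ex (piPMF fun _ : Fin (n + 1) => p) f =
      Ex (piPMF fun _ : Fin n => p) fun x => Ex p fun y => f (Fin.snoc (α := fun _ => B) x y) := by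
  simp only [Ex, piPMF_apply, tsum_fintype, Finset.mul_sum]
  rw [← Fintype.sum_prod_type', ← Equiv.sum_comp (Fin.snocEquiv fun _ => B),
    ← Equiv.sum_comp (Equiv.prodComm _ _)]
  refine Finset.sum_congr rfl fun x _ => ?_
  simp [Fin.prod_univ_castSucc, Fin.snocEquiv, mul_assoc]

/-! ### Noise -/

lemma nnz_eq_sum {R : Type} [CommRing R] {a b : ℕ} (S : Matrix (Fin a) (Fin b) R) :
    (nnz S : ℝ≥0∞) = ∑ i : Fin a, ∑ j : Fin b, ind (S i j ≠ 0) := by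
  classical
  rw [← Fintype.sum_prod_type' (f := fun i j => ind (S i j ≠ 0))]
  unfold nnz
  have h : {p : Fin a × Fin b | S p.1 p.2 ≠ 0} =
      ((Finset.univ.filter fun p : Fin a × Fin b => S p.1 p.2 ≠ 0 : Finset _) : Set _) := by
    ext p
    simp
  rw [h, Set.ncard_coe_finset, ← Finset.sum_boole]
  refine Finset.sum_congr rfl fun p _ => ?_
  by_cases hp : S p.1 p.2 = 0 <;> simp [hp]

section NoiseLemmas

variable {R : Type} [CommRing R] [Fintype R]

lemma Ex_coin (p : ℝ≥0) (h : p ≤ 1) (f : Bool → ℝ≥0∞) :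
    Ex (coin p h) f = p * f true + (1 - p) * f false := by
  simp [Ex, coin, tsum_fintype]

lemma Ex_noise {μ : ℝ} (hμ₁ : μ ≤ 1) (f : R → ℝ≥0∞) :
    Ex (noise R μ) f = ENNReal.ofReal μ * Ex (PMF.uniformOfFintype R) f +
      (1 - ENNReal.ofReal μ) * f 0 := by
  have h : min μ.toNNReal 1 = μ.toNNReal := min_eq_left (by simpa using hμ₁)
  rw [noise, Ex_bind, Ex_coin]
  simp only [if_true, Ex_pure, Bool.false_eq_true, if_false, h]
  rfl

lemma noise_one : noise R 1 = PMF.uniformOfFintype R := by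
  refine pmf_ext_Ex fun f => ?_
  rw [Ex_noise le_rfl]
  simp

/-- Additional independent noise raises the noise rate. -/
lemma noise_bind_noise {μ μ' : ℝ} (h₀ : 0 ≤ μ) (h : μ ≤ μ') (h₁ : μ < 1) (h₁' : μ' ≤ 1) :
    ((noise R μ).bind fun x => (noise R ((μ' - μ) / (1 - μ))).map fun y => x + y) =
      noise R μ' := by
  have h2 : 0 < 1 - μ := by linarith
  have hν₀ : 0 ≤ (μ' - μ) / (1 - μ) := div_nonneg (by linarith) h2.le
  have hν₁ : (μ' - μ) / (1 - μ) ≤ 1 := by rw [div_le_one h2]; linarith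
  refine pmf_ext_Ex fun f => ?_
  rw [Ex_bind]
  simp only [Ex_map]
  rw [Ex_noise h₁.le, Ex_noise h₁']
  simp only [Ex_noise hν₁, add_zero, zero_add]
  rw [Ex_add, Ex_mul_left, Ex_mul_left, Ex_comm]
  have hs : ∀ y : R, (Ex (PMF.uniformOfFintype R) fun x => f (x + y)) =
      Ex (PMF.uniformOfFintype R) f := by
    intro y
    simp only [add_comm _ y]
    exact Ex_uniform_add_left y f
  simp only [hs, Ex_const]
  generalize Ex (PMF.uniformOfFintype R) f = U
  have hsub : ∀ a : ℝ, 0 ≤ a → (1 : ℝ≥0∞) - ENNReal.ofReal a = ENNReal.ofReal (1 - a) := by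
    intro a ha
    rw [ENNReal.ofReal_sub _ ha, ENNReal.ofReal_one]
  rw [hsub _ h₀, hsub _ hν₀, hsub _ (h₀.trans h)]
  have e₁ : 1 - (μ' - μ) / (1 - μ) = (1 - μ') / (1 - μ) := by field_simp; ring
  have hn : 0 ≤ (1 - μ') / (1 - μ) := div_nonneg (by linarith) h2.le
  have e₂ : ENNReal.ofReal μ + ENNReal.ofReal (1 - μ) * ENNReal.ofReal ((μ' - μ) / (1 - μ)) =
      ENNReal.ofReal μ' := by
    rw [← ENNReal.ofReal_mul h2.le, ← ENNReal.ofReal_add h₀ (by positivity)]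
    congr 1
    field_simp
    ring
  have e₃ : ENNReal.ofReal (1 - μ) * ENNReal.ofReal ((1 - μ') / (1 - μ)) =
      ENNReal.ofReal (1 - μ') := by
    rw [← ENNReal.ofReal_mul h2.le]
    congr 1
    field_simp
  have e₄ : ENNReal.ofReal ((μ' - μ) / (1 - μ)) + ENNReal.ofReal ((1 - μ') / (1 - μ)) = 1 := by
    rw [← ENNReal.ofReal_add hν₀ hn, ← e₁]
    simp
  rw [e₁]
  calc _ = ENNReal.ofReal μ *
        (ENNReal.ofReal ((μ' - μ) / (1 - μ)) + ENNReal.ofReal ((1 - μ') / (1 - μ))) * U +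
        ENNReal.ofReal (1 - μ) * ENNReal.ofReal ((μ' - μ) / (1 - μ)) * U +
        ENNReal.ofReal (1 - μ) * ENNReal.ofReal ((1 - μ') / (1 - μ)) * f 0 := by ring
    _ = _ := by rw [e₄, mul_one, ← add_mul, e₂, e₃]

lemma uniformMatrix_eq_noiseMatrix (a b : ℕ) : uniformMatrix R a b = noiseMatrix R a b 1 := by
  unfold noiseMatrix
  rw [noise_one]
  have h₁ : (piPMF fun _ : Fin b => PMF.uniformOfFintype R) = PMF.uniformOfFintype (Fin b → R) :=
    piPMF_uniform
  rw [h₁]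
  exact (piPMF_uniform (ι := Fin a) (β := fun _ => Fin b → R)).symm

/-- A noise matrix is a family of independent rows of independent entries. -/
lemma Ex_noiseMatrix (a b : ℕ) (μ : ℝ) (f : Matrix (Fin a) (Fin b) R → ℝ≥0∞) :
    Ex (noiseMatrix R a b μ) f =
      Ex (piPMF fun _ : Fin a => piPMF fun _ : Fin b => noise R μ) fun x => f (Matrix.of x) := rfl

lemma noiseMatrix_bind_noiseMatrix {μ μ' : ℝ} (h₀ : 0 ≤ μ) (h : μ ≤ μ') (h₁ : μ < 1)
    (h₁' : μ' ≤ 1) (a b : ℕ) (f : Matrix (Fin a) (Fin b) R → ℝ≥0∞) :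
    (Ex (noiseMatrix R a b μ) fun S =>
      Ex (noiseMatrix R a b ((μ' - μ) / (1 - μ))) fun S' => f (S + S')) =
      Ex (noiseMatrix R a b μ') f := by
  rw [Ex_noiseMatrix _ _ μ', ← noise_bind_noise h₀ h h₁ h₁', ← piPMF_bind, ← piPMF_bind, Ex_bind,
    Ex_noiseMatrix]
  refine Ex_congr fun x => ?_
  simp_rw [← piPMF_map]
  rw [Ex_map, Ex_noiseMatrix]
  rfl

lemma Ex_noiseMatrix_rows {a a' : ℕ} (h : a ≤ a') (b : ℕ) (μ : ℝ)
    (f : Matrix (Fin a) (Fin b) R → ℝ≥0∞) :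
    (Ex (noiseMatrix R a' b μ) fun S => f (S.submatrix (Fin.castLE h) id)) =
      Ex (noiseMatrix R a b μ) f := by
  rw [Ex_noiseMatrix a, ← piPMF_comp_injective (B := Fin b → R)
    (fun _ : Fin a' => piPMF fun _ : Fin b => noise R μ)
    (Fin.castLE h) (Fin.castLE_injective h), Ex_map, Ex_noiseMatrix]
  rfl

lemma Ex_noiseMatrix_col {a b : ℕ} (j : Fin b) (μ : ℝ) (f : (Fin a → R) → ℝ≥0∞) :
    (Ex (noiseMatrix R a b μ) fun S => f fun i => S i j) =
      Ex (piPMF fun _ : Fin a => noise R μ) f := by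
  have h : (piPMF fun _ : Fin b => noise R μ).map (fun x => x j) = noise R μ := by
    refine pmf_ext_Ex fun g => ?_
    rw [Ex_map, Ex_piPMF_eval (fun _ : Fin b => noise R μ) j]
  conv_rhs => rw [← h]
  rw [← piPMF_map (β := fun _ : Fin a => Fin b → R) _ fun _ x => x j, Ex_map, Ex_noiseMatrix]
  rfl

/-- The expected number of nonzero entries of a noise matrix. -/
lemma Ex_nnz_noiseMatrix_le (a b : ℕ) {μ : ℝ} (h₁ : μ ≤ 1) :
    (Ex (noiseMatrix R a b μ) fun S => (nnz S : ℝ≥0∞)) ≤ ENNReal.ofReal (a * b * μ) := by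
  simp only [nnz_eq_sum]
  rw [Ex_finset_sum]
  have he : ∀ (i : Fin a) (j : Fin b),
      (Ex (noiseMatrix R a b μ) fun S => ind (S i j ≠ 0)) ≤ ENNReal.ofReal μ := by
    intro i j
    rw [Ex_noiseMatrix]
    simp only [Matrix.of_apply]
    rw [Ex_piPMF_eval (fun _ : Fin a => piPMF fun _ : Fin b => noise R μ) i
      (fun x => ind (x j ≠ 0)), Ex_piPMF_eval (fun _ : Fin b => noise R μ) j (fun x => ind (x ≠ 0)),
      Ex_noise h₁]
    simp only [ne_eq, not_true_eq_false, not_false_eq_true, ind_false, mul_zero, add_zero]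
    exact mul_le_of_le_one_right' (Ex_ind_le_one _ _)
  calc ∑ i : Fin a, (Ex (noiseMatrix R a b μ) fun S => ∑ j, ind (S i j ≠ 0))
      ≤ ∑ _i : Fin a, ∑ _j : Fin b, ENNReal.ofReal μ := by
        refine Finset.sum_le_sum fun i _ => ?_
        rw [Ex_finset_sum]
        exact Finset.sum_le_sum fun j _ => he i j
    _ = ENNReal.ofReal (a * b * μ) := by
        rw [ENNReal.ofReal_mul (by positivity), ENNReal.ofReal_mul (by positivity)]
        simp [mul_assoc]

end NoiseLemmas

/-! ### Building circuits -/

section CircuitBuilding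

variable {R X Y Z : Type} [CommRing R]

lemma Circuit.run_concat (c : Circuit R X) (g : Gate R X) (x : X → R) :
    Circuit.run (c ++ [g]) x = Circuit.run c x ++ [gateValue x (Circuit.run c x) g] := by
  simp [Circuit.run, List.foldl_append]

lemma Circuit.length_run (c : Circuit R X) (x : X → R) : (Circuit.run c x).length = c.length := by
  induction c using List.reverseRecOn with
  | nil => rfl
  | append_singleton c g ih => rw [Circuit.run_concat]; simp [ih]

/-- Replaces the inputs of a circuit with `M` gates by the wires `out` of a preceding circuit with
`N` gates. Wires to nonexistent gates carry `0`; they are moved beyond the last gate. -/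
def Wire.subst (N M : ℕ) (out : Y → Wire X) : Wire Y → Wire X
  | .input y => match out y with
    | .input x => .input x
    | .gate i => if i < N then .gate i else .gate (i + M)
  | .gate i => .gate (N + i)

def Gate.subst (N M : ℕ) (out : Y → Wire X) : Gate R Y → Gate R X
  | .const r => .const r
  | .add u v => .add (u.subst N M out) (v.subst N M out)
  | .sub u v => .sub (u.subst N M out) (v.subst N M out)
  | .mul u v => .mul (u.subst N M out) (v.subst N M out)
  | .isZero u => .isZero (u.subst N M out)

lemma wireValue_subst (c : Circuit R X) (out : Y → Wire X) (x : X → R) {M : ℕ} (mem : List R)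
    (hM : mem.length ≤ M) (w : Wire Y) :
    wireValue x (Circuit.run c x ++ mem) (w.subst c.length M out) =
      wireValue (fun y => Circuit.read c x (out y)) mem w := by
  have hl := Circuit.length_run c x
  cases w with
  | gate i =>
    simp only [Wire.subst, wireValue]
    rw [List.getD_append_right _ _ _ _ (by omega)]
    congr 1
    omega
  | input y =>
    change wireValue x (Circuit.run c x ++ mem) (Wire.subst c.length M out (.input y)) =
      wireValue x (Circuit.run c x) (out y)
    simp only [Wire.subst]
    cases out y with
    | input x' => rfl
    | gate i =>
      by_cases h : i < c.length
      · simp only [h, if_true, wireValue]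
        rw [List.getD_append _ _ _ _ (by omega)]
      · simp only [h, if_false, wireValue]
        rw [List.getD_eq_default _ _ (by simp; omega), List.getD_eq_default _ _ (by omega)]

lemma Circuit.run_append_subst (c : Circuit R X) (out : Y → Wire X) (x : X → R) {M : ℕ}
    (c' : Circuit R Y) (hM : c'.length ≤ M) :
    Circuit.run (c ++ c'.map (Gate.subst c.length M out)) x =
      Circuit.run c x ++ Circuit.run c' fun y => Circuit.read c x (out y) := by
  induction c' using List.reverseRecOn with
  | nil => simp [Circuit.run]
  | append_singleton c' g ih =>
    have hM' : c'.length + 1 ≤ M := by simpa using hM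
    rw [List.map_append, ← List.append_assoc]
    simp only [List.map_cons, List.map_nil]
    rw [Circuit.run_concat, ih (by omega), Circuit.run_concat, List.append_assoc]
    congr 3
    have hw := wireValue_subst c out x (M := M) (Circuit.run c' fun y => Circuit.read c x (out y))
      (by rw [Circuit.length_run]; omega)
    cases g with
    | isZero u =>
      simp only [Gate.subst, gateValue]
      rw [hw u]
    | _ => simp only [Gate.subst, gateValue, hw]

/-- `f` is computed by a circuit with at most `g` gates; its values are read off wires, so that
outputs may be inputs or coincide with one another. -/
def Computes (g : ℕ) (f : (X → R) → Y → R) : Prop :=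
  ∃ (c : Circuit R X) (out : Y → Wire X), c.length ≤ g ∧ ∀ x y, Circuit.read c x (out y) = f x y

lemma Computes.mono {g g' : ℕ} {f : (X → R) → Y → R} (h : Computes g f) (hg : g ≤ g') :
    Computes g' f := by
  obtain ⟨c, out, hc, hf⟩ := h
  exact ⟨c, out, hc.trans hg, hf⟩

lemma Computes.comp {g g' : ℕ} {f : (X → R) → Y → R} {f' : (Y → R) → Z → R} (h : Computes g f)
    (h' : Computes g' f') : Computes (g + g') fun x => f' (f x) := by
  obtain ⟨c, out, hc, hf⟩ := h
  obtain ⟨c', out', hc', hf'⟩ := h'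
  refine ⟨c ++ c'.map (Gate.subst c.length c'.length out),
    fun z => (out' z).subst c.length c'.length out, by simp; omega, fun x z => ?_⟩
  rw [Circuit.read, Circuit.run_append_subst c out x c' le_rfl,
    wireValue_subst c out x _ (Circuit.length_run _ _).le]
  have : (fun y => Circuit.read c x (out y)) = f x := funext fun y => hf x y
  rw [this]
  exact hf' _ _

lemma Computes.inputs (σ : Y → X) : Computes 0 fun (x : X → R) y => x (σ y) :=
  ⟨[], fun y => .input (σ y), le_rfl, fun _ _ => rfl⟩

lemma Computes.reindex {g : ℕ} {f : (X → R) → Y → R} (h : Computes g f) (σ : Z → Y) :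
    Computes g fun x z => f x (σ z) := by
  obtain ⟨c, out, hc, hf⟩ := h
  exact ⟨c, fun z => out (σ z), hc, fun x z => hf x (σ z)⟩

lemma Computes.keep {g : ℕ} {f : (X → R) → Y → R} (h : Computes g f) (σ : Z → X) :
    Computes g fun x => Sum.elim (fun z => x (σ z)) (f x) := by
  obtain ⟨c, out, hc, hf⟩ := h
  refine ⟨c, Sum.elim (fun z => .input (σ z)) out, hc, fun x y => ?_⟩
  cases y
  · rfl
  · exact hf x _

lemma Computes.sum {Y' : Type} {g g' : ℕ} {f : (X → R) → Y → R} {f' : (X → R) → Y' → R}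
    (h : Computes g f) (h' : Computes g' f') :
    Computes (g + g') fun x => Sum.elim (f x) (f' x) := by
  have h₁ := h.keep (Z := X) id
  have h₂ : Computes (0 + g') fun (z : X ⊕ Y → R) => f' fun x => z (Sum.inl x) :=
    (Computes.inputs (Sum.inl : X → X ⊕ Y)).comp h'
  rw [zero_add] at h₂
  exact h₁.comp (h₂.keep Sum.inr)

/-- A single value computed by a circuit. -/
def ComputesOne (g : ℕ) (f : (X → R) → R) : Prop := Computes g fun x (_ : Unit) => f x

lemma ComputesOne.mono {g g' : ℕ} {f : (X → R) → R} (h : ComputesOne g f) (hg : g ≤ g') :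
    ComputesOne g' f := Computes.mono h hg

lemma ComputesOne.zero : ComputesOne 0 fun _ : X → R => (0 : R) :=
  ⟨[], fun _ => .gate 0, le_rfl, fun _ _ => rfl⟩

lemma ComputesOne.input (y : X) : ComputesOne 0 fun x : X → R => x y :=
  Computes.inputs fun _ => y

lemma ComputesOne.const (r : R) : ComputesOne 1 fun _ : X → R => r :=
  ⟨[.const r], fun _ => .gate 0, le_rfl, fun _ _ => rfl⟩

lemma Computes.pi {Y : Type} [Fintype Y] {g : Y → ℕ} {f : (X → R) → Y → R}
    (h : ∀ y, ComputesOne (g y) fun x => f x y) : Computes (∑ y, g y) f := by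
  classical
  have key : ∀ s : Finset Y, Computes (∑ y ∈ s, g y) fun x y => if y ∈ s then f x y else 0 := by
    intro s
    induction s using Finset.induction_on with
    | empty => simpa using ComputesOne.zero.reindex fun _ : Y => ()
    | insert a s ha ih =>
      rw [Finset.sum_insert ha, add_comm]
      have h₁ := (ih.sum (h a)).reindex fun y => if y = a then Sum.inr () else Sum.inl y
      convert h₁ using 3 with x y
      by_cases hy : y = a <;> simp [hy]
  simpa using key Finset.univ

section Arithmetic

variable {g g' : ℕ} {f f' : (X → R) → R}

lemma ComputesOne.binary {op : R → R → R} {G : Wire (Unit ⊕ Unit) → Wire (Unit ⊕ Unit) → Gate R (Unit ⊕ Unit)}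
    (hG : ∀ x mem u v, gateValue x mem (G u v) = op (wireValue x mem u) (wireValue x mem v))
    (h : ComputesOne g f) (h' : ComputesOne g' f') :
    ComputesOne (g + g' + 1) fun x => op (f x) (f' x) := by
  have h₁ : ComputesOne 1 fun z : Unit ⊕ Unit → R => op (z (.inl ())) (z (.inr ())) := by
    refine ⟨[G (.input (.inl ())) (.input (.inr ()))], fun _ => .gate 0, le_rfl, fun x y => ?_⟩
    simp [Circuit.read, Circuit.run, wireValue, hG]
  exact (Computes.sum h h').comp h₁

lemma ComputesOne.add (h : ComputesOne g f) (h' : ComputesOne g' f') :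
    ComputesOne (g + g' + 1) fun x => f x + f' x :=
  ComputesOne.binary (G := Gate.add) (fun _ _ _ _ => rfl) h h'

lemma ComputesOne.sub (h : ComputesOne g f) (h' : ComputesOne g' f') :
    ComputesOne (g + g' + 1) fun x => f x - f' x :=
  ComputesOne.binary (G := Gate.sub) (fun _ _ _ _ => rfl) h h'

lemma ComputesOne.mul (h : ComputesOne g f) (h' : ComputesOne g' f') :
    ComputesOne (g + g' + 1) fun x => f x * f' x :=
  ComputesOne.binary (G := Gate.mul) (fun _ _ _ _ => rfl) h h'

lemma ComputesOne.sum {ι : Type} {s : Finset ι} {f : ι → (X → R) → R}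
    (h : ∀ i ∈ s, ComputesOne g (f i)) : ComputesOne (s.card * (g + 1)) fun x => ∑ i ∈ s, f i x := by
  classical
  induction s using Finset.induction_on with
  | empty => simpa using ComputesOne.zero
  | insert a s ha ih =>
    simp only [Finset.sum_insert ha, Finset.card_insert_of_notMem ha]
    exact ((h a (by simp)).add (ih fun i hi => h i (by simp [hi]))).mono (by ring_nf; omega)

end Arithmetic

open Classical in
/-- A property decided by a circuit, as a value `1` or `0`. -/
def Decides (g : ℕ) (P : (X → R) → Prop) : Prop := ComputesOne g fun x => if P x then 1 else 0

lemma Decides.mono {g g' : ℕ} {P : (X → R) → Prop} (h : Decides g P) (hg : g ≤ g') :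
    Decides g' P := Computes.mono h hg

lemma Decides.eq_zero {g : ℕ} {f : (X → R) → R} (h : ComputesOne g f) :
    Decides (g + 1) fun x => f x = 0 := by
  have h₁ : ComputesOne 1 fun z : Unit → R => gateValue z [] (.isZero (.input ())) :=
    ⟨[.isZero (.input ())], fun _ => .gate 0, le_rfl, fun x y => rfl⟩
  exact Computes.comp h h₁

lemma Decides.eq {g g' : ℕ} {f f' : (X → R) → R} (h : ComputesOne g f) (h' : ComputesOne g' f') :
    Decides (g + g' + 2) fun x => f x = f' x := by
  have := Decides.eq_zero (h.sub h')
  simpa only [sub_eq_zero] using this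

lemma Decides.true : Decides 1 fun _ : X → R => True := by
  simpa [Decides] using ComputesOne.const (X := X) (1 : R)

lemma Decides.and {g g' : ℕ} {P Q : (X → R) → Prop} (h : Decides g P) (h' : Decides g' Q) :
    Decides (g + g' + 1) fun x => P x ∧ Q x := by
  have h₁ := ComputesOne.mul h h'
  unfold Decides
  convert h₁ using 2 with x
  by_cases hP : P x <;> by_cases hQ : Q x <;> simp [hP, hQ]

lemma Decides.forall_mem {ι : Type} {s : Finset ι} {g : ℕ} {P : ι → (X → R) → Prop}
    (h : ∀ i ∈ s, Decides g (P i)) :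
    Decides (1 + s.card * (g + 1)) fun x => ∀ i ∈ s, P i x := by
  classical
  induction s using Finset.induction_on with
  | empty => simpa using Decides.true
  | insert a s ha ih =>
    simp only [Finset.forall_mem_insert, Finset.card_insert_of_notMem ha]
    exact ((h a (by simp)).and (ih fun i hi => h i (by simp [hi]))).mono (by ring_nf; omega)

lemma Decides.forall_fintype {ι : Type} [Fintype ι] {g : ℕ} {P : ι → (X → R) → Prop}
    (h : ∀ i, Decides g (P i)) :
    Decides (1 + Fintype.card ι * (g + 1)) fun x => ∀ i, P i x := by
  simpa using Decides.forall_mem (s := Finset.univ) fun i _ => h i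

/-- Every entry of the matrix is computed by a circuit with at most `g` gates. -/
def ComputesEntries {a b : ℕ} (g : ℕ) (F : (X → R) → Matrix (Fin a) (Fin b) R) : Prop :=
  ∀ i j, ComputesOne g fun x => F x i j

section Entries

variable {a b c g g' : ℕ}

lemma ComputesEntries.mono {F : (X → R) → Matrix (Fin a) (Fin b) R} (h : ComputesEntries g F)
    (hg : g ≤ g') : ComputesEntries g' F := fun i j => (h i j).mono hg

lemma ComputesEntries.const (M : Matrix (Fin a) (Fin b) R) :
    ComputesEntries 1 fun _ : X → R => M := fun i j => ComputesOne.const (M i j)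

lemma ComputesEntries.add {F G : (X → R) → Matrix (Fin a) (Fin b) R} (h : ComputesEntries g F)
    (h' : ComputesEntries g' G) : ComputesEntries (g + g' + 1) fun x => F x + G x :=
  fun i j => (h i j).add (h' i j)

lemma ComputesEntries.transpose {F : (X → R) → Matrix (Fin a) (Fin b) R}
    (h : ComputesEntries g F) : ComputesEntries g fun x => (F x).transpose :=
  fun i j => h j i

lemma ComputesEntries.mul {F : (X → R) → Matrix (Fin a) (Fin b) R}
    {G : (X → R) → Matrix (Fin b) (Fin c) R} (h : ComputesEntries g F)
    (h' : ComputesEntries g' G) : ComputesEntries (b * (g + g' + 2)) fun x => F x * G x := by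
  intro i j
  simp only [Matrix.mul_apply]
  have := ComputesOne.sum (s := (Finset.univ : Finset (Fin b)))
    (f := fun k x => F x i k * G x k j) fun k _ => (h i k).mul (h' k j)
  simpa using this

lemma Decides.eq_matrix {F G : (X → R) → Matrix (Fin a) (Fin b) R} (h : ComputesEntries g F)
    (h' : ComputesEntries g' G) : Decides (1 + a * b * (g + g' + 3)) fun x => F x = G x := by
  have h₁ := Decides.forall_fintype (ι := Fin a × Fin b)
    (P := fun p x => F x p.1 p.2 = G x p.1 p.2) fun p => Decides.eq (h p.1 p.2) (h' p.1 p.2)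
  simp only [Fintype.card_prod, Fintype.card_fin] at h₁
  convert h₁ using 2 with x
  rw [← Matrix.ext_iff]
  simp [Prod.forall]

lemma ComputesEntries.inputs (σ : Fin a → Fin b → X) :
    ComputesEntries 0 fun x : X → R => Matrix.of fun i j => x (σ i j) :=
  fun i j => ComputesOne.input (σ i j)

end Entries

end CircuitBuilding

/-! ### Consequences of the hardness of LPN -/

section Hardness

variable {R : Type} [CommRing R] [Fintype R]

lemma LPNHard.mono {N k t size size' : ℕ} {μ adv adv' : ℝ} (h : LPNHard R N k t μ size adv)
    (hs : size' ≤ size) (ha : adv ≤ adv') : LPNHard R N k t μ size' adv' :=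
  fun D hD => (h D (hD.trans hs)).trans ha

lemma LPNHard.decides [Nontrivial R] {N k t size g : ℕ} {μ adv : ℝ}
    (h : LPNHard R N k t μ size adv) {P : (PairVar N k N t → R) → Prop} (hP : Decides g P)
    (hg : g ≤ size) :
    |prob (lpnSample R N k t μ) (fun x => P (pairInput x.1 x.2)) -
      prob (idealSample R N k t) (fun x => P (pairInput x.1 x.2))| ≤ adv := by
  obtain ⟨c, out, hc, hf⟩ := hP
  have h₁ := h ⟨c, out ()⟩ (hc.trans hg)
  have h₂ : ∀ x, Distinguisher.Accepts (⟨c, out ()⟩ : Distinguisher R (PairVar N k N t)) x ↔ P x := by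
    intro x
    unfold Distinguisher.Accepts
    rw [hf x ()]
    by_cases hP : P x <;> simp [hP]
  simpa only [h₂] using h₁

lemma pmf_nonneg_of_abs_le {a b : ℝ} {c : ℝ} (h : |a - b| ≤ c) : 0 ≤ c := (abs_nonneg _).trans h

/-- Security of LPN in dimension `N` with noise rate `μ` implies security in smaller dimensions with
higher noise rates: rows are dropped and noise is added. The noise that is added can be fixed, as
adversaries are nonuniform. -/
lemma LPNHard.shrink [Nontrivial R] {N k t size g n : ℕ} {μ μ' adv : ℝ}
    (h : LPNHard R N k t μ size adv) (hn : n ≤ N) (h₀ : 0 ≤ μ) (h₁ : μ < 1) (hμ : μ ≤ μ')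
    (h₁' : μ' ≤ 1) {P : Matrix (Fin n) (Fin k) R → Matrix (Fin n) (Fin t) R → Prop}
    (hP : Decides g fun x : PairVar n k n t → R =>
      P (Matrix.of fun i j => x (.inl (i, j))) (Matrix.of fun i j => x (.inr (i, j))))
    (hg : g + 2 * (n * t) ≤ size) :
    ((Ex (uniformMatrix R n k) fun M => Ex (noiseMatrix R n t μ') fun Z =>
        Ex (uniformMatrix R k t) fun U => ind (P M (M * U + Z))) ≤
      (Ex (uniformMatrix R n k) fun M => Ex (uniformMatrix R n t) fun U => ind (P M U)) +
        ENNReal.ofReal adv) ∧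
    ((Ex (uniformMatrix R n k) fun M => Ex (uniformMatrix R n t) fun U => ind (P M U)) ≤
      (Ex (uniformMatrix R n k) fun M => Ex (noiseMatrix R n t μ') fun Z =>
        Ex (uniformMatrix R k t) fun U => ind (P M (M * U + Z))) + ENNReal.ofReal adv) := by
  set row : Fin n → Fin N := Fin.castLE hn with hrow
  have hdec : ∀ E : Matrix (Fin n) (Fin t) R, Decides (2 * (n * t) + g)
      fun x : PairVar N k N t → R => P (Matrix.of fun i j => x (.inl (row i, j)))
        (Matrix.of fun i j => x (.inr (row i, j)) + E i j) := by
    intro E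
    have hc : Computes (0 + ∑ _p : Fin n × Fin t, 2) fun x : PairVar N k N t → R =>
        Sum.elim (fun p : Fin n × Fin k => x (.inl (row p.1, p.2)))
          (fun p : Fin n × Fin t => x (.inr (row p.1, p.2)) + E p.1 p.2) := by
      refine (Computes.inputs _).sum (Computes.pi fun p => ?_)
      exact (ComputesOne.input _).add (ComputesOne.const _)
    have := hc.comp hP
    simp only [zero_add, Finset.sum_const, Finset.card_univ, Fintype.card_prod, Fintype.card_fin,
      smul_eq_mul] at this
    exact this.mono (by ring_nf; omega)
  have hadv := fun E => h.decides (hdec E) (by omega)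
  have hc : 0 ≤ adv := pmf_nonneg_of_abs_le (hadv 0)
  have hE : ∀ E : Matrix (Fin n) (Fin t) R, ∀ (L : Matrix (Fin N) (Fin k) R)
      (Y : Matrix (Fin N) (Fin t) R),
      (P (Matrix.of fun i j => pairInput L Y (.inl (row i, j)))
        (Matrix.of fun i j => pairInput L Y (.inr (row i, j)) + E i j)) =
      P (L.submatrix row id) (Y.submatrix row id + E) := fun E L Y => rfl
  simp only [hE] at hadv
  -- the two samples, restricted to the first rows
  have hreal : ∀ E : Matrix (Fin n) (Fin t) R,
      (Ex (lpnSample R N k t μ) fun x => ind (P (x.1.submatrix row id) (x.2.submatrix row id + E))) =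
      Ex (uniformMatrix R n k) fun M => Ex (uniformMatrix R k t) fun U =>
        Ex (noiseMatrix R n t μ) fun Z => ind (P M (M * U + (Z + E))) := by
    intro E
    simp only [lpnSample, Ex_bind, Ex_pure]
    rw [uniformMatrix_eq_noiseMatrix n k, ← Ex_noiseMatrix_rows hn, ← uniformMatrix_eq_noiseMatrix]
    refine Ex_congr fun L => Ex_congr fun U => ?_
    rw [← Ex_noiseMatrix_rows hn]
    refine Ex_congr fun S => ?_
    have : (L * U + S).submatrix row id + E =
        L.submatrix row id * U + (S.submatrix row id + E) := by
      rw [← add_assoc]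
      rfl
    rw [this]
  have hideal : ∀ E : Matrix (Fin n) (Fin t) R,
      (Ex (idealSample R N k t) fun x => ind (P (x.1.submatrix row id) (x.2.submatrix row id + E))) =
      Ex (uniformMatrix R n k) fun M => Ex (uniformMatrix R n t) fun U => ind (P M U) := by
    intro E
    simp only [idealSample, Ex_bind, Ex_pure]
    rw [uniformMatrix_eq_noiseMatrix n k, ← Ex_noiseMatrix_rows hn, ← uniformMatrix_eq_noiseMatrix]
    refine Ex_congr fun L => ?_
    rw [uniformMatrix_eq_noiseMatrix N t, Ex_noiseMatrix_rows hn t 1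
      (f := fun U => ind (P (L.submatrix row id) (U + E))), ← uniformMatrix_eq_noiseMatrix]
    simp only [add_comm _ E]
    exact Ex_uniform_add_left E fun U => ind (P (L.submatrix row id) U)
  have hsum : (Ex (noiseMatrix R n t ((μ' - μ) / (1 - μ))) fun E =>
      Ex (lpnSample R N k t μ) fun x => ind (P (x.1.submatrix row id) (x.2.submatrix row id + E))) =
      Ex (uniformMatrix R n k) fun M => Ex (noiseMatrix R n t μ') fun Z =>
        Ex (uniformMatrix R k t) fun U => ind (P M (M * U + Z)) := by
    simp only [hreal]
    rw [Ex_comm]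
    refine Ex_congr fun M => ?_
    rw [Ex_comm, Ex_comm (noiseMatrix R n t μ')]
    refine Ex_congr fun U => ?_
    rw [Ex_comm, noiseMatrix_bind_noiseMatrix h₀ hμ h₁ h₁' n t fun Z => ind (P M (M * U + Z))]
  have hadv' := fun E => (abs_prob_sub_le_iff hc).mp (hadv E)
  simp only [hideal] at hadv'
  rw [← hsum]
  constructor
  · exact Ex_le_of_le fun E => (hadv' E).1
  · refine le_trans (le_of_eq (Ex_const (noiseMatrix R n t ((μ' - μ) / (1 - μ))) _).symm) ?_
    exact Ex_le_Ex_add fun E => (hadv' E).2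

end Hardness

/-! ### Expectations over runs of interactive programs -/

section Calculus

variable {R : Type} {P : Params} {m l : ℕ} {α β : Type}

/-- The expectation of `f` over the results and final states of a run that starts in state `s`. -/
def wp (x : Prog R P m l α) (f : α → RunState R P m l → ℝ≥0∞) (s : RunState R P m l) : ℝ≥0∞ :=
  Ex (x.run s) fun o => f o.1 o.2

/-- The state after `c` further operations of the client. -/
def RunState.spend (s : RunState R P m l) (c : ℕ) : RunState R P m l :=
  { s with ledger := { s.ledger with client := s.ledger.client + c } }

@[simp] lemma RunState.spend_spend (s : RunState R P m l) (a b : ℕ) :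
    (s.spend a).spend b = s.spend (a + b) := by
  simp [RunState.spend, Nat.add_assoc]

@[simp] lemma RunState.spend_zero (s : RunState R P m l) : s.spend 0 = s := rfl

@[simp] lemma RunState.view_spend (s : RunState R P m l) (c : ℕ) : (s.spend c).view = s.view := rfl

/-- The state after a round with message `q`. -/
def RunState.round (srv : Server R P m l) (q : Msg R P m l) (s : RunState R P m l) :
    RunState R P m l where
  view := s.view ++ [q]
  ledger := {
    client := s.ledger.client + (q.words + q.replyWords)
    server := s.ledger.server + (srv.work s.view q + (q.words + q.replyWords))
    up := s.ledger.up + q.words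
    down := s.ledger.down + q.replyWords
    rounds := s.ledger.rounds + 1 }

@[simp] lemma RunState.view_round (srv : Server R P m l) (q : Msg R P m l) (s : RunState R P m l) :
    (s.round srv q).view = s.view ++ [q] := rfl

variable {f : α → RunState R P m l → ℝ≥0∞} {s : RunState R P m l}

@[simp] lemma wp_pure (a : α) : wp (pure a : Prog R P m l α) f s = f a s := Ex_pure _ _

@[simp] lemma wp_bind (x : Prog R P m l β) (k : β → Prog R P m l α) :
    wp (x >>= k) f s = wp x (fun b s' => wp (k b) f s') s := by
  unfold wp
  rw [StateT.run_bind]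
  exact Ex_bind _ _ _

@[simp] lemma wp_tick (c : ℕ) (f : Unit → RunState R P m l → ℝ≥0∞) :
    wp (HasTick.tick c : Prog R P m l Unit) f s = f () (s.spend c) := Ex_pure _ _

@[simp] lemma wp_modify (g : RunState R P m l → RunState R P m l)
    (f : PUnit → RunState R P m l → ℝ≥0∞) :
    wp (modify g : Prog R P m l PUnit) f s = f ⟨⟩ (g s) := Ex_pure _ _

@[simp] lemma wp_get (f : RunState R P m l → RunState R P m l → ℝ≥0∞) :
    wp (get : Prog R P m l (RunState R P m l)) f s = f s s := Ex_pure _ _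

@[simp] lemma wp_set (s' : RunState R P m l) (f : PUnit → RunState R P m l → ℝ≥0∞) :
    wp (set s' : Prog R P m l PUnit) f s = f ⟨⟩ s' := Ex_pure _ _

@[simp] lemma wp_lift (p : PMF α) :
    wp (StateT.lift p : Prog R P m l α) f s = Ex p fun a => f a s := by
  unfold wp
  have : (StateT.lift p : Prog R P m l α).run s = p.bind fun a => PMF.pure (a, s) := rfl
  rw [this, Ex_bind]
  simp [Ex_pure]

@[simp] lemma wp_sample (p : PMF α) (c : ℕ) :
    wp (sample p c : Prog R P m l α) f s = Ex p fun a => f a (s.spend c) := by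
  simp [sample]

@[simp] lemma wp_ask (srv : Server R P m l) (q : Msg R P m l)
    (f : Reply q → RunState R P m l → ℝ≥0∞) :
    wp (ask srv q) f s = f (srv.reply s.view q) (s.round srv q) := by
  simp only [ask, wp_bind, wp_get, wp_set, wp_pure, RunState.round]

@[simp] lemma wp_ite (b : Bool) (x y : Prog R P m l α) :
    wp (if b = true then x else y) f s = if b = true then wp x f s else wp y f s := by
  split_ifs <;> rfl

lemma wp_mono {x : Prog R P m l α} {f g : α → RunState R P m l → ℝ≥0∞}
    (h : ∀ a s, f a s ≤ g a s) : wp x f s ≤ wp x g s :=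
  Ex_mono fun o => h o.1 o.2

open Classical in
@[simp] lemma wp_meq {a b : ℕ} (X Y : Matrix (Fin a) (Fin b) R) (f : Bool → RunState R P m l → ℝ≥0∞) :
    wp (meq X Y : Prog R P m l _) f s = f (decide (X = Y)) (s.spend (a * b)) := by
  simp only [meq, wp_bind, wp_tick, wp_pure]

variable [CommRing R] {a b c : ℕ}

@[simp] lemma wp_dmul (sq : ℕ → ℕ) (X : Matrix (Fin a) (Fin b) R) (Y : Matrix (Fin b) (Fin c) R)
    (f : Matrix (Fin a) (Fin c) R → RunState R P m l → ℝ≥0∞) :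
    wp (dmul sq X Y : Prog R P m l _) f s = f (X * Y) (s.spend (mulCost sq a b c)) := by
  simp only [dmul, wp_bind, wp_tick, wp_pure]

@[simp] lemma wp_smulLeft (S : Matrix (Fin a) (Fin b) R) (Y : Matrix (Fin b) (Fin c) R)
    (f : Matrix (Fin a) (Fin c) R → RunState R P m l → ℝ≥0∞) :
    wp (smulLeft S Y : Prog R P m l _) f s = f (S * Y) (s.spend (2 * nnz S * c + a * c)) := by
  simp only [smulLeft, wp_bind, wp_tick, wp_pure]

@[simp] lemma wp_smulRight (X : Matrix (Fin a) (Fin b) R) (S : Matrix (Fin b) (Fin c) R)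
    (f : Matrix (Fin a) (Fin c) R → RunState R P m l → ℝ≥0∞) :
    wp (smulRight X S : Prog R P m l _) f s = f (X * S) (s.spend (2 * nnz S * a + a * c)) := by
  simp only [smulRight, wp_bind, wp_tick, wp_pure]

@[simp] lemma wp_madd (X Y : Matrix (Fin a) (Fin b) R)
    (f : Matrix (Fin a) (Fin b) R → RunState R P m l → ℝ≥0∞) :
    wp (madd X Y : Prog R P m l _) f s = f (X + Y) (s.spend (a * b)) := by
  simp only [madd, wp_bind, wp_tick, wp_pure]

@[simp] lemma wp_msub (X Y : Matrix (Fin a) (Fin b) R)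
    (f : Matrix (Fin a) (Fin b) R → RunState R P m l → ℝ≥0∞) :
    wp (msub X Y : Prog R P m l _) f s = f (X - Y) (s.spend (a * b)) := by
  simp only [msub, wp_bind, wp_tick, wp_pure]

lemma wp_accumulate {x : ℕ → Prog R P m l (Matrix (Fin a) (Fin b) R)}
    {F : ℕ → Matrix (Fin a) (Fin b) R} {w : ℕ → ℕ}
    (hx : ∀ j f s, wp (x j) f s = f (F j) (s.spend (w j))) (init : Matrix (Fin a) (Fin b) R) (k : ℕ)
    (f : Matrix (Fin a) (Fin b) R → RunState R P m l → ℝ≥0∞) (s : RunState R P m l) :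
    wp (accumulate x init k) f s = f (init + ∑ j ∈ Finset.range k, F j)
      (s.spend (∑ j ∈ Finset.range k, (w j + a * b))) := by
  induction k generalizing f s with
  | zero => simp [accumulate]
  | succ k ih =>
    simp only [accumulate, wp_bind, ih, hx, wp_madd, RunState.spend_spend, Finset.sum_range_succ,
      add_assoc]

end Calculus

/-! ### Products of the bases and the replies of the honest server -/

section Honest

variable {R : Type} {P : Params} {m l : ℕ} [CommRing R]

/-- The product `L₁ ⋯ L_i`. -/
def prodL (L : (i : ℕ) → Matrix (Fin (P.dim i)) (Fin (P.dim (i + 1))) R) :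
    (i : ℕ) → Matrix (Fin (P.dim 0)) (Fin (P.dim i)) R
  | 0 => 1
  | i + 1 => prodL L i * L i

lemma run_dmul {a b c : ℕ} (sq : ℕ → ℕ) (X : Matrix (Fin a) (Fin b) R)
    (Y : Matrix (Fin b) (Fin c) R) (w : ℕ) :
    StateT.run (dmul sq X Y : StateM ℕ _) w = (X * Y, w + mulCost sq a b c) := rfl

variable (L : (i : ℕ) → Matrix (Fin (P.dim i)) (Fin (P.dim (i + 1))) R)

lemma run_chain {a : ℕ} (X : Matrix (Fin a) (Fin (P.dim 0)) R) (k w : ℕ) :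
    (∀ i ≤ k, (StateT.run (chain L X k : StateM ℕ _) w).1 i = X * prodL L i) ∧
    (StateT.run (chain L X k : StateM ℕ _) w).2 =
      w + ∑ i ∈ Finset.range k, mulCost P.sq a (P.dim i) (P.dim (i + 1)) := by
  induction k with
  | zero =>
    refine ⟨fun i hi => ?_, rfl⟩
    obtain rfl : i = 0 := by omega
    have h : StateT.run (chain L X 0 : StateM ℕ _) w = (Function.update (fun _ => 0) 0 X, w) := rfl
    simp [h, prodL]
  | succ k ih =>
    obtain ⟨ih₁, ih₂⟩ := ih
    have h : StateT.run (chain L X (k + 1) : StateM ℕ _) w =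
        (Function.update (StateT.run (chain L X k : StateM ℕ _) w).1 (k + 1)
          ((StateT.run (chain L X k : StateM ℕ _) w).1 k * L k),
        (StateT.run (chain L X k : StateM ℕ _) w).2 +
          mulCost P.sq a (P.dim k) (P.dim (k + 1))) := rfl
    rw [h, ih₂, Finset.sum_range_succ, add_assoc]
    refine ⟨fun i hi => ?_, rfl⟩
    rcases Nat.lt_or_eq_of_le hi with hi | rfl
    · simp only [Function.update_of_ne hi.ne]
      exact ih₁ i (by omega)
    · simp [ih₁ k le_rfl, prodL, Matrix.mul_assoc]

lemma run_pullback (B : Matrix (Fin (P.dim 0)) (Fin l) R) (k w : ℕ) :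
    (∀ i ≤ k, (StateT.run (pullback L B k) w).1 i = (prodL L i).transpose * B) ∧
    (StateT.run (pullback L B k) w).2 =
      w + ∑ i ∈ Finset.range k, mulCost P.sq (P.dim (i + 1)) (P.dim i) l := by
  induction k with
  | zero =>
    refine ⟨fun i hi => ?_, rfl⟩
    obtain rfl : i = 0 := by omega
    have h : StateT.run (pullback L B 0) w = (Function.update (fun _ => 0) 0 B, w) := rfl
    simp [h, prodL]
  | succ k ih =>
    obtain ⟨ih₁, ih₂⟩ := ih
    have h : StateT.run (pullback L B (k + 1)) w =
        (Function.update (StateT.run (pullback L B k) w).1 (k + 1)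
          ((L k).transpose * (StateT.run (pullback L B k) w).1 k),
        (StateT.run (pullback L B k) w).2 +
          mulCost P.sq (P.dim (k + 1)) (P.dim k) l) := rfl
    rw [h, ih₂, Finset.sum_range_succ, add_assoc]
    refine ⟨fun i hi => ?_, rfl⟩
    rcases Nat.lt_or_eq_of_le hi with hi | rfl
    · simp only [Function.update_of_ne hi.ne]
      exact ih₁ i (by omega)
    · simp [ih₁ k le_rfl, prodL, Matrix.mul_assoc]

variable (P) in
/-- The cost of the entry `(j, k + 1)` of the table of products. -/
def gramEntryCost : ℕ → ℕ → ℕ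
  | 0, 0 => 0
  | j + 1, 0 => mulCost P.sq (P.dim (j + 1)) (P.dim 0) (P.dim 1)
  | j, k + 1 => mulCost P.sq (P.dim j) (P.dim (k + 1)) (P.dim (k + 2))

variable (P) in
/-- The cost of the table of products. -/
def gramCost (k : ℕ) : ℕ :=
  ∑ i ∈ Finset.range k, (∑ j ∈ Finset.range (i + 1), gramEntryCost P j i +
    mulCost P.sq (P.dim (i + 1)) (P.dim i) (P.dim (i + 1)))

lemma run_gramEntry (T : (j i : ℕ) → Matrix (Fin (P.dim j)) (Fin (P.dim i)) R) (k : ℕ)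
    (hT : ∀ j ≤ k, ∀ i ≤ k, T j i = (prodL L j).transpose * prodL L i) (j : ℕ) (hj : j ≤ k)
    (w : ℕ) : StateT.run (gramEntry L T j k) w =
      ((prodL L j).transpose * prodL L (k + 1), w + gramEntryCost P j k) := by
  match j, k with
  | 0, 0 =>
    have : StateT.run (gramEntry L T 0 0) w = (L 0, w) := rfl
    rw [this]
    simp [prodL, gramEntryCost]
  | j + 1, 0 => omega
  | j, k + 1 =>
    have : StateT.run (gramEntry L T j (k + 1)) w = (T j (k + 1) * L (k + 1),
        w + mulCost P.sq (P.dim j) (P.dim (k + 1)) (P.dim (k + 2))) := by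
      cases j <;> rfl
    rw [this, hT j hj (k + 1) le_rfl, Matrix.mul_assoc]
    cases j <;> rfl

lemma run_gramColumn (T : (j i : ℕ) → Matrix (Fin (P.dim j)) (Fin (P.dim i)) R) (k : ℕ)
    (hT : ∀ j ≤ k, ∀ i ≤ k, T j i = (prodL L j).transpose * prodL L i) (r : ℕ) (hr : r ≤ k + 1)
    (w : ℕ) :
    (∀ j < r, (StateT.run (gramColumn L T k r) w).1 j =
      (prodL L j).transpose * prodL L (k + 1)) ∧
    (StateT.run (gramColumn L T k r) w).2 = w + ∑ j ∈ Finset.range r, gramEntryCost P j k := by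
  induction r with
  | zero => exact ⟨fun j hj => absurd hj (by omega), rfl⟩
  | succ r ih =>
    obtain ⟨ih₁, ih₂⟩ := ih (by omega)
    have h : StateT.run (gramColumn L T k (r + 1)) w =
        (Function.update (StateT.run (gramColumn L T k r) w).1 r
          (StateT.run (gramEntry L T r k) (StateT.run (gramColumn L T k r) w).2).1,
        (StateT.run (gramEntry L T r k) (StateT.run (gramColumn L T k r) w).2).2) := rfl
    rw [h, run_gramEntry L T k hT r (by omega), ih₂, Finset.sum_range_succ, add_assoc]
    refine ⟨fun j hj => ?_, rfl⟩
    rcases Nat.lt_or_eq_of_le (Nat.le_of_lt_succ hj) with hj | rfl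
    · simp only [Function.update_of_ne hj.ne]
      exact ih₁ j hj
    · simp

lemma run_gramTable (k w : ℕ) :
    (∀ j ≤ k, ∀ i ≤ k, (StateT.run (gramTable L k) w).1 j i =
      (prodL L j).transpose * prodL L i) ∧
    (StateT.run (gramTable L k) w).2 = w + gramCost P k := by
  induction k with
  | zero =>
    refine ⟨fun j hj i hi => ?_, rfl⟩
    obtain rfl : i = 0 := by omega
    obtain rfl : j = 0 := by omega
    have : (StateT.run (gramTable L 0) w).1 = Function.update (fun _ _ => 0) 0
      (Function.update (fun _ => 0) 0 1) := rfl
    rw [this]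
    simp [prodL]
  | succ k ih =>
    obtain ⟨ih₁, ih₂⟩ := ih
    set T := (StateT.run (gramTable L k) w).1 with hT
    have hc := run_gramColumn L T k ih₁ (k + 1) le_rfl (StateT.run (gramTable L k) w).2
    set col := (StateT.run (gramColumn L T k (k + 1)) (StateT.run (gramTable L k) w).2).1 with hcol
    have h : StateT.run (gramTable L (k + 1)) w =
        (Function.update (fun j => Function.update (T j) (k + 1) (col j)) (k + 1)
          (Function.update (fun i => (col i).transpose) (k + 1) ((col k).transpose * L k)),
        (StateT.run (gramColumn L T k (k + 1)) (StateT.run (gramTable L k) w).2).2 +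
          mulCost P.sq (P.dim (k + 1)) (P.dim k) (P.dim (k + 1))) := rfl
    rw [h, hc.2, ih₂]
    refine ⟨fun j hj i hi => ?_, ?_⟩
    · simp only
      rcases Nat.lt_or_eq_of_le hj with hj | rfl
      · rw [Function.update_of_ne hj.ne]
        rcases Nat.lt_or_eq_of_le hi with hi | rfl
        · rw [Function.update_of_ne hi.ne]
          exact ih₁ j (by omega) i (by omega)
        · rw [Function.update_self]
          exact hc.1 j (by omega)
      · rw [Function.update_self]
        rcases Nat.lt_or_eq_of_le hi with hi | rfl
        · rw [Function.update_of_ne hi.ne, hc.1 i (by omega), Matrix.transpose_mul,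
            Matrix.transpose_transpose]
        · rw [Function.update_self, hc.1 k (by omega), Matrix.transpose_mul,
            Matrix.transpose_transpose, Matrix.mul_assoc]
          rfl
    · simp only [gramCost, Finset.sum_range_succ]
      ring

/-- The correct table of products. -/
def trueGram (Lf : Family R P.depth P.dim fun i => P.dim (i + 1)) : GramReply R P where
  top i := prodL (extend Lf) (i + 1)
  inner j i := (prodL (extend Lf) (j + 1)).transpose * prodL (extend Lf) (i + 1)

lemma honest_reply_bases (past : List (Msg R P m l))
    (Lf : Family R P.depth P.dim fun i => P.dim (i + 1)) :
    (honestServer R P m l).reply past (.bases Lf) = trueGram Lf := by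
  have h := (run_gramTable (extend Lf) P.depth 0).1
  have h' : (honestServer R P m l).reply past (.bases Lf) =
    (GramReply.mk (fun i => (StateT.run (gramTable (P := P) (extend Lf) P.depth) 0).1 0 (i + 1))
      (fun j i => (StateT.run (gramTable (P := P) (extend Lf) P.depth) 0).1 (j + 1) (i + 1)) :
      GramReply R P) := rfl
  rw [h']
  unfold trueGram
  congr 1
  · funext i
    rw [h 0 (by omega) _ i.2]
    simp [prodL]
  · funext j i
    rw [h _ j.2 _ i.2]

lemma honest_work_bases (past : List (Msg R P m l))
    (Lf : Family R P.depth P.dim fun i => P.dim (i + 1)) :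
    (honestServer R P m l).work past (.bases Lf) = gramCost P P.depth := by
  have h := (run_gramTable (extend Lf) P.depth 0).2
  rw [zero_add] at h
  exact h

lemma honest_reply_left (past : List (Msg R P m l)) (A : Matrix (Fin m) (Fin (P.dim 0)) R) :
    (honestServer R P m l).reply past (.left A) =
      (LeftReply.mk fun i => A * prodL (basesOf past) (i + 1) : LeftReply R P m) := by
  have h := (run_chain (basesOf past) A P.depth 0).1
  have h' : (honestServer R P m l).reply past (.left A) = (LeftReply.mk
    (fun i => (StateT.run (chain (P := P) (basesOf past) A P.depth : StateM ℕ _) 0).1 (i + 1)) :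
      LeftReply R P m) := rfl
  rw [h']
  congr 1
  funext i
  rw [h _ i.2]

lemma honest_work_left (past : List (Msg R P m l)) (A : Matrix (Fin m) (Fin (P.dim 0)) R) :
    (honestServer R P m l).work past (.left A) =
      ∑ i ∈ Finset.range P.depth, mulCost P.sq m (P.dim i) (P.dim (i + 1)) := by
  have h := (run_chain (basesOf past) A P.depth 0).2
  rw [zero_add] at h
  exact h

lemma honest_reply_right (past : List (Msg R P m l)) (B : Matrix (Fin (P.dim 0)) (Fin l) R) :
    (honestServer R P m l).reply past (.right B) =
      (RightReply.mk (leftOf past * B) (fun i => (prodL (basesOf past) (i + 1)).transpose * B) :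
        RightReply R P m l) := by
  have h := (run_pullback (basesOf past) B P.depth
    (StateT.run (dmul P.sq (leftOf past) B : StateM ℕ _) 0).2).1
  have h' : (honestServer R P m l).reply past (.right B) = (RightReply.mk (leftOf past * B)
    (fun i => (StateT.run (pullback (P := P) (basesOf past) B P.depth)
      (StateT.run (dmul P.sq (leftOf past) B : StateM ℕ _) 0).2).1 (i + 1)) :
      RightReply R P m l) := rfl
  rw [h']
  congr 1
  funext i
  rw [h _ i.2]

lemma honest_work_right (past : List (Msg R P m l)) (B : Matrix (Fin (P.dim 0)) (Fin l) R) :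
    (honestServer R P m l).work past (.right B) = mulCost P.sq m (P.dim 0) l +
      ∑ i ∈ Finset.range P.depth, mulCost P.sq (P.dim (i + 1)) (P.dim i) l := by
  have h := (run_pullback (basesOf past) B P.depth
    (StateT.run (dmul P.sq (leftOf past) B : StateM ℕ _) 0).2).2
  refine h.trans ?_
  rw [run_dmul, zero_add]

lemma extend_of_lt {d : ℕ} {f g : ℕ → ℕ} (X : Family R d f g) {i : ℕ} (h : i < d) :
    extend X i = X ⟨i, h⟩ := dif_pos h

lemma table_trueGram (Lf : Family R P.depth P.dim fun i => P.dim (i + 1)) {j i : ℕ}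
    (hj : j ≤ P.depth) (hi : i ≤ P.depth) :
    (trueGram Lf).table j i = (prodL (extend Lf) j).transpose * prodL (extend Lf) i := by
  match j, i with
  | 0, 0 => simp [GramReply.table, prodL]
  | 0, i + 1 =>
    simp only [GramReply.table]
    rw [extend_of_lt _ hi]
    simp [trueGram, prodL]
  | j + 1, 0 =>
    simp only [GramReply.table]
    rw [extend_of_lt _ hj]
    simp [trueGram, prodL]
  | j + 1, i + 1 =>
    simp only [GramReply.table]
    rw [dif_pos (Nat.lt_of_succ_le hj), extend_of_lt _ hi]
    rfl

/-- A reply whose table is correct is the correct reply. -/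
lemma eq_trueGram_of_table (Lf : Family R P.depth P.dim fun i => P.dim (i + 1)) (G : GramReply R P)
    (h : ∀ j ≤ P.depth, ∀ i ≤ P.depth,
      G.table j i = (prodL (extend Lf) j).transpose * prodL (extend Lf) i) : G = trueGram Lf := by
  obtain ⟨top, inner⟩ := G
  unfold trueGram
  congr 1
  · funext i
    have := h 0 (by omega) (i + 1) i.2
    simp only [GramReply.table] at this
    rw [extend_of_lt _ i.2] at this
    simpa [prodL] using this
  · funext j i
    have := h (j + 1) j.2 (i + 1) i.2
    simp only [GramReply.table] at this
    rw [dif_pos j.2, extend_of_lt _ i.2] at this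
    exact this

lemma table_leftReply {V : LeftReply R P m} {X : Matrix (Fin m) (Fin (P.dim 0)) R}
    (hV : V = LeftReply.mk fun i => X * prodL L (i + 1)) {i : ℕ} (hi : i ≤ P.depth) :
    V.table X i = X * prodL L i := by
  subst hV
  match i with
  | 0 => simp [LeftReply.table, prodL]
  | i + 1 =>
    simp only [LeftReply.table]
    rw [extend_of_lt _ hi]

lemma eq_leftReply_of_table (V : LeftReply R P m) (X : Matrix (Fin m) (Fin (P.dim 0)) R)
    (h : ∀ i ≤ P.depth, V.table X i = X * prodL L i) :
    V = LeftReply.mk fun i => X * prodL L (i + 1) := by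
  obtain ⟨prods⟩ := V
  congr 1
  funext i
  have := h (i + 1) i.2
  simp only [LeftReply.table] at this
  rw [extend_of_lt _ i.2] at this
  exact this

lemma table_rightReply {C : Matrix (Fin m) (Fin l) R} {B : Matrix (Fin (P.dim 0)) (Fin l) R} {i : ℕ}
    (hi : i ≤ P.depth) :
    (RightReply.mk C (fun i => (prodL L (i + 1)).transpose * B) : RightReply R P m l).table B i =
      (prodL L i).transpose * B := by
  match i with
  | 0 => simp [RightReply.table, prodL]
  | i + 1 =>
    simp only [RightReply.table]
    rw [extend_of_lt _ hi]

end Honest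

/-! ### The checks of the client -/

lemma minIdealCard_le {R : Type} [CommRing R] {I : Ideal R} (hI : I ≠ ⊥) : minIdealCard R ≤ Nat.card I :=
  Nat.sInf_le ⟨I, hI, rfl⟩

section Checks

variable {R : Type} {P : Params} {m l : ℕ} [CommRing R] [Fintype R]

@[simp] lemma wp_sampleUniform (a b : ℕ) {s : RunState R P m l}
    (f : Matrix (Fin a) (Fin b) R → RunState R P m l → ℝ≥0∞) :
    wp (sampleUniform a b : Prog R P m l _) f s =
      Ex (uniformMatrix R a b) fun X => f X (s.spend (a * b)) := by
  simp [sampleUniform]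

variable (P) in
/-- The cost of checking one product. -/
def stepCheckCost (a i : ℕ) : ℕ :=
  P.dim (i + 1) * P.checks + mulCost P.sq a (P.dim (i + 1)) P.checks +
    mulCost P.sq (P.dim i) (P.dim (i + 1)) P.checks + mulCost P.sq a (P.dim i) P.checks +
    a * P.checks

variable (P) in
/-- The cost of checking `k` products. -/
def checkCost (a k : ℕ) : ℕ := ∑ i ∈ Finset.range k, stepCheckCost P a i

variable (P) in
/-- The cost of checking `r` rows of the table of products. -/
def tableCheckCost (r : ℕ) : ℕ := ∑ j ∈ Finset.range r, checkCost P (P.dim j) P.depth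

variable (L : (i : ℕ) → Matrix (Fin (P.dim i)) (Fin (P.dim (i + 1))) R)

open Classical in
lemma wp_checkPartial_succ {a : ℕ} (claim : (i : ℕ) → Matrix (Fin a) (Fin (P.dim i)) R) (k : ℕ)
    (f : Bool → RunState R P m l → ℝ≥0∞) (s : RunState R P m l) :
    wp (checkPartial L claim (k + 1)) f s = wp (checkPartial L claim k) (fun ok s' =>
      if ok = true then Ex (uniformMatrix R (P.dim (k + 1)) P.checks) fun X =>
        f (decide (claim (k + 1) * X = claim k * (L k * X))) (s'.spend (stepCheckCost P a k))
      else f false s') s := by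
  simp only [checkPartial, wp_bind, wp_ite, wp_sampleUniform, wp_dmul, wp_meq, wp_pure,
    RunState.spend_spend, stepCheckCost, add_assoc]

/-- Correct claims pass the checks. -/
lemma wp_checkPartial_of_correct {a : ℕ} {claim : (i : ℕ) → Matrix (Fin a) (Fin (P.dim i)) R}
    {X : Matrix (Fin a) (Fin (P.dim 0)) R} (k : ℕ) (h : ∀ i ≤ k, claim i = X * prodL L i)
    (f : Bool → RunState R P m l → ℝ≥0∞) (s : RunState R P m l) :
    wp (checkPartial L claim k) f s = f true (s.spend (checkCost P a k)) := by
  classical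
  induction k generalizing f s with
  | zero => simp [checkPartial, checkCost]
  | succ k ih =>
    rw [wp_checkPartial_succ, ih fun i hi => h i (by omega)]
    have h' : claim (k + 1) = claim k * L k := by
      rw [h (k + 1) le_rfl, h k (by omega), Matrix.mul_assoc]
      rfl
    simp [h', Matrix.mul_assoc, checkCost, Finset.sum_range_succ]

lemma wp_checkPartial_le {a : ℕ} (claim : (i : ℕ) → Matrix (Fin a) (Fin (P.dim i)) R) (k : ℕ)
    {f : Bool → RunState R P m l → ℝ≥0∞} {s : RunState R P m l} {M : ℝ≥0∞}
    (h : ∀ b, ∀ c ≤ checkCost P a k, f b (s.spend c) ≤ M) : wp (checkPartial L claim k) f s ≤ M := by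
  induction k generalizing f s with
  | zero => simpa [checkPartial] using h true 0 (by simp)
  | succ k ih =>
    rw [wp_checkPartial_succ]
    refine ih fun b c hc => ?_
    rw [checkCost, Finset.sum_range_succ, ← checkCost] at h
    split_ifs
    · refine Ex_le_of_le fun X => ?_
      rw [RunState.spend_spend]
      exact h _ _ (by omega)
    · exact h _ _ (by omega)

/-- The checks with their random matrices drawn in advance, for functions that do not depend on
the costs. -/
lemma wp_checkPartial_eq_Ex {a : ℕ} (claim : (i : ℕ) → Matrix (Fin a) (Fin (P.dim i)) R) (k : ℕ)
    (hk : k ≤ P.depth) {f : Bool → RunState R P m l → ℝ≥0∞} {s : RunState R P m l}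
    {F : Prop → ℝ≥0∞} (ht : ∀ c, f true (s.spend c) = F True)
    (hf : ∀ c, f false (s.spend c) = F False) :
    wp (checkPartial L claim k) f s =
      Ex (piPMF fun i : Fin P.depth => uniformMatrix R (P.dim (i + 1)) P.checks) fun X =>
        F (∀ i : Fin P.depth, i.1 < k → claim (i + 1) * X i = claim i * (L i * X i)) := by
  classical
  induction k generalizing f s F with
  | zero => simpa [checkPartial] using ht 0
  | succ k ih =>
    rw [wp_checkPartial_succ, ih (by omega) (F := fun E =>
      Ex (uniformMatrix R (P.dim (k + 1)) P.checks) fun Y =>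
        F (E ∧ claim (k + 1) * Y = claim k * (L k * Y)))]
    · rw [Ex_piPMF_resample _ (⟨k, hk⟩ : Fin P.depth) fun X => F (∀ i : Fin P.depth, i.1 < k + 1 →
        claim (i + 1) * X i = claim i * (L i * X i))]
      refine Ex_congr fun X => Ex_congr fun Y => ?_
      congr 1
      rw [eq_iff_iff]
      constructor
      · rintro ⟨h₁, h₂⟩ i hi
        rcases Nat.lt_or_eq_of_le (Nat.le_of_lt_succ hi) with hi' | hi'
        · rw [Function.update_of_ne (by intro h; rw [h] at hi'; simp at hi')]
          exact h₁ i hi'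
        · obtain rfl : i = ⟨k, hk⟩ := Fin.ext hi'
          rw [Function.update_self]
          exact h₂
      · intro h
        refine ⟨fun i hi => ?_, ?_⟩
        · have := h i (by omega)
          rwa [Function.update_of_ne (by intro h; rw [h] at hi; simp at hi)] at this
        · have := h ⟨k, hk⟩ (by simp)
          rwa [Function.update_self] at this
    · intro c
      simp only [if_true, true_and, RunState.spend_spend]
      refine Ex_congr fun Y => ?_
      by_cases h : claim (k + 1) * Y = claim k * (L k * Y)
      · simp only [h, decide_true, ht]
      · simp only [h, decide_false, hf]
    · intro c
      simp [hf]

section Soundness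

variable [Nontrivial R]

lemma two_le_minIdealCard (R : Type) [CommRing R] [Fintype R] [Nontrivial R] :
    2 ≤ minIdealCard R := by
  have hne : {k | ∃ I : Ideal R, I ≠ ⊥ ∧ Nat.card I = k}.Nonempty := ⟨_, ⊤, top_ne_bot, rfl⟩
  obtain ⟨I, hI, hc⟩ := Nat.sInf_mem hne
  rw [minIdealCard, ← hc]
  have : Nontrivial I := Submodule.nontrivial_iff_ne_bot.mpr hI
  have : Fintype I := Fintype.ofFinite I
  rw [Nat.card_eq_fintype_card]
  exact Fintype.one_lt_card

/-- A nonzero linear form vanishes with probability at most `1 / q`: its values are uniformly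
distributed over a nonzero ideal. -/
lemma Ex_linear_form_le {k : ℕ} {v : Fin k → R} (hv : v ≠ 0) :
    (Ex (PMF.uniformOfFintype (Fin k → R)) fun x => ind (∑ i, v i * x i = 0)) ≤
      (minIdealCard R : ℝ≥0∞)⁻¹ := by
  let φ : (Fin k → R) →ₗ[R] R :=
    { toFun := fun x => ∑ i, v i * x i
      map_add' := fun x y => by simp [mul_add, Finset.sum_add_distrib]
      map_smul' := fun r x => by
        simp only [Pi.smul_apply, smul_eq_mul, RingHom.id_apply, Finset.mul_sum]
        exact Finset.sum_congr rfl fun i _ => by ring }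
  have h₁ := Ex_uniform_mem_addSubgroup φ.toAddMonoidHom.ker
  have h₂ : ∀ x, x ∈ φ.toAddMonoidHom.ker ↔ ∑ i, v i * x i = 0 := fun x => Iff.rfl
  simp only [h₂] at h₁
  rw [h₁, AddSubgroup.index_ker]
  have hI : LinearMap.range φ ≠ ⊥ := by
    obtain ⟨i, hi⟩ := Function.ne_iff.mp hv
    intro h
    have h' : φ (Pi.single i 1) ∈ LinearMap.range φ := ⟨_, rfl⟩
    rw [h, Submodule.mem_bot] at h'
    have : φ (Pi.single i 1) = v i := by
      change ∑ j, v j * (Pi.single i 1 : Fin k → R) j = v i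
      simp [Pi.single_apply]
    exact hi (this ▸ h')
  gcongr
  exact minIdealCard_le hI

/-- A wrong matrix is detected by a random product, except with probability `q ^ (-c)`. -/
lemma Ex_mul_eq_le {a b c : ℕ} {D E : Matrix (Fin a) (Fin b) R} (h : D ≠ E) :
    (Ex (uniformMatrix R b c) fun X => ind (D * X = E * X)) ≤ ((minIdealCard R : ℝ≥0∞)⁻¹) ^ c := by
  classical
  obtain ⟨i, hi⟩ : ∃ i, (fun j => D i j - E i j) ≠ 0 := by
    by_contra hcon
    push Not at hcon
    refine h (Matrix.ext fun i j => ?_)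
    have := congrFun (hcon i) j
    simpa [sub_eq_zero] using this
  set v : Fin b → R := fun j => D i j - E i j with hv
  -- the columns of the random matrix are independent
  let e : (Fin c → Fin b → R) ≃ Matrix (Fin b) (Fin c) R :=
    { toFun := fun x => Matrix.of fun j k => x k j
      invFun := fun X k j => X j k
      left_inv := fun _ => rfl
      right_inv := fun _ => rfl }
  have h₁ : (Ex (uniformMatrix R b c) fun X => ind (D * X = E * X)) =
      Ex (piPMF fun _ : Fin c => PMF.uniformOfFintype (Fin b → R)) fun x =>
        ind (D * e x = E * e x) := by
    rw [piPMF_uniform]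
    exact (Ex_uniform_equiv e _).symm
  have h₂ : ∀ x : Fin c → Fin b → R, ind (D * e x = E * e x) ≤
      ∏ k, ind (∑ j, v j * x k j = 0) := by
    intro x
    by_cases hx : D * e x = E * e x
    · have : ∀ k, ∑ j, v j * x k j = 0 := by
        intro k
        have := congrFun (congrFun hx i) k
        simp only [Matrix.mul_apply] at this
        have h0 : ∑ j, v j * x k j = ∑ j, D i j * e x j k - ∑ j, E i j * e x j k := by
          rw [← Finset.sum_sub_distrib]
          exact Finset.sum_congr rfl fun j _ => sub_mul (D i j) (E i j) (x k j)
        rw [h0, this, sub_self]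
      simp [this, hx]
    · simp [hx]
  rw [h₁]
  refine (Ex_mono h₂).trans ?_
  have h₃ : (Ex (piPMF fun _ : Fin c => PMF.uniformOfFintype (Fin b → R)) fun x =>
      ∏ k, ind (∑ j, v j * x k j = 0)) =
      ∏ _k : Fin c, Ex (PMF.uniformOfFintype (Fin b → R)) fun x => ind (∑ j, v j * x j = 0) := by
    simp only [Ex, tsum_fintype, piPMF_apply, ← Finset.prod_mul_distrib]
    rw [Finset.prod_univ_sum, Fintype.piFinset_univ]
  rw [h₃]
  refine (Finset.prod_le_prod' fun k _ => Ex_linear_form_le hi).trans ?_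
  simp

/-- Wrong claims pass the checks with probability at most `q ^ (-checks)`: only the check of the
first wrong claim matters. -/
lemma wp_checkPartial_of_wrong {a : ℕ} {claim : (i : ℕ) → Matrix (Fin a) (Fin (P.dim i)) R}
    {X : Matrix (Fin a) (Fin (P.dim 0)) R} (k : ℕ) (h₀ : claim 0 = X)
    (h : ¬∀ i ≤ k, claim i = X * prodL L i) (s : RunState R P m l) :
    wp (checkPartial L claim k) (fun b _ => ind (b = true)) s ≤
      ((minIdealCard R : ℝ≥0∞)⁻¹) ^ P.checks := by
  classical
  induction k with
  | zero =>
    refine absurd (fun i hi => ?_) h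
    obtain rfl : i = 0 := by omega
    simp [h₀, prodL]
  | succ k ih =>
    rw [wp_checkPartial_succ]
    by_cases hk : ∀ i ≤ k, claim i = X * prodL L i
    · rw [wp_checkPartial_of_correct L k hk]
      have hne : claim (k + 1) ≠ claim k * L k := by
        intro heq
        refine h fun i hi => ?_
        rcases Nat.lt_or_eq_of_le hi with hi | rfl
        · exact hk i (by omega)
        · rw [heq, hk k le_rfl, Matrix.mul_assoc]
          rfl
      simp only [if_true, decide_eq_true_eq, ← Matrix.mul_assoc]
      exact Ex_mul_eq_le hne
    · refine le_trans (wp_mono fun b s' => ?_) (ih hk)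
      cases b
      · simp
      · simp only [if_true, ind_true]
        exact Ex_ind_le_one _ _

end Soundness

lemma wp_checkTable_succ (T : (j i : ℕ) → Matrix (Fin (P.dim j)) (Fin (P.dim i)) R) (r : ℕ)
    (f : Bool → RunState R P m l → ℝ≥0∞) (s : RunState R P m l) :
    wp (checkTable L T (r + 1)) f s = wp (checkTable L T r) (fun ok s' =>
      if ok = true then wp (checkPartial L (T r) P.depth) f s' else f false s') s := by
  simp only [checkTable, wp_bind, wp_ite, wp_pure]

lemma wp_checkTable_of_correct {T : (j i : ℕ) → Matrix (Fin (P.dim j)) (Fin (P.dim i)) R} (r : ℕ)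
    (h : ∀ j < r, ∀ i ≤ P.depth, T j i = (prodL L j).transpose * prodL L i)
    (f : Bool → RunState R P m l → ℝ≥0∞) (s : RunState R P m l) :
    wp (checkTable L T r) f s = f true (s.spend (tableCheckCost P r)) := by
  induction r generalizing f s with
  | zero => simp [checkTable, tableCheckCost]
  | succ r ih =>
    rw [wp_checkTable_succ, ih fun j hj => h j (by omega), if_pos rfl,
      wp_checkPartial_of_correct L _ (h r (by omega))]
    simp [tableCheckCost, Finset.sum_range_succ]

lemma wp_checkTable_le (T : (j i : ℕ) → Matrix (Fin (P.dim j)) (Fin (P.dim i)) R) (r : ℕ)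
    {f : Bool → RunState R P m l → ℝ≥0∞} {s : RunState R P m l} {M : ℝ≥0∞}
    (h : ∀ b, ∀ c ≤ tableCheckCost P r, f b (s.spend c) ≤ M) : wp (checkTable L T r) f s ≤ M := by
  induction r generalizing f s with
  | zero => simpa [checkTable] using h true 0 (by simp)
  | succ r ih =>
    rw [wp_checkTable_succ]
    rw [tableCheckCost, Finset.sum_range_succ, ← tableCheckCost] at h
    refine ih fun b c hc => ?_
    split_ifs
    · refine wp_checkPartial_le L _ _ fun b c' hc' => ?_
      rw [RunState.spend_spend]
      exact h _ _ (by omega)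
    · exact h _ _ (by omega)

/-- A wrong table of products passes the checks with probability at most `q ^ (-checks)`. -/
lemma wp_checkTable_of_wrong [Nontrivial R]
    {T : (j i : ℕ) → Matrix (Fin (P.dim j)) (Fin (P.dim i)) R} (r : ℕ) (h₀ : T 0 0 = 1)
    (hsymm : ∀ j < r, T j 0 = (T 0 j).transpose) (hr : r ≤ P.depth + 1)
    (h : ¬∀ j < r, ∀ i ≤ P.depth, T j i = (prodL L j).transpose * prodL L i)
    (s : RunState R P m l) :
    wp (checkTable L T r) (fun b _ => ind (b = true)) s ≤
      ((minIdealCard R : ℝ≥0∞)⁻¹) ^ P.checks := by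
  induction r with
  | zero => exact absurd (fun j hj => absurd hj (by omega)) h
  | succ r ih =>
    rw [wp_checkTable_succ]
    by_cases hk : ∀ j < r, ∀ i ≤ P.depth, T j i = (prodL L j).transpose * prodL L i
    · rw [wp_checkTable_of_correct L r hk, if_pos rfl]
      refine wp_checkPartial_of_wrong L (X := (prodL L r).transpose) _ ?_ ?_ _
      · rcases Nat.eq_zero_or_pos r with rfl | hr'
        · simp [h₀, prodL]
        · rw [hsymm r (by omega), hk 0 hr' r (by omega)]
          simp [prodL]
      · intro hcon
        refine h fun j hj => ?_
        rcases Nat.lt_or_eq_of_le (Nat.le_of_lt_succ hj) with hj | rfl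
        · exact hk j hj
        · exact hcon
    · refine le_trans (wp_mono fun b s' => ?_)
        (ih (fun j hj => hsymm j (by omega)) (by omega) hk)
      cases b
      · simp
      · simp only [if_true, ind_true]
        calc _ ≤ wp (checkPartial L (T r) P.depth) (fun _ _ => 1) s' :=
              wp_mono fun _ _ => ind_le_one _
          _ ≤ 1 := Ex_le_of_le fun _ => le_rfl

end Checks

/-! ### The runs of the client -/

section Runs

variable {R : Type} {P : Params} {m l : ℕ}

@[simp] lemma RunState.round_spend (srv : Server R P m l) (q : Msg R P m l)
    (s : RunState R P m l) (c : ℕ) : (s.spend c).round srv q = (s.round srv q).spend c := by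
  simp [RunState.round, RunState.spend, Nat.add_right_comm]

variable [CommRing R]

@[simp] lemma wp_accumulate_smulLeft {a c : ℕ} {dim : ℕ → ℕ}
    (S : (i : ℕ) → Matrix (Fin a) (Fin (dim i)) R) (Y : (i : ℕ) → Matrix (Fin (dim i)) (Fin c) R)
    (init : Matrix (Fin a) (Fin c) R) (k : ℕ)
    (f : Matrix (Fin a) (Fin c) R → RunState R P m l → ℝ≥0∞) (s : RunState R P m l) :
    wp (accumulate (fun i => smulLeft (S i) (Y i)) init k) f s =
      f (init + ∑ i ∈ Finset.range k, S i * Y i)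
        (s.spend (∑ i ∈ Finset.range k, (2 * nnz (S i) * c + a * c + a * c))) :=
  wp_accumulate (fun _ _ _ => wp_smulLeft _ _ _) init k f s

@[simp] lemma wp_accumulate_smulRight {a c : ℕ} {dim : ℕ → ℕ}
    (Y : (i : ℕ) → Matrix (Fin a) (Fin (dim i)) R) (S : (i : ℕ) → Matrix (Fin (dim i)) (Fin c) R)
    (init : Matrix (Fin a) (Fin c) R) (k : ℕ)
    (f : Matrix (Fin a) (Fin c) R → RunState R P m l → ℝ≥0∞) (s : RunState R P m l) :
    wp (accumulate (fun i => smulRight (Y i) (S i)) init k) f s =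
      f (init + ∑ i ∈ Finset.range k, Y i * S i)
        (s.spend (∑ i ∈ Finset.range k, (2 * nnz (S i) * a + a * c + a * c))) :=
  wp_accumulate (fun _ _ _ => wp_smulRight _ _ _) init k f s

/-- The products `A L₁ ⋯ L_i` for `i ≤ k` as the client computes them. -/
def unmaskTable (T : (j i : ℕ) → Matrix (Fin (P.dim j)) (Fin (P.dim i)) R)
    (V : (i : ℕ) → Matrix (Fin m) (Fin (P.dim i)) R) (A : Matrix (Fin m) (Fin (P.dim 0)) R)
    (H : Matrix (Fin m) (Fin (P.dim P.depth)) R)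
    (S : (i : ℕ) → Matrix (Fin m) (Fin (P.dim i)) R) (k : ℕ) :
    (i : ℕ) → Matrix (Fin m) (Fin (P.dim i)) R
  | 0 => A
  | i + 1 => if i < k then V (i + 1) - (H * T P.depth (i + 1) +
      ∑ j ∈ Finset.range P.depth, S j * T j (i + 1)) else 0

variable (P) in
/-- The cost of computing `k` of the products `A L₁ ⋯ L_i`. -/
def unmaskCost (S : (i : ℕ) → Matrix (Fin m) (Fin (P.dim i)) R) (k : ℕ) : ℕ :=
  ∑ i ∈ Finset.range k, (mulCost P.sq m (P.dim P.depth) (P.dim (i + 1)) +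
    ∑ j ∈ Finset.range P.depth,
      (2 * nnz (S j) * P.dim (i + 1) + m * P.dim (i + 1) + m * P.dim (i + 1)) +
    m * P.dim (i + 1))

lemma wp_unmaskLefts (T : (j i : ℕ) → Matrix (Fin (P.dim j)) (Fin (P.dim i)) R)
    (V : (i : ℕ) → Matrix (Fin m) (Fin (P.dim i)) R) (A : Matrix (Fin m) (Fin (P.dim 0)) R)
    (H : Matrix (Fin m) (Fin (P.dim P.depth)) R)
    (S : (i : ℕ) → Matrix (Fin m) (Fin (P.dim i)) R) (k : ℕ)
    (f : ((i : ℕ) → Matrix (Fin m) (Fin (P.dim i)) R) → RunState R P m l → ℝ≥0∞)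
    (s : RunState R P m l) :
    wp (unmaskLefts T V A H S k) f s = f (unmaskTable T V A H S k) (s.spend (unmaskCost P S k)) := by
  induction k generalizing f s with
  | zero =>
    have : unmaskTable T V A H S 0 = Function.update (fun _ => 0) 0 A := by
      funext i
      cases i <;> simp [unmaskTable]
    simp [unmaskLefts, unmaskCost, this]
  | succ k ih =>
    have : unmaskTable T V A H S (k + 1) = Function.update (unmaskTable T V A H S k) (k + 1)
        (V (k + 1) - (H * T P.depth (k + 1) +
          ∑ j ∈ Finset.range P.depth, S j * T j (k + 1))) := by
      funext i
      rcases eq_or_ne i (k + 1) with rfl | hi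
      · simp [unmaskTable]
      · rw [Function.update_of_ne hi]
        cases i with
        | zero => rfl
        | succ i =>
          have h : i ≠ k := by omega
          have h' : i < k + 1 ↔ i < k := by omega
          simp only [unmaskTable, h']
    simp only [unmaskLefts, wp_bind, ih, wp_dmul, wp_accumulate_smulLeft, wp_msub, wp_pure,
      RunState.spend_spend, this, unmaskCost, Finset.sum_range_succ _ k, add_assoc]

variable (m l) in
/-- The mask of the left matrix. -/
def leftMask (T : (i : ℕ) → Matrix (Fin (P.dim 0)) (Fin (P.dim i)) R)
    (H : Matrix (Fin m) (Fin (P.dim P.depth)) R)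
    (S : (i : ℕ) → Matrix (Fin m) (Fin (P.dim i)) R) : Matrix (Fin m) (Fin (P.dim 0)) R :=
  H * (T P.depth).transpose + ∑ i ∈ Finset.range P.depth, S i * (T i).transpose

variable (P) in
/-- The cost of masking the left matrix. -/
def leftMaskCost (S : (i : ℕ) → Matrix (Fin m) (Fin (P.dim i)) R) : ℕ :=
  m * P.dim P.depth + (familySize P.depth (fun _ => m) P.dim +
    (mulCost P.sq m (P.dim P.depth) (P.dim 0) +
    (∑ i ∈ Finset.range P.depth, (2 * nnz (S i) * P.dim 0 + m * P.dim 0 + m * P.dim 0) +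
    m * P.dim 0)))

variable [Fintype R]

/-- The second round of the initialization, in terms of the table `T` claimed in the first one. -/
def wpSecondRound (srv : Server R P m l) (A : Matrix (Fin m) (Fin (P.dim 0)) R)
    (L : (i : ℕ) → Matrix (Fin (P.dim i)) (Fin (P.dim (i + 1))) R)
    (T : (j i : ℕ) → Matrix (Fin (P.dim j)) (Fin (P.dim i)) R)
    (f : Option (ClientState R P m) → RunState R P m l → ℝ≥0∞) (s : RunState R P m l) : ℝ≥0∞ :=
  Ex (uniformMatrix R m (P.dim P.depth)) fun H =>
    Ex (piPMF fun i : Fin P.depth => noiseMatrix R m (P.dim i) (P.rate i)) fun Sf =>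
      wp (checkPartial L (LeftReply.table
          (srv.reply s.view (.left (A + leftMask m (T 0) H (extend (g := P.dim) Sf))))
          (A + leftMask m (T 0) H (extend (g := P.dim) Sf))) P.depth)
        (fun ok s' => if ok = true then
          f (some ⟨T 0, unmaskTable T (LeftReply.table
            (srv.reply s.view (.left (A + leftMask m (T 0) H (extend (g := P.dim) Sf))))
            (A + leftMask m (T 0) H (extend (g := P.dim) Sf))) A H (extend (g := P.dim) Sf) P.depth,
            H, extend (g := P.dim) Sf⟩) (s'.spend (unmaskCost P (extend (g := P.dim) Sf) P.depth))
          else f none s')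
        ((s.round srv (.left (A + leftMask m (T 0) H (extend (g := P.dim) Sf)))).spend
          (leftMaskCost P (extend (f := fun _ => m) (g := P.dim) Sf)))

variable (P) in
/-- The number of entries of the bases. -/
def basesSize : ℕ := familySize P.depth P.dim fun i => P.dim (i + 1)

lemma wp_clientSetup (srv : Server R P m l) (A : Matrix (Fin m) (Fin (P.dim 0)) R)
    (f : Option (ClientState R P m) → RunState R P m l → ℝ≥0∞) (s : RunState R P m l) :
    wp (clientSetup srv A) f s =
      Ex (PMF.uniformOfFintype (Family R P.depth P.dim fun i => P.dim (i + 1))) fun Lf =>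
        wp (checkTable (extend Lf) (GramReply.table (srv.reply s.view (.bases Lf))) (P.depth + 1))
          (fun ok s' => if ok = true then
            wpSecondRound srv A (extend Lf) (GramReply.table (srv.reply s.view (.bases Lf))) f s'
            else f none s')
          ((s.round srv (.bases Lf)).spend (basesSize P)) := by
  simp only [clientSetup, wp_bind, wp_sample, wp_ask, wp_ite, wp_sampleUniform, wp_dmul,
    wp_accumulate_smulLeft, wp_madd, wp_unmaskLefts, wp_pure, RunState.view_spend,
    RunState.round_spend, RunState.spend_spend]
  rfl

/-- The mask of a right matrix. -/
def rightMask (T : (i : ℕ) → Matrix (Fin (P.dim 0)) (Fin (P.dim i)) R)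
    (G : Matrix (Fin (P.dim P.depth)) (Fin l) R)
    (S : (i : ℕ) → Matrix (Fin (P.dim i)) (Fin l) R) : Matrix (Fin (P.dim 0)) (Fin l) R :=
  T P.depth * G + ∑ i ∈ Finset.range P.depth, T i * S i

variable (P m) in
/-- The cost of an online step before the message is sent, for the noise `S`. -/
def maskCost (S : (i : ℕ) → Matrix (Fin (P.dim i)) (Fin l) R) : ℕ :=
  P.dim P.depth * l + (familySize P.depth P.dim (fun _ => l) +
    (mulCost P.sq (P.dim 0) (P.dim P.depth) l +
    (∑ i ∈ Finset.range P.depth, (2 * nnz (S i) * P.dim 0 + P.dim 0 * l + P.dim 0 * l) +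
    (P.dim 0 * l + (mulCost P.sq m (P.dim P.depth) l +
    ∑ i ∈ Finset.range P.depth, (2 * nnz (S i) * m + m * l + m * l))))))

variable (P l) in
/-- The cost of an online step after the reply, for the noise `S` in the mask of the left matrix. -/
def unmaskStepCost (S : (i : ℕ) → Matrix (Fin m) (Fin (P.dim i)) R) : ℕ :=
  mulCost P.sq m (P.dim P.depth) l +
    (∑ i ∈ Finset.range P.depth, (2 * nnz (S i) * l + m * l + m * l) + (m * l + m * l))

lemma wp_multiply (srv : Server R P m l) (c : ClientState R P m)
    (B : Matrix (Fin (P.dim 0)) (Fin l) R)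
    (f : Matrix (Fin m) (Fin l) R → RunState R P m l → ℝ≥0∞) (s : RunState R P m l) :
    wp (multiply srv c B) f s = Ex (uniformMatrix R (P.dim P.depth) l) fun G =>
      Ex (piPMF fun i : Fin P.depth => noiseMatrix R (P.dim i) l (P.rate i)) fun Tf =>
        f (RightReply.prod (srv.reply s.view
              (.right (B + rightMask c.bases G (extend (g := fun _ => l) Tf)))) -
            (c.lefts P.depth * G + ∑ i ∈ Finset.range P.depth,
              c.lefts i * extend (f := P.dim) (g := fun _ => l) Tf i) -
            (c.dense * RightReply.table (srv.reply s.view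
              (.right (B + rightMask c.bases G (extend (g := fun _ => l) Tf))))
              (B + rightMask c.bases G (extend (g := fun _ => l) Tf)) P.depth +
              ∑ i ∈ Finset.range P.depth, c.sparse i * RightReply.table (srv.reply s.view
              (.right (B + rightMask c.bases G (extend (g := fun _ => l) Tf))))
              (B + rightMask c.bases G (extend (g := fun _ => l) Tf)) i))
          ((s.round srv (.right (B + rightMask c.bases G (extend (g := fun _ => l) Tf)))).spend
            (maskCost P m (extend (g := fun _ => l) Tf) + unmaskStepCost P l c.sparse)) := by
  simp only [multiply, wp_bind, wp_sample, wp_ask, wp_sampleUniform, wp_dmul,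
    wp_accumulate_smulLeft, wp_accumulate_smulRight, wp_madd, wp_msub,
    RunState.view_spend, RunState.round_spend, RunState.spend_spend, maskCost, unmaskStepCost,
    add_assoc]
  rfl

lemma wp_multiplyAll_succ (srv : Server R P m l) (c : ClientState R P m)
    (B : ℕ → Matrix (Fin (P.dim 0)) (Fin l) R) (T : ℕ)
    (f : List (Matrix (Fin m) (Fin l) R) → RunState R P m l → ℝ≥0∞) (s : RunState R P m l) :
    wp (multiplyAll srv c B (T + 1)) f s = wp (multiplyAll srv c B T)
      (fun xs s' => wp (multiply srv c (B T)) (fun x s'' => f (xs ++ [x]) s'') s') s := by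
  simp only [multiplyAll, wp_bind, wp_pure]

lemma Ex_initRun (srv : Server R P m l) (A : Matrix (Fin m) (Fin (P.dim 0)) R)
    (f : Option (ClientState R P m) × RunState R P m l → ℝ≥0∞) :
    Ex (initRun srv A) f = wp (clientSetup srv A) (fun o s => f (o, s)) (startState R P m l) := rfl

lemma Ex_fullRun (srv : Server R P m l) (A : Matrix (Fin m) (Fin (P.dim 0)) R)
    (B : ℕ → Matrix (Fin (P.dim 0)) (Fin l) R) (T : ℕ)
    (f : Option (List (Matrix (Fin m) (Fin l) R)) × RunState R P m l → ℝ≥0∞) :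
    Ex (fullRun srv A B T) f = wp (clientSetup srv A) (fun o s => match o with
      | none => f (none, s)
      | some c => wp (multiplyAll srv c B T) (fun xs s' => f (some xs, s')) s)
      (startState R P m l) := by
  have h : Ex (fullRun srv A B T) f = wp (do
    match ← clientSetup srv A with
    | none => pure none
    | some c => do
        let xs ← multiplyAll srv c B T
        pure (some xs)) (fun o s => f (o, s)) (startState R P m l) := rfl
  rw [h, wp_bind]
  congr 1
  funext o s
  cases o <;> simp only [wp_bind, wp_pure]

/-- The state with all costs set to zero. -/
def RunState.reset (s : RunState R P m l) : RunState R P m l := { s with ledger := emptyLedger }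

lemma Ex_stepRun (srv : Server R P m l) (A : Matrix (Fin m) (Fin (P.dim 0)) R)
    (B : ℕ → Matrix (Fin (P.dim 0)) (Fin l) R) (k : ℕ)
    (f : Option (Matrix (Fin m) (Fin l) R) × RunState R P m l → ℝ≥0∞) :
    Ex (stepRun srv A B k) f = wp (clientSetup srv A) (fun o s => match o with
      | none => f (none, s.reset)
      | some c => wp (multiplyAll srv c B k) (fun _ s' =>
          wp (multiply srv c (B k)) (fun x s'' => f (some x, s'')) s'.reset) s)
      (startState R P m l) := by
  have h : Ex (stepRun srv A B k) f = wp (do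
    match ← clientSetup srv A with
    | none => do
        modify fun s => { s with ledger := emptyLedger }
        pure none
    | some c => do
        let _ ← multiplyAll srv c B k
        modify fun s => { s with ledger := emptyLedger }
        let x ← multiply srv c (B k)
        pure (some x)) (fun o s => f (o, s)) (startState R P m l) := rfl
  rw [h, wp_bind]
  congr 1
  funext o s
  cases o <;> simp only [wp_bind, wp_pure, wp_modify] <;> rfl

end Runs

/-! ### Runs with the honest server -/

section HonestRuns

variable {R : Type} {P : Params} {m l : ℕ} [CommRing R] [Fintype R]

/-- The state of the client and the messages sent after an initialization with the honest server,
followed by any number of online steps. -/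
def HonestState (A : Matrix (Fin m) (Fin (P.dim 0)) R) (c : ClientState R P m)
    (view : List (Msg R P m l)) : Prop :=
  ∃ Lf rest, view = .bases Lf :: .left (A + leftMask m c.bases c.dense c.sparse) :: rest ∧
    ∀ i ≤ P.depth, c.bases i = prodL (extend Lf) i ∧ c.lefts i = A * prodL (extend Lf) i

/-- The cost of the honest server in an online step. -/
def stepWork (P : Params) (m l : ℕ) : ℕ :=
  mulCost P.sq m (P.dim 0) l +
    ∑ i ∈ Finset.range P.depth, mulCost P.sq (P.dim (i + 1)) (P.dim i) l +
    P.dim 0 * l + (m * l + familySize P.depth (fun i => P.dim (i + 1)) fun _ => l)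

/-- The number of elements in the reply with the table of products. -/
def gramWords (P : Params) : ℕ :=
  familySize P.depth (fun _ => P.dim 0) (fun i => P.dim (i + 1)) +
    ∑ j ∈ Finset.range P.depth, familySize P.depth (fun _ => P.dim (j + 1)) fun i => P.dim (i + 1)

lemma wp_setup_honest (A : Matrix (Fin m) (Fin (P.dim 0)) R)
    {f : Option (ClientState R P m) → RunState R P m l → ℝ≥0∞} {M : ℝ≥0∞}
    (h : ∀ c s, HonestState A c s.view → s.ledger.rounds = 2 →
      s.ledger.server = gramCost P P.depth + (basesSize P + gramWords P) +
        (∑ i ∈ Finset.range P.depth, mulCost P.sq m (P.dim i) (P.dim (i + 1)) +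
          (m * P.dim 0 + familySize P.depth (fun _ => m) fun i => P.dim (i + 1))) →
      s.ledger.up = basesSize P + m * P.dim 0 →
      s.ledger.down = gramWords P + familySize P.depth (fun _ => m) (fun i => P.dim (i + 1)) →
      f (some c) s ≤ M) :
    wp (clientSetup (honestServer R P m l) A) f (startState R P m l) ≤ M := by
  rw [wp_clientSetup]
  refine Ex_le_of_le fun Lf => ?_
  rw [honest_reply_bases, wp_checkTable_of_correct _ _
    (fun j hj i hi => table_trueGram Lf (Nat.le_of_lt_succ hj) hi), if_pos rfl]
  unfold wpSecondRound
  refine Ex_le_of_le fun H => Ex_le_of_le fun Sf => ?_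
  set s₁ : RunState R P m l := (RunState.round (honestServer R P m l) (.bases Lf)
    (startState R P m l)).spend (basesSize P) with hs₁
  rw [honest_reply_left]
  set T := (trueGram Lf).table with hT
  set S := extend (f := fun _ => m) (g := P.dim) Sf with hS
  set Aenc := A + leftMask m (T 0) H S with hA
  have hview : (s₁.spend (tableCheckCost P (P.depth + 1))).view = [.bases Lf] := rfl
  have hbases : basesOf [Msg.bases (m := m) (l := l) Lf] = extend Lf := rfl
  rw [hview, hbases]
  rw [wp_checkPartial_of_correct (X := Aenc) _ _ (fun i hi => table_leftReply _ rfl hi), if_pos rfl]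
  have hT' : ∀ j ≤ P.depth, ∀ i ≤ P.depth, T j i =
    (prodL (extend Lf) j).transpose * prodL (extend Lf) i := fun j hj i hi => table_trueGram Lf hj hi
  have hT0 : ∀ i ≤ P.depth, T 0 i = prodL (extend Lf) i := fun i hi => by
    rw [hT' 0 (by omega) i hi]
    simp [prodL]
  refine h _ _ ⟨Lf, [], rfl, fun i hi => ⟨hT0 i hi, ?_⟩⟩ rfl ?_ ?_ ?_
  · cases i with
    | zero => simp [unmaskTable, prodL]
    | succ i =>
      simp only [unmaskTable]
      have hi' : i < P.depth := hi
      rw [if_pos hi', table_leftReply _ rfl hi, hT' P.depth le_rfl _ hi]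
      have hsum : ∑ j ∈ Finset.range P.depth, S j * T j (i + 1) =
          (∑ j ∈ Finset.range P.depth, S j * (T 0 j).transpose) * prodL (extend Lf) (i + 1) := by
        rw [Matrix.sum_mul]
        refine Finset.sum_congr rfl fun j hj => ?_
        have hj' : j ≤ P.depth := (Finset.mem_range.mp hj).le
        rw [hT' j hj' _ hi, hT0 j hj', Matrix.mul_assoc]
      rw [hsum, hA, leftMask, hT0 _ le_rfl, ← Matrix.mul_assoc, ← Matrix.add_mul, ← Matrix.sub_mul,
        add_sub_cancel_right]
  · change 0 + ((honestServer R P m l).work [] (.bases Lf) + (basesSize P + gramWords P)) +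
      ((honestServer R P m l).work [.bases Lf] (.left Aenc) + (m * P.dim 0 +
        familySize P.depth (fun _ => m) fun i => P.dim (i + 1))) = _
    rw [honest_work_bases, honest_work_left, zero_add]
  · change 0 + basesSize P + m * P.dim 0 = _
    rw [zero_add]
  · change 0 + gramWords P + _ = _
    rw [zero_add]
    rfl

lemma wp_multiply_honest {A : Matrix (Fin m) (Fin (P.dim 0)) R} {c : ClientState R P m}
    (B : Matrix (Fin (P.dim 0)) (Fin l) R)
    {f : Matrix (Fin m) (Fin l) R → RunState R P m l → ℝ≥0∞} {s : RunState R P m l} {M : ℝ≥0∞}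
    (hs : HonestState A c s.view)
    (h : ∀ s', HonestState A c s'.view → s'.ledger.rounds = s.ledger.rounds + 1 →
      s'.ledger.server = s.ledger.server + stepWork P m l →
      s'.ledger.up = s.ledger.up + P.dim 0 * l →
      s'.ledger.down = s.ledger.down +
        (m * l + familySize P.depth (fun i => P.dim (i + 1)) fun _ => l) →
      f (A * B) s' ≤ M) :
    wp (multiply (honestServer R P m l) c B) f s ≤ M := by
  rw [wp_multiply]
  refine Ex_le_of_le fun G => Ex_le_of_le fun Tf => ?_
  obtain ⟨Lf, rest, hview, hc⟩ := hs
  rw [honest_reply_right]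
  set S := extend (f := P.dim) (g := fun _ => l) Tf with hS
  set Benc := B + rightMask c.bases G S with hB
  have hl : leftOf s.view = A + leftMask m c.bases c.dense c.sparse := by rw [hview]; rfl
  have hb : basesOf s.view = extend Lf := by rw [hview]; rfl
  rw [hl, hb]
  have hQ : ∀ i ≤ P.depth, (RightReply.mk ((A + leftMask m c.bases c.dense c.sparse) * Benc)
      (fun i => (prodL (extend Lf) (i + 1)).transpose * Benc) : RightReply R P m l).table Benc i =
      (c.bases i).transpose * Benc := fun i hi => by
    rw [table_rightReply _ hi, (hc i hi).1]
  have hval : (A + leftMask m c.bases c.dense c.sparse) * Benc -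
      (c.lefts P.depth * G + ∑ i ∈ Finset.range P.depth, c.lefts i * S i) -
      (c.dense * ((c.bases P.depth).transpose * Benc) +
        ∑ i ∈ Finset.range P.depth, c.sparse i * ((c.bases i).transpose * Benc)) = A * B := by
    have h₁ : c.dense * ((c.bases P.depth).transpose * Benc) +
        ∑ i ∈ Finset.range P.depth, c.sparse i * ((c.bases i).transpose * Benc) =
        leftMask m c.bases c.dense c.sparse * Benc := by
      simp only [leftMask, Matrix.add_mul, Matrix.sum_mul, Matrix.mul_assoc]
    have h₂ : c.lefts P.depth * G + ∑ i ∈ Finset.range P.depth, c.lefts i * S i =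
        A * rightMask c.bases G S := by
      have h₃ : ∀ i ≤ P.depth, c.lefts i = A * c.bases i := fun i hi => by
        rw [(hc i hi).2, (hc i hi).1]
      rw [rightMask, Matrix.mul_add, Matrix.mul_sum, h₃ _ le_rfl, Matrix.mul_assoc]
      congr 1
      refine Finset.sum_congr rfl fun i hi => ?_
      rw [h₃ i (Finset.mem_range.mp hi).le, Matrix.mul_assoc]
    rw [h₁, h₂, Matrix.add_mul, hB, Matrix.mul_add A]
    abel
  have hsum : ∑ i ∈ Finset.range P.depth, c.sparse i *
      (RightReply.mk ((A + leftMask m c.bases c.dense c.sparse) * Benc)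
      (fun i => (prodL (extend Lf) (i + 1)).transpose * Benc) : RightReply R P m l).table Benc i =
      ∑ i ∈ Finset.range P.depth, c.sparse i * ((c.bases i).transpose * Benc) :=
    Finset.sum_congr rfl fun i hi => by rw [hQ i (Finset.mem_range.mp hi).le]
  rw [hQ _ le_rfl, hsum, hval]
  refine h _ ⟨Lf, rest ++ [.right Benc], ?_, hc⟩ rfl ?_ rfl rfl
  · simp [hview]
  · change s.ledger.server + ((honestServer R P m l).work s.view (.right Benc) + (P.dim 0 * l +
      (m * l + familySize P.depth (fun i => P.dim (i + 1)) fun _ => l))) = _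
    rw [honest_work_right, stepWork]
    ring

lemma wp_multiplyAll_honest {A : Matrix (Fin m) (Fin (P.dim 0)) R} {c : ClientState R P m}
    (B : ℕ → Matrix (Fin (P.dim 0)) (Fin l) R) (T : ℕ)
    {f : List (Matrix (Fin m) (Fin l) R) → RunState R P m l → ℝ≥0∞} {s : RunState R P m l}
    {M : ℝ≥0∞} (hs : HonestState A c s.view)
    (h : ∀ s', HonestState A c s'.view →
      s'.ledger.server = s.ledger.server + T * stepWork P m l →
      s'.ledger.up = s.ledger.up + T * (P.dim 0 * l) →
      s'.ledger.down = s.ledger.down +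
        T * (m * l + familySize P.depth (fun i => P.dim (i + 1)) fun _ => l) →
      f ((List.range T).map fun k => A * B k) s' ≤ M) :
    wp (multiplyAll (honestServer R P m l) c B T) f s ≤ M := by
  induction T generalizing f with
  | zero =>
    have : wp (multiplyAll (honestServer R P m l) c B 0) f s = f [] s := by simp [multiplyAll]
    rw [this]
    exact h s hs (by simp) (by simp) (by simp)
  | succ T ih =>
    rw [wp_multiplyAll_succ]
    refine ih fun s₁ hs₁ h₁ h₂ h₃ => ?_
    refine wp_multiply_honest (B T) hs₁ fun s₂ hs₂ _ h₁' h₂' h₃' => ?_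
    rw [List.range_succ, List.map_append] at h
    refine h s₂ hs₂ ?_ ?_ ?_
    · rw [h₁', h₁]; ring
    · rw [h₂', h₂]; ring
    · rw [h₃', h₃]; ring

/-- With the honest server the client returns the products. -/
lemma exactOutput : ExactOutput R P m l := by
  intro A B T
  rw [forall_support_iff, Ex_fullRun, ← nonpos_iff_eq_zero]
  refine wp_setup_honest A fun c s hs _ _ _ _ => ?_
  refine wp_multiplyAll_honest B T hs fun s' _ _ _ _ => ?_
  simp

/-- The initialization takes two rounds and an online step takes one. -/
lemma twoPlusOneRounds : TwoPlusOneRounds R P m l := by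
  intro A B
  constructor
  · rw [forall_support_iff, Ex_initRun, ← nonpos_iff_eq_zero]
    refine wp_setup_honest A fun c s _ h _ _ _ => ?_
    simp [h]
  · intro k
    rw [forall_support_iff, Ex_stepRun, ← nonpos_iff_eq_zero]
    refine wp_setup_honest A fun c s hs _ _ _ _ => ?_
    refine wp_multiplyAll_honest B k hs fun s' hs' _ _ _ => ?_
    refine wp_multiply_honest (B k) (s := s'.reset) hs' fun s'' _ h _ _ _ => ?_
    have h' : s''.ledger.rounds = 1 := h
    simp [h']

/-- The cost of the honest server in the initialization. -/
lemma initRun_server (A : Matrix (Fin m) (Fin (P.dim 0)) R) :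
    ∀ o ∈ (initRun (honestServer R P m l) A).support, o.2.ledger.server =
      gramCost P P.depth + (basesSize P + gramWords P) +
        (∑ i ∈ Finset.range P.depth, mulCost P.sq m (P.dim i) (P.dim (i + 1)) +
          (m * P.dim 0 + familySize P.depth (fun _ => m) fun i => P.dim (i + 1))) := by
  rw [forall_support_iff, Ex_initRun, ← nonpos_iff_eq_zero]
  refine wp_setup_honest A fun c s _ _ h _ _ => ?_
  simp [h]

lemma stepRun_server (A : Matrix (Fin m) (Fin (P.dim 0)) R)
    (B : ℕ → Matrix (Fin (P.dim 0)) (Fin l) R) (k : ℕ) :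
    ∀ o ∈ (stepRun (honestServer R P m l) A B k).support,
      o.2.ledger.server = stepWork P m l := by
  rw [forall_support_iff, Ex_stepRun, ← nonpos_iff_eq_zero]
  refine wp_setup_honest A fun c s hs _ _ _ _ => ?_
  refine wp_multiplyAll_honest B k hs fun s' hs' _ _ _ => ?_
  refine wp_multiply_honest (B k) (s := s'.reset) hs' fun s'' _ _ h _ _ => ?_
  have h' : s''.ledger.server = stepWork P m l := h.trans (Nat.zero_add _)
  simp [h']

lemma fullRun_ledger (A : Matrix (Fin m) (Fin (P.dim 0)) R)
    (B : ℕ → Matrix (Fin (P.dim 0)) (Fin l) R) (T : ℕ) :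
    ∀ o ∈ (fullRun (honestServer R P m l) A B T).support,
      o.2.ledger.server = gramCost P P.depth + (basesSize P + gramWords P) +
        (∑ i ∈ Finset.range P.depth, mulCost P.sq m (P.dim i) (P.dim (i + 1)) +
          (m * P.dim 0 + familySize P.depth (fun _ => m) fun i => P.dim (i + 1))) +
          T * stepWork P m l ∧
      o.2.ledger.up = basesSize P + m * P.dim 0 + T * (P.dim 0 * l) ∧
      o.2.ledger.down = gramWords P + familySize P.depth (fun _ => m) (fun i => P.dim (i + 1)) +
        T * (m * l + familySize P.depth (fun i => P.dim (i + 1)) fun _ => l) := by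
  rw [forall_support_iff, Ex_fullRun, ← nonpos_iff_eq_zero]
  refine wp_setup_honest A fun c s hs _ h₁ h₂ h₃ => ?_
  refine wp_multiplyAll_honest B T hs fun s' _ h₁' h₂' h₃' => ?_
  rw [h₁] at h₁'
  rw [h₂] at h₂'
  rw [h₃] at h₃'
  simp only [h₁', h₂', h₃', and_self, not_true_eq_false, not_false_eq_true, ind_false, le_refl]

end HonestRuns

/-! ### Wrong replies in the initialization -/

/-- The table is wrong if the reply is. -/
lemma not_table_correct {R : Type} {P : Params} [CommRing R]
    {Lf : Family R P.depth P.dim fun i => P.dim (i + 1)} {G : GramReply R P}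
    (h : G ≠ trueGram Lf) : ¬∀ j < P.depth + 1, ∀ i ≤ P.depth,
      G.table j i = (prodL (extend Lf) j).transpose * prodL (extend Lf) i := by
  intro hcon
  exact h (eq_trueGram_of_table Lf G fun j hj => hcon j (Nat.lt_succ_of_le hj))

section Soundness

variable {R : Type} {P : Params} {m l : ℕ} [CommRing R] [Fintype R]

lemma wp_checkTable_of_ne [Nontrivial R] {Lf : Family R P.depth P.dim fun i => P.dim (i + 1)} {G : GramReply R P}
    (h : G ≠ trueGram Lf) (s : RunState R P m l) :
    wp (checkTable (extend Lf) G.table (P.depth + 1)) (fun b _ => ind (b = true)) s ≤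
      ((minIdealCard R : ℝ≥0∞)⁻¹) ^ P.checks := by
  refine wp_checkTable_of_wrong _ _ rfl (fun j _ => ?_) le_rfl (not_table_correct h) s
  cases j with
  | zero => simp [GramReply.table]
  | succ j => rfl

lemma wpSecondRound_le_one (srv : Server R P m l) (A : Matrix (Fin m) (Fin (P.dim 0)) R)
    (L : (i : ℕ) → Matrix (Fin (P.dim i)) (Fin (P.dim (i + 1))) R)
    (T : (j i : ℕ) → Matrix (Fin (P.dim j)) (Fin (P.dim i)) R)
    {f : Option (ClientState R P m) → RunState R P m l → ℝ≥0∞} (hf : ∀ o s, f o s ≤ 1)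
    (s : RunState R P m l) : wpSecondRound srv A L T f s ≤ 1 := by
  refine Ex_le_of_le fun H => Ex_le_of_le fun Sf => Ex_le_of_le fun o => ?_
  dsimp only
  split_ifs
  · exact hf _ _
  · exact hf _ _

/-- A wrong reply in the initialization goes unnoticed with probability at most `q ^ (-checks)`:
the first wrong claim has correct predecessors. -/
lemma Ex_wrong_reply_le [Nontrivial R] (srv : Server R P m l) (A : Matrix (Fin m) (Fin (P.dim 0)) R) :
    (Ex (initRun srv A) fun o => ind (o.1.isSome ∧ ∃ past q, (past ++ [q]) <+: o.2.view ∧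
      srv.reply past q ≠ (honestServer R P m l).reply past q)) ≤
      ((minIdealCard R : ℝ≥0∞)⁻¹) ^ P.checks := by
  rw [Ex_initRun, wp_clientSetup]
  refine Ex_le_of_le fun Lf => ?_
  by_cases hG : srv.reply [] (.bases Lf) = trueGram Lf
  · have hG' : srv.reply (startState R P m l).view (.bases Lf) = trueGram Lf := hG
    rw [hG', wp_checkTable_of_correct _ _
      (fun j hj i hi => table_trueGram Lf (Nat.le_of_lt_succ hj) hi), if_pos rfl]
    refine Ex_le_of_le fun H => Ex_le_of_le fun Sf => ?_
    set S := extend (f := fun _ => m) (g := P.dim) Sf with hS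
    set Aenc := A + leftMask m ((trueGram Lf).table 0) H S with hA
    have hview : (((RunState.round srv (.bases Lf) (startState R P m l)).spend (basesSize P)).spend
      (tableCheckCost P (P.depth + 1))).view = [.bases Lf] := rfl
    rw [hview]
    by_cases hV : srv.reply [.bases Lf] (.left Aenc) =
        LeftReply.mk fun i => Aenc * prodL (extend Lf) (i + 1)
    · refine le_trans (le_of_eq ?_) zero_le
      rw [wp_checkPartial_of_correct (X := Aenc) _ _ (fun i hi => table_leftReply _ hV hi),
        if_pos rfl]
      apply ind_false
      rintro ⟨-, past, q, hp, hne⟩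
      have hp' : past ++ [q] <+: [.bases Lf] ++ [.left Aenc] := hp
      rw [List.prefix_concat_iff] at hp'
      rcases hp' with hp' | hp'
      · obtain ⟨rfl, hq⟩ := List.append_inj' hp' rfl
        obtain rfl : q = .left Aenc := by simpa using hq
        apply hne
        rw [hV, honest_reply_left]
        rfl
      · have hp'' : past ++ [q] <+: [] ++ [.bases Lf] := hp'
        rw [List.prefix_concat_iff] at hp''
        rcases hp'' with hp'' | hp''
        · obtain ⟨rfl, hq⟩ := List.append_inj' hp'' rfl
          obtain rfl : q = .bases Lf := by simpa using hq
          exact hne (hG.trans (honest_reply_bases _ _).symm)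
        · simp at hp''
    · refine le_trans (wp_mono (g := fun b _ => ind (b = true)) fun b s => ?_)
        (wp_checkPartial_of_wrong (X := Aenc) (extend Lf) P.depth rfl
          (fun hcon => hV (eq_leftReply_of_table _ _ _ hcon)) _)
      cases b
      · simp
      · simp only [if_true, ind_true]
        exact ind_le_one _
  · refine le_trans (wp_mono fun b s => ?_) (wp_checkTable_of_ne (m := m) (l := l) hG
      ((RunState.round srv (.bases Lf) (startState R P m l)).spend (basesSize P)))
    cases b
    · simp
    · simp only [if_true, ind_true]
      exact wpSecondRound_le_one _ _ _ _ (fun _ _ => ind_le_one _) _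

lemma soundInitialization_of_checks [Nontrivial R] {bits : ℝ}
    (h : ((minIdealCard R : ℝ)⁻¹) ^ P.checks ≤ (2 : ℝ) ^ (-bits)) :
    SoundInitialization R P m l bits := by
  intro srv A
  rw [prob_eq_Ex]
  refine (ENNReal.toReal_mono ?_ (Ex_wrong_reply_le srv A)).trans (le_trans (le_of_eq ?_) h)
  · refine ENNReal.pow_ne_top (ENNReal.inv_ne_top.mpr ?_)
    have := two_le_minIdealCard R
    exact_mod_cast (by omega : minIdealCard R ≠ 0)
  · simp

/-- Without recursion there is nothing to check. -/
lemma soundInitialization_of_depth_eq_zero (hd : P.depth = 0) (bits : ℝ) :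
    SoundInitialization R P m l bits := by
  intro srv A
  have hemp : IsEmpty (Fin P.depth) := by rw [hd]; infer_instance
  have hGram : ∀ G G' : GramReply R P, G = G' := by
    rintro ⟨t, i⟩ ⟨t', i'⟩
    congr 1 <;> funext j <;> exact hemp.elim j
  have hLeft : ∀ V V' : LeftReply R P m, V = V' := by
    rintro ⟨t⟩ ⟨t'⟩
    congr 1
    funext j
    exact hemp.elim j
  have h : (Ex (initRun srv A) fun o => ind (o.1.isSome ∧ ∃ past q, (past ++ [q]) <+: o.2.view ∧
      srv.reply past q ≠ (honestServer R P m l).reply past q)) ≤ 0 := by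
    rw [Ex_initRun, wp_clientSetup]
    refine Ex_le_of_le fun Lf => wp_checkTable_le _ _ _ fun b c _ => ?_
    have hone : ∀ q : Msg R P m l, q = .bases Lf → ∀ past,
        srv.reply past q = (honestServer R P m l).reply past q := by
      rintro q rfl past
      exact hGram _ _
    have htwo : ∀ A', ∀ q : Msg R P m l, q = .left A' → ∀ past,
        srv.reply past q = (honestServer R P m l).reply past q := by
      rintro A' q rfl past
      exact hLeft _ _
    split_ifs
    · refine Ex_le_of_le fun H => Ex_le_of_le fun Sf => wp_checkPartial_le _ _ _ fun b' c' _ => ?_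
      split_ifs
      · refine le_of_eq (ind_false ?_)
        rintro ⟨-, past, q, hp, hne⟩
        have hq : q = .bases Lf ∨ ∃ A', q = .left A' := by
          have hmem := hp.subset (show q ∈ past ++ [q] by simp)
          simp only [RunState.view_spend, RunState.view_round, startState, List.mem_append,
            List.mem_singleton, List.not_mem_nil, false_or] at hmem
          rcases hmem with h | h
          · exact Or.inl h
          · exact Or.inr ⟨_, h⟩
        rcases hq with hq | ⟨A', hq⟩
        · exact hne (hone q hq past)
        · exact hne (htwo A' q hq past)
      · simp
    · simp
  rw [prob_eq_Ex, nonpos_iff_eq_zero.mp h, ENNReal.toReal_zero]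
  positivity

end Soundness

/-! ### The masks of all inputs as one matrix -/

section Glue

variable {R : Type}

/-- The columns that belong to the left matrix, as rows. -/
def leftPart {a m T l : ℕ} (W : Matrix (Fin a) (Fin (m + T * l)) R) : Matrix (Fin m) (Fin a) R :=
  Matrix.of fun j i => W i (Fin.castAdd _ j)

/-- The columns that belong to the right matrix with index `k`. -/
def rightPart {a m T l : ℕ} (W : Matrix (Fin a) (Fin (m + T * l)) R) (k : Fin T) :
    Matrix (Fin a) (Fin l) R :=
  Matrix.of fun i c => W i (Fin.natAdd m (finProdFinEquiv (k, c)))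

/-- The matrix with the columns `Xᵀ, Y 0, Y 1, …`. -/
def glue {a m T l : ℕ} (X : Matrix (Fin m) (Fin a) R) (Y : Fin T → Matrix (Fin a) (Fin l) R) :
    Matrix (Fin a) (Fin (m + T * l)) R :=
  Matrix.of fun i => Fin.addCases (fun j => X j i) fun p =>
    Y (finProdFinEquiv.symm p).1 i (finProdFinEquiv.symm p).2

variable {a m T l : ℕ}

@[simp] lemma leftPart_glue (X : Matrix (Fin m) (Fin a) R) (Y : Fin T → Matrix (Fin a) (Fin l) R) :
    leftPart (glue X Y) = X := by
  ext j i
  simp [leftPart, glue]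

@[simp] lemma rightPart_glue (X : Matrix (Fin m) (Fin a) R)
    (Y : Fin T → Matrix (Fin a) (Fin l) R) : rightPart (glue X Y) = Y := by
  funext k
  ext i c
  simp only [rightPart, glue, Matrix.of_apply, Fin.addCases_right, Equiv.symm_apply_apply]

/-- Gluing is a bijection. -/
def glueEquiv (R : Type) (a m T l : ℕ) :
    (Matrix (Fin m) (Fin a) R × (Fin T → Matrix (Fin a) (Fin l) R)) ≃
      Matrix (Fin a) (Fin (m + T * l)) R where
  toFun p := glue p.1 p.2
  invFun W := (leftPart W, rightPart W)
  left_inv p := by simp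
  right_inv W := by
    ext i j
    refine Fin.addCases (fun j => ?_) (fun p => ?_) j
    · simp [glue, leftPart]
    · simp only [glue, rightPart, Matrix.of_apply, Fin.addCases_right, Prod.mk.eta,
        Equiv.apply_symm_apply]

lemma prod_glue {β : Type} [CommMonoid β] (w : R → β) (X : Matrix (Fin m) (Fin a) R)
    (Y : Fin T → Matrix (Fin a) (Fin l) R) :
    ∏ i, ∏ j, w (glue X Y i j) = (∏ j, ∏ i, w (X j i)) * ∏ k, ∏ i, ∏ c, w (Y k i c) := by
  have h : ∀ i, ∏ j, w (glue X Y i j) = (∏ j, w (X j i)) * ∏ k, ∏ c, w (Y k i c) := by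
    intro i
    rw [Fin.prod_univ_add]
    congr 1
    · simp [glue]
    · rw [← Fintype.prod_prod_type', ← Equiv.prod_comp finProdFinEquiv]
      refine Finset.prod_congr rfl fun p _ => ?_
      simp only [glue, Matrix.of_apply, Fin.addCases_right, Equiv.symm_apply_apply]
  rw [Finset.prod_congr rfl fun i _ => h i, Finset.prod_mul_distrib]
  congr 1
  · exact Finset.prod_comm
  · exact Finset.prod_comm

variable [CommRing R] [Fintype R]

lemma noiseMatrix_apply (a b : ℕ) (μ : ℝ) (S : Matrix (Fin a) (Fin b) R) :
    noiseMatrix R a b μ S = ∏ i, ∏ j, noise R μ (S i j) := rfl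

lemma noiseMatrix_glue (μ : ℝ) (X : Matrix (Fin m) (Fin a) R)
    (Y : Fin T → Matrix (Fin a) (Fin l) R) :
    noiseMatrix R a (m + T * l) μ (glue X Y) =
      noiseMatrix R m a μ X * ∏ k, noiseMatrix R a l μ (Y k) := by
  simp only [noiseMatrix_apply]
  exact prod_glue (noise R μ) X Y

/-- Independent noise for the parts is noise for the glued matrix, in all dimensions at once. -/
lemma Ex_glue_noise {d : ℕ} (dim : Fin d → ℕ) (μ : Fin d → ℝ)
    (f : (∀ i, Matrix (Fin m) (Fin (dim i)) R) →
      (Fin T → ∀ i, Matrix (Fin (dim i)) (Fin l) R) → ℝ≥0∞) :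
    (Ex (piPMF fun i => noiseMatrix R m (dim i) (μ i)) fun S =>
      Ex (piPMF fun _ : Fin T => piPMF fun i => noiseMatrix R (dim i) l (μ i)) fun Z => f S Z) =
    Ex (piPMF fun i => noiseMatrix R (dim i) (m + T * l) (μ i)) fun W =>
      f (fun i => leftPart (W i)) fun k i => rightPart (W i) k := by
  let e : ((∀ i, Matrix (Fin m) (Fin (dim i)) R) × (Fin T → ∀ i, Matrix (Fin (dim i)) (Fin l) R)) ≃
      ∀ i, Matrix (Fin (dim i)) (Fin (m + T * l)) R :=
    { toFun := fun p i => glue (p.1 i) fun k => p.2 k i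
      invFun := fun W => (fun i => leftPart (W i), fun k i => rightPart (W i) k)
      left_inv := fun p => by simp
      right_inv := fun W => funext fun i => (glueEquiv R (dim i) m T l).right_inv (W i) }
  simp only [Ex, tsum_fintype, Finset.mul_sum]
  rw [← Fintype.sum_prod_type', ← Equiv.sum_comp e]
  refine Finset.sum_congr rfl fun p _ => ?_
  have hw : (piPMF fun i => noiseMatrix R (dim i) (m + T * l) (μ i)) (e p) =
      (piPMF fun i => noiseMatrix R m (dim i) (μ i)) p.1 *
        (piPMF fun _ : Fin T => piPMF fun i => noiseMatrix R (dim i) l (μ i)) p.2 := by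
    simp only [piPMF_apply]
    rw [Finset.prod_comm, ← Finset.prod_mul_distrib]
    exact Finset.prod_congr rfl fun i _ => noiseMatrix_glue (μ i) (p.1 i) fun k => p.2 k i
  have hf : f (fun i => leftPart (e p i)) (fun k i => rightPart (e p i) k) = f p.1 p.2 := by
    simp [e]
  rw [hw, hf, mul_assoc]

lemma Ex_glue_uniform (f : Matrix (Fin m) (Fin a) R → (Fin T → Matrix (Fin a) (Fin l) R) → ℝ≥0∞) :
    (Ex (uniformMatrix R m a) fun X =>
      Ex (piPMF fun _ : Fin T => uniformMatrix R a l) fun Y => f X Y) =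
    Ex (uniformMatrix R a (m + T * l)) fun W => f (leftPart W) (rightPart W) := by
  simp only [uniformMatrix_eq_noiseMatrix, Ex, tsum_fintype, Finset.mul_sum]
  rw [← Fintype.sum_prod_type', ← Equiv.sum_comp (glueEquiv R a m T l)]
  refine Finset.sum_congr rfl fun p _ => ?_
  have hw : noiseMatrix R a (m + T * l) 1 (glueEquiv R a m T l p) =
      noiseMatrix R m a 1 p.1 * (piPMF fun _ : Fin T => noiseMatrix R a l 1) p.2 := by
    rw [piPMF_apply]
    exact noiseMatrix_glue 1 p.1 p.2
  have hf : f (leftPart (glueEquiv R a m T l p)) (rightPart (glueEquiv R a m T l p)) = f p.1 p.2 := by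
    simp [glueEquiv]
  rw [hw, hf, mul_assoc]

end Glue

/-! ### The view of the server -/

section Masks

variable {R : Type} {P : Params} {m l : ℕ} [CommRing R]

/-- The mask with the parts `U` and `S`, down to dimension `i`. -/
def maskAt {t : ℕ} (L : (i : ℕ) → Matrix (Fin (P.dim i)) (Fin (P.dim (i + 1))) R) (i : ℕ)
    (S : (i : ℕ) → Matrix (Fin (P.dim i)) (Fin t) R) (U : Matrix (Fin (P.dim i)) (Fin t) R) :
    Matrix (Fin (P.dim 0)) (Fin t) R :=
  prodL L i * U + ∑ j ∈ Finset.range i, prodL L j * S j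

lemma leftPart_add {a T : ℕ} (W W' : Matrix (Fin a) (Fin (m + T * l)) R) :
    leftPart (W + W') = leftPart W + leftPart W' := rfl

lemma rightPart_add {a T : ℕ} (W W' : Matrix (Fin a) (Fin (m + T * l)) R) (k : Fin T) :
    rightPart (W + W') k = rightPart W k + rightPart W' k := rfl

lemma leftPart_mul {a b T : ℕ} (M : Matrix (Fin a) (Fin b) R)
    (W : Matrix (Fin b) (Fin (m + T * l)) R) :
    leftPart (M * W) = leftPart W * M.transpose := by
  ext j i
  simp [leftPart, Matrix.mul_apply, mul_comm]

lemma rightPart_mul {a b T : ℕ} (M : Matrix (Fin a) (Fin b) R)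
    (W : Matrix (Fin b) (Fin (m + T * l)) R) (k : Fin T) :
    rightPart (M * W) k = M * rightPart W k := rfl

lemma leftPart_maskAt {T : ℕ} (L : (i : ℕ) → Matrix (Fin (P.dim i)) (Fin (P.dim (i + 1))) R)
    (S : (i : ℕ) → Matrix (Fin (P.dim i)) (Fin (m + T * l)) R)
    (U : Matrix (Fin (P.dim P.depth)) (Fin (m + T * l)) R) :
    leftPart (maskAt L P.depth S U) = leftMask m (prodL L) (leftPart U) fun i => leftPart (S i) := by
  have hsum : ∀ s : Finset ℕ, leftPart (∑ j ∈ s, prodL L j * S j) =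
      ∑ j ∈ s, leftPart (S j) * (prodL L j).transpose := by
    intro s
    classical
    induction s using Finset.induction_on with
    | empty => rfl
    | insert j s hj ih =>
      rw [Finset.sum_insert hj, Finset.sum_insert hj, leftPart_add, leftPart_mul, ih]
  rw [maskAt, leftPart_add, leftPart_mul, hsum, leftMask]

lemma rightPart_maskAt {T : ℕ} (L : (i : ℕ) → Matrix (Fin (P.dim i)) (Fin (P.dim (i + 1))) R)
    (S : (i : ℕ) → Matrix (Fin (P.dim i)) (Fin (m + T * l)) R)
    (U : Matrix (Fin (P.dim P.depth)) (Fin (m + T * l)) R) (k : Fin T) :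
    rightPart (maskAt L P.depth S U) k =
      rightMask (prodL L) (rightPart U k) fun i => rightPart (S i) k := by
  have hsum : ∀ s : Finset ℕ, rightPart (∑ j ∈ s, prodL L j * S j) k =
      ∑ j ∈ s, prodL L j * rightPart (S j) k := by
    intro s
    classical
    induction s using Finset.induction_on with
    | empty => rfl
    | insert j s hj ih =>
      rw [Finset.sum_insert hj, Finset.sum_insert hj, rightPart_add, rightPart_mul, ih]
  rw [maskAt, rightPart_add, rightPart_mul, hsum, rightMask]

lemma extend_leftPart {d T : ℕ} {dim : ℕ → ℕ} (W : Family R d dim fun _ => m + T * l) (i : ℕ) :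
    extend (f := fun _ => m) (g := dim) (fun i : Fin d => leftPart (W i)) i =
      leftPart (extend W i) := by
  unfold extend
  split_ifs <;> rfl

lemma extend_rightPart {d T : ℕ} {dim : ℕ → ℕ} (W : Family R d dim fun _ => m + T * l)
    (k : Fin T) (i : ℕ) :
    extend (f := dim) (g := fun _ => l) (fun i : Fin d => rightPart (W i) k) i =
      rightPart (extend W i) k := by
  unfold extend
  split_ifs <;> rfl

lemma leftMask_congr {T T' : (i : ℕ) → Matrix (Fin (P.dim 0)) (Fin (P.dim i)) R}
    {S S' : (i : ℕ) → Matrix (Fin m) (Fin (P.dim i)) R}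
    (H : Matrix (Fin m) (Fin (P.dim P.depth)) R) (h : ∀ i ≤ P.depth, T i = T' i)
    (hS : ∀ i, S i = S' i) : leftMask m T H S = leftMask m T' H S' := by
  obtain rfl : S = S' := funext hS
  unfold leftMask
  rw [h _ le_rfl]
  congr 1
  exact Finset.sum_congr rfl fun i hi => by rw [h i (Finset.mem_range.mp hi).le]

lemma rightMask_congr {T T' : (i : ℕ) → Matrix (Fin (P.dim 0)) (Fin (P.dim i)) R}
    {S S' : (i : ℕ) → Matrix (Fin (P.dim i)) (Fin l) R}
    (G : Matrix (Fin (P.dim P.depth)) (Fin l) R) (h : ∀ i ≤ P.depth, T i = T' i)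
    (hS : ∀ i, S i = S' i) : rightMask T G S = rightMask T' G S' := by
  obtain rfl : S = S' := funext hS
  unfold rightMask
  rw [h _ le_rfl]
  congr 1
  exact Finset.sum_congr rfl fun i hi => by rw [h i (Finset.mem_range.mp hi).le]

end Masks

section View

variable {R : Type} {P : Params} {m l : ℕ} [CommRing R] [Fintype R]

lemma wp_multiplyAll_view (srv : Server R P m l) (c : ClientState R P m)
    (B : ℕ → Matrix (Fin (P.dim 0)) (Fin l) R) (T : ℕ) (f : List (Msg R P m l) → ℝ≥0∞)
    (s : RunState R P m l) :
    wp (multiplyAll srv c B T) (fun _ s' => f s'.view) s =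
      Ex (piPMF fun _ : Fin T => uniformMatrix R (P.dim P.depth) l) fun G =>
        Ex (piPMF fun _ : Fin T =>
          piPMF fun i : Fin P.depth => noiseMatrix R (P.dim i) l (P.rate i)) fun Z =>
          f (s.view ++ List.ofFn fun k : Fin T => Msg.right
            (B k + rightMask c.bases (G k) (extend (g := fun _ => l) (Z k)))) := by
  induction T generalizing f with
  | zero => simp [multiplyAll]
  | succ T ih =>
    rw [wp_multiplyAll_succ]
    simp only [wp_multiply, RunState.view_spend, RunState.view_round]
    rw [ih fun v => Ex (uniformMatrix R (P.dim P.depth) l) fun G =>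
      Ex (piPMF fun i : Fin P.depth => noiseMatrix R (P.dim i) l (P.rate i)) fun Tf =>
        f (v ++ [Msg.right (B T + rightMask c.bases G (extend (g := fun _ => l) Tf))]),
      Ex_piPMF_snoc]
    refine Ex_congr fun G => ?_
    rw [Ex_comm]
    refine Ex_congr fun G' => ?_
    rw [Ex_piPMF_snoc]
    refine Ex_congr fun Z => Ex_congr fun Z' => ?_
    rw [List.ofFn_succ_last, List.append_assoc]
    simp

/-- The messages of a run in which the masked inputs are the columns of `Y`. -/
def maskedView {T : ℕ} (Lf : Family R P.depth P.dim fun i => P.dim (i + 1))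
    (Y : Matrix (Fin (P.dim 0)) (Fin (m + T * l)) R) : List (Msg R P m l) :=
  [.bases Lf, .left (leftPart Y)] ++ List.ofFn fun k : Fin T => Msg.right (rightPart Y k)

/-- The products `A_enc L₁ ⋯ L_i` as claimed by the server after the messages `v`. -/
def leftTable (srv : Server R P m l) (v : List (Msg R P m l))
    (A : Matrix (Fin m) (Fin (P.dim 0)) R) : (i : ℕ) → Matrix (Fin m) (Fin (P.dim i)) R :=
  LeftReply.table (srv.reply v (.left A)) A

/-- The second reply passes the checks with the random matrices `X`. -/
def Passes (srv : Server R P m l) (Lf : Family R P.depth P.dim fun i => P.dim (i + 1))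
    (X : Family R P.depth (fun i => P.dim (i + 1)) fun _ => P.checks)
    (A : Matrix (Fin m) (Fin (P.dim 0)) R) : Prop :=
  ∀ i : Fin P.depth, leftTable srv [.bases Lf] A (i + 1) * X i =
    leftTable srv [.bases Lf] A i * (extend Lf i * X i)

open Classical in
/-- The value of a test `f` of the view when the first reply is correct. -/
def testView {T : ℕ} (srv : Server R P m l) (f : List (Msg R P m l) → ℝ≥0∞)
    (X : Family R P.depth (fun i => P.dim (i + 1)) fun _ => P.checks)
    (Lf : Family R P.depth P.dim fun i => P.dim (i + 1))
    (Y : Matrix (Fin (P.dim 0)) (Fin (m + T * l)) R) : ℝ≥0∞ :=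
  if Passes srv Lf X (leftPart Y) then f (maskedView Lf Y)
  else f [.bases Lf, .left (leftPart Y)]

/-- The test of the view after a correct first reply, for fixed bases. -/
lemma wpSecondRound_view (srv : Server R P m l) (A : Matrix (Fin m) (Fin (P.dim 0)) R)
    (B : ℕ → Matrix (Fin (P.dim 0)) (Fin l) R) (T : ℕ) (f : List (Msg R P m l) → ℝ≥0∞)
    (Lf : Family R P.depth P.dim fun i => P.dim (i + 1)) (s : RunState R P m l)
    (hs : s.view = [.bases Lf]) :
    wpSecondRound srv A (extend Lf) (trueGram Lf).table (fun o s => match o with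
      | none => f s.view
      | some c => wp (multiplyAll srv c B T) (fun _ s' => f s'.view) s) s =
    Ex (piPMF fun i : Fin P.depth => uniformMatrix R (P.dim (i + 1)) P.checks) fun X =>
      Ex (piPMF fun i : Fin P.depth => noiseMatrix R (P.dim i) (m + T * l) (P.rate i)) fun S =>
        Ex (uniformMatrix R (P.dim P.depth) (m + T * l)) fun U =>
          testView srv f X Lf (glue A (fun k : Fin T => B k) +
            maskAt (extend Lf) P.depth (extend (g := fun _ => m + T * l) S) U) := by
  classical
  have hT0 : ∀ i ≤ P.depth, (trueGram Lf).table 0 i = prodL (extend Lf) i := fun i hi => by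
    rw [table_trueGram Lf (Nat.zero_le _) hi]
    simp [prodL]
  obtain ⟨v, led⟩ := s
  obtain rfl : v = [.bases Lf] := hs
  have hstep : ∀ (H : Matrix (Fin m) (Fin (P.dim P.depth)) R)
      (Sf : (i : Fin P.depth) → Matrix (Fin m) (Fin (P.dim i)) R)
      (A' : Matrix (Fin m) (Fin (P.dim 0)) R) (c c' : ℕ)
      (_ : A' = A + leftMask m (prodL (extend Lf)) H (extend (g := P.dim) Sf))
      (cs : ClientState R P m) (_ : cs.bases = (trueGram Lf).table 0),
      wp (checkPartial (extend Lf) (leftTable srv [.bases Lf] A') P.depth)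
        (fun ok s' => if ok = true then
          wp (multiplyAll srv cs B T) (fun _ s'' => f s''.view) (s'.spend c')
          else f s'.view)
        (((⟨[.bases Lf], led⟩ : RunState R P m l).round srv (.left A')).spend c) =
      Ex (piPMF fun i : Fin P.depth => uniformMatrix R (P.dim (i + 1)) P.checks) fun X =>
      Ex (piPMF fun _ : Fin T => uniformMatrix R (P.dim P.depth) l) fun G =>
      Ex (piPMF fun _ : Fin T =>
          piPMF fun i : Fin P.depth => noiseMatrix R (P.dim i) l (P.rate i)) fun Z =>
        testView srv f X Lf (glue (A + leftMask m (prodL (extend Lf)) H (extend (g := P.dim) Sf))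
          fun k : Fin T =>
            B k + rightMask (prodL (extend Lf)) (G k) (extend (g := fun _ => l) (Z k))) := by
    intro H Sf A' c c' hA' cs hcs
    rw [wp_checkPartial_eq_Ex _ _ _ le_rfl (F := fun E => if E then
      Ex (piPMF fun _ : Fin T => uniformMatrix R (P.dim P.depth) l) fun G =>
      Ex (piPMF fun _ : Fin T =>
        piPMF fun i : Fin P.depth => noiseMatrix R (P.dim i) l (P.rate i)) fun Z =>
        f ([.bases Lf, .left A'] ++ List.ofFn fun k : Fin T => Msg.right
          (B k + rightMask cs.bases (G k) (extend (g := fun _ => l) (Z k))))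
      else f [.bases Lf, .left A'])]
    · refine Ex_congr fun X => ?_
      have h₄ : ∀ (G : Matrix (Fin (P.dim P.depth)) (Fin l) R)
          (Z : (i : Fin P.depth) → Matrix (Fin (P.dim i)) (Fin l) R),
          rightMask cs.bases G (extend (g := fun _ => l) Z) =
            rightMask (prodL (extend Lf)) G (extend (g := fun _ => l) Z) := fun G Z =>
        hcs ▸ rightMask_congr G hT0 fun _ => rfl
      simp only [h₄, testView, maskedView, leftPart_glue, rightPart_glue, ← hA']
      by_cases hp : Passes srv Lf X A'
      · rw [if_pos fun i _ => hp i]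
        simp only [if_pos hp]
      · rw [if_neg fun h => hp fun i => h i i.2]
        simp only [if_neg hp, Ex_const]
    · intro c''
      simp only [if_true, wp_multiplyAll_view]
      rfl
    · intro c''
      simp only [if_false]
      rfl
  -- the random choices for the parts are glued
  calc _ = Ex (piPMF fun i : Fin P.depth => uniformMatrix R (P.dim (i + 1)) P.checks) fun X =>
      Ex (uniformMatrix R m (P.dim P.depth)) fun H =>
      Ex (piPMF fun _ : Fin T => uniformMatrix R (P.dim P.depth) l) fun G =>
      Ex (piPMF fun i : Fin P.depth => noiseMatrix R m (P.dim i) (P.rate i)) fun Sf =>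
      Ex (piPMF fun _ : Fin T =>
          piPMF fun i : Fin P.depth => noiseMatrix R (P.dim i) l (P.rate i)) fun Z =>
        testView srv f X Lf (glue (A + leftMask m (prodL (extend Lf)) H (extend (g := P.dim) Sf))
            fun k : Fin T => B k + rightMask (prodL (extend Lf)) (G k) (extend (g := fun _ => l) (Z k))) := by
        rw [Ex_comm (piPMF fun i : Fin P.depth => uniformMatrix R (P.dim (i + 1)) P.checks)]
        refine Ex_congr fun H => ?_
        refine (Ex_congr fun Sf => hstep H Sf _ _ _
          (by rw [leftMask_congr H hT0 fun _ => rfl]) _ rfl).trans ?_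
        rw [Ex_comm]
        refine Ex_congr fun X => ?_
        rw [Ex_comm]
    _ = _ := by
        refine Ex_congr fun X => ?_
        simp only [Ex_glue_noise (fun i : Fin P.depth => P.dim i) (fun i => P.rate i)]
        rw [Ex_glue_uniform, Ex_comm]
        refine Ex_congr fun S => Ex_congr fun U => ?_
        congr 1
        have e₁ := leftPart_maskAt (extend Lf) (extend (g := fun _ => m + T * l) S) U
        have e₂ := rightPart_maskAt (extend Lf) (extend (g := fun _ => m + T * l) S) U
        have e₃ : leftMask m (prodL (extend Lf)) (leftPart U)
            (extend (g := P.dim) fun i : Fin P.depth => leftPart (S i)) =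
            leftPart (maskAt (extend Lf) P.depth (extend (g := fun _ => m + T * l) S) U) := by
          rw [e₁]
          exact leftMask_congr _ (fun _ _ => rfl) fun i => extend_leftPart S i
        have e₄ : ∀ k, rightMask (prodL (extend Lf)) (rightPart U k)
            (extend (g := fun _ => l) fun i : Fin P.depth => rightPart (S i) k) =
            rightPart (maskAt (extend Lf) P.depth (extend (g := fun _ => m + T * l) S) U) k := by
          intro k
          rw [e₂]
          exact rightMask_congr _ (fun _ _ => rfl) fun i => extend_rightPart S k i
        rw [e₃]
        simp only [e₄]
        apply (glueEquiv R (P.dim 0) m T l).symm.injective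
        refine Prod.ext ?_ ?_
        · change leftPart (glue _ _) = leftPart (glue _ _ + _)
          rw [leftPart_add, leftPart_glue, leftPart_glue]
        · change rightPart (glue _ _) = rightPart (glue _ _ + _)
          funext k
          rw [rightPart_add, rightPart_glue, rightPart_glue]

end View

/-! ### The hybrid argument -/

section Hybrids

variable {R : Type} {P : Params} {m l : ℕ} [CommRing R]

lemma prodL_congr {L L' : (i : ℕ) → Matrix (Fin (P.dim i)) (Fin (P.dim (i + 1))) R} {i : ℕ}
    (h : ∀ j < i, L j = L' j) : prodL L i = prodL L' i := by
  induction i with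
  | zero => rfl
  | succ i ih =>
    rw [prodL, prodL, ih fun j hj => h j (by omega), h i (by omega)]

lemma extend_update_of_ne {d : ℕ} {f g : ℕ → ℕ} (X : Family R d f g) (i : Fin d)
    (M : Matrix (Fin (f i)) (Fin (g i)) R) {j : ℕ} (h : j ≠ i) :
    extend (Function.update X i M : Family R d f g) j = extend X j := by
  unfold extend
  split_ifs with hj
  · rw [Function.update_of_ne (fun h' => h (congrArg Fin.val h'))]
  · rfl

lemma extend_update_self {d : ℕ} {f g : ℕ → ℕ} (X : Family R d f g) (i : Fin d)
    (M : Matrix (Fin (f i)) (Fin (g i)) R) :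
    extend (Function.update X i M : Family R d f g) i = M := by
  rw [extend_of_lt _ i.2]
  exact Function.update_self (β := fun i : Fin d => Matrix (Fin (f i)) (Fin (g i)) R) i M X

/-- One level of the mask: in the recursion the uniform part is replaced by an LPN sample. -/
lemma maskAt_succ {t : ℕ} (L : (i : ℕ) → Matrix (Fin (P.dim i)) (Fin (P.dim (i + 1))) R) (i : ℕ)
    (S : (i : ℕ) → Matrix (Fin (P.dim i)) (Fin t) R) (U : Matrix (Fin (P.dim (i + 1))) (Fin t) R) :
    maskAt L (i + 1) S U = maskAt L i S (L i * U + S i) := by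
  rw [maskAt, maskAt, Finset.sum_range_succ, prodL, Matrix.mul_add, Matrix.mul_assoc]
  abel

variable [Fintype R]

/-- The test `Acc` accepts the messages that are sent after a correct first reply. -/
def TestAccepts {T : ℕ} (srv : Server R P m l) (Acc : List (Msg R P m l) → Prop)
    (X : Family R P.depth (fun i => P.dim (i + 1)) fun _ => P.checks)
    (Lf : Family R P.depth P.dim fun i => P.dim (i + 1))
    (Y : Matrix (Fin (P.dim 0)) (Fin (m + T * l)) R) : Prop :=
  srv.reply [] (.bases Lf) = trueGram Lf ∧
    (Passes srv Lf X (leftPart Y) → Acc (maskedView Lf Y)) ∧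
    (¬Passes srv Lf X (leftPart Y) → Acc [.bases Lf, .left (leftPart Y)])

/-- The probability that the first reply is correct and the test accepts, when the inputs `W` are
masked by LPN samples down to dimension `i` only. -/
def hybrid {T : ℕ} (srv : Server R P m l) (Acc : List (Msg R P m l) → Prop)
    (W : Matrix (Fin (P.dim 0)) (Fin (m + T * l)) R) (i : ℕ) : ℝ≥0∞ :=
  Ex (piPMF fun i : Fin P.depth => uniformMatrix R (P.dim (i + 1)) P.checks) fun X =>
    Ex (PMF.uniformOfFintype (Family R P.depth P.dim fun i => P.dim (i + 1))) fun Lf =>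
      Ex (piPMF fun i : Fin P.depth => noiseMatrix R (P.dim i) (m + T * l) (P.rate i)) fun S =>
        Ex (uniformMatrix R (P.dim i) (m + T * l)) fun U =>
          ind (TestAccepts srv Acc X Lf
            (W + maskAt (extend Lf) i (extend (g := fun _ => m + T * l) S) U))

/-- A uniform mask hides everything. -/
lemma hybrid_zero {T : ℕ} (srv : Server R P m l) (Acc : List (Msg R P m l) → Prop)
    (W : Matrix (Fin (P.dim 0)) (Fin (m + T * l)) R) :
    hybrid srv Acc W 0 = hybrid (T := T) srv Acc 0 0 := by
  unfold hybrid
  refine Ex_congr fun X => Ex_congr fun Lf => Ex_congr fun S => ?_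
  have h : ∀ V : Matrix (Fin (P.dim 0)) (Fin (m + T * l)) R,
      (Ex (uniformMatrix R (P.dim 0) (m + T * l)) fun U => ind (TestAccepts srv Acc X Lf
        (V + maskAt (extend Lf) 0 (extend (g := fun _ => m + T * l) S) U))) =
      Ex (uniformMatrix R (P.dim 0) (m + T * l)) fun U => ind (TestAccepts srv Acc X Lf U) := by
    intro V
    have h' := Ex_uniform_add_left V fun U => ind (TestAccepts srv Acc X Lf U)
    rw [uniformMatrix, ← h']
    refine Ex_congr fun U => ?_
    simp [maskAt, prodL]
  rw [h W, h 0]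

/-- Consecutive hybrids differ by one LPN sample. -/
lemma hybrid_succ [Nontrivial R] {T : ℕ} (srv : Server R P m l) (Acc : List (Msg R P m l) → Prop)
    (W : Matrix (Fin (P.dim 0)) (Fin (m + T * l)) R) (i : Fin P.depth) {N g size : ℕ} {μ adv : ℝ}
    (hLPN : LPNHard R N (P.dim (i + 1)) (m + T * l) μ size adv) (hN : P.dim i ≤ N) (hμ₀ : 0 ≤ μ)
    (hμ₁ : μ < 1) (hμ : μ ≤ P.rate i) (hrate : P.rate i ≤ 1)
    (hdec : ∀ (X : Family R P.depth (fun i => P.dim (i + 1)) fun _ => P.checks)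
      (Lf : Family R P.depth P.dim fun i => P.dim (i + 1))
      (V : Matrix (Fin (P.dim 0)) (Fin (m + T * l)) R),
      Decides g fun x : PairVar (P.dim i) (P.dim (i + 1)) (P.dim i) (m + T * l) → R =>
        TestAccepts srv Acc X
          (Function.update Lf i (Matrix.of fun a b => x (.inl (a, b))) :
            Family R P.depth P.dim fun i => P.dim (i + 1))
          (V + prodL (extend Lf) i * Matrix.of fun a b => x (.inr (a, b))))
    (hg : g + 2 * (P.dim i * (m + T * l)) ≤ size) :
    hybrid srv Acc W (i + 1) ≤ hybrid srv Acc W i + ENNReal.ofReal adv ∧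
      hybrid srv Acc W i ≤ hybrid srv Acc W (i + 1) + ENNReal.ofReal adv := by
  -- the event, for the random choices on level `i`
  let E : Family R P.depth (fun i => P.dim (i + 1)) (fun _ => P.checks) →
      (Family R P.depth P.dim fun i => P.dim (i + 1)) → (Family R P.depth P.dim fun _ => m + T * l) →
      Matrix (Fin (P.dim i)) (Fin (P.dim (i + 1))) R → Matrix (Fin (P.dim i)) (Fin (m + T * l)) R → Prop :=
    fun X Lf S M Y => TestAccepts srv Acc X
      (Function.update Lf i M : Family R P.depth P.dim fun i => P.dim (i + 1))
      (W + maskAt (extend Lf) i (extend (g := fun _ => m + T * l) S) Y)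
  have hmask : ∀ (Lf : Family R P.depth P.dim fun i => P.dim (i + 1))
      (S S' : Family R P.depth P.dim fun _ => m + T * l) (M : Matrix (Fin (P.dim i)) (Fin (P.dim (i + 1))) R)
      (Y : Matrix (Fin (P.dim i)) (Fin (m + T * l)) R), (∀ j < i.1, extend S' j = extend S j) →
      maskAt (extend (Function.update Lf i M : Family R P.depth P.dim fun i => P.dim (i + 1))) i
        (extend S') Y = maskAt (extend Lf) i (extend S) Y := by
    intro Lf S S' M Y hS
    have hL : ∀ j ≤ i.1, prodL (extend (Function.update Lf i M :
        Family R P.depth P.dim fun i => P.dim (i + 1))) j = prodL (extend Lf) j := fun j hj =>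
      prodL_congr fun j' hj' => extend_update_of_ne Lf i M (by omega)
    unfold maskAt
    rw [hL i le_rfl]
    congr 1
    refine Finset.sum_congr rfl fun j hj => ?_
    have hj' := Finset.mem_range.mp hj
    rw [hL j hj'.le, hS j hj']
  have hunif : PMF.uniformOfFintype (Family R P.depth P.dim fun i => P.dim (i + 1)) =
      piPMF fun i : Fin P.depth => uniformMatrix R (P.dim i) (P.dim (i + 1)) :=
    (piPMF_uniform (β := fun i : Fin P.depth => Matrix (Fin (P.dim i)) (Fin (P.dim (i + 1))) R)).symm
  have h₀ : hybrid srv Acc W i =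
      Ex (piPMF fun i : Fin P.depth => uniformMatrix R (P.dim (i + 1)) P.checks) fun X =>
      Ex (piPMF fun i : Fin P.depth => uniformMatrix R (P.dim i) (P.dim (i + 1))) fun Lf =>
      Ex (piPMF fun i : Fin P.depth => noiseMatrix R (P.dim i) (m + T * l) (P.rate i)) fun S =>
      Ex (uniformMatrix R (P.dim i) (P.dim (i + 1))) fun M => Ex (uniformMatrix R (P.dim i) (m + T * l)) fun U =>
        ind (E X Lf S M U) := by
    unfold hybrid
    refine Ex_congr fun X => ?_
    rw [hunif, Ex_piPMF_resample _ i]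
    refine Ex_congr fun Lf => ?_
    rw [Ex_comm]
    refine Ex_congr fun S => Ex_congr fun M => Ex_congr fun U => ?_
    simp only [E]
    rw [hmask Lf S S M U fun _ _ => rfl]
  have h₁ : hybrid srv Acc W (i + 1) =
      Ex (piPMF fun i : Fin P.depth => uniformMatrix R (P.dim (i + 1)) P.checks) fun X =>
      Ex (piPMF fun i : Fin P.depth => uniformMatrix R (P.dim i) (P.dim (i + 1))) fun Lf =>
      Ex (piPMF fun i : Fin P.depth => noiseMatrix R (P.dim i) (m + T * l) (P.rate i)) fun S =>
      Ex (uniformMatrix R (P.dim i) (P.dim (i + 1))) fun M =>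
      Ex (noiseMatrix R (P.dim i) (m + T * l) (P.rate i)) fun Z =>
      Ex (uniformMatrix R (P.dim (i + 1)) (m + T * l)) fun U => ind (E X Lf S M (M * U + Z)) := by
    unfold hybrid
    refine Ex_congr fun X => ?_
    rw [hunif, Ex_piPMF_resample _ i]
    refine Ex_congr fun Lf => ?_
    rw [Ex_comm (piPMF fun i : Fin P.depth => noiseMatrix R (P.dim i) (m + T * l) (P.rate i))]
    refine Ex_congr fun M => ?_
    rw [Ex_piPMF_resample _ i]
    refine Ex_congr fun S => Ex_congr fun Z => Ex_congr fun U => ?_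
    simp only [E]
    rw [maskAt_succ, extend_update_self (g := fun i => P.dim (i + 1)) Lf i M,
      hmask Lf S _ M _ fun j hj => extend_update_of_ne (g := fun _ => m + T * l) S i Z hj.ne]
    rw [extend_update_self (g := fun _ => m + T * l) S i Z]
  have hstep := fun X Lf S => hLPN.shrink (P := E X Lf S) hN hμ₀ hμ₁ hμ hrate (by
    have := hdec X Lf (W + ∑ j ∈ Finset.range i, prodL (extend Lf) j *
      extend (g := fun _ => m + T * l) S j)
    refine (congrArg (Decides g) ?_).mp this
    funext x
    simp only [E, maskAt]
    congr 1
    abel) hg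
  rw [h₀, h₁]
  exact ⟨Ex_le_Ex_add fun X => Ex_le_Ex_add fun Lf => Ex_le_Ex_add fun S => (hstep X Lf S).1,
    Ex_le_Ex_add fun X => Ex_le_Ex_add fun Lf => Ex_le_Ex_add fun S => (hstep X Lf S).2⟩

end Hybrids

/-! ### The simulation -/

section Simulation

variable {R : Type} {P : Params} {m l : ℕ} [CommRing R] [Fintype R]

/-- The probability that the view for the bases `Lf` passes the test `f`. -/
def viewTest (srv : Server R P m l) (A : Matrix (Fin m) (Fin (P.dim 0)) R)
    (B : ℕ → Matrix (Fin (P.dim 0)) (Fin l) R) (T : ℕ) (f : List (Msg R P m l) → ℝ≥0∞)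
    (Lf : Family R P.depth P.dim fun i => P.dim (i + 1)) : ℝ≥0∞ :=
  wp (checkTable (extend Lf) (GramReply.table (srv.reply [] (.bases Lf))) (P.depth + 1))
    (fun ok s' => if ok = true then
      wpSecondRound srv A (extend Lf) (GramReply.table (srv.reply [] (.bases Lf)))
        (fun o s => match o with
          | none => f s.view
          | some c => wp (multiplyAll srv c B T) (fun _ s' => f s'.view) s) s'
      else f s'.view)
    (((startState R P m l).round srv (.bases Lf)).spend (basesSize P))

lemma Ex_realView (srv : Server R P m l) (A : Matrix (Fin m) (Fin (P.dim 0)) R)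
    (B : ℕ → Matrix (Fin (P.dim 0)) (Fin l) R) (T : ℕ) (f : List (Msg R P m l) → ℝ≥0∞) :
    Ex (realView srv A B T) f =
      Ex (PMF.uniformOfFintype (Family R P.depth P.dim fun i => P.dim (i + 1)))
        (viewTest srv A B T f) := by
  rw [realView, Ex_map, Ex_fullRun, wp_clientSetup]
  rfl

lemma viewTest_of_correct (srv : Server R P m l) (A : Matrix (Fin m) (Fin (P.dim 0)) R)
    (B : ℕ → Matrix (Fin (P.dim 0)) (Fin l) R) (T : ℕ) (f : List (Msg R P m l) → ℝ≥0∞)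
    {Lf : Family R P.depth P.dim fun i => P.dim (i + 1)}
    (h : srv.reply [] (.bases Lf) = trueGram Lf) :
    viewTest srv A B T f Lf =
    Ex (piPMF fun i : Fin P.depth => uniformMatrix R (P.dim (i + 1)) P.checks) fun X =>
      Ex (piPMF fun i : Fin P.depth => noiseMatrix R (P.dim i) (m + T * l) (P.rate i)) fun S =>
        Ex (uniformMatrix R (P.dim P.depth) (m + T * l)) fun U =>
          testView srv f X Lf (glue A (fun k : Fin T => B k) +
            maskAt (extend Lf) P.depth (extend (g := fun _ => m + T * l) S) U) := by
  unfold viewTest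
  rw [h, wp_checkTable_of_correct _ _
    (fun j hj i hi => table_trueGram Lf (Nat.le_of_lt_succ hj) hi), if_pos rfl]
  exact wpSecondRound_view srv A B T f Lf _ rfl

lemma wp_checkPartial_view {a : ℕ} (L : (i : ℕ) → Matrix (Fin (P.dim i)) (Fin (P.dim (i + 1))) R)
    (claim : (i : ℕ) → Matrix (Fin a) (Fin (P.dim i)) R) (k : ℕ)
    (F : Bool → List (Msg R P m l) → ℝ≥0∞) (s : RunState R P m l) :
    wp (checkPartial L claim k) (fun ok s' => F ok s'.view) s =
      wp (checkPartial L claim k) (fun ok _ => F ok s.view) s := by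
  classical
  induction k generalizing F with
  | zero => simp [checkPartial]
  | succ k ih =>
    rw [wp_checkPartial_succ, wp_checkPartial_succ]
    exact ih fun ok v => if ok = true then Ex (uniformMatrix R (P.dim (k + 1)) P.checks) fun X =>
      F (decide (claim (k + 1) * X = claim k * (L k * X))) v else F false v

/-- The checks do not send messages. -/
lemma wp_checkTable_view (L : (i : ℕ) → Matrix (Fin (P.dim i)) (Fin (P.dim (i + 1))) R)
    (T : (j i : ℕ) → Matrix (Fin (P.dim j)) (Fin (P.dim i)) R) (r : ℕ)
    (F : Bool → List (Msg R P m l) → ℝ≥0∞) (s : RunState R P m l) :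
    wp (checkTable L T r) (fun ok s' => F ok s'.view) s =
      wp (checkTable L T r) (fun ok _ => F ok s.view) s := by
  induction r generalizing F with
  | zero => simp [checkTable]
  | succ r ih =>
    rw [wp_checkTable_succ, wp_checkTable_succ]
    simp only [wp_checkPartial_view L (T r) P.depth F]
    have h := ih fun ok v => if ok = true then
      wp (checkPartial L (T r) P.depth) (fun ok _ => F ok v) (startState R P m l) else F false v
    have h' : ∀ (v : List (Msg R P m l)) (s' : RunState R P m l),
        wp (checkPartial L (T r) P.depth) (fun ok _ => F ok v) s' =
          wp (checkPartial L (T r) P.depth) (fun ok _ => F ok v) (startState R P m l) := by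
      intro v s'
      rw [wp_checkPartial_eq_Ex L (T r) P.depth le_rfl (F := fun E => F (@decide E (Classical.dec E)) v),
        wp_checkPartial_eq_Ex L (T r) P.depth le_rfl (F := fun E => F (@decide E (Classical.dec E)) v)]
      all_goals simp
    simp only [h'] at h ⊢
    exact h

lemma viewTest_le_one (srv : Server R P m l) (A : Matrix (Fin m) (Fin (P.dim 0)) R)
    (B : ℕ → Matrix (Fin (P.dim 0)) (Fin l) R) (T : ℕ) {f : List (Msg R P m l) → ℝ≥0∞}
    (hf : ∀ v, f v ≤ 1) (Lf : Family R P.depth P.dim fun i => P.dim (i + 1)) :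
    viewTest srv A B T f Lf ≤ 1 := by
  refine Ex_le_of_le fun o => ?_
  dsimp only
  split_ifs
  · refine wpSecondRound_le_one _ _ _ _ (fun c s => ?_) _
    cases c
    · exact hf _
    · exact Ex_le_of_le fun _ => hf _
  · exact hf _

/-- After a wrong first reply the view is the first message, unless a check fails to notice. -/
lemma viewTest_of_wrong [Nontrivial R] (srv : Server R P m l)
    (A A' : Matrix (Fin m) (Fin (P.dim 0)) R)
    (B B' : ℕ → Matrix (Fin (P.dim 0)) (Fin l) R) (T : ℕ) (Acc : List (Msg R P m l) → Prop)
    {Lf : Family R P.depth P.dim fun i => P.dim (i + 1)}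
    (h : srv.reply [] (.bases Lf) ≠ trueGram Lf) :
    viewTest srv A B T (fun v => ind (Acc v)) Lf ≤
      viewTest srv A' B' T (fun v => ind (Acc v)) Lf + ((minIdealCard R : ℝ≥0∞)⁻¹) ^ P.checks := by
  have h₁ := wp_checkTable_of_ne (m := m) (l := l) h
    (((startState R P m l).round srv (.bases Lf)).spend (basesSize P))
  by_cases hA : Acc [.bases Lf]
  · refine (viewTest_le_one srv A B T (fun v => ind_le_one (Acc v)) Lf).trans ?_
    refine le_trans ?_ (add_le_add_right h₁ _)
    have h₂ := wp_checkTable_view (m := m) (l := l) (extend Lf)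
      (GramReply.table (srv.reply [] (.bases Lf))) (P.depth + 1)
      (fun ok v => if ok = true then 0 else ind (Acc v))
      (((startState R P m l).round srv (.bases Lf)).spend (basesSize P))
    refine le_trans ?_ (add_le_add_left (le_trans h₂.ge (wp_mono fun ok s => ?_)) _)
    · refine le_trans (le_of_eq ?_) (Ex_add _ _ _).le
      refine (Ex_const _ 1).symm.trans (Ex_congr fun o => ?_)
      have hv : (((startState R P m l).round srv (.bases Lf)).spend (basesSize P)).view =
        [.bases Lf] := rfl
      rw [hv, ind_true hA]
      cases o.1 <;> simp
    · split_ifs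
      · exact zero_le
      · exact le_rfl
  · refine le_trans (le_trans (le_trans (wp_mono
      (g := fun ok s => if ok = true then 1 else ind (Acc s.view)) fun ok s => ?_)
      (wp_checkTable_view (m := m) (l := l) (extend Lf)
      (GramReply.table (srv.reply [] (.bases Lf))) (P.depth + 1)
      (fun ok v => if ok = true then 1 else ind (Acc v))
      (((startState R P m l).round srv (.bases Lf)).spend (basesSize P))).le) ?_)
      (le_add_of_nonneg_left zero_le)
    · split_ifs
      · refine wpSecondRound_le_one _ _ _ _ (fun c s => ?_) _
        cases c
        · exact ind_le_one _
        · exact Ex_le_of_le fun _ => ind_le_one _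
      · exact le_rfl
    · refine le_trans (wp_mono fun ok s => ?_) h₁
      have hv : (((startState R P m l).round srv (.bases Lf)).spend (basesSize P)).view =
        [.bases Lf] := rfl
      rw [hv, ind_false hA]
      cases ok <;> simp

/-- The views for two inputs, in terms of the distance of consecutive hybrids. -/
lemma Ex_realView_le [Nontrivial R] (srv : Server R P m l)
    (A A' : Matrix (Fin m) (Fin (P.dim 0)) R) (B B' : ℕ → Matrix (Fin (P.dim 0)) (Fin l) R) (T : ℕ)
    (Acc : List (Msg R P m l) → Prop) {adv err : ℝ} (hadv : 0 ≤ adv)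
    (hstep : ∀ (W : Matrix (Fin (P.dim 0)) (Fin (m + T * l)) R) (i : ℕ), i < P.depth →
      hybrid srv Acc W (i + 1) ≤ hybrid srv Acc W i + ENNReal.ofReal adv ∧
        hybrid srv Acc W i ≤ hybrid srv Acc W (i + 1) + ENNReal.ofReal adv)
    (herr : 0 < P.depth → ((minIdealCard R : ℝ≥0∞)⁻¹) ^ P.checks ≤ ENNReal.ofReal err)
    (herr₀ : 0 ≤ err) :
    (Ex (realView srv A B T) fun v => ind (Acc v)) ≤
      (Ex (realView srv A' B' T) fun v => ind (Acc v)) +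
        ENNReal.ofReal (2 * P.depth * adv + err) := by
  classical
  have hsplit : ∀ (A : Matrix (Fin m) (Fin (P.dim 0)) R)
      (B : ℕ → Matrix (Fin (P.dim 0)) (Fin l) R),
      (Ex (realView srv A B T) fun v => ind (Acc v)) =
        hybrid srv Acc (glue A fun k : Fin T => B k) P.depth +
        Ex (PMF.uniformOfFintype (Family R P.depth P.dim fun i => P.dim (i + 1))) fun Lf =>
          if srv.reply [] (.bases Lf) = trueGram Lf then 0
          else viewTest srv A B T (fun v => ind (Acc v)) Lf := by
    intro A B
    rw [Ex_realView, hybrid, Ex_comm, ← Ex_add]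
    refine Ex_congr fun Lf => ?_
    by_cases h : srv.reply [] (.bases Lf) = trueGram Lf
    · rw [if_pos h, add_zero, viewTest_of_correct srv A B T _ h]
      refine Ex_congr fun X => Ex_congr fun S => Ex_congr fun U => ?_
      unfold testView TestAccepts
      split_ifs with hp
      · exact congrArg ind (propext ⟨fun ha => ⟨h, fun _ => ha, fun hn => absurd hp hn⟩,
          fun ha => ha.2.1 hp⟩)
      · exact congrArg ind (propext ⟨fun ha => ⟨h, fun hn => absurd hn hp, fun _ => ha⟩,
          fun ha => ha.2.2 hp⟩)
    · rw [if_neg h]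
      have : ∀ X Y, ¬TestAccepts (T := T) srv Acc X Lf Y := fun X Y hT => h hT.1
      simp [this, ind_false]
  have hsteps : ∀ (W : Matrix (Fin (P.dim 0)) (Fin (m + T * l)) R) (i : ℕ), i ≤ P.depth →
      hybrid srv Acc W i ≤ hybrid srv Acc W 0 + ENNReal.ofReal (i * adv) ∧
        hybrid srv Acc W 0 ≤ hybrid srv Acc W i + ENNReal.ofReal (i * adv) := by
    intro W i
    induction i with
    | zero => simp
    | succ i ih =>
      intro hi
      obtain ⟨h₁, h₂⟩ := ih (by omega)
      obtain ⟨h₃, h₄⟩ := hstep W i (by omega)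
      have hsum : ENNReal.ofReal ((i + 1 : ℕ) * adv) =
          ENNReal.ofReal (i * adv) + ENNReal.ofReal adv := by
        rw [← ENNReal.ofReal_add (by positivity) hadv]
        congr 1
        push_cast
        ring
      rw [hsum, ← add_assoc, add_comm (ENNReal.ofReal (i * adv)) (ENNReal.ofReal adv), ← add_assoc]
      exact ⟨h₃.trans (add_le_add_left h₁ _), h₂.trans (add_le_add_left h₄ _)⟩
  have hwrong : (Ex (PMF.uniformOfFintype (Family R P.depth P.dim fun i => P.dim (i + 1))) fun Lf =>
        if srv.reply [] (.bases Lf) = trueGram Lf then 0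
        else viewTest srv A B T (fun v => ind (Acc v)) Lf) ≤
      (Ex (PMF.uniformOfFintype (Family R P.depth P.dim fun i => P.dim (i + 1))) fun Lf =>
        if srv.reply [] (.bases Lf) = trueGram Lf then 0
        else viewTest srv A' B' T (fun v => ind (Acc v)) Lf) + ENNReal.ofReal err := by
    refine Ex_le_Ex_add fun Lf => ?_
    by_cases h : srv.reply [] (.bases Lf) = trueGram Lf
    · rw [if_pos h]
      exact zero_le
    · rw [if_neg h, if_neg h]
      refine (viewTest_of_wrong srv A A' B B' T Acc h).trans (add_le_add_right (herr ?_) _)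
      -- without bases there is nothing to claim
      by_contra h0
      refine not_table_correct h fun j hj i hi => ?_
      obtain rfl : j = 0 := by omega
      obtain rfl : i = 0 := by omega
      simp [GramReply.table, prodL]
  rw [hsplit A B, hsplit A' B']
  have hd : (0 : ℝ) ≤ P.depth * adv := by positivity
  calc _ ≤ (hybrid srv Acc (glue A' fun k : Fin T => B' k) P.depth +
        ENNReal.ofReal (P.depth * adv) + ENNReal.ofReal (P.depth * adv)) + (_ +
        ENNReal.ofReal err) := by
        refine add_le_add (((hsteps _ _ le_rfl).1).trans (add_le_add_left ?_ _)) hwrong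
        rw [hybrid_zero, ← hybrid_zero srv Acc (glue A' fun k : Fin T => B' k)]
        exact (hsteps _ _ le_rfl).2
    _ = _ := by
        rw [show 2 * (P.depth : ℝ) * adv + err = P.depth * adv + P.depth * adv + err by ring,
          ENNReal.ofReal_add (by positivity) herr₀, ENNReal.ofReal_add hd hd]
        ring

end Simulation

/-! ### The adversary as one circuit -/

section Adversaries

variable {X R : Type} [CommRing R]

lemma Decides.cond {g g' g'' : ℕ} {P Q Q' : (X → R) → Prop} (h : Decides g P) (h' : Decides g' Q)
    (h'' : Decides g'' Q') :
    Decides (2 * g + g' + g'' + 5) fun x => (P x → Q x) ∧ (¬P x → Q' x) := by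
  have h₁ := (ComputesOne.mul h h').add
    (ComputesOne.mul (ComputesOne.sub (ComputesOne.const 1) h) h'')
  refine ComputesOne.mono (g := g + g' + 1 + (1 + g + 1 + g'' + 1) + 1) ?_ (by omega)
  convert h₁ using 2 with x
  by_cases hP : P x <;> by_cases hQ : Q x <;> by_cases hQ' : Q' x <;> simp [hP, hQ, hQ']

variable {P : Params} {m l T : ℕ}

variable (P m l T) in
/-- Names for the values that occur in the views: constants, entries of the bases, and entries of
the masked inputs. -/
abbrev ViewEntry : Type :=
  Bool ⊕ (Σ i : Fin P.depth, Fin (P.dim i) × Fin (P.dim (i + 1))) ⊕ (Fin (P.dim 0) × Fin (m + T * l))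

/-- The value with a given name. -/
def entryValue (Lf : Family R P.depth P.dim fun i => P.dim (i + 1))
    (Y : Matrix (Fin (P.dim 0)) (Fin (m + T * l)) R) : ViewEntry P m l T → R :=
  Sum.elim (fun b => if b then 1 else 0)
    (Sum.elim (fun p => Lf p.1 p.2.1 p.2.2) fun p => Y p.1 p.2)

lemma computes_entryValue {Lf : (X → R) → Family R P.depth P.dim fun i => P.dim (i + 1)}
    {Y : (X → R) → Matrix (Fin (P.dim 0)) (Fin (m + T * l)) R} {g : ℕ}
    (hL : ∀ i a b, ComputesOne 1 fun x => Lf x i a b) (hY : ComputesEntries g Y) :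
    Computes (2 + basesSize P + P.dim 0 * (m + T * l) * g) fun x => entryValue (Lf x) (Y x) := by
  have h₁ : Computes (∑ _b : Bool, 1) fun (_ : X → R) (b : Bool) => if b then (1 : R) else 0 :=
    Computes.pi fun b => ComputesOne.const _
  have h₂ : Computes (∑ _p : Σ i : Fin P.depth, Fin (P.dim i) × Fin (P.dim (i + 1)), 1)
      fun (x : X → R) (p : Σ i : Fin P.depth, Fin (P.dim i) × Fin (P.dim (i + 1))) =>
        Lf x p.1 p.2.1 p.2.2 := Computes.pi fun p => hL _ _ _
  have h₃ : Computes (∑ _p : Fin (P.dim 0) × Fin (m + T * l), g)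
      fun (x : X → R) (p : Fin (P.dim 0) × Fin (m + T * l)) => Y x p.1 p.2 := Computes.pi fun p => hY _ _
  refine (h₁.sum (h₂.sum h₃)).mono (le_of_eq ?_)
  have : basesSize P = Fintype.card (Σ i : Fin P.depth, Fin (P.dim i) × Fin (P.dim (i + 1))) := by
    simp [basesSize, familySize, Finset.sum_range]
  simp [this]
  ring

lemma computes_view_bases {Lf : (X → R) → Family R P.depth P.dim fun i => P.dim (i + 1)}
    {Y : (X → R) → Matrix (Fin (P.dim 0)) (Fin (m + T * l)) R} {g : ℕ}
    (h : Computes g fun x => entryValue (Lf x) (Y x)) :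
    Computes g fun x => viewValue [(.bases (Lf x) : Msg R P m l)] := by
  refine (congrArg (Computes g) ?_).mp (h.reindex fun q : ViewVar P m l => match q with
    | .sent k => .inl (decide (k < 1))
    | .base i a b => .inr (.inl ⟨i, a, b⟩)
    | .left _ _ => .inl false
    | .right _ _ _ => .inl false)
  funext x q
  cases q <;> simp [entryValue, viewValue]

lemma computes_view_left {Lf : (X → R) → Family R P.depth P.dim fun i => P.dim (i + 1)}
    {Y : (X → R) → Matrix (Fin (P.dim 0)) (Fin (m + T * l)) R} {g : ℕ}
    (h : Computes g fun x => entryValue (Lf x) (Y x)) :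
    Computes g fun x => viewValue [(.bases (Lf x) : Msg R P m l), .left (leftPart (Y x))] := by
  refine (congrArg (Computes g) ?_).mp (h.reindex fun q : ViewVar P m l => match q with
    | .sent k => .inl (decide (k < 2))
    | .base i a b => .inr (.inl ⟨i, a, b⟩)
    | .left a b => .inr (.inr (b, Fin.castAdd _ a))
    | .right _ _ _ => .inl false)
  funext x q
  cases q <;> simp [entryValue, viewValue, leftPart]

lemma computes_view_masked {Lf : (X → R) → Family R P.depth P.dim fun i => P.dim (i + 1)}
    {Y : (X → R) → Matrix (Fin (P.dim 0)) (Fin (m + T * l)) R} {g : ℕ}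
    (h : Computes g fun x => entryValue (Lf x) (Y x)) :
    Computes g fun x => viewValue (maskedView (m := m) (l := l) (Lf x) (Y x)) := by
  refine (congrArg (Computes g) ?_).mp (h.reindex fun q : ViewVar P m l => match q with
    | .sent k => .inl (decide (k < T + 2))
    | .base i a b => .inr (.inl ⟨i, a, b⟩)
    | .left a b => .inr (.inr (b, Fin.castAdd _ a))
    | .right k a b => if h : k < T then
        .inr (.inr (a, Fin.natAdd m (finProdFinEquiv (⟨k, h⟩, b)))) else .inl false)
  funext x q
  cases q with
  | sent k =>
    have : k ≤ T + 1 ↔ k < T + 2 := by omega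
    simp [entryValue, viewValue, maskedView, this]
  | base i a b => simp [entryValue, viewValue, maskedView]
  | left a b => simp [entryValue, viewValue, maskedView, leftPart]
  | right k a b =>
    by_cases hk : k < T <;> simp [entryValue, viewValue, maskedView, rightPart, hk]

/-- A product of bases depends on one of them as an affine function. -/
lemma exists_prodL_update (Lf : Family R P.depth P.dim fun i => P.dim (i + 1)) (i : Fin P.depth)
    (j : ℕ) : ∃ (C₀ : Matrix (Fin (P.dim 0)) (Fin (P.dim j)) R)
      (C₁ : Matrix (Fin (P.dim 0)) (Fin (P.dim i)) R)
      (C₂ : Matrix (Fin (P.dim (i + 1))) (Fin (P.dim j)) R),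
      ∀ M : Matrix (Fin (P.dim i)) (Fin (P.dim (i + 1))) R,
        prodL (extend (Function.update Lf i M : Family R P.depth P.dim fun i => P.dim (i + 1))) j =
          C₀ + C₁ * M * C₂ := by
  by_cases hij : j ≤ i
  · refine ⟨prodL (extend Lf) j, 0, 0, fun M => ?_⟩
    rw [prodL_congr fun j' hj' => extend_update_of_ne (g := fun i => P.dim (i + 1)) Lf i M
      (show j' ≠ i by omega)]
    simp
  · have hij' : i.1 + 1 ≤ j := by omega
    clear hij
    induction hij' with
    | refl =>
      refine ⟨0, prodL (extend Lf) i, 1, fun M => ?_⟩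
      rw [prodL, extend_update_self (g := fun i => P.dim (i + 1)) Lf i M,
        prodL_congr fun j' hj' => extend_update_of_ne (g := fun i => P.dim (i + 1)) Lf i M
        (show j' ≠ i by omega)]
      simp
    | @step k hk ih =>
      obtain ⟨C₀, C₁, C₂, h⟩ := ih
      have hk' : i.1 + 1 ≤ k := hk
      refine ⟨C₀ * extend Lf k, C₁, C₂ * extend Lf k, fun M => ?_⟩
      rw [prodL, h M, extend_update_of_ne (g := fun i => P.dim (i + 1)) Lf i M
        (show k ≠ i by omega), Matrix.add_mul, Matrix.mul_assoc]

lemma CircuitServer.reply_bases_iff (S : CircuitServer R P m l)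
    (Lf : Family R P.depth P.dim fun i => P.dim (i + 1)) :
    S.toServer.reply [] (.bases Lf) = trueGram Lf ↔
      (∀ i : Fin P.depth, (S.top i).map (S.setup.read (viewValue [.bases Lf])) =
        prodL (extend Lf) (i + 1)) ∧
      ∀ j i : Fin P.depth, (S.inner j i).map (S.setup.read (viewValue [.bases Lf])) =
        (prodL (extend Lf) (j + 1)).transpose * prodL (extend Lf) (i + 1) := by
  change GramReply.mk _ _ = GramReply.mk _ _ ↔ _
  rw [GramReply.mk.injEq]
  simp only [funext_iff]
  rfl

lemma CircuitServer.leftTable_succ (S : CircuitServer R P m l)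
    (Lf : Family R P.depth P.dim fun i => P.dim (i + 1)) (A : Matrix (Fin m) (Fin (P.dim 0)) R)
    (i : Fin P.depth) : leftTable S.toServer [.bases Lf] A (i + 1) =
      (S.leftOut i).map (S.lefts.read (viewValue [.bases Lf, .left A])) :=
  extend_of_lt (f := fun _ => m) (g := fun i => P.dim (i + 1)) (fun i : Fin P.depth =>
    (S.leftOut i).map (S.lefts.read (viewValue [.bases Lf, .left A]))) i.2

section Bounds

lemma mul_le_pow_succ {N a b k : ℕ} (ha : a ≤ N) (hb : b ≤ N ^ k) : a * b ≤ N ^ (k + 1) := by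
  rw [pow_succ']
  exact Nat.mul_le_mul ha hb

lemma sixteen_mul_pow_le {N : ℕ} (hN : 16 ≤ N) (k : ℕ) : 16 * N ^ k ≤ N ^ (k + 1) ∧ 1 ≤ N ^ k := by
  refine ⟨?_, Nat.one_le_pow _ _ (by omega)⟩
  rw [pow_succ']
  exact Nat.mul_le_mul_right _ hN

lemma add_three_le_pow {N a b k : ℕ} (hN : 16 ≤ N) (ha : a ≤ N ^ k) (hb : b ≤ N ^ k) :
    a + b + 3 ≤ N ^ (k + 1) := by
  have := sixteen_mul_pow_le hN k
  omega

lemma Decides.forall_fin {N d k : ℕ} (hN : 16 ≤ N) (hd : d ≤ N) {E : Fin d → (X → R) → Prop}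
    (h : ∀ i, Decides (N ^ k) (E i)) : Decides (N ^ (k + 2)) fun x => ∀ i, E i x := by
  refine (Decides.forall_fintype h).mono ?_
  have h₁ := sixteen_mul_pow_le hN k
  have h₂ : d * (N ^ k + 1) ≤ N * (N ^ k + 1) := Nat.mul_le_mul_right _ hd
  have h₃ := sixteen_mul_pow_le hN (k + 1)
  rw [Fintype.card_fin]
  have h₄ : N * (N ^ k + 1) = N ^ (k + 1) + N := by ring
  have h₅ : N * 1 ≤ N * N ^ k := Nat.mul_le_mul_left _ h₁.2
  rw [← pow_succ'] at h₅
  rw [show k + 2 = k + 1 + 1 by ring]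
  omega

lemma Decides.eq_matrix_pow {N a b k : ℕ} (hN : 16 ≤ N) (ha : a ≤ N) (hb : b ≤ N)
    {F G : (X → R) → Matrix (Fin a) (Fin b) R} (hF : ComputesEntries (N ^ k) F)
    (hG : ComputesEntries (N ^ k) G) : Decides (N ^ (k + 4)) fun x => F x = G x := by
  refine (Decides.eq_matrix hF hG).mono ?_
  have h₁ : a * (b * (N ^ k + N ^ k + 3)) ≤ N ^ (k + 1 + 1 + 1) :=
    mul_le_pow_succ ha (mul_le_pow_succ hb (add_three_le_pow hN le_rfl le_rfl))
  have h₂ := sixteen_mul_pow_le hN (k + 1 + 1 + 1)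
  rw [mul_assoc, show k + 4 = k + 1 + 1 + 1 + 1 by ring]
  omega

lemma ComputesEntries.mul_pow {N a b c k : ℕ} (hN : 16 ≤ N) (hb : b ≤ N)
    {F : (X → R) → Matrix (Fin a) (Fin b) R} {G : (X → R) → Matrix (Fin b) (Fin c) R}
    (hF : ComputesEntries (N ^ k) F) (hG : ComputesEntries (N ^ k) G) :
    ComputesEntries (N ^ (k + 2)) fun x => F x * G x := by
  refine (hF.mul hG).mono ?_
  have h₁ : b * (N ^ k + N ^ k + 3) ≤ N ^ (k + 1 + 1) :=
    mul_le_pow_succ hb (add_three_le_pow hN le_rfl le_rfl)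
  exact le_trans (Nat.mul_le_mul_left _ (by omega)) h₁

lemma ComputesEntries.pow_mono {N a b k k' : ℕ} (hN : 16 ≤ N) (hk : k ≤ k')
    {F : (X → R) → Matrix (Fin a) (Fin b) R} (hF : ComputesEntries (N ^ k) F) :
    ComputesEntries (N ^ k') F :=
  hF.mono (Nat.pow_le_pow_right (by omega) hk)

lemma ComputesEntries.add_pow {N a b k : ℕ} (hN : 16 ≤ N)
    {F G : (X → R) → Matrix (Fin a) (Fin b) R} (hF : ComputesEntries (N ^ k) F)
    (hG : ComputesEntries (N ^ k) G) : ComputesEntries (N ^ (k + 1)) fun x => F x + G x :=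
  (hF.add hG).mono (by have := add_three_le_pow hN (le_refl (N ^ k)) le_rfl; omega)

end Bounds

/-- The server, the checks and the distinguisher together form a circuit of polynomial size that
reads one of the bases and the corresponding part of the mask. -/
lemma decides_testAccepts (S : CircuitServer R P m l) (D : Distinguisher R (ViewVar P m l)) {N : ℕ}
    [Fintype R]
    (hN : 16 ≤ N) (hdim : ∀ i, P.dim i ≤ N) (hdepth : P.depth ≤ N) (hchecks : P.checks ≤ N)
    (ht : m + T * l ≤ N) (hsetup : S.setup.length ≤ N) (hlefts : S.lefts.length ≤ N)
    (hD : D.circuit.length ≤ N) (i : Fin P.depth)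
    (Z : Family R P.depth (fun i => P.dim (i + 1)) fun _ => P.checks)
    (Lf : Family R P.depth P.dim fun i => P.dim (i + 1))
    (V : Matrix (Fin (P.dim 0)) (Fin (m + T * l)) R) :
    Decides (N ^ 18) fun x : PairVar (P.dim i) (P.dim (i + 1)) (P.dim i) (m + T * l) → R =>
      TestAccepts S.toServer (fun v => D.Accepts (viewValue v)) Z
        (Function.update Lf i (Matrix.of fun a b => x (.inl (a, b))) :
          Family R P.depth P.dim fun i => P.dim (i + 1))
        (V + prodL (extend Lf) i * Matrix.of fun a b => x (.inr (a, b))) := by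
  have hm : m ≤ N := le_trans (Nat.le_add_right _ _) ht
  have hconst : ∀ {Y : Type} {a b : ℕ} (M : Matrix (Fin a) (Fin b) R) (k : ℕ),
      ComputesEntries (N ^ k) fun _ : Y → R => M := fun M k =>
    (ComputesEntries.const M).mono (sixteen_mul_pow_le hN k).2
  have hin : ∀ {Y : Type} {a b : ℕ} (σ : Fin a → Fin b → Y) (k : ℕ),
      ComputesEntries (N ^ k) fun x : Y → R => Matrix.of fun i j => x (σ i j) := fun σ k =>
    (ComputesEntries.inputs σ).mono (Nat.zero_le _)
  set Y : (PairVar (P.dim i) (P.dim (i + 1)) (P.dim i) (m + T * l) → R) →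
    Matrix (Fin (P.dim 0)) (Fin (m + T * l)) R := fun x =>
      V + prodL (extend Lf) i * Matrix.of fun a b => x (.inr (a, b)) with hYdef
  set L' : (PairVar (P.dim i) (P.dim (i + 1)) (P.dim i) (m + T * l) → R) →
    Family R P.depth P.dim fun i => P.dim (i + 1) := fun x =>
      (Function.update Lf i (Matrix.of fun a b => x (.inl (a, b))) :
          Family R P.depth P.dim fun i => P.dim (i + 1)) with hLdef
  have hY : ComputesEntries (N ^ 3) Y :=
    ComputesEntries.add_pow hN (hconst V 2) (ComputesEntries.mul_pow hN (hdim i) (hconst _ 0) (hin _ 0))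
  have hL : ∀ j a b, ComputesOne 1 fun x => L' x j a b := by
    intro j a b
    rcases eq_or_ne j i with rfl | hj
    · simp only [hLdef, Function.update_self]
      exact (ComputesOne.input _).mono (Nat.zero_le _)
    · simp only [hLdef, Function.update_of_ne hj]
      exact ComputesOne.const _
  have hview : Computes (N ^ 6) fun x => entryValue (L' x) (Y x) := by
    refine (computes_entryValue hL hY).mono ?_
    have h₁ : basesSize P ≤ N ^ 3 := by
      unfold basesSize familySize
      refine (Finset.sum_le_card_nsmul _ _ (N * N) fun j _ => Nat.mul_le_mul (hdim _) (hdim _)).trans ?_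
      rw [Finset.card_range, smul_eq_mul, pow_succ', sq]
      exact Nat.mul_le_mul_right _ hdepth
    have h₂ : P.dim 0 * ((m + T * l) * N ^ 3) ≤ N ^ 5 :=
      mul_le_pow_succ (hdim 0) (mul_le_pow_succ ht le_rfl)
    have h₃ : 16 * N ^ 3 ≤ N ^ 4 ∧ 1 ≤ N ^ 3 := sixteen_mul_pow_le hN 3
    have h₄ : 16 * N ^ 4 ≤ N ^ 5 ∧ 1 ≤ N ^ 4 := sixteen_mul_pow_le hN 4
    have h₅ : 16 * N ^ 5 ≤ N ^ 6 ∧ 1 ≤ N ^ 5 := sixteen_mul_pow_le hN 5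
    rw [mul_assoc]
    omega
  -- the first reply
  have hprod : ∀ j, ComputesEntries (N ^ 5) fun x => prodL (extend (L' x)) j := by
    intro j
    obtain ⟨C₀, C₁, C₂, h⟩ := exists_prodL_update Lf i j
    have h' : (fun x => prodL (extend (L' x)) j) = fun x =>
        C₀ + C₁ * (Matrix.of fun a b => x (.inl (a, b))) * C₂ := funext fun x => h _
    rw [h']
    exact ComputesEntries.add_pow hN (hconst C₀ 4) (ComputesEntries.mul_pow hN (hdim _)
      (ComputesEntries.mul_pow hN (hdim i) (hconst C₁ 0) (hin _ 0)) (hconst C₂ 2))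
  have hN1 : N ≤ N ^ 6 := by
    have := mul_le_pow_succ (le_refl N) (sixteen_mul_pow_le hN 5).2
    simpa using this
  have hread : ∀ {v : (PairVar (P.dim i) (P.dim (i + 1)) (P.dim i) (m + T * l) → R) →
      ViewVar P m l → R} (_ : Computes (N ^ 6) v) (c : Circuit R (ViewVar P m l)) (_ : c.length ≤ N)
      {a b : ℕ} (out : Matrix (Fin a) (Fin b) (Wire (ViewVar P m l))),
      ComputesEntries (N ^ 7) fun x => out.map (c.read (v x)) := by
    intro v hv c hc a b out p q
    have h₁ : ComputesOne c.length fun y : ViewVar P m l → R => c.read y (out p q) :=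
      ⟨c, fun _ => out p q, le_rfl, fun _ _ => rfl⟩
    refine (hv.comp h₁).mono ?_
    have : 16 * N ^ 6 ≤ N ^ 7 ∧ 1 ≤ N ^ 6 := sixteen_mul_pow_le hN 6
    omega
  have hreply : Decides (N ^ 16) fun x => S.toServer.reply [] (.bases (L' x)) = trueGram (L' x) := by
    simp only [CircuitServer.reply_bases_iff]
    refine (Decides.and (g := N ^ 13) (g' := N ^ 15) ?_ ?_).mono ?_
    · exact Decides.forall_fin (k := 11) hN hdepth fun j =>
        Decides.eq_matrix_pow hN (hdim _) (hdim _) (hread (computes_view_bases hview) _ hsetup _)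
          ((hprod _).pow_mono hN (by omega))
    · exact Decides.forall_fin (k := 13) hN hdepth fun j => Decides.forall_fin (k := 11) hN hdepth
        fun k => Decides.eq_matrix_pow hN (hdim _) (hdim _)
          (hread (computes_view_bases hview) _ hsetup _)
          (ComputesEntries.mul_pow hN (hdim _) (hprod _).transpose (hprod _))
    · have h₁ : 16 * N ^ 13 ≤ N ^ 14 ∧ 1 ≤ N ^ 13 := sixteen_mul_pow_le hN 13
      have h₂ : 16 * N ^ 14 ≤ N ^ 15 ∧ 1 ≤ N ^ 14 := sixteen_mul_pow_le hN 14
      have h₃ : 16 * N ^ 15 ≤ N ^ 16 ∧ 1 ≤ N ^ 15 := sixteen_mul_pow_le hN 15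
      omega
  -- the second reply
  have htable : ∀ j ≤ P.depth, ComputesEntries (N ^ 7) fun x =>
      leftTable S.toServer [.bases (L' x)] (leftPart (Y x)) j := by
    intro j hj
    cases j with
    | zero => exact ComputesEntries.pow_mono hN (k := 3) (by omega) fun a b => hY b _
    | succ j =>
      have h : (fun x => leftTable S.toServer [.bases (L' x)] (leftPart (Y x)) (j + 1)) = fun x =>
          (S.leftOut ⟨j, hj⟩).map (S.lefts.read (viewValue [.bases (L' x), .left (leftPart (Y x))])) :=
        funext fun x => S.leftTable_succ (L' x) _ ⟨j, hj⟩
      rw [h]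
      exact hread (computes_view_left hview) _ hlefts _
  have hext : ∀ j : Fin P.depth, ComputesEntries (N ^ 0) fun x => extend (L' x) j := by
    intro j a b
    have h : (fun x => extend (L' x) j a b) = fun x => L' x j a b := funext fun x => by
      rw [extend_of_lt (g := fun i => P.dim (i + 1)) (L' x) j.2]
    rw [h]
    exact hL j a b
  have hpasses : Decides (N ^ 15) fun x => Passes S.toServer (L' x) Z (leftPart (Y x)) := by
    refine Decides.forall_fin (k := 13) hN hdepth fun j => Decides.eq_matrix_pow hN hm hchecks ?_ ?_
    · exact ComputesEntries.mul_pow hN (hdim _) (htable _ j.2) (hconst _ _)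
    · refine ComputesEntries.mul_pow hN (hdim _) (htable _ j.2.le) ?_
      exact (ComputesEntries.mul_pow hN (hdim _) (hext j) (hconst _ 0)).pow_mono hN (by omega)
  -- the verdict
  have hacc : ∀ {v : (PairVar (P.dim i) (P.dim (i + 1)) (P.dim i) (m + T * l) → R) →
      ViewVar P m l → R} (_ : Computes (N ^ 6) v), Decides (N ^ 7) fun x => D.Accepts (v x) := by
    intro v hv
    have h₁ : ComputesOne D.circuit.length fun y : ViewVar P m l → R => D.circuit.read y D.out :=
      ⟨D.circuit, fun _ => D.out, le_rfl, fun _ _ => rfl⟩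
    refine (Decides.eq (hv.comp h₁) (ComputesOne.const 1)).mono ?_
    have : 16 * N ^ 6 ≤ N ^ 7 ∧ 1 ≤ N ^ 6 := sixteen_mul_pow_le hN 6
    omega
  refine (hreply.and (hpasses.cond (hacc (computes_view_masked hview))
    (hacc (computes_view_left hview)))).mono ?_
  have h₁ : 16 * N ^ 15 ≤ N ^ 16 ∧ 1 ≤ N ^ 15 := sixteen_mul_pow_le hN 15
  have h₂ : 16 * N ^ 16 ≤ N ^ 17 ∧ 1 ≤ N ^ 16 := sixteen_mul_pow_le hN 16
  have h₃ : 16 * N ^ 17 ≤ N ^ 18 ∧ 1 ≤ N ^ 17 := sixteen_mul_pow_le hN 17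
  have h₄ : N ^ 7 ≤ N ^ 15 := Nat.pow_le_pow_right (by omega) (by omega)
  omega

end Adversaries

/-! ### Zero-knowledge from LPN -/

section Reduction

variable {R : Type} {P : Params} {m l : ℕ} [CommRing R] [Fintype R]

lemma zeroKnowledge_of_LPNHard [Nontrivial R] {T s N size : ℕ} {bits adv err : ℝ} (hN : 16 ≤ N)
    (hdim : 0 < P.depth → ∀ i, P.dim i ≤ N) (hdepth : P.depth ≤ N)
    (hchecks : 0 < P.depth → P.checks ≤ N)
    (ht : m + T * l ≤ N) (hs : s ≤ N) (hsize : N ^ 19 ≤ size) (hadv : 0 ≤ adv) (herr₀ : 0 ≤ err)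
    (herr : 0 < P.depth → ((minIdealCard R : ℝ)⁻¹) ^ P.checks ≤ err)
    (htotal : 2 * P.depth * adv + err ≤ (2 : ℝ) ^ (-bits))
    (hLPN : ∀ i < P.depth, ∃ (M : ℕ) (μ : ℝ), LPNHard R M (P.dim (i + 1)) (m + T * l) μ size adv ∧
      P.dim i ≤ M ∧ 0 ≤ μ ∧ μ < 1 ∧ μ ≤ P.rate i ∧ P.rate i ≤ 1) :
    ZeroKnowledge R P m l T s bits := by
  intro S D hS hD A B
  have hS₁ : S.setup.length ≤ N := by unfold CircuitServer.size at hS; omega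
  have hS₂ : S.lefts.length ≤ N := by unfold CircuitServer.size at hS; omega
  have hstep : ∀ (W : Matrix (Fin (P.dim 0)) (Fin (m + T * l)) R) (i : ℕ), i < P.depth →
      hybrid S.toServer (fun v => D.Accepts (viewValue v)) W (i + 1) ≤
        hybrid S.toServer (fun v => D.Accepts (viewValue v)) W i + ENNReal.ofReal adv ∧
      hybrid S.toServer (fun v => D.Accepts (viewValue v)) W i ≤
        hybrid S.toServer (fun v => D.Accepts (viewValue v)) W (i + 1) + ENNReal.ofReal adv := by
    intro W i hi
    have hd : 0 < P.depth := by omega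
    obtain ⟨M, μ, h₁, h₂, h₃, h₄, h₅, h₆⟩ := hLPN i hi
    refine hybrid_succ S.toServer _ W ⟨i, hi⟩ h₁ h₂ h₃ h₄ h₅ h₆ (fun X Lf V =>
      decides_testAccepts S D hN (hdim hd) hdepth (hchecks hd) ht hS₁ hS₂ (hD.trans hs) ⟨i, hi⟩ X Lf V) ?_
    refine le_trans ?_ hsize
    have e₁ : P.dim i * (m + T * l) ≤ N * N := Nat.mul_le_mul (hdim hd i) ht
    have e₂ : N * N ≤ N ^ 18 := by
      rw [← sq]
      exact Nat.pow_le_pow_right (by omega) (by omega)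
    have e₃ : 16 * N ^ 18 ≤ N ^ 19 ∧ 1 ≤ N ^ 18 := sixteen_mul_pow_le hN 18
    change N ^ 18 + 2 * (P.dim i * (m + T * l)) ≤ N ^ 19
    omega
  have herr' : 0 < P.depth → ((minIdealCard R : ℝ≥0∞)⁻¹) ^ P.checks ≤ ENNReal.ofReal err := by
    intro hd
    have hq : (0 : ℝ) < minIdealCard R := by
      exact_mod_cast (by have := two_le_minIdealCard R; omega : 0 < minIdealCard R)
    refine le_trans (le_of_eq ?_) (ENNReal.ofReal_le_ofReal (herr hd))
    rw [ENNReal.ofReal_pow (by positivity), ENNReal.ofReal_inv_of_pos hq, ENNReal.ofReal_natCast]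
  have key := fun A A' B B' => Ex_realView_le S.toServer A A' B B' T
    (fun v => D.Accepts (viewValue v)) hadv hstep herr' herr₀
  refine le_trans ((abs_prob_sub_le_iff (by positivity)).mpr ⟨key _ _ _ _, key _ _ _ _⟩) htotal

end Reduction

/-! ### The dimensions -/

section Dimensions

variable {δ : ℝ} {F n : ℕ}

/-- The number of levels of the recursion. -/
def depthOf (δ : ℝ) (F n : ℕ) : ℕ := sInf {i | dims δ F n i ≤ F}

lemma dims_succ (i : ℕ) : dims δ F n (i + 1) = max ⌈δ * dims δ F n i⌉₊ F := rfl

lemma dims_succ_lt (hδ₁ : δ < 1) (hF : 4 / (1 - δ) ≤ F) {i : ℕ} (hi : F < dims δ F n i) :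
    dims δ F n (i + 1) < dims δ F n i := by
  have hi' : (F : ℝ) < dims δ F n i := by exact_mod_cast hi
  have h : 0 < 1 - δ := by linarith
  have h₁ : 4 < dims δ F n i * (1 - δ) := (div_lt_iff₀ h).mp (hF.trans_lt hi')
  rw [dims_succ, max_lt_iff]
  refine ⟨?_, hi⟩
  have h₂ : ⌈δ * dims δ F n i⌉₊ ≤ dims δ F n i - 1 := by
    rw [Nat.ceil_le, Nat.cast_sub (by omega)]
    push_cast
    linarith
  omega

lemma dims_depthOf_le (hδ₁ : δ < 1) (hF : 4 / (1 - δ) ≤ F) : dims δ F n (depthOf δ F n) ≤ F := by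
  refine Nat.sInf_mem (s := {i | dims δ F n i ≤ F}) ?_
  by_contra hne
  rw [Set.not_nonempty_iff_eq_empty, Set.eq_empty_iff_forall_notMem] at hne
  have h : ∀ i, dims δ F n i + i ≤ n := by
    intro i
    induction i with
    | zero => simp [dims]
    | succ i ih =>
      have := dims_succ_lt (n := n) hδ₁ hF (not_le.mp (hne i))
      omega
  have := h (n + 1)
  omega

lemma lt_dims_of_lt {i : ℕ} (hi : i < depthOf δ F n) : F < dims δ F n i :=
  not_le.mp (Nat.notMem_of_lt_sInf (s := {i | dims δ F n i ≤ F}) hi)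

lemma dims_add_le (hδ₁ : δ < 1) (hF : 4 / (1 - δ) ≤ F) {i : ℕ} (hi : i ≤ depthOf δ F n) :
    dims δ F n i + i ≤ n := by
  induction i with
  | zero => simp [dims]
  | succ i ih =>
    have := dims_succ_lt (n := n) hδ₁ hF (lt_dims_of_lt hi)
    have := ih (by omega)
    omega

lemma le_dims_succ (i : ℕ) : F ≤ dims δ F n (i + 1) := le_max_right _ _

lemma lt_of_depthOf_pos (h : 0 < depthOf δ F n) : F < n := lt_dims_of_lt h

lemma dims_le_max (hδ₁ : δ < 1) (i : ℕ) : dims δ F n i ≤ max n F := by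
  induction i with
  | zero => exact le_max_left _ _
  | succ i ih =>
    refine max_le ?_ (le_max_right _ _)
    refine le_trans ?_ ih
    rw [Nat.ceil_le]
    have : (0 : ℝ) ≤ dims δ F n i := by positivity
    nlinarith

lemma mul_dims_le (i : ℕ) : δ * dims δ F n i ≤ dims δ F n (i + 1) := by
  rw [dims_succ]
  push_cast
  exact (Nat.le_ceil _).trans (le_max_left _ _)

lemma dims_le_floor (hδ₀ : 0 < δ) (i : ℕ) :
    dims δ F n i ≤ ⌊(dims δ F n (i + 1) : ℝ) / δ⌋₊ := by
  rw [Nat.le_floor_iff (by positivity), le_div_iff₀ hδ₀, mul_comm]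
  exact mul_dims_le i

/-- The dimensions decrease geometrically, up to the fixed point `1 / (1 - δ)` of `x ↦ δ x + 1`. -/
lemma dims_sub_le (hδ₀ : 0 ≤ δ) (hδ₁ : δ < 1) {i : ℕ} (hi : i < depthOf δ F n) :
    dims δ F n i - 1 / (1 - δ) ≤ δ ^ i * (n - 1 / (1 - δ)) := by
  induction i with
  | zero => simp [dims]
  | succ i ih =>
    have h₁ := ih (by omega)
    have h₂ := lt_dims_of_lt hi
    rw [dims_succ, lt_max_iff] at h₂
    have h₃ : dims δ F n (i + 1) = ⌈δ * dims δ F n i⌉₊ := by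
      rw [dims_succ, max_eq_left]
      rcases h₂ with h₂ | h₂ <;> omega
    have h₄ := Nat.ceil_lt_add_one (a := δ * dims δ F n i) (by positivity)
    have h₅ : (1 - δ) * (1 / (1 - δ)) = 1 := by
      field_simp [show (1 - δ) ≠ 0 by linarith]
    have h₆ := mul_le_mul_of_nonneg_left h₁ hδ₀
    rw [h₃, pow_succ]
    nlinarith

lemma pow_mul_le_of_depthOf (hδ₀ : 0 < δ) (hδ₁ : δ < 1) (hF : 4 / (1 - δ) ≤ F) {d : ℕ}
    (hd : depthOf δ F n = d + 1) : 4 * (1 / δ) ^ d ≤ n := by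
  have h₁ := dims_sub_le (n := n) hδ₀.le hδ₁ (by omega : d < depthOf δ F n)
  have h₂ : (F : ℝ) < dims δ F n d := by exact_mod_cast lt_dims_of_lt (by omega : d < depthOf δ F n)
  have h₃ : 1 ≤ 1 / (1 - δ) := by
    rw [le_div_iff₀ (by linarith)]
    linarith
  have h₄ : 4 / (1 - δ) = 4 * (1 / (1 - δ)) := by ring
  have h₅ : 0 < δ ^ d := by positivity
  have h₆ : 3 ≤ δ ^ d * n := by nlinarith
  have h₇ : F + 1 ≤ dims δ F n d := lt_dims_of_lt (by omega : d < depthOf δ F n)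
  have h₈ : (F : ℝ) + 1 ≤ dims δ F n d := by exact_mod_cast h₇
  have h₉ : 4 ≤ δ ^ d * n := by nlinarith
  rw [one_div, inv_pow, ← div_eq_mul_inv, div_le_iff₀ h₅]
  linarith

lemma logb_inv_pos (hδ₀ : 0 < δ) (hδ₁ : δ < 1) : 0 < Real.logb 2 (1 / δ) := by
  refine Real.logb_pos (by norm_num) ?_
  rw [lt_div_iff₀ hδ₀]
  linarith

lemma depthOf_add_one_le_levels (hδ₀ : 0 < δ) (hδ₁ : δ < 1) (hF : 4 / (1 - δ) ≤ F)
    (hd : 0 < depthOf δ F n) : (depthOf δ F n : ℝ) + 1 ≤ levels δ n := by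
  obtain ⟨d, hd⟩ := Nat.exists_eq_succ_of_ne_zero hd.ne'
  have h₁ := pow_mul_le_of_depthOf hδ₀ hδ₁ hF hd
  have hn : (0 : ℝ) < n := lt_of_lt_of_le (by positivity) h₁
  have hy := logb_inv_pos hδ₀ hδ₁
  set y := Real.logb 2 (1 / δ) with hydef
  have h₂ : 2 + d * y ≤ Real.logb 2 n := by
    have := Real.logb_le_logb_of_le (b := 2) (by norm_num) (by positivity) h₁
    rw [Real.logb_mul (by norm_num) (by positivity), Real.logb_pow] at this
    have h4 : Real.logb 2 4 = 2 := by
      rw [show (4 : ℝ) = 2 ^ (2 : ℕ) by norm_num, Real.logb_pow]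
      simp
    linarith
  have hlog : 0 ≤ Real.logb 2 n := le_trans (by positivity) h₂
  rw [hd]
  push_cast
  unfold levels
  rw [← hydef]
  rcases le_total 1 y with hy1 | hy1
  · have h₃ : 1 * Real.logb 2 n ≤ max 1 (1 / y) * Real.logb 2 n :=
      mul_le_mul_of_nonneg_right (le_max_left _ _) hlog
    have : (d : ℝ) ≤ d * y := le_mul_of_one_le_right (by positivity) hy1
    linarith
  · have h₃ : 1 / y * Real.logb 2 n ≤ max 1 (1 / y) * Real.logb 2 n :=
      mul_le_mul_of_nonneg_right (le_max_right _ _) hlog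
    refine le_trans ?_ h₃
    rw [one_div, inv_mul_eq_div, le_div_iff₀ hy]
    linarith

lemma levels_le_sq (hδ₀ : 0 < δ) (hδ₁ : δ < 1) (hn : 4 / (1 - δ) ≤ n) : levels δ n ≤ (n : ℝ) ^ 2 := by
  have h : 0 < 1 - δ := by linarith
  have h₁ : 4 ≤ n * (1 - δ) := (div_le_iff₀ h).mp hn
  have hn0 : (0 : ℝ) < n := by
    by_contra h'
    nlinarith
  have hn1 : (1 : ℝ) ≤ n := by exact_mod_cast hn0
  have hl2 : 0 < Real.log 2 := Real.log_pos (by norm_num)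
  have hl2' : Real.log 2 < 1 := Real.log_two_lt_d9.trans (by norm_num)
  have hy : 1 - δ ≤ Real.logb 2 (1 / δ) := by
    rw [Real.logb, le_div_iff₀ hl2, one_div, Real.log_inv]
    have := Real.log_le_sub_one_of_pos hδ₀
    nlinarith
  have h₂ : max 1 (1 / Real.logb 2 (1 / δ)) ≤ n := by
    refine max_le hn1 ?_
    rw [div_le_iff₀ (by linarith)]
    nlinarith
  have h₃ : Real.logb 2 n ≤ n := by
    have h2 : (n : ℝ) ≤ 2 ^ (n : ℝ) := by
      rw [Real.rpow_natCast]
      exact_mod_cast Nat.lt_two_pow_self.le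
    exact (Real.logb_le_iff_le_rpow (by norm_num) hn0).mpr h2
  have h₄ : 0 ≤ Real.logb 2 n := Real.logb_nonneg (by norm_num) hn1
  unfold levels
  rw [sq]
  exact mul_le_mul h₂ h₃ h₄ hn0.le

end Dimensions

/-! ### The security level of LPN -/

section Iota

variable {R : Type} [CommRing R] [Fintype R]

lemma secureDims_nonempty {δ ε bits : ℝ} (hδ₀ : 0 < δ) (hδ₁ : δ < 1) (h : LPNAssumption R δ ε)
    (t size : ℕ) : (secureDims R δ ε bits t size).Nonempty := by
  obtain ⟨N₀, hN₀⟩ := h 1 1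
  refine ⟨1 + N₀ + t + size + ⌈(2 : ℝ) ^ bits⌉₊, by omega, fun κ hκ => ?_⟩
  set N := ⌊(κ : ℝ) / δ⌋₊ with hN
  have hκN : κ ≤ N := by
    refine Nat.le_floor ?_
    rw [le_div_iff₀ hδ₀]
    have : (0 : ℝ) ≤ κ := by positivity
    nlinarith
  have hdim : ⌈δ * N⌉₊ = κ := by
    have h₁ : (N : ℝ) ≤ κ / δ := Nat.floor_le (by positivity)
    have h₂ : (κ : ℝ) / δ < N + 1 := Nat.lt_floor_add_one _
    rw [le_div_iff₀ hδ₀] at h₁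
    rw [div_lt_iff₀ hδ₀] at h₂
    rw [Nat.ceil_eq_iff (by omega), Nat.cast_sub (by omega)]
    push_cast
    constructor <;> nlinarith
  have h₁ := hN₀ N (by omega) t (by rw [pow_one]; omega)
  rw [hdim] at h₁
  refine h₁.mono (by rw [pow_one]; omega) ?_
  rw [pow_one, Real.rpow_neg (by norm_num)]
  refine inv_anti₀ (by positivity) ((Nat.le_ceil _).trans ?_)
  exact_mod_cast (by omega : ⌈(2 : ℝ) ^ bits⌉₊ ≤ N)

lemma isLeast_iota {δ ε bits : ℝ} (hδ₀ : 0 < δ) (hδ₁ : δ < 1) (h : LPNAssumption R δ ε)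
    (t size : ℕ) : IsLeast (secureDims R δ ε bits t size) (iota R δ ε bits t size) :=
  ⟨Nat.sInf_mem (secureDims_nonempty hδ₀ hδ₁ h t size), fun _ hx => Nat.sInf_le hx⟩

end Iota

/-! ### Security with the chosen parameters -/

section Parameters

variable {R : Type} [CommRing R] [Fintype R] {sq : ℕ → ℕ} {δ ε : ℝ} {lam n t size : ℕ}

lemma params_depth : (params R sq δ ε lam n t size).depth =
    depthOf δ (lastDim R δ ε lam n t size) n := rfl

lemma lastDim_ge : 4 / (1 - δ) ≤ lastDim R δ ε lam n t size := by
  refine (Nat.le_ceil _).trans ?_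
  exact_mod_cast le_max_right _ _

lemma iota_le_lastDim : iota R δ ε (lpnBits δ lam n) t size ≤ lastDim R δ ε lam n t size := by
  have h : (iota R δ ε (lpnBits δ lam n) t size : ℝ) ≤ ⌈nu R δ ε lam n t size⌉₊ :=
    (le_max_right _ _).trans (Nat.le_ceil _)
  have h' : iota R δ ε (lpnBits δ lam n) t size ≤ ⌈nu R δ ε lam n t size⌉₊ := by exact_mod_cast h
  exact h'.trans (le_max_left _ _)

lemma five_le_lastDim (hδ₀ : 0 < δ) (hδ₁ : δ < 1) : 5 ≤ lastDim R δ ε lam n t size := by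
  have h := lastDim_ge (R := R) (δ := δ) (ε := ε) (lam := lam) (n := n) (t := t) (size := size)
  have h₁ : 4 < 4 / (1 - δ) := by
    rw [lt_div_iff₀ (by linarith)]
    linarith
  have : (4 : ℝ) < lastDim R δ ε lam n t size := h₁.trans_le h
  exact_mod_cast this

lemma one_le_logb_minIdealCard (R : Type) [CommRing R] [Fintype R] [Nontrivial R] :
    1 ≤ Real.logb 2 (minIdealCard R) := by
  rw [Real.le_logb_iff_rpow_le (by norm_num)]
  · rw [Real.rpow_one]
    exact_mod_cast two_le_minIdealCard R
  · exact_mod_cast (by have := two_le_minIdealCard R; omega : 0 < minIdealCard R)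

/-- The number of checks makes the error of the checks small enough. -/
lemma inv_pow_checks_le [Nontrivial R] :
    ((minIdealCard R : ℝ)⁻¹) ^ (params R sq δ ε lam n t size).checks ≤
      (2 : ℝ) ^ (-((lam : ℝ) + Real.logb 2 (levels δ n))) := by
  have h₁ := one_le_logb_minIdealCard R
  have hq : (0 : ℝ) < minIdealCard R := by
    exact_mod_cast (by have := two_le_minIdealCard R; omega : 0 < minIdealCard R)
  set k := (params R sq δ ε lam n t size).checks with hk
  have h₂ : (lam + Real.logb 2 (levels δ n)) / Real.logb 2 (minIdealCard R) ≤ k := Nat.le_ceil _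
  rw [div_le_iff₀ (by linarith)] at h₂
  have h₃ : (minIdealCard R : ℝ) = 2 ^ Real.logb 2 (minIdealCard R) :=
    (Real.rpow_logb (by norm_num) (by norm_num) hq).symm
  rw [inv_pow, Real.rpow_neg (by norm_num), ← Real.rpow_natCast]
  conv_lhs => rw [h₃]
  rw [← Real.rpow_mul (by norm_num)]
  refine inv_anti₀ (by positivity) (Real.rpow_le_rpow_of_exponent_le (by norm_num) ?_)
  linarith

lemma two_rpow_neg_add_logb {D : ℝ} (hD : 0 < D) (x : ℝ) :
    (2 : ℝ) ^ (-(x + Real.logb 2 D)) = 2 ^ (-x) / D := by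
  rw [neg_add, Real.rpow_add (by norm_num), Real.rpow_neg (by norm_num) (Real.logb 2 D),
    Real.rpow_logb (by norm_num) (by norm_num) hD]
  rfl

lemma one_le_levels (hδ₀ : 0 < δ) (hδ₁ : δ < 1)
    (hd : 0 < (params R sq δ ε lam n t size).depth) : 1 ≤ levels δ n := by
  refine le_trans ?_ (depthOf_add_one_le_levels (F := lastDim R δ ε lam n t size) hδ₀ hδ₁
    lastDim_ge hd)
  linarith [Nat.cast_nonneg (α := ℝ) (depthOf δ (lastDim R δ ε lam n t size) n)]

lemma soundInitialization_params [Nontrivial R] (hδ₀ : 0 < δ) (hδ₁ : δ < 1) (m l : ℕ) :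
    SoundInitialization R (params R sq δ ε lam n t size) m l lam := by
  rcases Nat.eq_zero_or_pos (params R sq δ ε lam n t size).depth with hd | hd
  · exact soundInitialization_of_depth_eq_zero hd _
  · refine soundInitialization_of_checks (inv_pow_checks_le.trans ?_)
    refine Real.rpow_le_rpow_of_exponent_le (by norm_num) ?_
    have := Real.logb_nonneg (b := 2) (by norm_num) (one_le_levels hδ₀ hδ₁ hd)
    linarith

lemma dim_le_of_depth_pos (hδ₁ : δ < 1) (hd : 0 < (params R sq δ ε lam n t size).depth) (i : ℕ) :
    (params R sq δ ε lam n t size).dim i ≤ n := by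
  have h := lt_of_depthOf_pos hd
  have h' := dims_le_max (F := lastDim R δ ε lam n t size) (n := n) hδ₁ i
  rw [max_eq_left h.le] at h'
  exact h'

lemma checks_le [Nontrivial R] (hδ₀ : 0 < δ) (hδ₁ : δ < 1)
    (hd : 0 < (params R sq δ ε lam n t size).depth) :
    (params R sq δ ε lam n t size).checks ≤ lam + 2 * n := by
  have h₁ := one_le_logb_minIdealCard R
  have h₂ := one_le_levels hδ₀ hδ₁ hd
  have hn := lt_of_depthOf_pos hd
  have hn0 : (0 : ℝ) < n := by exact_mod_cast (by omega : 0 < n)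
  have h₃ : levels δ n ≤ (n : ℝ) ^ 2 := by
    refine levels_le_sq hδ₀ hδ₁ (lastDim_ge.trans (b := (lastDim R δ ε lam n t size : ℝ)) ?_)
    exact_mod_cast hn.le
  have h₄ : Real.logb 2 (levels δ n) ≤ 2 * n := by
    rw [Real.logb_le_iff_le_rpow (by norm_num) (by linarith), mul_comm, Real.rpow_mul (by norm_num)]
    refine h₃.trans ?_
    rw [Real.rpow_two, Real.rpow_natCast]
    refine pow_le_pow_left₀ hn0.le ?_ 2
    exact_mod_cast Nat.lt_two_pow_self.le
  have h₅ := Real.logb_nonneg (b := 2) (by norm_num) h₂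
  change ⌈(lam + Real.logb 2 (levels δ n)) / Real.logb 2 (minIdealCard R)⌉₊ ≤ _
  rw [Nat.ceil_le, div_le_iff₀ (by linarith)]
  push_cast
  have : (0 : ℝ) ≤ lam := by positivity
  nlinarith

lemma lpnHard_level (hδ₀ : 0 < δ) (hδ₁ : δ < 1) (hε : ε < 1) (h : LPNAssumption R δ ε) {i : ℕ}
    (hi : i < (params R sq δ ε lam n t size).depth) :
    ∃ (M : ℕ) (μ : ℝ), LPNHard R M ((params R sq δ ε lam n t size).dim (i + 1)) t μ size
        ((2 : ℝ) ^ (-lpnBits δ lam n)) ∧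
      (params R sq δ ε lam n t size).dim i ≤ M ∧ 0 ≤ μ ∧ μ < 1 ∧
      μ ≤ (params R sq δ ε lam n t size).rate i ∧ (params R sq δ ε lam n t size).rate i ≤ 1 := by
  set F := lastDim R δ ε lam n t size with hF
  have h5 : 5 ≤ F := five_le_lastDim hδ₀ hδ₁
  have h₁ : F < dims δ F n i := lt_dims_of_lt hi
  have h₂ : dims δ F n i ≤ ⌊(dims δ F n (i + 1) : ℝ) / δ⌋₊ := dims_le_floor hδ₀ i
  have hpos : (1 : ℝ) < dims δ F n i := by exact_mod_cast (by omega : 1 < dims δ F n i)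
  have h₃ : (dims δ F n i : ℝ) ≤ ⌊(dims δ F n (i + 1) : ℝ) / δ⌋₊ := by exact_mod_cast h₂
  refine ⟨_, _, (isLeast_iota hδ₀ hδ₁ h t size).1.2 (dims δ F n (i + 1))
    (iota_le_lastDim.trans (le_dims_succ i)), h₂, by positivity, ?_, ?_, ?_⟩
  · exact Real.rpow_lt_one_of_one_lt_of_neg (hpos.trans_le h₃) (by linarith)
  · exact Real.rpow_le_rpow_of_nonpos (by linarith) h₃ (by linarith)
  · exact Real.rpow_le_one_of_one_le_of_nonpos hpos.le (by linarith)

lemma zeroKnowledge_params [Nontrivial R] (hδ₀ : 0 < δ) (hδ₁ : δ < 1) (hε : ε < 1)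
    (h : LPNAssumption R δ ε) (hn : 1 ≤ n) {m l T s K : ℕ} (hm : 1 ≤ m) (hK : 38 ≤ K)
    (ht : t = m + T * l) (hsize : size = (n + m + T * l + lam + s + 2) ^ K) :
    ZeroKnowledge R (params R sq δ ε lam n t size) m l T s lam := by
  set Z := n + m + T * l + lam + s + 2 with hZ
  have hZ4 : 4 ≤ Z := by omega
  have hZZ : 4 * Z ≤ Z ^ 2 := by
    rw [pow_two]
    exact Nat.mul_le_mul_right _ hZ4
  have hd₁ : (params R sq δ ε lam n t size).depth ≤ n := by
    have := dims_add_le (n := n) hδ₁ (lastDim_ge (R := R) (ε := ε) (lam := lam) (n := n) (t := t)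
      (size := size)) le_rfl
    rw [params_depth]
    omega
  have key : ∀ adv err : ℝ, 0 ≤ adv → 0 ≤ err →
      (0 < (params R sq δ ε lam n t size).depth → (2 : ℝ) ^ (-lpnBits δ lam n) ≤ adv ∧
        ((minIdealCard R : ℝ)⁻¹) ^ (params R sq δ ε lam n t size).checks ≤ err) →
      2 * (params R sq δ ε lam n t size).depth * adv + err ≤ (2 : ℝ) ^ (-(lam : ℝ)) →
      ZeroKnowledge R (params R sq δ ε lam n t size) m l T s lam := by
    intro adv err h₁ h₂ h₃ h₄
    refine zeroKnowledge_of_LPNHard (N := Z ^ 2) (size := size) (adv := adv) (err := err) (by omega)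
      (fun hd i => (dim_le_of_depth_pos hδ₁ hd i).trans (by omega)) (by omega)
      (fun hd => (checks_le hδ₀ hδ₁ hd).trans (by omega)) (by omega) (by omega) ?_ h₁ h₂
      (fun hd => (h₃ hd).2) h₄ fun i hi => ?_
    · rw [hsize, ← pow_mul]
      exact Nat.pow_le_pow_right (by omega) (by omega)
    · obtain ⟨M, μ, hM, h'⟩ := lpnHard_level (sq := sq) hδ₀ hδ₁ hε h hi
      rw [← ht]
      exact ⟨M, μ, hM.mono le_rfl (h₃ (by omega)).1, h'⟩
  rcases Nat.eq_zero_or_pos (params R sq δ ε lam n t size).depth with hd | hd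
  · refine key 0 0 le_rfl le_rfl (fun h => absurd h (by omega)) ?_
    rw [mul_zero, add_zero]
    positivity
  · have hD := one_le_levels hδ₀ hδ₁ hd
    have hD' := depthOf_add_one_le_levels (F := lastDim R δ ε lam n t size) (n := n) hδ₀ hδ₁ lastDim_ge hd
    rw [← params_depth (sq := sq)] at hD'
    have hbits : (2 : ℝ) ^ (-lpnBits δ lam n) = 2 ^ (-(lam : ℝ)) / levels δ n / 2 := by
      rw [← two_rpow_neg_add_logb (by linarith), lpnBits, neg_add, Real.rpow_add (by norm_num),
        Real.rpow_neg_one]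
      rfl
    refine key _ _ (by positivity) (by positivity)
      (fun _ => ⟨le_rfl, inv_pow_checks_le⟩) ?_
    rw [hbits, two_rpow_neg_add_logb (by linarith)]
    have h2 : (0 : ℝ) < 2 ^ (-(lam : ℝ)) := by positivity
    calc _ = 2 ^ (-(lam : ℝ)) * (((params R sq δ ε lam n t size).depth + 1) / levels δ n) := by
          field_simp
      _ ≤ 2 ^ (-(lam : ℝ)) * 1 := by
          refine mul_le_mul_of_nonneg_left ?_ h2.le
          rw [div_le_one (by linarith)]
          exact hD'
      _ = _ := mul_one _

end Parameters

/-! ### Gaussian elimination with zero tests -/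

section Elimination

variable {R : Type} [CommRing R] {M : ℕ}

/-- An element `e` of the socle of `R`: the annihilator of `e` is prime, and `e * x = 0` tests
whether `x` vanishes in the residue field. -/
lemma exists_prime_annihilator (R : Type) [CommRing R] [Fintype R] [Nontrivial R] :
    ∃ e : R, e ≠ 0 ∧ ∀ a b : R, e * a ≠ 0 → e * b ≠ 0 → e * (a * b) ≠ 0 := by
  obtain h | ⟨I, hI, -⟩ := eq_bot_or_exists_atom_le (⊤ : Ideal R)
  · exact absurd h top_ne_bot
  · obtain ⟨e, he, he0⟩ := Submodule.exists_mem_ne_zero_of_ne_bot hI.1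
    refine ⟨e, he0, fun a b ha hb hab => hb ?_⟩
    have h₁ : Ideal.span {e * a} ≤ I := by
      rw [Ideal.span_singleton_le_iff_mem]
      exact I.mul_mem_right a he
    have h₂ : Ideal.span {e * a} = I := by
      refine (hI.le_iff.mp h₁).resolve_left ?_
      exact fun h => ha (Ideal.span_singleton_eq_bot.mp h)
    rw [← h₂, Ideal.mem_span_singleton'] at he
    obtain ⟨r, hr⟩ := he
    rw [← hr]
    linear_combination r * hab

/-- The first row in which the column `v` does not vanish in the residue field. -/
def IsPivot (e : R) (v : Fin M → R) (p : Fin M) : Prop := e * v p ≠ 0 ∧ ∀ q < p, e * v q = 0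

open Classical in
/-- One step of fraction-free elimination on the rows of `W`, where `v` is the column to be
cleared. -/
def eliminate (e : R) (v : Fin M → R) (W : Matrix (Fin M) (Fin M) R) : Matrix (Fin M) (Fin M) R :=
  Matrix.of fun i j => (if ∀ p, e * v p = 0 then W i j else 0) +
    ∑ p, if IsPivot e v p then v p * W i j - v i * W p j else 0

lemma eliminate_of_zero {e : R} {v : Fin M → R} (h : ∀ p, e * v p = 0)
    (W : Matrix (Fin M) (Fin M) R) : eliminate e v W = W := by
  ext i j
  simp only [eliminate, Matrix.of_apply, if_pos h]
  rw [Finset.sum_eq_zero, add_zero]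
  intro p _
  rw [if_neg]
  exact fun hp => hp.1 (h p)

lemma eliminate_of_pivot {e : R} {v : Fin M → R} {p : Fin M} (h : IsPivot e v p)
    (W : Matrix (Fin M) (Fin M) R) (i j : Fin M) :
    eliminate e v W i j = v p * W i j - v i * W p j := by
  simp only [eliminate, Matrix.of_apply]
  rw [if_neg fun h' => h.1 (h' p), zero_add, Finset.sum_eq_single p, if_pos h]
  · intro q _ hq
    rw [if_neg]
    intro hq'
    rcases lt_or_gt_of_ne hq with hlt | hlt
    · exact hq'.1 (h.2 q hlt)
    · exact h.1 (hq'.2 p hlt)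
  · simp

lemma exists_isPivot {e : R} {v : Fin M → R} (h : ¬∀ p, e * v p = 0) : ∃ p, IsPivot e v p := by
  push Not at h
  obtain ⟨p, hp, hmin⟩ := WellFounded.has_min (wellFounded_lt (α := Fin M)) {p | e * v p ≠ 0} h
  exact ⟨p, hp, fun q hq => by_contra fun hq' => hmin q hq' hq⟩

variable {k : ℕ}

/-- The transformation of the rows after the first `c` columns of `L` are cleared. -/
def rowTransform (e : R) (L : Matrix (Fin M) (Fin k) R) : ℕ → Matrix (Fin M) (Fin M) R
  | 0 => 1
  | c + 1 => if h : c < k then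
      eliminate e (fun i => (rowTransform e L c * L) i ⟨c, h⟩) (rowTransform e L c)
    else rowTransform e L c

/-- After `c` steps at most `c` rows have been used up; the others stay independent in the residue
field, since they are diagonal on the unused coordinates. -/
lemma rowTransform_spec {e : R} (he : e ≠ 0) (hp : ∀ a b : R, e * a ≠ 0 → e * b ≠ 0 → e * (a * b) ≠ 0)
    (L : Matrix (Fin M) (Fin k) R) {c : ℕ} (hc : c ≤ k) :
    (∀ (j : Fin k) (i : Fin M), j.1 < c → e * (rowTransform e L c * L) i j = 0) ∧
      ∃ U : Finset (Fin M), U.card ≤ c ∧ (∀ i ∈ U, ∀ j, rowTransform e L c i j = 0) ∧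
        ∀ i ∉ U, e * rowTransform e L c i i ≠ 0 ∧ ∀ j ∉ U, j ≠ i → rowTransform e L c i j = 0 := by
  induction c with
  | zero =>
    refine ⟨fun j i hj => absurd hj (by omega), ∅, le_rfl, by simp, fun i _ => ⟨?_, fun j _ hj => ?_⟩⟩
    · simpa [rowTransform] using he
    · simp [rowTransform, Matrix.one_apply_ne hj.symm]
  | succ c ih =>
    obtain ⟨h₁, U, hU, hU₀, hU₁⟩ := ih (by omega)
    have hck : c < k := hc
    set W := rowTransform e L c with hW
    set v : Fin M → R := fun i => (W * L) i ⟨c, hck⟩ with hv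
    have hstep : rowTransform e L (c + 1) = eliminate e v W := by
      rw [rowTransform, dif_pos hck]
    rw [hstep]
    by_cases hz : ∀ p, e * v p = 0
    · rw [eliminate_of_zero hz]
      refine ⟨fun j i hj => ?_, U, by omega, hU₀, hU₁⟩
      rcases Nat.lt_succ_iff_lt_or_eq.mp hj with hj | hj
      · exact h₁ j i hj
      · obtain rfl : j = ⟨c, hck⟩ := Fin.ext hj
        exact hz i
    · obtain ⟨p, hpv⟩ := exists_isPivot hz
      have hpU : p ∉ U := by
        intro hpU
        apply hpv.1
        simp [hv, Matrix.mul_apply, hU₀ p hpU]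
      have hmul : ∀ i j, (eliminate e v W * L) i j = v p * (W * L) i j - v i * (W * L) p j := by
        intro i j
        simp only [Matrix.mul_apply, eliminate_of_pivot hpv, sub_mul, Finset.sum_sub_distrib,
          Finset.mul_sum, mul_assoc]
      refine ⟨fun j i hj => ?_, insert p U, ?_, fun i hi j => ?_, fun i hi => ⟨?_, fun j hj hji => ?_⟩⟩
      · rw [hmul]
        rcases Nat.lt_succ_iff_lt_or_eq.mp hj with hj | hj
        · linear_combination v p * h₁ j i hj - v i * h₁ j p hj
        · obtain rfl : j = ⟨c, hck⟩ := Fin.ext hj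
          change e * (v p * v i - v i * v p) = 0
          ring
      · exact (Finset.card_insert_le _ _).trans (by omega)
      · rw [eliminate_of_pivot hpv]
        rcases Finset.mem_insert.mp hi with rfl | hi
        · ring
        · have : v i = 0 := by simp [hv, Matrix.mul_apply, hU₀ i hi]
          rw [hU₀ i hi, this]
          ring
      · rw [Finset.mem_insert, not_or] at hi
        rw [eliminate_of_pivot hpv, (hU₁ p hpU).2 i hi.2 hi.1, mul_zero, sub_zero]
        exact hp _ _ hpv.1 (hU₁ i hi.2).1
      · rw [Finset.mem_insert, not_or] at hi hj
        rw [eliminate_of_pivot hpv, (hU₁ p hpU).2 j hj.2 hj.1, (hU₁ i hi.2).2 j hj.2 hji]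
        ring

/-- The vectors that the elimination cannot tell from combinations of the columns of `L`. -/
def testGroup (e : R) (L : Matrix (Fin M) (Fin k) R) : AddSubgroup (Fin M → R) where
  carrier := {y | ∀ i, e * (rowTransform e L k).mulVec y i = 0}
  zero_mem' := by simp
  add_mem' := by
    intro y z hy hz i
    rw [Matrix.mulVec_add, Pi.add_apply, mul_add, hy i, hz i, add_zero]
  neg_mem' := by
    intro y hy i
    rw [Matrix.mulVec_neg, Pi.neg_apply, mul_neg, hy i, neg_zero]

lemma mulVec_mem_testGroup {e : R} (he : e ≠ 0)
    (hp : ∀ a b : R, e * a ≠ 0 → e * b ≠ 0 → e * (a * b) ≠ 0) (L : Matrix (Fin M) (Fin k) R)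
    (u : Fin k → R) : L.mulVec u ∈ testGroup e L := by
  intro i
  have h := (rowTransform_spec he hp L le_rfl).1
  rw [Matrix.mulVec_mulVec, Matrix.mulVec, dotProduct, Finset.mul_sum]
  refine Finset.sum_eq_zero fun j _ => ?_
  rw [← mul_assoc, h j i j.2, zero_mul]

lemma testGroup_ne_top {e : R} (he : e ≠ 0)
    (hp : ∀ a b : R, e * a ≠ 0 → e * b ≠ 0 → e * (a * b) ≠ 0) (L : Matrix (Fin M) (Fin k) R)
    (hM : k < M) : testGroup e L ≠ ⊤ := by
  obtain ⟨-, U, hU, -, hU₁⟩ := rowTransform_spec he hp L le_rfl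
  obtain ⟨i, hi⟩ : ∃ i, i ∉ U := by
    by_contra! h
    have : U = Finset.univ := Finset.eq_univ_iff_forall.mpr h
    rw [this, Finset.card_univ, Fintype.card_fin] at hU
    omega
  intro htop
  have h : Pi.single i 1 ∈ testGroup e L := htop ▸ AddSubgroup.mem_top _
  apply (hU₁ i hi).1
  have h' := h i
  rwa [Matrix.mulVec_single_one] at h'

end Elimination

/-! ### Sparse vectors in subgroups -/

section SparseNoise

variable {R : Type} [CommRing R] [Fintype R]

/-- Sparse noise lies in a proper subgroup with noticeably higher probability than a uniform
vector. -/
lemma Ex_noise_mem_ge {M : ℕ} {μ : ℝ} (hμ₀ : 0 ≤ μ) (hμ₁ : μ ≤ 1) {H : AddSubgroup (Fin M → R)}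
    (hH : H ≠ ⊤) : (H.index : ℝ≥0∞)⁻¹ + ENNReal.ofReal ((1 - μ) ^ M / 2) ≤
      Ex (piPMF fun _ : Fin M => noise R μ) fun s => ind (s ∈ H) := by
  classical
  have hindex : (H.index : ℝ≥0∞)⁻¹ ≤ 2⁻¹ := by
    rw [ENNReal.inv_le_inv]
    have h₀ : H.index ≠ 0 := AddSubgroup.index_ne_zero_of_finite
    have h₁ : H.index ≠ 1 := fun h => hH (AddSubgroup.index_eq_one.mp h)
    exact_mod_cast (by omega : 2 ≤ H.index)
  set q := min μ.toNNReal 1 with hq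
  have hq1 : q ≤ 1 := min_le_right _ _
  have hqμ : (q : ℝ≥0∞) = ENNReal.ofReal μ := by
    rw [hq, min_eq_left (by simpa using hμ₁)]
    rfl
  have h₁ : (Ex (piPMF fun _ : Fin M => noise R μ) fun s => ind (s ∈ H)) =
      Ex (piPMF fun _ : Fin M => coin q hq1) fun b =>
        Ex (piPMF fun i : Fin M => if b i then PMF.uniformOfFintype R else PMF.pure 0)
          fun s => ind (s ∈ H) := by
    rw [← Ex_bind, piPMF_bind (fun _ : Fin M => coin q hq1)
      fun _ c => if c then PMF.uniformOfFintype R else PMF.pure 0]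
    rfl
  have h₂ : ∀ b : Fin M → Bool, (H.index : ℝ≥0∞)⁻¹ ≤
      Ex (piPMF fun i : Fin M => if b i then PMF.uniformOfFintype R else PMF.pure 0)
        fun s => ind (s ∈ H) := by
    intro b
    let φ : (Fin M → R) →+ (Fin M → R) :=
      { toFun := fun y i => if b i then y i else 0
        map_zero' := by ext i; simp
        map_add' := fun y z => by ext i; by_cases hb : b i <;> simp [hb] }
    have h₃ : (piPMF fun i : Fin M => if b i then PMF.uniformOfFintype R else PMF.pure 0) =
        (PMF.uniformOfFintype (Fin M → R)).map φ := by
      rw [← piPMF_uniform (ι := Fin M) (β := fun _ => R)]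
      have h₄ := piPMF_map (fun _ : Fin M => PMF.uniformOfFintype R)
        fun i (y : R) => if b i then y else 0
      refine Eq.trans ?_ h₄.symm
      congr 1
      funext i
      by_cases hb : b i
      · simp only [hb, if_true]
        exact (PMF.map_id _).symm
      · simp only [hb, if_false, Bool.false_eq_true]
        exact (PMF.map_const _ _).symm
    rw [h₃, Ex_map]
    have h₅ : (Ex (PMF.uniformOfFintype (Fin M → R)) fun y => ind (φ y ∈ H)) =
        ((H.comap φ).index : ℝ≥0∞)⁻¹ := Ex_uniform_mem_addSubgroup (H.comap φ)
    rw [h₅, ENNReal.inv_le_inv, AddSubgroup.index_comap]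
    have h₆ : H.index ≠ 0 := AddSubgroup.index_ne_zero_of_finite
    exact_mod_cast Nat.le_of_dvd (Nat.pos_of_ne_zero h₆) (AddSubgroup.relIndex_dvd_index_of_normal H φ.range)
  have h₃ : (Ex (piPMF fun _ : Fin M => coin q hq1) fun b => ind (b = fun _ => false)) =
      ENNReal.ofReal ((1 - μ) ^ M) := by
    rw [Ex, tsum_fintype, Finset.sum_eq_single fun _ => false]
    · rw [piPMF_apply]
      have hc : coin q hq1 false = ENNReal.ofReal (1 - μ) := by
        rw [ENNReal.ofReal_sub _ hμ₀, ENNReal.ofReal_one, ← hqμ]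
        simp [coin]
      simp only [hc, Finset.prod_const, Finset.card_univ, Fintype.card_fin, ind_true, mul_one]
      rw [ENNReal.ofReal_pow (by linarith)]
    · intro b _ hb
      rw [ind_false hb, mul_zero]
    · simp
  have h₄ : ENNReal.ofReal ((1 - μ) ^ M / 2) = 2⁻¹ * ENNReal.ofReal ((1 - μ) ^ M) := by
    rw [div_eq_inv_mul, ENNReal.ofReal_mul (by norm_num), ENNReal.ofReal_inv_of_pos (by norm_num),
      ENNReal.ofReal_ofNat]
  rw [h₁, h₄, ← h₃, ← Ex_mul_left, ← Ex_const (piPMF fun _ : Fin M => coin q hq1)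
    (H.index : ℝ≥0∞)⁻¹, ← Ex_add]
  refine Ex_mono fun b => ?_
  by_cases hb : b = fun _ => false
  · rw [ind_true hb, mul_one]
    subst hb
    have h₅ : (piPMF fun _ : Fin M => if false = true then PMF.uniformOfFintype R else PMF.pure 0) =
        PMF.pure 0 := piPMF_pure (fun _ : Fin M => (0 : R))
    rw [h₅, Ex_pure, ind_true H.zero_mem]
    refine (add_le_add_left hindex _).trans (le_of_eq ?_)
    exact ENNReal.inv_two_add_inv_two
  · rw [ind_false hb, mul_zero, add_zero]
    exact h₂ b

end SparseNoise

/-! ### An attack on LPN -/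

section AttackCircuit

variable {X R : Type} [CommRing R]

open Classical in
lemma ComputesOne.ite {g g' : ℕ} {E : (X → R) → Prop} {f : (X → R) → R} (h : Decides g E)
    (h' : ComputesOne g' f) : ComputesOne (g + g' + 1) fun x => if E x then f x else 0 := by
  have h₁ := ComputesOne.mul h h'
  simpa only [ite_mul, one_mul, zero_mul] using h₁

lemma Decides.not {g : ℕ} {E : (X → R) → Prop} (h : Decides g E) :
    Decides (g + 2) fun x => ¬E x := by
  have h₁ := ComputesOne.sub (ComputesOne.const (X := X) 1) h
  refine ComputesOne.mono (g := 1 + g + 1) ?_ (by omega)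
  convert h₁ using 2 with x
  by_cases hE : E x <;> simp [hE]

lemma computes_eliminate {N M k : ℕ} (hN : 16 ≤ N) (hM : M ≤ N) (e : R) (j : Fin k)
    {W : (X → R) → Matrix (Fin M) (Fin M) R} {L : (X → R) → Matrix (Fin M) (Fin k) R}
    (hW : ComputesEntries (N ^ 0) W) (hL : ComputesEntries (N ^ 0) L) :
    Computes (N ^ 13) fun x (p : Fin M × Fin M) =>
      eliminate e (fun i => (W x * L x) i j) (W x) p.1 p.2 := by
  classical
  have h₀ : 16 * N ^ 0 ≤ N ^ 1 ∧ 1 ≤ N ^ 0 := sixteen_mul_pow_le hN 0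
  have h₁ : 16 * N ^ 1 ≤ N ^ 2 ∧ 1 ≤ N ^ 1 := sixteen_mul_pow_le hN 1
  have h₂ : 16 * N ^ 2 ≤ N ^ 3 ∧ 1 ≤ N ^ 2 := sixteen_mul_pow_le hN 2
  have h₃ : 16 * N ^ 3 ≤ N ^ 4 ∧ 1 ≤ N ^ 3 := sixteen_mul_pow_le hN 3
  have h₄ : 16 * N ^ 4 ≤ N ^ 5 ∧ 1 ≤ N ^ 4 := sixteen_mul_pow_le hN 4
  have h₅ : 16 * N ^ 5 ≤ N ^ 6 ∧ 1 ≤ N ^ 5 := sixteen_mul_pow_le hN 5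
  have h₆ : 16 * N ^ 6 ≤ N ^ 7 ∧ 1 ≤ N ^ 6 := sixteen_mul_pow_le hN 6
  have h₇ : 16 * N ^ 7 ≤ N ^ 8 ∧ 1 ≤ N ^ 7 := sixteen_mul_pow_le hN 7
  have h₈ : 16 * N ^ 10 ≤ N ^ 11 ∧ 1 ≤ N ^ 10 := sixteen_mul_pow_le hN 10
  have h₉ : N ^ 6 ≤ N ^ 10 := Nat.pow_le_pow_right (by omega) (by omega)
  have hv : ∀ i, ComputesOne (N ^ 2) fun x => (W x * L x) i j := fun i =>
    ComputesEntries.mul_pow hN hM hW hL i j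
  have hz : ∀ i, Decides (N ^ 4) fun x => e * (W x * L x) i j = 0 := fun i =>
    (Decides.eq_zero ((ComputesOne.const e).mul (hv i))).mono (by omega)
  have hall : Decides (N ^ 6) fun x => ∀ i, e * (W x * L x) i j = 0 :=
    Decides.forall_fin hN hM hz
  have hpivot : ∀ p, Decides (N ^ 7) fun x => IsPivot e (fun i => (W x * L x) i j) p := by
    intro p
    have h' : Decides (N ^ 6) fun x => ∀ q < p, e * (W x * L x) q j = 0 := by
      refine Decides.forall_fin hN hM fun q => ?_
      by_cases hq : q < p
      · simpa [hq] using hz q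
      · simpa [hq] using Decides.true.mono h₄.2
    exact ((hz p).not.and h').mono (by omega)
  have hterm : ∀ (p : Fin M × Fin M) (r : Fin M), ComputesOne (N ^ 8) fun x =>
      if IsPivot e (fun i => (W x * L x) i j) r then
        (W x * L x) r j * W x p.1 p.2 - (W x * L x) p.1 j * W x r p.2 else 0 := by
    intro p r
    refine (ComputesOne.ite (hpivot r) (((hv r).mul (hW p.1 p.2)).sub
      ((hv p.1).mul (hW r p.2)))).mono ?_
    omega
  have hentry : ∀ p : Fin M × Fin M, ComputesOne (N ^ 11) fun x =>
      eliminate e (fun i => (W x * L x) i j) (W x) p.1 p.2 := by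
    intro p
    have hsum := ComputesOne.sum (s := (Finset.univ : Finset (Fin M))) fun r _ => hterm p r
    refine (congrArg (ComputesOne _) ?_).mp (((ComputesOne.ite hall (hW p.1 p.2)).add hsum).mono
      (g' := N ^ 11) ?_)
    · funext x
      simp only [eliminate, Matrix.of_apply]
      congr!
    rw [Finset.card_univ, Fintype.card_fin]
    have h' : M * (N ^ 8 + N ^ 8 + 3) ≤ N ^ 10 := mul_le_pow_succ hM (add_three_le_pow hN le_rfl le_rfl)
    have h'' : M * (N ^ 8 + 1) ≤ M * (N ^ 8 + N ^ 8 + 3) := Nat.mul_le_mul_left _ (by omega)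
    omega
  refine (Computes.pi hentry).mono ?_
  rw [Finset.sum_const, Finset.card_univ, Fintype.card_prod, Fintype.card_fin, smul_eq_mul, mul_assoc]
  exact mul_le_pow_succ hM (mul_le_pow_succ hM le_rfl)

lemma computes_rowTransform {N M k : ℕ} (hN : 16 ≤ N) (hM : M ≤ N) (e : R)
    {L : (X → R) → Matrix (Fin M) (Fin k) R} (σ : Fin M → Fin k → X)
    (hL : ∀ x, L x = Matrix.of fun i j => x (σ i j)) (c : ℕ) :
    Computes (N ^ 2 + c * N ^ 13) fun x (p : Fin M × Fin M) => rowTransform e (L x) c p.1 p.2 := by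
  induction c with
  | zero =>
    refine (Computes.pi fun p : Fin M × Fin M =>
      ComputesOne.const (X := X) ((1 : Matrix (Fin M) (Fin M) R) p.1 p.2)).mono ?_
    simp only [Finset.sum_const, Finset.card_univ, Fintype.card_prod, Fintype.card_fin, smul_eq_mul,
      mul_one, zero_mul, add_zero, sq]
    exact Nat.mul_le_mul hM hM
  | succ c ih =>
    by_cases hc : c < k
    · have hstep := computes_eliminate (X := X ⊕ Fin M × Fin M) hN hM e (⟨c, hc⟩ : Fin k)
        (W := fun z => Matrix.of fun i j => z (.inr (i, j)))
        (L := fun z => Matrix.of fun i j => z (.inl (σ i j)))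
        ((ComputesEntries.inputs _).mono (Nat.zero_le _))
        ((ComputesEntries.inputs _).mono (Nat.zero_le _))
      refine (congrArg (Computes _) ?_).mp (((ih.keep (Z := X) id).comp hstep).mono
        (g' := N ^ 2 + (c + 1) * N ^ 13) (by ring_nf; omega))
      funext x p
      rw [rowTransform, dif_pos hc, hL x]
      rfl
    · refine (congrArg (Computes _) ?_).mp (ih.mono (g' := N ^ 2 + (c + 1) * N ^ 13) (by
        ring_nf; omega))
      funext x p
      rw [rowTransform, dif_neg hc]

lemma decides_mem_testGroup {N M k : ℕ} (hN : 16 ≤ N) (hM : M ≤ N) (hk : k ≤ N) (e : R)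
    (σ : Fin M → Fin k → X) (τ : Fin M → X) :
    Decides (N ^ 15) fun x => (fun i => x (τ i)) ∈
      testGroup e (Matrix.of fun (i : Fin M) (j : Fin k) => x (σ i j)) := by
  have h₁ := computes_rowTransform hN hM e σ (fun _ => rfl) k
  have h₂ : Decides (N ^ 6) fun z : X ⊕ Fin M × Fin M → R =>
      ∀ i, e * ∑ j, z (.inr (i, j)) * z (.inl (τ j)) = 0 := by
    refine Decides.forall_fin hN hM fun i => ?_
    have hsum := ComputesOne.sum (s := (Finset.univ : Finset (Fin M))) fun j _ =>
      (ComputesOne.input (R := R) (Sum.inr (i, j) : X ⊕ Fin M × Fin M)).mul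
        (ComputesOne.input (Sum.inl (τ j)))
    refine (Decides.eq_zero ((ComputesOne.const e).mul hsum)).mono ?_
    rw [Finset.card_univ, Fintype.card_fin]
    have e₀ : N ^ 1 = N := pow_one N
    have e₁ : 16 * N ^ 1 ≤ N ^ 2 ∧ 1 ≤ N ^ 1 := sixteen_mul_pow_le hN 1
    have e₂ : 16 * N ^ 2 ≤ N ^ 3 ∧ 1 ≤ N ^ 2 := sixteen_mul_pow_le hN 2
    have e₃ : 16 * N ^ 3 ≤ N ^ 4 ∧ 1 ≤ N ^ 3 := sixteen_mul_pow_le hN 3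
    omega
  refine (congrArg (Decides _) ?_).mp (Decides.mono (Computes.comp (h₁.keep (Z := X) id) h₂)
    (g' := N ^ 15) ?_)
  · rfl
  · have e₁ : k * N ^ 13 ≤ N ^ 14 := mul_le_pow_succ hk le_rfl
    have e₂ : 16 * N ^ 14 ≤ N ^ 15 ∧ 1 ≤ N ^ 14 := sixteen_mul_pow_le hN 14
    have e₃ : N ^ 2 ≤ N ^ 14 := Nat.pow_le_pow_right (by omega) (by omega)
    have e₄ : N ^ 6 ≤ N ^ 14 := Nat.pow_le_pow_right (by omega) (by omega)
    omega

end AttackCircuit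

section Attack

variable {R : Type} [CommRing R] [Fintype R]

/-- Elimination breaks LPN whenever the first `k + 1` entries of the noise vanish: no security level
beyond this probability is possible. -/
lemma pow_le_of_LPNHard [Nontrivial R] {d k t size N : ℕ} {μ adv : ℝ}
    (h : LPNHard R d k t μ size adv) (hd : k + 1 ≤ d) (ht : 0 < t) (hμ₀ : 0 ≤ μ) (hμ₁ : μ < 1)
    (hN : 16 ≤ N) (hkN : k + 1 ≤ N) (htN : t ≤ N) (hsize : N ^ 16 ≤ size) :
    (1 - μ) ^ (k + 1) / 2 ≤ adv := by
  obtain ⟨e, he, hp⟩ := exists_prime_annihilator R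
  have hdec := decides_mem_testGroup (R := R) (X := PairVar (k + 1) k (k + 1) t) hN hkN
    (by omega : k ≤ N) e (fun i j => .inl (i, j)) fun i => .inr (i, ⟨0, ht⟩)
  have hs : N ^ 15 + 2 * ((k + 1) * t) ≤ size := by
    have e₁ : 16 * N ^ 15 ≤ N ^ 16 ∧ 1 ≤ N ^ 15 := sixteen_mul_pow_le hN 15
    have e₂ : (k + 1) * t ≤ N * N := Nat.mul_le_mul hkN htN
    have e₃ : N * N ≤ N ^ 15 := by
      rw [← sq]
      exact Nat.pow_le_pow_right (by omega) (by omega)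
    omega
  have key := (h.shrink hd hμ₀ hμ₁ le_rfl hμ₁.le
    (P := fun M Y => (fun i => Y i ⟨0, ht⟩) ∈ testGroup e M) hdec hs).1
  have hreal : ∀ M : Matrix (Fin (k + 1)) (Fin k) R,
      (Ex (noiseMatrix R (k + 1) t μ) fun Z => Ex (uniformMatrix R k t) fun U =>
        ind ((fun i => (M * U + Z) i ⟨0, ht⟩) ∈ testGroup e M)) =
      Ex (piPMF fun _ : Fin (k + 1) => noise R μ) fun s => ind (s ∈ testGroup e M) := by
    intro M
    rw [← Ex_noiseMatrix_col (⟨0, ht⟩ : Fin t) μ fun s => ind (s ∈ testGroup e M)]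
    refine Ex_congr fun Z => ?_
    refine Eq.trans (Ex_congr fun U => ?_) (Ex_const _ _)
    congr 1
    have hcol : (fun i => (M * U + Z) i ⟨0, ht⟩) =
        M.mulVec (fun j => U j ⟨0, ht⟩) + fun i => Z i ⟨0, ht⟩ := rfl
    rw [hcol, eq_iff_iff]
    exact AddSubgroup.add_mem_cancel_left _ (mulVec_mem_testGroup he hp M _)
  have hideal : ∀ M : Matrix (Fin (k + 1)) (Fin k) R,
      (Ex (uniformMatrix R (k + 1) t) fun U => ind ((fun i => U i ⟨0, ht⟩) ∈ testGroup e M)) =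
        ((testGroup e M).index : ℝ≥0∞)⁻¹ := by
    intro M
    rw [uniformMatrix_eq_noiseMatrix,
      Ex_noiseMatrix_col (⟨0, ht⟩ : Fin t) 1 fun s => ind (s ∈ testGroup e M), noise_one,
      piPMF_uniform]
    exact Ex_uniform_mem_addSubgroup _
  simp only [hreal, hideal] at key
  have hgap : (Ex (uniformMatrix R (k + 1) k) fun M => ((testGroup e M).index : ℝ≥0∞)⁻¹) +
      ENNReal.ofReal ((1 - μ) ^ (k + 1) / 2) ≤
      Ex (uniformMatrix R (k + 1) k) fun M =>
        Ex (piPMF fun _ : Fin (k + 1) => noise R μ) fun s => ind (s ∈ testGroup e M) := by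
    rw [← Ex_const (uniformMatrix R (k + 1) k) (ENNReal.ofReal ((1 - μ) ^ (k + 1) / 2)), ← Ex_add]
    exact Ex_mono fun M => Ex_noise_mem_ge hμ₀ hμ₁.le (testGroup_ne_top he hp M (by omega))
  have hfin : (Ex (uniformMatrix R (k + 1) k) fun M => ((testGroup e M).index : ℝ≥0∞)⁻¹) ≠ ∞ := by
    refine ne_top_of_le_ne_top ENNReal.one_ne_top (Ex_le_of_le fun M => ?_)
    rw [ENNReal.inv_le_one]
    have : (testGroup e M).index ≠ 0 := AddSubgroup.index_ne_zero_of_finite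
    exact_mod_cast (by omega : 1 ≤ (testGroup e M).index)
  have h₁ := (ENNReal.add_le_add_iff_left hfin).mp (hgap.trans key)
  have h₂ : 0 < (1 - μ) ^ (k + 1) / 2 := by
    have : 0 < 1 - μ := by linarith
    positivity
  rcases le_or_gt 0 adv with hadv | hadv
  · exact (ENNReal.ofReal_le_ofReal_iff hadv).mp h₁
  · rw [ENNReal.ofReal_of_nonpos hadv.le, nonpos_iff_eq_zero, ENNReal.ofReal_eq_zero] at h₁
    linarith

end Attack

/-! ### The number of checks -/

section Checks

variable {R : Type} [CommRing R] [Fintype R] {sq : ℕ → ℕ} {δ ε : ℝ} {lam n t size : ℕ}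

/-- The elimination attack bounds the security of LPN by the probability that `n_d + 1` noise
entries vanish, so that the security parameter `λ` is at most of the order of `n_d ^ ε`. -/
lemma bits_le [Nontrivial R] (hδ₀ : 0 < δ) (hδ₁ : δ < 1) (hε : ε < 1)
    (h : LPNAssumption R δ ε) {Z : ℕ} (hZ : 4 ≤ Z) (ht : 0 < t) (htZ : t ≤ Z) (hnZ : n ≤ Z)
    (hsize : Z ^ 32 ≤ size) (hd : 0 < (params R sq δ ε lam n t size).depth) :
    lam + Real.logb 2 (levels δ n) ≤
      1 / (Real.log 2 * (1 - 2 ^ (ε - 1))) *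
        ((lastDim R δ ε lam n t size : ℝ) + 1) ^ ε := by
  set F := lastDim R δ ε lam n t size with hF
  have h5 : 5 ≤ F := five_le_lastDim hδ₀ hδ₁
  have hD := one_le_levels hδ₀ hδ₁ hd
  have hFn : F < n := lt_of_depthOf_pos hd
  obtain ⟨k, hk⟩ := Nat.exists_eq_succ_of_ne_zero hd.ne'
  have hk' : depthOf δ F n = k + 1 := hk
  have h₁ : F < dims δ F n k := lt_dims_of_lt (by omega)
  have h₂ : dims δ F n (k + 1) = F :=
    le_antisymm (hk' ▸ dims_depthOf_le hδ₁ lastDim_ge) (le_dims_succ k)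
  have h₃ : F + 1 ≤ ⌊(F : ℝ) / δ⌋₊ := by
    have := dims_le_floor (F := F) (n := n) hδ₀ k
    rw [h₂] at this
    omega
  have h₃' : (F : ℝ) + 1 ≤ ⌊(F : ℝ) / δ⌋₊ := by exact_mod_cast h₃
  have hF5 : (5 : ℝ) ≤ F := by exact_mod_cast h5
  -- LPN is secure for the subspace dimension `n_d`, in a dimension that leaves room for the attack.
  have hLPN := (isLeast_iota hδ₀ hδ₁ h t size).1.2 F iota_le_lastDim
  set μ : ℝ := (⌊(F : ℝ) / δ⌋₊ : ℝ) ^ (ε - 1) with hμ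
  have hμ₁ : μ ≤ ((F : ℝ) + 1) ^ (ε - 1) :=
    Real.rpow_le_rpow_of_nonpos (by linarith) h₃' (by linarith)
  have hμ₂ : μ ≤ 2 ^ (ε - 1) :=
    Real.rpow_le_rpow_of_nonpos (by norm_num) (by linarith) (by linarith)
  have h2 : (2 : ℝ) ^ (ε - 1) < 1 :=
    Real.rpow_lt_one_of_one_lt_of_neg (by norm_num) (by linarith)
  have hμ₀ : 0 ≤ μ := by positivity
  have hZZ : 4 * Z ≤ Z ^ 2 := by
    rw [pow_two]
    exact Nat.mul_le_mul_right _ hZ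
  have key := pow_le_of_LPNHard (N := Z ^ 2) hLPN h₃ ht hμ₀ (by linarith) (by omega) (by omega)
    (by omega) (by rw [← pow_mul]; exact hsize)
  have e : (2 : ℝ) ^ (-lpnBits δ lam n) = 2 ^ (-(lam + Real.logb 2 (levels δ n))) / 2 := by
    rw [lpnBits, neg_add, Real.rpow_add (by norm_num), Real.rpow_neg_one]
    rfl
  rw [e, div_le_div_iff_of_pos_right (by norm_num)] at key
  have h1μ : 0 < 1 - μ := by linarith
  have key₂ := Real.log_le_log (by positivity) key
  rw [Real.log_pow, Real.log_rpow (by norm_num)] at key₂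
  -- `1 - μ` is bounded away from `0`, so that its logarithm is of the order of `-μ`.
  have h₆ : -Real.log (1 - μ) ≤ μ / (1 - 2 ^ (ε - 1)) := by
    have := Real.one_sub_inv_le_log_of_pos h1μ
    have h₇ : (1 - μ)⁻¹ - 1 = μ / (1 - μ) := by
      field_simp
      ring
    have h₈ : μ / (1 - μ) ≤ μ / (1 - 2 ^ (ε - 1)) :=
      div_le_div_of_nonneg_left hμ₀ (by linarith) (by linarith)
    linarith
  have hl2 : 0 < Real.log 2 := Real.log_pos (by norm_num)
  have h₉ : (lam + Real.logb 2 (levels δ n)) * Real.log 2 ≤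
      ((F : ℝ) + 1) * (((F : ℝ) + 1) ^ (ε - 1) / (1 - 2 ^ (ε - 1))) := by
    have h₁₀ : μ / (1 - 2 ^ (ε - 1)) ≤ ((F : ℝ) + 1) ^ (ε - 1) / (1 - 2 ^ (ε - 1)) :=
      div_le_div_of_nonneg_right hμ₁ (by linarith)
    have h₁₁ := mul_le_mul_of_nonneg_left (h₆.trans h₁₀) (by linarith : (0 : ℝ) ≤ F + 1)
    push_cast at key₂
    nlinarith
  have h₁₂ : ((F : ℝ) + 1) ^ ε = ((F : ℝ) + 1) * ((F : ℝ) + 1) ^ (ε - 1) := by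
    rw [Real.rpow_sub_one (by linarith)]
    field_simp
  rw [h₁₂, div_mul_eq_mul_div, one_mul, le_div_iff₀ (by nlinarith)]
  have h13 : 0 < 1 - (2 : ℝ) ^ (ε - 1) := by linarith
  rw [mul_div_assoc', le_div_iff₀ h13] at h₉
  linarith

/-- The number of checks is of the order of `n_i ^ ε` at every level `i`. -/
lemma checks_le_rpow [Nontrivial R] (hδ₀ : 0 < δ) (hδ₁ : δ < 1) (hε₀ : 0 < ε) (hε : ε < 1)
    (h : LPNAssumption R δ ε) {Z : ℕ} (hZ : 4 ≤ Z) (ht : 0 < t) (htZ : t ≤ Z) (hnZ : n ≤ Z)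
    (hsize : Z ^ 32 ≤ size) {i : ℕ} (hi : i < (params R sq δ ε lam n t size).depth) :
    ((params R sq δ ε lam n t size).checks : ℝ) ≤
      (1 / (Real.log 2 * (1 - 2 ^ (ε - 1))) + 1) *
        ((params R sq δ ε lam n t size).dim i : ℝ) ^ ε := by
  have hd : 0 < (params R sq δ ε lam n t size).depth := by omega
  have hb := bits_le (sq := sq) hδ₀ hδ₁ hε h hZ ht htZ hnZ hsize hd
  have h2 : (2 : ℝ) ^ (ε - 1) < 1 :=
    Real.rpow_lt_one_of_one_lt_of_neg (by norm_num) (by linarith)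
  have h13 : 0 < 1 - (2 : ℝ) ^ (ε - 1) := by linarith
  have hl2 : 0 < Real.log 2 := Real.log_pos (by norm_num)
  have h₁ : lastDim R δ ε lam n t size + 1 ≤ (params R sq δ ε lam n t size).dim i :=
    lt_dims_of_lt hi
  have h₁' : (lastDim R δ ε lam n t size : ℝ) + 1 ≤ (params R sq δ ε lam n t size).dim i := by
    exact_mod_cast h₁
  have h₂ : ((lastDim R δ ε lam n t size : ℝ) + 1) ^ ε ≤
      ((params R sq δ ε lam n t size).dim i : ℝ) ^ ε :=
    Real.rpow_le_rpow (by positivity) h₁' hε₀.le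
  have h₃ : 1 ≤ ((params R sq δ ε lam n t size).dim i : ℝ) ^ ε :=
    Real.one_le_rpow (by linarith [Nat.cast_nonneg (α := ℝ) (lastDim R δ ε lam n t size)]) hε₀.le
  have hlog := Real.logb_nonneg (b := 2) (by norm_num) (one_le_levels hδ₀ hδ₁ hd)
  have h₄ := one_le_logb_minIdealCard R
  have h₅ : (lam + Real.logb 2 (levels δ n)) / Real.logb 2 (minIdealCard R) ≤
      lam + Real.logb 2 (levels δ n) := div_le_self (by positivity) h₄
  have h₆ : ((params R sq δ ε lam n t size).checks : ℝ) <
      (lam + Real.logb 2 (levels δ n)) / Real.logb 2 (minIdealCard R) + 1 :=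
    Nat.ceil_lt_add_one (by positivity)
  have h₇ := mul_le_mul_of_nonneg_left h₂
    (by positivity : 0 ≤ 1 / (Real.log 2 * (1 - (2 : ℝ) ^ (ε - 1))))
  linarith

end Checks

/-! ### The cost of rectangular products -/

section Products

/-- The order of the cost of an `x × y` by `y × z` product, `x y z min (x, y, z) ^ (ω - 3)`. As a
maximum of three monomials it is visibly monotone in the three dimensions. -/
def mm (ω x y z : ℝ) : ℝ :=
  max (x ^ (ω - 2) * y * z) (max (x * y ^ (ω - 2) * z) (x * y * z ^ (ω - 2)))

variable {ω x y z x' y' z' : ℝ}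

lemma mm_mono (hω : 2 ≤ ω) (hx : 0 ≤ x) (hy : 0 ≤ y) (hz : 0 ≤ z) (hx' : x ≤ x') (hy' : y ≤ y')
    (hz' : z ≤ z') : mm ω x y z ≤ mm ω x' y' z' := by
  have h : 0 ≤ ω - 2 := by linarith
  have h₁ : 0 ≤ x' := by linarith
  have h₂ : 0 ≤ y' := by linarith
  have h₃ : 0 ≤ z' := by linarith
  unfold mm
  gcongr

/-- A smaller base gains more from the exponent `1` in exchange for the exponent `ω - 2 ≤ 1`. -/
lemma rpow_mul_le_mul_rpow (hω' : ω ≤ 3) (hy : 0 ≤ y) (hxy : y ≤ x) :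
    x ^ (ω - 2) * y ≤ x * y ^ (ω - 2) := by
  rcases hy.eq_or_lt with rfl | hy
  · rw [mul_zero]
    positivity
  · have hx : 0 < x := by linarith
    have h₁ : x ^ (ω - 3) ≤ y ^ (ω - 3) := Real.rpow_le_rpow_of_nonpos hy hxy (by linarith)
    have h₂ : x ^ (ω - 2) = x * x ^ (ω - 3) := by
      rw [mul_comm, ← Real.rpow_add_one hx.ne']
      ring_nf
    have h₃ : y ^ (ω - 2) = y * y ^ (ω - 3) := by
      rw [mul_comm, ← Real.rpow_add_one hy.ne']
      ring_nf
    rw [h₂, h₃]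
    nlinarith [mul_pos hx hy]

lemma mm_swap₁₂ : mm ω x y z = mm ω y x z := by
  unfold mm
  rw [max_left_comm]
  ring_nf

lemma mm_swap₂₃ : mm ω x y z = mm ω x z y := by
  unfold mm
  rw [max_comm (x * y ^ (ω - 2) * z)]
  ring_nf

lemma mm_eq (hω' : ω ≤ 3) (hz : 0 ≤ z) (hx : z ≤ x) (hy : z ≤ y) :
    mm ω x y z = x * y * z ^ (ω - 2) := by
  have h₁ := rpow_mul_le_mul_rpow hω' hz hx
  have h₂ := rpow_mul_le_mul_rpow hω' hz hy
  unfold mm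
  rw [max_eq_right (le_max_of_le_right _), max_eq_right]
  · nlinarith
  · nlinarith

lemma mm_nonneg (hx : 0 ≤ x) (hy : 0 ≤ y) (hz : 0 ≤ z) : 0 ≤ mm ω x y z :=
  le_max_of_le_left (by positivity)

lemma rpow_le_self_of_one_le (hω' : ω ≤ 3) (hx : 1 ≤ x) : x ^ (ω - 2) ≤ x := by
  calc x ^ (ω - 2) ≤ x ^ (1 : ℝ) := Real.rpow_le_rpow_of_exponent_le hx (by linarith)
    _ = x := Real.rpow_one x

lemma mm_le_mul (hω' : ω ≤ 3) (hx : 1 ≤ x) (hy : 1 ≤ y) (hz : 1 ≤ z) :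
    mm ω x y z ≤ x * y * z := by
  have h₁ := rpow_le_self_of_one_le hω' hx
  have h₂ := rpow_le_self_of_one_le hω' hy
  have h₃ := rpow_le_self_of_one_le hω' hz
  unfold mm
  refine max_le ?_ (max_le ?_ ?_) <;> gcongr

lemma mm_natCast_eq (hω' : ω ≤ 3) {a b c : ℕ} (ha : 1 ≤ a) (hb : 1 ≤ b) (hc : 1 ≤ c) :
    mm ω a b c = a * b * c * ((min a (min b c) : ℕ) : ℝ) ^ (ω - 3) := by
  have key : ∀ x y z : ℕ, 1 ≤ z → z ≤ x → z ≤ y →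
      mm ω x y z = x * y * z * (z : ℝ) ^ (ω - 3) := by
    intro x y z hz hx hy
    rw [mm_eq hω' (by positivity) (by exact_mod_cast hx) (by exact_mod_cast hy), mul_assoc (_ * _),
      mul_comm (z : ℝ), ← Real.rpow_add_one (by positivity)]
    ring_nf
  by_cases h₁ : c ≤ a ∧ c ≤ b
  · rw [key a b c hc h₁.1 h₁.2, show min a (min b c) = c by omega]
  · by_cases h₂ : b ≤ a ∧ b ≤ c
    · rw [mm_swap₂₃, key a c b hb h₂.1 h₂.2, show min a (min b c) = b by omega]
      ring
    · rw [mm_swap₁₂, mm_swap₂₃, key b c a ha (by omega) (by omega),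
        show min a (min b c) = a by omega]
      ring

lemma blocks_le {a r : ℕ} (hr : 1 ≤ r) (ha : r ≤ a) :
    (((a + r - 1) / r : ℕ) : ℝ) ≤ 2 * a / r := by
  refine Nat.cast_div_le.trans ?_
  have h : a + r - 1 ≤ 2 * a := by omega
  have h' : ((a + r - 1 : ℕ) : ℝ) ≤ 2 * a := by exact_mod_cast h
  gcongr

lemma le_blocks {a r : ℕ} (hr : 1 ≤ r) : (a : ℝ) / r ≤ ((a + r - 1) / r : ℕ) := by
  rw [div_le_iff₀ (by positivity)]
  have h := Nat.div_add_mod (a + r - 1) r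
  have h' := Nat.mod_lt (a + r - 1) (by omega : 0 < r)
  have : a ≤ (a + r - 1) / r * r := by
    rw [mul_comm]
    omega
  exact_mod_cast this

lemma mulCost_eq_zero (sq : ℕ → ℕ) {a b c : ℕ} (h : ¬(1 ≤ a ∧ 1 ≤ b ∧ 1 ≤ c)) :
    mulCost sq a b c = 0 := by
  have : min a (min b c) = 0 := by omega
  simp [mulCost, this]

variable {sq : ℕ → ℕ} {c₁ c₂ : ℝ}

lemma mulCost_le_mm (hω : 2 ≤ ω) (hω' : ω ≤ 3) (hc₂ : 0 ≤ c₂)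
    (hsq : ∀ k : ℕ, 1 ≤ k → (sq k : ℝ) ≤ c₂ * (k : ℝ) ^ ω) (a b c : ℕ) :
    (mulCost sq a b c : ℝ) ≤ 8 * (c₂ + 1) * mm ω a b c := by
  by_cases h : 1 ≤ a ∧ 1 ≤ b ∧ 1 ≤ c
  swap
  · rw [mulCost_eq_zero sq h, Nat.cast_zero]
    have := mm_nonneg (ω := ω) (Nat.cast_nonneg (α := ℝ) a) (Nat.cast_nonneg (α := ℝ) b)
      (Nat.cast_nonneg (α := ℝ) c)
    positivity
  · obtain ⟨ha, hb, hc⟩ := h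
    rw [mm_natCast_eq hω' ha hb hc]
    unfold mulCost
    set r := min a (min b c) with hr
    have hr1 : 1 ≤ r := by omega
    have hr0 : (0 : ℝ) < r := by exact_mod_cast hr1
    have hr1' : (1 : ℝ) ≤ r := by exact_mod_cast hr1
    have e₁ := blocks_le hr1 (by omega : r ≤ a)
    have e₂ := blocks_le hr1 (by omega : r ≤ b)
    have e₃ := blocks_le hr1 (by omega : r ≤ c)
    have e₄ : (sq r : ℝ) + (r : ℝ) ^ 2 ≤ (c₂ + 1) * (r : ℝ) ^ ω := by
      have h₁ := hsq r hr1
      have h₂ : (r : ℝ) ^ 2 ≤ (r : ℝ) ^ ω := by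
        rw [← Real.rpow_two]
        exact Real.rpow_le_rpow_of_exponent_le hr1' hω
      linarith
    have e₅ : (r : ℝ) ^ ω = (r : ℝ) ^ (ω - 3) * r ^ 3 := by
      rw [← Real.rpow_natCast, ← Real.rpow_add hr0]
      norm_num
    simp only
    push_cast
    calc _ ≤ (2 * a / r) * (2 * b / r) * (2 * c / r) * ((c₂ + 1) * (r : ℝ) ^ ω) := by gcongr
      _ = _ := by
        rw [e₅]
        field_simp
        ring

lemma mm_le_mulCost (hω' : ω ≤ 3) (hc₁ : 0 ≤ c₁)
    (hsq : ∀ k : ℕ, 1 ≤ k → c₁ * (k : ℝ) ^ ω ≤ sq k) {a b c : ℕ} (ha : 1 ≤ a) (hb : 1 ≤ b)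
    (hc : 1 ≤ c) : c₁ * mm ω a b c ≤ mulCost sq a b c := by
  rw [mm_natCast_eq hω' ha hb hc]
  unfold mulCost
  set r := min a (min b c) with hr
  have hr1 : 1 ≤ r := by omega
  have hr0 : (0 : ℝ) < r := by exact_mod_cast hr1
  have e₁ := le_blocks (a := a) hr1
  have e₂ := le_blocks (a := b) hr1
  have e₃ := le_blocks (a := c) hr1
  have e₄ : c₁ * (r : ℝ) ^ ω ≤ (sq r : ℝ) + (r : ℝ) ^ 2 := by
    have := hsq r hr1
    nlinarith [pow_two_nonneg (r : ℝ)]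
  have e₅ : (r : ℝ) ^ ω = (r : ℝ) ^ (ω - 3) * r ^ 3 := by
    rw [← Real.rpow_natCast, ← Real.rpow_add hr0]
    norm_num
  simp only
  push_cast
  calc _ = ((a : ℝ) / r) * (b / r) * (c / r) * (c₁ * (r : ℝ) ^ ω) := by
        rw [e₅]
        field_simp
    _ ≤ _ := by gcongr

end Products

/-! ### The sizes that determine the costs -/

section Sizes

lemma sum_le_of_geometric {x : ℕ → ℝ} {θ : ℝ} {d : ℕ} (hx : ∀ i, 0 ≤ x i) (hθ₀ : 0 ≤ θ)
    (hθ₁ : θ < 1) (h : ∀ i, i + 1 < d → x (i + 1) ≤ θ * x i) :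
    ∑ i ∈ Finset.range d, x i ≤ 1 / (1 - θ) * x 0 := by
  have h₁ : ∀ i < d, x i ≤ θ ^ i * x 0 := by
    intro i hi
    induction i with
    | zero => simp
    | succ i ih =>
      have := mul_le_mul_of_nonneg_left (ih (by omega)) hθ₀
      rw [pow_succ']
      linarith [h i hi]
  calc ∑ i ∈ Finset.range d, x i ≤ ∑ i ∈ Finset.range d, θ ^ i * x 0 :=
        Finset.sum_le_sum fun i hi => h₁ i (Finset.mem_range.mp hi)
    _ = (∑ i ∈ Finset.range d, θ ^ i) * x 0 := by rw [Finset.sum_mul]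
    _ ≤ _ := by
      refine mul_le_mul_of_nonneg_right ?_ (hx 0)
      rw [le_div_iff₀ (by linarith), geom_sum_mul_neg]
      linarith [pow_nonneg hθ₀ d]

/-- What the cost estimates use about the parameters: up to the constant `B`, sums over all levels
are bounded by their first terms. -/
structure CostBounds (P : Params) (n : ℕ) (δ ε ν ω B : ℝ) : Prop where
  one_le : 1 ≤ B
  δ_pos : 0 < δ
  δ_lt : δ < 1
  ε_pos : 0 < ε
  ε_lt : ε < 1
  two_le : 2 ≤ ω
  le_three : ω ≤ 3
  one_le_ν : 1 ≤ ν
  n_pos : 1 ≤ n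
  dim_zero : P.dim 0 = n
  dim_pos : ∀ i, 1 ≤ P.dim i
  dim_le : ∀ i ≤ P.depth, P.dim i ≤ n
  dim_succ_le : ∀ i < P.depth, P.dim (i + 1) ≤ P.dim i
  depth_le_dim : ∀ i ≤ P.depth, P.dim P.depth ≤ P.dim i
  rate_eq : ∀ i, P.rate i = (P.dim i : ℝ) ^ (ε - 1)
  dim_depth_le : (P.dim P.depth : ℝ) ≤ B * ν
  sum_dim : ∑ i ∈ Finset.range P.depth, (P.dim i : ℝ) ≤ B * n
  sum_dim_succ : ∑ i ∈ Finset.range P.depth, (P.dim (i + 1) : ℝ) ≤ B * (δ * n)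
  sum_rpow : ∑ i ∈ Finset.range P.depth, (P.dim i : ℝ) ^ ε ≤ B * (n : ℝ) ^ ε
  depth_mul_checks : (P.depth : ℝ) * P.checks ≤ B * (n : ℝ) ^ ε
  one_le_δ : 1 ≤ B * (δ * n)
  mulCost_le : ∀ a b c, (mulCost P.sq a b c : ℝ) ≤ B * mm ω a b c

/-- The constant in `CostBounds`; `b` bounds the number of checks and `c` the cost of products. -/
def boundConst (δ₀ ε κ b c : ℝ) : ℝ :=
  1 + 3 / (1 - δ₀) + 5 * κ / (1 - δ₀) + (b + 1) * (1 / (1 - ((1 + 3 * δ₀) / 4) ^ ε)) + 8 * (c + 1) +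
    κ

variable {R : Type} [CommRing R] [Fintype R] {sq : ℕ → ℕ} {δ ε δ₀ κ ω c₂ : ℝ}
  {lam n t size : ℕ}

lemma one_le_nu (hδ₀ : 0 < δ) (hδ₁ : δ < 1) (h : LPNAssumption R δ ε) :
    1 ≤ nu R δ ε lam n t size := by
  refine le_trans ?_ (le_max_right _ _)
  exact_mod_cast (isLeast_iota hδ₀ hδ₁ h t size).1.1

lemma lastDim_le (hδ₀ : 0 < δ) (hδ : δ ≤ δ₀) (hδ₁ : δ₀ < 1) (h : LPNAssumption R δ ε) :
    (lastDim R δ ε lam n t size : ℝ) ≤ 5 / (1 - δ₀) * nu R δ ε lam n t size := by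
  have hν := one_le_nu (lam := lam) (n := n) (t := t) (size := size) hδ₀ (by linarith) h
  have h1 : 0 < 1 - δ₀ := by linarith
  have h₁ : 1 ≤ 1 / (1 - δ₀) := by
    rw [le_div_iff₀ h1]
    linarith
  have h₂ : 5 / (1 - δ₀) = 5 * (1 / (1 - δ₀)) := by ring
  have h₃ : 4 / (1 - δ) ≤ 4 * (1 / (1 - δ₀)) := by
    rw [mul_one_div]
    exact div_le_div_of_nonneg_left (by norm_num) h1 (by linarith)
  have h₄ := Nat.ceil_lt_add_one (a := nu R δ ε lam n t size) (by linarith)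
  have h₅ := Nat.ceil_lt_add_one (a := 4 / (1 - δ)) (div_nonneg (by norm_num) (by linarith))
  unfold lastDim
  rw [Nat.cast_max, h₂]
  refine max_le ?_ ?_ <;> nlinarith

lemma dims_succ_le_mul {F i : ℕ} (hδ₀ : 0 < δ) (hδ : δ ≤ δ₀) (hδ₁ : δ₀ < 1)
    (hF : 4 / (1 - δ) ≤ F) (hi : i + 1 < depthOf δ F n) :
    (dims δ F n (i + 1) : ℝ) ≤ (1 + 3 * δ₀) / 4 * dims δ F n i ∧
      (dims δ F n (i + 1) : ℝ) ≤ 5 / 4 * δ * dims δ F n i := by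
  have h₁ := lt_dims_of_lt hi
  have h₂ : (F : ℝ) < dims δ F n i := by
    exact_mod_cast lt_dims_of_lt (by omega : i < depthOf δ F n)
  have hδ1 : 0 < 1 - δ := by linarith
  have h₃ : dims δ F n (i + 1) = ⌈δ * dims δ F n i⌉₊ := by
    rw [dims_succ, lt_max_iff] at h₁
    rw [dims_succ, max_eq_left]
    rcases h₁ with h₁ | h₁ <;> omega
  have h₄ := Nat.ceil_lt_add_one (a := δ * dims δ F n i) (by positivity)
  rw [← h₃] at h₄
  have h₅ : (F : ℝ) + 1 ≤ dims δ F n (i + 1) := by exact_mod_cast h₁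
  have h₆ := (div_le_iff₀ hδ1).mp hF
  have h₇ : (0 : ℝ) ≤ F := by positivity
  constructor
  · nlinarith
  · nlinarith

lemma costBounds_params [Nontrivial R] (hω : 2 ≤ ω) (hω' : ω ≤ 3) (hε₀ : 0 < ε) (hε : ε < 1)
    (hδ₀ : 0 < δ) (hδ : δ ≤ δ₀) (hδ₁ : δ₀ < 1) (hκ : 1 ≤ κ) (h : LPNAssumption R δ ε)
    (hc₂ : 0 ≤ c₂) (hsq : ∀ k : ℕ, 1 ≤ k → (sq k : ℝ) ≤ c₂ * (k : ℝ) ^ ω)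
    {Z : ℕ} (hZ : 4 ≤ Z) (ht : 0 < t) (htZ : t ≤ Z) (hn : 1 ≤ n) (hnZ : n ≤ Z)
    (hsize : Z ^ 32 ≤ size) (hν : nu R δ ε lam n t size ≤ κ * (δ * n)) :
    CostBounds (params R sq δ ε lam n t size) n δ ε (nu R δ ε lam n t size) ω
      (boundConst δ₀ ε κ (1 / (Real.log 2 * (1 - 2 ^ (ε - 1))) + 1) c₂) := by
  have hδ1 : δ < 1 := by linarith
  set F := lastDim R δ ε lam n t size with hF
  set P := params R sq δ ε lam n t size with hP
  have hdep : P.depth = depthOf δ F n := rfl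
  have hdim : P.dim = dims δ F n := rfl
  have hF4 : 4 / (1 - δ) ≤ F := lastDim_ge
  have hF5 : 5 ≤ F := five_le_lastDim hδ₀ hδ1
  have h1 : 0 < 1 - δ₀ := by linarith
  set θ := (1 + 3 * δ₀) / 4 with hθ
  have hθ₀ : 0 < θ := by
    rw [hθ]
    linarith
  have hθ₁ : θ < 1 := by
    rw [hθ]
    linarith
  have hθε : θ ^ ε < 1 := Real.rpow_lt_one hθ₀.le hθ₁ hε₀
  have h2 : (2 : ℝ) ^ (ε - 1) < 1 :=
    Real.rpow_lt_one_of_one_lt_of_neg (by norm_num) (by linarith)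
  have h13 : 0 < 1 - (2 : ℝ) ^ (ε - 1) := by linarith
  have hl2 : 0 < Real.log 2 := Real.log_pos (by norm_num)
  set b := 1 / (Real.log 2 * (1 - 2 ^ (ε - 1))) + 1 with hb
  have hb0 : 0 ≤ b := by positivity
  set g := 1 / (1 - θ ^ ε) with hg
  have hg0 : 0 ≤ g := div_nonneg zero_le_one (by linarith)
  set B := boundConst δ₀ ε κ b c₂ with hB
  have hBdef : B = 1 + 3 / (1 - δ₀) + 5 * κ / (1 - δ₀) + (b + 1) * g + 8 * (c₂ + 1) + κ := rfl
  have p₁ : 0 ≤ 3 / (1 - δ₀) := by positivity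
  have p₂ : 0 ≤ 5 * κ / (1 - δ₀) := by positivity
  have p₃ : 0 ≤ (b + 1) * g := by positivity
  have p₄ : 0 ≤ b * g := by positivity
  have p₅ : (b + 1) * g = b * g + g := by ring
  have hn0 : (0 : ℝ) ≤ n := by positivity
  have hνF := lastDim_le (lam := lam) (n := n) (t := t) (size := size) hδ₀ hδ hδ₁ h
  have hν1 := one_le_nu (lam := lam) (n := n) (t := t) (size := size) hδ₀ hδ1 h
  set ν := nu R δ ε lam n t size with hνdef
  have hlast : (P.dim P.depth : ℝ) ≤ F := by exact_mod_cast dims_depthOf_le hδ1 hF4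
  have q₁ : 5 / (1 - δ₀) ≤ 5 * κ / (1 - δ₀) := by
    gcongr
    linarith
  have hlast₁ : (P.dim P.depth : ℝ) ≤ 5 / (1 - δ₀) * ν := hlast.trans hνF
  have hlast₂ : (P.dim P.depth : ℝ) ≤ 5 * κ / (1 - δ₀) * (δ * n) := by
    refine hlast₁.trans ?_
    have : 5 * κ / (1 - δ₀) * (δ * n) = 5 / (1 - δ₀) * (κ * (δ * n)) := by ring
    rw [this]
    gcongr
  have hgeo : ∀ i, i + 1 < P.depth → (P.dim (i + 1) : ℝ) ≤ θ * P.dim i ∧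
      (P.dim (i + 1) : ℝ) ≤ 5 / 4 * δ * P.dim i := fun i hi =>
    dims_succ_le_mul hδ₀ hδ hδ₁ hF4 hi
  have hδn : 0 < δ * n := by
    have : (0 : ℝ) < n := by exact_mod_cast hn
    positivity
  have s₁ : ∑ i ∈ Finset.range P.depth, (P.dim i : ℝ) ≤ 2 / (1 - δ₀) * n := by
    have := sum_le_of_geometric (x := fun i => (P.dim i : ℝ)) (d := P.depth)
      (fun i => by positivity) hθ₀.le hθ₁ fun i hi => (hgeo i hi).1
    refine this.trans (mul_le_mul_of_nonneg_right ?_ hn0)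
    rw [div_le_div_iff₀ (by linarith) h1, hθ]
    linarith
  have s₂ : ∑ i ∈ Finset.range P.depth, (P.dim i : ℝ) ^ ε ≤ g * (n : ℝ) ^ ε := by
    have := sum_le_of_geometric (x := fun i => (P.dim i : ℝ) ^ ε) (d := P.depth) (θ := θ ^ ε)
      (fun i => by positivity) (by positivity) hθε fun i hi => by
        rw [← Real.mul_rpow hθ₀.le (by positivity)]
        exact Real.rpow_le_rpow (by positivity) (hgeo i hi).1 hε₀.le
    exact this
  refine ⟨by linarith, hδ₀, hδ1, hε₀, hε, hω, hω', hν1, hn, rfl, fun i => ?_, fun i hi => ?_,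
    fun i hi => (dims_succ_lt hδ1 hF4 (lt_dims_of_lt hi)).le, fun i hi => ?_, fun i => rfl, ?_, ?_,
    ?_, ?_, ?_, ?_, fun a b c => ?_⟩
  · rw [hdim]
    cases i with
    | zero => exact hn
    | succ i => exact le_trans (by omega) (le_dims_succ i)
  · have := dims_add_le hδ1 hF4 hi
    rw [hdim]
    omega
  · rw [hdim]
    rcases hi.eq_or_lt with rfl | hi
    · exact le_rfl
    · exact (dims_depthOf_le hδ1 hF4).trans (lt_dims_of_lt hi).le
  · refine hlast₁.trans (mul_le_mul_of_nonneg_right ?_ (by linarith))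
    linarith
  · refine s₁.trans (mul_le_mul_of_nonneg_right ?_ hn0)
    have : 2 / (1 - δ₀) = 2 / 3 * (3 / (1 - δ₀)) := by ring
    linarith
  -- The last dimension is not `δ` times the one before; it is bounded through `ν ≤ κ δ n`.
  · rcases hd : P.depth with _ | d
    · rw [Finset.sum_range_zero]
      have : 0 ≤ B := by linarith
      positivity
    · rw [Finset.sum_range_succ, ← hd]
      have r₁ : ∑ i ∈ Finset.range d, (P.dim (i + 1) : ℝ) ≤ 5 / 4 * δ * (2 / (1 - δ₀) * n) := by
        calc _ ≤ ∑ i ∈ Finset.range d, 5 / 4 * δ * (P.dim i : ℝ) :=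
              Finset.sum_le_sum fun i hi =>
                (hgeo i (by have := Finset.mem_range.mp hi; omega)).2
          _ = 5 / 4 * δ * ∑ i ∈ Finset.range d, (P.dim i : ℝ) := by rw [Finset.mul_sum]
          _ ≤ _ := by
            refine mul_le_mul_of_nonneg_left (le_trans ?_ s₁) (by positivity)
            exact Finset.sum_le_sum_of_subset_of_nonneg
              (Finset.range_subset_range.mpr (by omega)) fun i _ _ => by positivity
      have r₂ : 5 / 4 * δ * (2 / (1 - δ₀) * n) = 5 / 4 * (2 / (1 - δ₀)) * (δ * n) := by ring
      rw [r₂] at r₁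
      have r₄ : 5 / 4 * (2 / (1 - δ₀)) + 5 * κ / (1 - δ₀) ≤ B := by
        have : 5 / 4 * (2 / (1 - δ₀)) = 5 / 6 * (3 / (1 - δ₀)) := by ring
        linarith
      calc _ ≤ (5 / 4 * (2 / (1 - δ₀)) + 5 * κ / (1 - δ₀)) * (δ * n) := by linarith
        _ ≤ _ := mul_le_mul_of_nonneg_right r₄ hδn.le
  · refine s₂.trans (mul_le_mul_of_nonneg_right ?_ (by positivity))
    linarith
  · calc (P.depth : ℝ) * P.checks = ∑ i ∈ Finset.range P.depth, (P.checks : ℝ) := by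
          rw [Finset.sum_const, Finset.card_range, nsmul_eq_mul]
      _ ≤ ∑ i ∈ Finset.range P.depth, b * (P.dim i : ℝ) ^ ε :=
          Finset.sum_le_sum fun i hi =>
            checks_le_rpow hδ₀ hδ1 hε₀ hε h hZ ht htZ hnZ hsize (Finset.mem_range.mp hi)
      _ = b * ∑ i ∈ Finset.range P.depth, (P.dim i : ℝ) ^ ε := by rw [Finset.mul_sum]
      _ ≤ b * (g * (n : ℝ) ^ ε) := mul_le_mul_of_nonneg_left s₂ hb0
      _ ≤ _ := by
        rw [← mul_assoc]
        refine mul_le_mul_of_nonneg_right ?_ (by positivity)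
        linarith
  · refine (hν1.trans hν).trans (mul_le_mul_of_nonneg_right ?_ hδn.le)
    linarith
  · refine (mulCost_le_mm hω hω' hc₂ hsq a b c).trans (mul_le_mul_of_nonneg_right ?_ ?_)
    · linarith
    · exact mm_nonneg (by positivity) (by positivity) (by positivity)

end Sizes

/-! ### The expected cost of the client -/

section ClientCost

variable {R : Type} {P : Params} {m l : ℕ} [CommRing R]

variable (P) in
/-- The part of the cost of the initialization that does not depend on the noise. -/
def setupFixedCost (m : ℕ) : ℕ :=
  2 * basesSize P + gramWords P + tableCheckCost P (P.depth + 1) +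
    (m * P.dim P.depth + familySize P.depth (fun _ => m) P.dim +
      mulCost P.sq m (P.dim P.depth) (P.dim 0) + P.depth * (2 * (m * P.dim 0)) + m * P.dim 0) +
    (m * P.dim 0 + familySize P.depth (fun _ => m) fun i => P.dim (i + 1)) +
    checkCost P m P.depth +
    ∑ i ∈ Finset.range P.depth, (mulCost P.sq m (P.dim P.depth) (P.dim (i + 1)) +
      P.depth * (2 * (m * P.dim (i + 1))) + m * P.dim (i + 1))

/-- The number of nonzero entries in a family of noise matrices. -/
def familyNnz (d : ℕ) {f g : ℕ → ℕ} (S : (i : ℕ) → Matrix (Fin (f i)) (Fin (g i)) R) : ℕ :=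
  ∑ i ∈ Finset.range d, nnz (S i)

variable (P) in
/-- The cost of the initialization to a client that does not abort, for the noise `S`. -/
def setupCost (S : (i : ℕ) → Matrix (Fin m) (Fin (P.dim i)) R) : ℕ :=
  setupFixedCost P m + familyNnz P.depth (f := fun _ => m) S *
    (2 * P.dim 0 + 2 * ∑ i ∈ Finset.range P.depth, P.dim (i + 1))

variable (P) in
/-- The part of the cost of an online step that does not depend on the noise. -/
def stepFixedCost (m l : ℕ) : ℕ :=
  P.dim 0 * l + (m * l + familySize P.depth (fun i => P.dim (i + 1)) fun _ => l) +
    (P.dim P.depth * l + familySize P.depth P.dim (fun _ => l) +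
      mulCost P.sq (P.dim 0) (P.dim P.depth) l + P.depth * (2 * (P.dim 0 * l)) + P.dim 0 * l +
      mulCost P.sq m (P.dim P.depth) l + P.depth * (2 * (m * l))) +
    (mulCost P.sq m (P.dim P.depth) l + P.depth * (2 * (m * l)) + 2 * (m * l))

variable (P) in
/-- The cost of an online step for the noise `T` in the mask of the right matrix and the noise `S`
in that of the left one. -/
def stepCost (T : (i : ℕ) → Matrix (Fin (P.dim i)) (Fin l) R)
    (S : (i : ℕ) → Matrix (Fin m) (Fin (P.dim i)) R) : ℕ :=
  stepFixedCost P m l + familyNnz P.depth (g := fun _ => l) T * (2 * P.dim 0 + 2 * m) +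
    familyNnz P.depth (f := fun _ => m) S * (2 * l)

lemma setupCost_eq (S : (i : ℕ) → Matrix (Fin m) (Fin (P.dim i)) R) :
    setupCost P S = (basesSize P + gramWords P) + basesSize P + tableCheckCost P (P.depth + 1) +
      (m * P.dim 0 + familySize P.depth (fun _ => m) fun i => P.dim (i + 1)) + leftMaskCost P S +
      checkCost P m P.depth + unmaskCost P S P.depth := by
  have h₁ : ∀ c, ∑ j ∈ Finset.range P.depth, (2 * nnz (S j) * c + m * c + m * c) =
      familyNnz P.depth (f := fun _ => m) S * (2 * c) + P.depth * (2 * (m * c)) := by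
    intro c
    rw [familyNnz, Finset.sum_mul, Finset.sum_add_distrib, Finset.sum_add_distrib,
      Finset.sum_const, Finset.card_range, smul_eq_mul]
    have : ∀ j, 2 * nnz (S j) * c = nnz (S j) * (2 * c) := fun j => by ring
    simp only [this]
    ring
  simp only [setupCost, setupFixedCost, leftMaskCost, unmaskCost, h₁, Finset.sum_add_distrib,
    ← Finset.mul_sum]
  ring

lemma stepCost_eq (T : (i : ℕ) → Matrix (Fin (P.dim i)) (Fin l) R)
    (S : (i : ℕ) → Matrix (Fin m) (Fin (P.dim i)) R) :
    stepCost P T S = P.dim 0 * l +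
      (m * l + familySize P.depth (fun i => P.dim (i + 1)) fun _ => l) +
      (maskCost P m T + unmaskStepCost P l S) := by
  have h₁ : ∀ c, ∑ j ∈ Finset.range P.depth, (2 * nnz (T j) * c + c * l + c * l) =
      familyNnz P.depth (g := fun _ => l) T * (2 * c) + P.depth * (2 * (c * l)) := by
    intro c
    rw [familyNnz, Finset.sum_mul, Finset.sum_add_distrib, Finset.sum_add_distrib,
      Finset.sum_const, Finset.card_range, smul_eq_mul]
    have : ∀ j, 2 * nnz (T j) * c = nnz (T j) * (2 * c) := fun j => by ring
    simp only [this]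
    ring
  have h₂ : ∑ j ∈ Finset.range P.depth, (2 * nnz (S j) * l + m * l + m * l) =
      familyNnz P.depth (f := fun _ => m) S * (2 * l) + P.depth * (2 * (m * l)) := by
    rw [familyNnz, Finset.sum_mul, Finset.sum_add_distrib, Finset.sum_add_distrib,
      Finset.sum_const, Finset.card_range, smul_eq_mul]
    have : ∀ j, 2 * nnz (S j) * l = nnz (S j) * (2 * l) := fun j => by ring
    simp only [this]
    ring
  simp only [stepCost, stepFixedCost, maskCost, unmaskStepCost, h₁, h₂]
  ring

variable [Fintype R]

variable (R P m) in
/-- The noise in the mask of the left matrix. -/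
def leftNoise : PMF (Family R P.depth (fun _ => m) P.dim) :=
  piPMF fun i : Fin P.depth => noiseMatrix R m (P.dim i) (P.rate i)

variable (R P l) in
/-- The noise in the mask of a right matrix. -/
def rightNoise : PMF (Family R P.depth P.dim fun _ => l) :=
  piPMF fun i : Fin P.depth => noiseMatrix R (P.dim i) l (P.rate i)

/-- An abort only lowers the cost of the initialization. -/
lemma wp_clientSetup_le (srv : Server R P m l) (A : Matrix (Fin m) (Fin (P.dim 0)) R)
    {f : Option (ClientState R P m) → RunState R P m l → ℝ≥0∞} {s : RunState R P m l}
    {M : Family R P.depth (fun _ => m) P.dim → ℝ≥0∞}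
    (h : ∀ Sf o s', (∀ c ∈ o, c.sparse = extend (f := fun _ => m) (g := P.dim) Sf) →
      s'.ledger.client ≤ s.ledger.client + setupCost P (extend (f := fun _ => m) (g := P.dim) Sf) →
      f o s' ≤ M Sf) :
    wp (clientSetup srv A) f s ≤ Ex (leftNoise R P m) M := by
  rw [wp_clientSetup]
  refine Ex_le_of_le fun Lf => wp_checkTable_le _ _ _ fun ok c hc => ?_
  split_ifs with hok
  · unfold wpSecondRound
    refine Ex_le_of_le fun H => Ex_mono fun Sf => wp_checkPartial_le _ _ _ fun ok' c' hc' => ?_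
    split_ifs with hok'
    · refine h Sf _ _ (fun c hc => ?_) ?_
      · rw [Option.mem_some_iff] at hc
        rw [← hc]
      · rw [setupCost_eq]
        simp only [RunState.spend, RunState.round, Msg.words, Msg.replyWords, basesSize, gramWords]
          at hc hc' ⊢
        omega
    · refine h Sf _ _ (fun c hc => by simp at hc) ?_
      rw [setupCost_eq]
      simp only [RunState.spend, RunState.round, Msg.words, Msg.replyWords, basesSize, gramWords]
        at hc hc' ⊢
      omega
  · rw [← Ex_const (leftNoise R P m) (f none _)]
    refine Ex_mono fun Sf => h Sf _ _ (fun c hc => by simp at hc) ?_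
    rw [setupCost_eq]
    simp only [RunState.spend, RunState.round, Msg.words, Msg.replyWords, basesSize, gramWords]
      at hc ⊢
    omega

lemma wp_multiply_le (srv : Server R P m l) (c : ClientState R P m)
    (B : Matrix (Fin (P.dim 0)) (Fin l) R) (s : RunState R P m l) :
    wp (multiply srv c B) (fun _ s' => (s'.ledger.client : ℝ≥0∞)) s ≤ s.ledger.client +
      Ex (rightNoise R P l) fun Tf => (stepCost P (extend (g := fun _ => l) Tf) c.sparse : ℝ≥0∞) := by
  rw [wp_multiply, ← Ex_const (rightNoise R P l) (s.ledger.client : ℝ≥0∞), ← Ex_add]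
  refine Ex_le_of_le fun G => Ex_mono fun Tf => ?_
  rw [stepCost_eq]
  simp only [RunState.spend, RunState.round, Msg.words, Msg.replyWords]
  rw [← Nat.cast_add, Nat.cast_le]
  omega

lemma wp_multiplyAll_le (srv : Server R P m l) (c : ClientState R P m)
    (B : ℕ → Matrix (Fin (P.dim 0)) (Fin l) R) (T : ℕ) (s : RunState R P m l) :
    wp (multiplyAll srv c B T) (fun _ s' => (s'.ledger.client : ℝ≥0∞)) s ≤ s.ledger.client +
      T * Ex (rightNoise R P l) fun Tf =>
        (stepCost P (extend (g := fun _ => l) Tf) c.sparse : ℝ≥0∞) := by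
  induction T with
  | zero => simp [multiplyAll]
  | succ T ih =>
    rw [wp_multiplyAll_succ]
    refine (wp_mono fun xs s' => wp_multiply_le srv c (B T) s').trans ?_
    unfold wp at ih ⊢
    rw [Ex_add, Ex_const, Nat.cast_succ, add_mul, one_mul, ← add_assoc]
    gcongr

lemma expect_initRun_le (srv : Server R P m l) (A : Matrix (Fin m) (Fin (P.dim 0)) R) :
    expect (initRun srv A) (fun o => o.2.ledger.client) ≤ Ex (leftNoise R P m) fun Sf =>
      (setupCost P (extend (f := fun _ => m) (g := P.dim) Sf) : ℝ≥0∞) := by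
  rw [expect_eq_Ex, Ex_initRun]
  refine wp_clientSetup_le srv A fun Sf o s' _ hs' => ?_
  rw [Nat.cast_le]
  exact hs'.trans (Nat.zero_add _).le

lemma expect_stepRun_le (srv : Server R P m l) (A : Matrix (Fin m) (Fin (P.dim 0)) R)
    (B : ℕ → Matrix (Fin (P.dim 0)) (Fin l) R) (k : ℕ) :
    expect (stepRun srv A B k) (fun o => o.2.ledger.client) ≤ Ex (leftNoise R P m) fun Sf =>
      Ex (rightNoise R P l) fun Tf => (stepCost P (extend (g := fun _ => l) Tf)
        (extend (f := fun _ => m) (g := P.dim) Sf) : ℝ≥0∞) := by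
  rw [expect_eq_Ex, Ex_stepRun]
  refine wp_clientSetup_le srv A fun Sf o s' ho _ => ?_
  cases o with
  | none => simp [RunState.reset, emptyLedger]
  | some c =>
    refine Ex_le_of_le fun o => (wp_multiply_le srv c (B k) o.2.reset).trans ?_
    rw [ho c rfl]
    simp [RunState.reset, emptyLedger]

lemma expect_fullRun_le (srv : Server R P m l) (A : Matrix (Fin m) (Fin (P.dim 0)) R)
    (B : ℕ → Matrix (Fin (P.dim 0)) (Fin l) R) (T : ℕ) :
    expect (fullRun srv A B T) (fun o => o.2.ledger.client) ≤ (Ex (leftNoise R P m) fun Sf =>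
      (setupCost P (extend (f := fun _ => m) (g := P.dim) Sf) : ℝ≥0∞)) +
      T * Ex (leftNoise R P m) fun Sf =>
        Ex (rightNoise R P l) fun Tf => (stepCost P (extend (g := fun _ => l) Tf)
          (extend (f := fun _ => m) (g := P.dim) Sf) : ℝ≥0∞) := by
  rw [expect_eq_Ex, Ex_fullRun, ← Ex_mul_left, ← Ex_add]
  refine wp_clientSetup_le srv A fun Sf o s' ho hs' => ?_
  have hs : (s'.ledger.client : ℝ≥0∞) ≤
      (setupCost P (extend (f := fun _ => m) (g := P.dim) Sf) : ℕ) := by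
    rw [Nat.cast_le]
    exact hs'.trans (Nat.zero_add _).le
  cases o with
  | none => exact hs.trans le_self_add
  | some c =>
    refine (wp_multiplyAll_le srv c B T s').trans ?_
    rw [ho c rfl]
    gcongr

lemma Ex_familyNnz_le {d : ℕ} {f g : ℕ → ℕ} {μ : ℕ → ℝ} (hμ₀ : ∀ i, 0 ≤ μ i) (hμ₁ : ∀ i, μ i ≤ 1) :
    (Ex (piPMF fun i : Fin d => noiseMatrix R (f i) (g i) (μ i)) fun S =>
      (familyNnz d (extend (f := f) (g := g) S) : ℝ≥0∞)) ≤
      ENNReal.ofReal (∑ i ∈ Finset.range d, f i * g i * μ i) := by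
  have h₁ : ∀ S : Family R d f g, (familyNnz d (extend (f := f) (g := g) S) : ℝ≥0∞) =
      ∑ i : Fin d, (nnz (S i) : ℝ≥0∞) := by
    intro S
    rw [familyNnz, ← Fin.sum_univ_eq_sum_range fun i => nnz (extend (f := f) (g := g) S i),
      Nat.cast_sum]
    refine Finset.sum_congr rfl fun i _ => ?_
    simp [extend]
  simp only [h₁]
  rw [Ex_finset_sum, ENNReal.ofReal_sum_of_nonneg fun i _ => mul_nonneg (by positivity) (hμ₀ i),
    ← Fin.sum_univ_eq_sum_range fun i => ENNReal.ofReal (f i * g i * μ i)]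
  refine Finset.sum_le_sum fun i _ => ?_
  rw [Ex_piPMF_eval (fun i : Fin d => noiseMatrix R (f i) (g i) (μ i)) i fun S => (nnz S : ℝ≥0∞)]
  exact Ex_nnz_noiseMatrix_le _ _ (hμ₁ i)

end ClientCost

/-! ### Bounds for the cost of the client -/

namespace CostBounds

variable {P : Params} {n : ℕ} {δ ε ν ω B : ℝ}

lemma B_nonneg (h : CostBounds P n δ ε ν ω B) : 0 ≤ B := zero_le_one.trans h.one_le

lemma one_le_n (h : CostBounds P n δ ε ν ω B) : (1 : ℝ) ≤ n := by exact_mod_cast h.n_pos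

lemma one_le_rpow (h : CostBounds P n δ ε ν ω B) : 1 ≤ (n : ℝ) ^ ε := Real.one_le_rpow h.one_le_n h.ε_pos.le

lemma one_le_dim (h : CostBounds P n δ ε ν ω B) (i : ℕ) : (1 : ℝ) ≤ P.dim i := by exact_mod_cast h.dim_pos i

lemma dim_le_n (h : CostBounds P n δ ε ν ω B) {i : ℕ} (hi : i ≤ P.depth) : (P.dim i : ℝ) ≤ n := by exact_mod_cast h.dim_le i hi

lemma dim_succ_le_dim (h : CostBounds P n δ ε ν ω B) {i : ℕ} (hi : i < P.depth) : (P.dim (i + 1) : ℝ) ≤ P.dim i := by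
  exact_mod_cast h.dim_succ_le i hi

lemma dim_anti (h : CostBounds P n δ ε ν ω B) {i j : ℕ} (hij : i ≤ j) (hj : j ≤ P.depth) : P.dim j ≤ P.dim i := by
  induction j, hij using Nat.le_induction with
  | base => exact le_rfl
  | succ j _ ih => exact (h.dim_succ_le j hj).trans (ih (by omega))

lemma δn_pos (h : CostBounds P n δ ε ν ω B) : 0 < δ * n := mul_pos h.δ_pos (by linarith [h.one_le_n])

lemma depth_le (h : CostBounds P n δ ε ν ω B) : (P.depth : ℝ) ≤ B * (n : ℝ) ^ ε := by
  refine le_trans ?_ h.sum_rpow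
  calc (P.depth : ℝ) = ∑ i ∈ Finset.range P.depth, (1 : ℝ) := by simp
    _ ≤ _ := Finset.sum_le_sum fun i _ => Real.one_le_rpow (h.one_le_dim i) h.ε_pos.le

lemma dim_succ_le_δn (h : CostBounds P n δ ε ν ω B) {i : ℕ} (hi : i < P.depth) : (P.dim (i + 1) : ℝ) ≤ B * (δ * n) :=
  (Finset.single_le_sum (f := fun i => (P.dim (i + 1) : ℝ)) (fun i _ => by positivity)
    (Finset.mem_range.mpr hi)).trans h.sum_dim_succ

lemma sum_dim_succ' (h : CostBounds P n δ ε ν ω B) : ∑ i ∈ Finset.range P.depth, (P.dim (i + 1) : ℝ) ≤ B * n :=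
  (Finset.sum_le_sum fun _ hi => h.dim_succ_le_dim (Finset.mem_range.mp hi)).trans h.sum_dim

lemma rpow_mul_le (h : CostBounds P n δ ε ν ω B) {x : ℝ} (hx : 0 ≤ x) : (B * x) ^ (ω - 2) ≤ B * x ^ (ω - 2) := by
  rw [Real.mul_rpow h.B_nonneg hx]
  exact mul_le_mul_of_nonneg_right (rpow_le_self_of_one_le h.le_three h.one_le) (by positivity)

lemma dim_depth_rpow_le (h : CostBounds P n δ ε ν ω B) : (P.dim P.depth : ℝ) ^ (ω - 2) ≤ B * ν ^ (ω - 2) :=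
  (Real.rpow_le_rpow (by positivity) h.dim_depth_le (by linarith [h.two_le])).trans
    (h.rpow_mul_le (by linarith [h.one_le_ν]))

lemma dim_succ_rpow_le (h : CostBounds P n δ ε ν ω B) {i : ℕ} (hi : i < P.depth) :
    (P.dim (i + 1) : ℝ) ^ (ω - 2) ≤ B * (δ * n) ^ (ω - 2) :=
  (Real.rpow_le_rpow (by positivity) (h.dim_succ_le_δn hi) (by linarith [h.two_le])).trans
    (h.rpow_mul_le h.δn_pos.le)

lemma mulCost_le_mul (h : CostBounds P n δ ε ν ω B) (a b c : ℕ) : (mulCost P.sq a b c : ℝ) ≤ B * (a * b * c) := by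
  have hB := h.B_nonneg
  by_cases h' : 1 ≤ a ∧ 1 ≤ b ∧ 1 ≤ c
  · refine (h.mulCost_le a b c).trans (mul_le_mul_of_nonneg_left ?_ hB)
    exact mm_le_mul h.le_three (by exact_mod_cast h'.1) (by exact_mod_cast h'.2.1)
      (by exact_mod_cast h'.2.2)
  · rw [mulCost_eq_zero _ h', Nat.cast_zero]
    positivity

/-- The inner dimension `n_d` of a product with the dense factor `H` of the mask is the smallest of
the three, and of order `ν`. -/
lemma mulCost_depth_le (h : CostBounds P n δ ε ν ω B) (m : ℕ) {c : ℕ} (hc : c ≤ n) (hd : P.dim P.depth ≤ c) :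
    (mulCost P.sq m (P.dim P.depth) c : ℝ) ≤ B ^ 2 * ((m + n) * c * ν ^ (ω - 2)) := by
  have hB := h.B_nonneg
  have hd' : (P.dim P.depth : ℝ) ≤ c := by exact_mod_cast hd
  have hc' : (c : ℝ) ≤ n := by exact_mod_cast hc
  have hm : (0 : ℝ) ≤ m := by positivity
  have h₁ : mm ω m (P.dim P.depth) c ≤ (m + n) * c * (B * ν ^ (ω - 2)) := by
    calc _ ≤ mm ω (m + n) (P.dim P.depth) c :=
          mm_mono h.two_le hm (by positivity) (by positivity) (by linarith) le_rfl le_rfl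
      _ = (m + n) * c * (P.dim P.depth : ℝ) ^ (ω - 2) := by
          rw [mm_swap₂₃, mm_eq h.le_three (by positivity) (by linarith) hd']
      _ ≤ _ := mul_le_mul_of_nonneg_left h.dim_depth_rpow_le (by positivity)
  calc _ ≤ B * mm ω m (P.dim P.depth) c := h.mulCost_le _ _ _
    _ ≤ B * ((m + n) * c * (B * ν ^ (ω - 2))) := mul_le_mul_of_nonneg_left h₁ hB
    _ = _ := by ring

lemma basesSize_le (h : CostBounds P n δ ε ν ω B) : (basesSize P : ℝ) ≤ B * (n * (δ * n)) := by
  unfold basesSize familySize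
  push_cast
  calc _ ≤ ∑ i ∈ Finset.range P.depth, (n : ℝ) * P.dim (i + 1) :=
        Finset.sum_le_sum fun i hi => mul_le_mul_of_nonneg_right
          (h.dim_le_n (Finset.mem_range.mp hi).le) (by positivity)
    _ = n * ∑ i ∈ Finset.range P.depth, (P.dim (i + 1) : ℝ) := by rw [Finset.mul_sum]
    _ ≤ n * (B * (δ * n)) := mul_le_mul_of_nonneg_left h.sum_dim_succ (by positivity)
    _ = _ := by ring

lemma gramWords_le (h : CostBounds P n δ ε ν ω B) : (gramWords P : ℝ) ≤ 2 * B ^ 2 * (n * (δ * n)) := by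
  have hB := h.B_nonneg
  have hδn := h.δn_pos
  unfold gramWords familySize
  rw [h.dim_zero]
  push_cast
  simp only [← Finset.mul_sum, ← Finset.sum_mul]
  have h₁ := mul_le_mul_of_nonneg_left h.sum_dim_succ (by positivity : (0 : ℝ) ≤ n)
  have h₂ := mul_le_mul h.sum_dim_succ' h.sum_dim_succ
    (Finset.sum_nonneg fun i _ => by positivity) (by positivity)
  have h₃ : B * (n * (δ * n)) ≤ B ^ 2 * (n * (δ * n)) := by
    refine mul_le_mul_of_nonneg_right ?_ (by positivity)
    nlinarith [h.one_le]
  calc _ ≤ (n : ℝ) * (B * (δ * n)) + B * n * (B * (δ * n)) := add_le_add h₁ h₂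
    _ = B * (n * (δ * n)) + B ^ 2 * (n * (δ * n)) := by ring
    _ ≤ _ := by linarith

lemma stepCheckCost_le (h : CostBounds P n δ ε ν ω B) (a : ℕ) {i : ℕ} (hi : i < P.depth) :
    (stepCheckCost P a i : ℝ) ≤ 3 * B * ((a + n) * P.checks) * P.dim i := by
  have hB := h.B_nonneg
  have e₁ := h.mulCost_le_mul a (P.dim (i + 1)) P.checks
  have e₂ := h.mulCost_le_mul (P.dim i) (P.dim (i + 1)) P.checks
  have e₃ := h.mulCost_le_mul a (P.dim i) P.checks
  have hx := h.one_le_dim i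
  have hxn := h.dim_le_n hi.le
  have hy := h.dim_succ_le_dim hi
  unfold stepCheckCost
  push_cast
  have hB1 := h.one_le
  set q : ℝ := (P.checks : ℝ) with hq
  set x : ℝ := (P.dim i : ℝ) with hxdef
  set y : ℝ := (P.dim (i + 1) : ℝ) with hydef
  have hq0 : 0 ≤ q := by positivity
  have hx0 : 0 ≤ x := by linarith
  have ha0 : (0 : ℝ) ≤ a := by positivity
  have f₁ : y * q ≤ B * (n * q * x) := by
    calc y * q ≤ x * q := mul_le_mul_of_nonneg_right hy hq0
      _ = 1 * (1 * q * x) := by ring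
      _ ≤ B * (n * q * x) := by
        have := h.one_le_n
        gcongr
  have f₂ : B * (a * y * q) ≤ B * (a * q * x) := by
    calc _ ≤ B * (a * x * q) := by gcongr
      _ = _ := by ring
  have f₃ : B * (x * y * q) ≤ B * (n * q * x) := by
    calc _ ≤ B * (x * n * q) := by
          gcongr
          linarith
      _ = _ := by ring
  have f₄ : a * q ≤ B * (a * q * x) := by
    calc (a : ℝ) * q = 1 * (a * q * 1) := by ring
      _ ≤ B * (a * q * x) := by gcongr
  have f₅ : B * (a * x * q) = B * (a * q * x) := by ring
  have f₆ : 0 ≤ B * (n * q * x) := by positivity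
  calc _ ≤ B * (n * q * x) + B * (a * q * x) + B * (n * q * x) + B * (a * q * x) +
        B * (a * q * x) := by linarith
    _ ≤ _ := by
      have : 3 * B * ((a + n) * q) * x = 3 * (B * (a * q * x)) + 3 * (B * (n * q * x)) := by ring
      linarith

lemma checkCost_le_aux (h : CostBounds P n δ ε ν ω B) (a : ℕ) :
    (checkCost P a P.depth : ℝ) ≤ 3 * B ^ 2 * ((a + n) * n * P.checks) := by
  have hB := h.B_nonneg
  unfold checkCost
  push_cast
  calc _ ≤ ∑ i ∈ Finset.range P.depth, 3 * B * (((a : ℝ) + n) * P.checks) * P.dim i :=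
        Finset.sum_le_sum fun i hi => h.stepCheckCost_le a (Finset.mem_range.mp hi)
    _ = 3 * B * ((a + n) * P.checks) * ∑ i ∈ Finset.range P.depth, (P.dim i : ℝ) := by
        rw [Finset.mul_sum]
    _ ≤ 3 * B * ((a + n) * P.checks) * (B * n) :=
        mul_le_mul_of_nonneg_left h.sum_dim (by positivity)
    _ = _ := by ring

lemma checkCost_le (h : CostBounds P n δ ε ν ω B) (a : ℕ) :
    (checkCost P a P.depth : ℝ) ≤ 3 * B ^ 3 * ((a + n) * n * (n : ℝ) ^ ε) := by
  have hB := h.B_nonneg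
  rcases Nat.eq_zero_or_pos P.depth with hd | hd
  · rw [hd, checkCost, Finset.sum_range_zero, Nat.cast_zero]
    positivity
  · have h₁ : (P.checks : ℝ) ≤ B * (n : ℝ) ^ ε := by
      refine le_trans ?_ h.depth_mul_checks
      exact le_mul_of_one_le_left (by positivity) (by exact_mod_cast hd)
    calc _ ≤ 3 * B ^ 2 * (((a : ℝ) + n) * n * P.checks) := h.checkCost_le_aux a
      _ ≤ 3 * B ^ 2 * (((a : ℝ) + n) * n * (B * (n : ℝ) ^ ε)) := by gcongr
      _ = _ := by ring

lemma tableCheckCost_le (h : CostBounds P n δ ε ν ω B) :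
    (tableCheckCost P (P.depth + 1) : ℝ) ≤ 12 * B ^ 3 * (n * n * (n : ℝ) ^ ε) := by
  have hB := h.B_nonneg
  rcases Nat.eq_zero_or_pos P.depth with hd | hd
  · simp only [tableCheckCost, checkCost, hd, Finset.sum_range_zero, Finset.sum_const_zero,
      Nat.cast_zero]
    positivity
  · have h₁ : ((P.depth : ℝ) + 1) * P.checks ≤ 2 * (B * (n : ℝ) ^ ε) := by
      have hd' : (1 : ℝ) ≤ P.depth := by exact_mod_cast hd
      have hq : (0 : ℝ) ≤ P.checks := by positivity
      nlinarith [h.depth_mul_checks]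
    unfold tableCheckCost
    push_cast
    calc _ ≤ ∑ j ∈ Finset.range (P.depth + 1), 3 * B ^ 2 * (((n : ℝ) + n) * n * P.checks) :=
          Finset.sum_le_sum fun j hj => (h.checkCost_le_aux _).trans (by
            have := h.dim_le_n (Nat.lt_succ_iff.mp (Finset.mem_range.mp hj))
            gcongr)
      _ = 6 * B ^ 2 * (n * n) * ((P.depth + 1) * P.checks) := by
          rw [Finset.sum_const, Finset.card_range, nsmul_eq_mul]
          push_cast
          ring
      _ ≤ 6 * B ^ 2 * (n * n) * (2 * (B * (n : ℝ) ^ ε)) := by gcongr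
      _ = _ := by ring

lemma pow_mul_le_pow_mul (h : CostBounds P n δ ε ν ω B) {k : ℕ} (hk : k ≤ 3) {x y : ℝ} (hx : 0 ≤ x) (hxy : x ≤ y) :
    B ^ k * x ≤ B ^ 3 * y :=
  mul_le_mul (pow_le_pow_right₀ h.one_le hk) hxy hx (pow_nonneg h.B_nonneg 3)

lemma setupFixedCost_le (h : CostBounds P n δ ε ν ω B) (m : ℕ) :
    (setupFixedCost P m : ℝ) ≤ 31 * B ^ 3 * (n * (m + n) * ((n : ℝ) ^ ε + ν ^ (ω - 2))) := by
  have hB := h.B_nonneg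
  have hE := h.one_le_rpow
  have hV : 0 ≤ ν ^ (ω - 2) := Real.rpow_nonneg (by linarith [h.one_le_ν]) _
  have hm : (0 : ℝ) ≤ m := by positivity
  have hn := h.one_le_n
  have hn0 : (0 : ℝ) ≤ n := by linarith
  have hW : 0 ≤ n * (m + n) * ((n : ℝ) ^ ε + ν ^ (ω - 2)) := by positivity
  have hδn := h.δn_pos
  set E := (n : ℝ) ^ ε with hEdef
  set V := ν ^ (ω - 2) with hVdef
  have hE0 : 0 ≤ E := by linarith
  have w₁ : (m : ℝ) * n ≤ n * (m + n) * (E + V) := by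
    calc (m : ℝ) * n = n * (m + 0) * (1 + 0) := by ring
      _ ≤ _ := by gcongr
  have w₂ : (m : ℝ) * n * E ≤ n * (m + n) * (E + V) := by
    calc (m : ℝ) * n * E = n * (m + 0) * (E + 0) := by ring
      _ ≤ _ := by gcongr
  have w₃ : (m + n) * n * V ≤ n * (m + n) * (E + V) := by
    calc (m + n) * n * V = n * (m + n) * (0 + V) := by ring
      _ ≤ _ := by gcongr
  have w₄ : (m + n) * n * E ≤ n * (m + n) * (E + V) := by
    calc (m + n) * n * E = n * (m + n) * (E + 0) := by ring
      _ ≤ _ := by gcongr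
  have w₅ : n * n * E ≤ n * (m + n) * (E + V) := by
    calc n * n * E = n * (0 + n) * (E + 0) := by ring
      _ ≤ _ := by gcongr
  have w₆ : n * (δ * n) ≤ n * (m + n) * (E + V) := by
    have := h.δ_lt
    have := h.δ_pos
    calc n * (δ * n) ≤ n * (1 * n) := by gcongr
      _ = n * (0 + n) * (1 + 0) := by ring
      _ ≤ _ := by gcongr
  set W := n * (m + n) * (E + V) with hWdef
  have hd0 : (0 : ℝ) ≤ P.dim P.depth := by positivity
  have t₁ : (basesSize P : ℝ) ≤ B ^ 3 * W := h.basesSize_le.trans (by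
    simpa using h.pow_mul_le_pow_mul (k := 1) (by norm_num) (by positivity) w₆)
  have t₂ : (gramWords P : ℝ) ≤ 2 * (B ^ 3 * W) := h.gramWords_le.trans (by
    rw [mul_assoc]
    exact mul_le_mul_of_nonneg_left (h.pow_mul_le_pow_mul (by norm_num) (by positivity) w₆)
      (by norm_num))
  have t₃ : (tableCheckCost P (P.depth + 1) : ℝ) ≤ 12 * (B ^ 3 * W) := h.tableCheckCost_le.trans (by
    rw [mul_assoc]
    exact mul_le_mul_of_nonneg_left (h.pow_mul_le_pow_mul (by norm_num) (by positivity) w₅)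
      (by norm_num))
  have t₄ : (checkCost P m P.depth : ℝ) ≤ 3 * (B ^ 3 * W) := (h.checkCost_le m).trans (by
    rw [mul_assoc]
    exact mul_le_mul_of_nonneg_left (h.pow_mul_le_pow_mul (by norm_num) (by positivity) w₄)
      (by norm_num))
  have b₀ : (m : ℝ) * n ≤ B ^ 3 * W := by
    simpa using h.pow_mul_le_pow_mul (k := 0) (by norm_num) (by positivity) w₁
  have b₁ : B * (m * n) ≤ B ^ 3 * W := by
    simpa using h.pow_mul_le_pow_mul (k := 1) (by norm_num) (by positivity) w₁
  have b₂ : B * (m * n * E) ≤ B ^ 3 * W := by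
    simpa using h.pow_mul_le_pow_mul (k := 1) (by norm_num) (by positivity) w₂
  have b₃ : B ^ 2 * (m * n * E) ≤ B ^ 3 * W :=
    h.pow_mul_le_pow_mul (by norm_num) (by positivity) w₂
  have b₄ : B ^ 2 * ((m + n) * n * V) ≤ B ^ 3 * W :=
    h.pow_mul_le_pow_mul (by norm_num) (by positivity) w₃
  have b₅ : B ^ 3 * ((m + n) * n * V) ≤ B ^ 3 * W :=
    h.pow_mul_le_pow_mul (by norm_num) (by positivity) w₃
  have t₅ : (m : ℝ) * P.dim P.depth ≤ B ^ 3 * W :=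
    (mul_le_mul_of_nonneg_left (h.dim_le_n le_rfl) hm).trans b₀
  have t₆ : (familySize P.depth (fun _ => m) P.dim : ℝ) ≤ B ^ 3 * W := by
    unfold familySize
    push_cast
    rw [← Finset.mul_sum]
    refine (mul_le_mul_of_nonneg_left h.sum_dim hm).trans ?_
    linarith
  have t₇ : (mulCost P.sq m (P.dim P.depth) n : ℝ) ≤ B ^ 3 * W :=
    (h.mulCost_depth_le m le_rfl (h.dim_le _ le_rfl)).trans b₄
  have t₈ : (P.depth : ℝ) * (2 * (m * n)) ≤ 2 * (B ^ 3 * W) := by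
    have := mul_le_mul_of_nonneg_right h.depth_le (by positivity : (0 : ℝ) ≤ 2 * (m * n))
    linarith
  have hs := mul_le_mul_of_nonneg_left h.sum_dim_succ' hm
  have t₉ : (familySize P.depth (fun _ => m) fun i => P.dim (i + 1) : ℝ) ≤ B ^ 3 * W := by
    unfold familySize
    push_cast
    rw [← Finset.mul_sum]
    linarith
  have t₁₀ : ∑ i ∈ Finset.range P.depth, (mulCost P.sq m (P.dim P.depth) (P.dim (i + 1)) : ℝ) ≤
      B ^ 3 * W := by
    calc _ ≤ ∑ i ∈ Finset.range P.depth, B ^ 2 * ((m + n) * V) * (P.dim (i + 1) : ℝ) := by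
          refine Finset.sum_le_sum fun i hi => ?_
          have hi' := Finset.mem_range.mp hi
          refine (h.mulCost_depth_le m (h.dim_le _ hi') (h.depth_le_dim _ hi')).trans (le_of_eq ?_)
          ring
      _ = B ^ 2 * ((m + n) * V) * ∑ i ∈ Finset.range P.depth, (P.dim (i + 1) : ℝ) := by
          rw [Finset.mul_sum]
      _ ≤ B ^ 2 * ((m + n) * V) * (B * n) :=
          mul_le_mul_of_nonneg_left h.sum_dim_succ' (by positivity)
      _ = B ^ 3 * ((m + n) * n * V) := by ring
      _ ≤ _ := b₅
  have t₁₁ : (P.depth : ℝ) * (2 * (m * ∑ i ∈ Finset.range P.depth, (P.dim (i + 1) : ℝ))) ≤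
      2 * (B ^ 3 * W) := by
    have := mul_le_mul h.depth_le hs (mul_nonneg hm (Finset.sum_nonneg fun i _ => by positivity))
      (by positivity)
    linarith
  have t₁₂ : m * ∑ i ∈ Finset.range P.depth, (P.dim (i + 1) : ℝ) ≤ B ^ 3 * W := by linarith
  unfold setupFixedCost
  rw [h.dim_zero]
  simp only [Finset.sum_add_distrib, ← Finset.mul_sum]
  push_cast
  linarith

lemma stepFixedCost_le (h : CostBounds P n δ ε ν ω B) (m l : ℕ) :
    (stepFixedCost P m l : ℝ) ≤ 17 * B ^ 3 * ((m + n) * l * ((n : ℝ) ^ ε + ν)) := by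
  have hB := h.B_nonneg
  have hE := h.one_le_rpow
  have hν := h.one_le_ν
  have hm : (0 : ℝ) ≤ m := by positivity
  have hl : (0 : ℝ) ≤ l := by positivity
  have hn := h.one_le_n
  have hn0 : (0 : ℝ) ≤ n := by linarith
  have hν0 : (0 : ℝ) ≤ ν := by linarith
  set E := (n : ℝ) ^ ε with hEdef
  have hE0 : (0 : ℝ) ≤ E := by linarith
  have w : ∀ x y : ℝ, 0 ≤ x → 0 ≤ y → x ≤ m + n → y ≤ E + ν → ∀ k ≤ 3,
      B ^ k * (x * l * y) ≤ B ^ 3 * ((m + n) * l * (E + ν)) := by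
    intro x y hx hy hx' hy' k hk
    exact h.pow_mul_le_pow_mul hk (by positivity) (by gcongr)
  set W := (m + n) * l * (E + ν) with hWdef
  have b₁ : (n : ℝ) * l ≤ B ^ 3 * W := by
    simpa using w n 1 hn0 zero_le_one (by linarith) (by linarith) 0 (by norm_num)
  have b₂ : (m : ℝ) * l ≤ B ^ 3 * W := by
    simpa using w m 1 hm zero_le_one (by linarith) (by linarith) 0 (by norm_num)
  have b₃ : B * (n * l) ≤ B ^ 3 * W := by
    simpa using w n 1 hn0 zero_le_one (by linarith) (by linarith) 1 (by norm_num)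
  have b₄ : B * (n * l * E) ≤ B ^ 3 * W := by
    simpa using w n E hn0 hE0 (by linarith) (by linarith) 1 (by norm_num)
  have b₅ : B * (m * l * E) ≤ B ^ 3 * W := by
    simpa using w m E hm hE0 (by linarith) (by linarith) 1 (by norm_num)
  have b₆ : B ^ 2 * (n * l * ν) ≤ B ^ 3 * W :=
    w n ν hn0 hν0 (by linarith) (by linarith) 2 (by norm_num)
  have b₇ : B ^ 2 * (m * l * ν) ≤ B ^ 3 * W :=
    w m ν hm hν0 (by linarith) (by linarith) 2 (by norm_num)
  have hmul : ∀ a : ℕ, (mulCost P.sq a (P.dim P.depth) l : ℝ) ≤ B ^ 2 * (a * l * ν) := by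
    intro a
    calc _ ≤ B * (a * P.dim P.depth * l) := h.mulCost_le_mul _ _ _
      _ ≤ B * (a * (B * ν) * l) := by
        have := h.dim_depth_le
        gcongr
      _ = _ := by ring
  have t₁ : (familySize P.depth (fun i => P.dim (i + 1)) fun _ => l : ℝ) ≤ B ^ 3 * W := by
    unfold familySize
    push_cast
    rw [← Finset.sum_mul]
    have := mul_le_mul_of_nonneg_right h.sum_dim_succ' hl
    linarith
  have t₂ : (familySize P.depth P.dim fun _ => l : ℝ) ≤ B ^ 3 * W := by
    unfold familySize
    push_cast
    rw [← Finset.sum_mul]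
    have := mul_le_mul_of_nonneg_right h.sum_dim hl
    linarith
  have t₃ : (P.dim P.depth : ℝ) * l ≤ B ^ 3 * W :=
    (mul_le_mul_of_nonneg_right (h.dim_le_n le_rfl) hl).trans b₁
  have t₄ := (hmul n).trans b₆
  have t₅ := (hmul m).trans b₇
  have t₆ : (P.depth : ℝ) * (2 * (n * l)) ≤ 2 * (B ^ 3 * W) := by
    have := mul_le_mul_of_nonneg_right h.depth_le (by positivity : (0 : ℝ) ≤ 2 * (n * l))
    linarith
  have t₇ : (P.depth : ℝ) * (2 * (m * l)) ≤ 2 * (B ^ 3 * W) := by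
    have := mul_le_mul_of_nonneg_right h.depth_le (by positivity : (0 : ℝ) ≤ 2 * (m * l))
    linarith
  unfold stepFixedCost
  rw [h.dim_zero]
  push_cast
  linarith

lemma sum_dim_mul_rate (h : CostBounds P n δ ε ν ω B) (a : ℝ) (ha : 0 ≤ a) :
    ∑ i ∈ Finset.range P.depth, a * (P.dim i * P.rate i) ≤ a * (B * (n : ℝ) ^ ε) := by
  rw [← Finset.mul_sum]
  refine mul_le_mul_of_nonneg_left (le_trans (le_of_eq ?_) h.sum_rpow) ha
  refine Finset.sum_congr rfl fun i _ => ?_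
  have : (0 : ℝ) < P.dim i := by linarith [h.one_le_dim i]
  rw [h.rate_eq, Real.rpow_sub_one this.ne']
  field_simp

lemma rate_nonneg (h : CostBounds P n δ ε ν ω B) (i : ℕ) : 0 ≤ P.rate i := by
  rw [h.rate_eq]
  positivity

lemma rate_le_one (h : CostBounds P n δ ε ν ω B) (i : ℕ) : P.rate i ≤ 1 := by
  rw [h.rate_eq]
  exact Real.rpow_le_one_of_one_le_of_nonpos (h.one_le_dim i) (by linarith [h.ε_lt])

variable {R : Type} [CommRing R] [Fintype R]

lemma Ex_leftNoise_le (h : CostBounds P n δ ε ν ω B) (m : ℕ) :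
    (Ex (leftNoise R P m) fun S =>
      (familyNnz P.depth (extend (f := fun _ => m) (g := P.dim) S) : ℝ≥0∞)) ≤
      ENNReal.ofReal (m * (B * (n : ℝ) ^ ε)) := by
  refine (Ex_familyNnz_le (R := R) (f := fun _ => m) (g := P.dim) h.rate_nonneg
    h.rate_le_one).trans (ENNReal.ofReal_le_ofReal ?_)
  refine le_trans (le_of_eq ?_) (h.sum_dim_mul_rate m (by positivity))
  exact Finset.sum_congr rfl fun i _ => by ring

lemma Ex_rightNoise_le (h : CostBounds P n δ ε ν ω B) (l : ℕ) :
    (Ex (rightNoise R P l) fun S =>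
      (familyNnz P.depth (extend (f := P.dim) (g := fun _ => l) S) : ℝ≥0∞)) ≤
      ENNReal.ofReal (l * (B * (n : ℝ) ^ ε)) := by
  refine (Ex_familyNnz_le (R := R) (f := P.dim) (g := fun _ => l) h.rate_nonneg
    h.rate_le_one).trans (ENNReal.ofReal_le_ofReal ?_)
  refine le_trans (le_of_eq ?_) (h.sum_dim_mul_rate l (by positivity))
  exact Finset.sum_congr rfl fun i _ => by ring

lemma Ex_setupCost_le (h : CostBounds P n δ ε ν ω B) (m : ℕ) :
    (Ex (leftNoise R P m) fun S =>
      (setupCost P (extend (f := fun _ => m) (g := P.dim) S) : ℝ≥0∞)) ≤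
      ENNReal.ofReal (35 * B ^ 3 * (n * (m + n) * ((n : ℝ) ^ ε + ν ^ (ω - 2)))) := by
  have hB := h.B_nonneg
  have hE := h.one_le_rpow
  have hV : 0 ≤ ν ^ (ω - 2) := Real.rpow_nonneg (by linarith [h.one_le_ν]) _
  have hn := h.one_le_n
  have hm : (0 : ℝ) ≤ m := by positivity
  set w : ℕ := 2 * P.dim 0 + 2 * ∑ i ∈ Finset.range P.depth, P.dim (i + 1) with hw
  have hw' : (w : ℝ) ≤ 4 * (B * n) := by
    rw [hw, h.dim_zero]
    push_cast
    have := h.sum_dim_succ'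
    nlinarith [h.one_le]
  have h₁ : ∀ S : Family R P.depth (fun _ => m) P.dim,
      (setupCost P (extend (f := fun _ => m) (g := P.dim) S) : ℝ≥0∞) = setupFixedCost P m +
        w * familyNnz P.depth (extend (f := fun _ => m) (g := P.dim) S) := by
    intro S
    rw [setupCost, ← hw]
    push_cast
    ring
  simp only [h₁]
  rw [Ex_add, Ex_const, Ex_mul_left]
  calc _ ≤ ENNReal.ofReal (setupFixedCost P m) +
        ENNReal.ofReal w * ENNReal.ofReal (m * (B * (n : ℝ) ^ ε)) := by
        rw [ENNReal.ofReal_natCast, ENNReal.ofReal_natCast]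
        gcongr
        exact h.Ex_leftNoise_le m
    _ = ENNReal.ofReal (setupFixedCost P m + w * (m * (B * (n : ℝ) ^ ε))) := by
        rw [← ENNReal.ofReal_mul (by positivity), ← ENNReal.ofReal_add (by positivity)
          (by positivity)]
    _ ≤ _ := by
        refine ENNReal.ofReal_le_ofReal ?_
        have f₁ := h.setupFixedCost_le m
        have f₂ : w * (m * (B * (n : ℝ) ^ ε)) ≤ 4 * (B * n) * (m * (B * (n : ℝ) ^ ε)) := by gcongr
        have f₃ : B ^ 2 * (n * (m + 0) * ((n : ℝ) ^ ε + 0)) ≤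
            B ^ 3 * (n * (m + n) * ((n : ℝ) ^ ε + ν ^ (ω - 2))) :=
          h.pow_mul_le_pow_mul (by norm_num) (by positivity) (by gcongr; linarith)
        linarith

lemma Ex_stepCost_le (h : CostBounds P n δ ε ν ω B) (m l : ℕ) :
    (Ex (leftNoise R P m) fun S => Ex (rightNoise R P l) fun S' =>
      (stepCost P (extend (g := fun _ => l) S') (extend (f := fun _ => m) (g := P.dim) S) : ℝ≥0∞)) ≤
      ENNReal.ofReal (21 * B ^ 3 * ((m + n) * l * ((n : ℝ) ^ ε + ν))) := by
  have hB := h.B_nonneg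
  have hE := h.one_le_rpow
  have hν := h.one_le_ν
  have hn := h.one_le_n
  have hm : (0 : ℝ) ≤ m := by positivity
  have hl : (0 : ℝ) ≤ l := by positivity
  have h₁ : ∀ (S : Family R P.depth (fun _ => m) P.dim) (S' : Family R P.depth P.dim fun _ => l),
      (stepCost P (extend (g := fun _ => l) S') (extend (f := fun _ => m) (g := P.dim) S) : ℝ≥0∞) =
        stepFixedCost P m l +
          (2 * n + 2 * m : ℕ) * familyNnz P.depth (extend (g := fun _ => l) S') +
          (2 * l : ℕ) * familyNnz P.depth (extend (f := fun _ => m) (g := P.dim) S) := by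
    intro S S'
    rw [stepCost, h.dim_zero]
    push_cast
    ring
  simp only [h₁, Ex_add, Ex_const, Ex_mul_left]
  calc _ ≤ ENNReal.ofReal (stepFixedCost P m l) +
        ENNReal.ofReal (2 * n + 2 * m : ℕ) * ENNReal.ofReal (l * (B * (n : ℝ) ^ ε)) +
        ENNReal.ofReal (2 * l : ℕ) * ENNReal.ofReal (m * (B * (n : ℝ) ^ ε)) := by
        rw [ENNReal.ofReal_natCast, ENNReal.ofReal_natCast, ENNReal.ofReal_natCast]
        gcongr
        · exact h.Ex_rightNoise_le l
        · exact h.Ex_leftNoise_le m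
    _ = ENNReal.ofReal (stepFixedCost P m l + (2 * n + 2 * m : ℕ) * (l * (B * (n : ℝ) ^ ε)) +
          (2 * l : ℕ) * (m * (B * (n : ℝ) ^ ε))) := by
        rw [← ENNReal.ofReal_mul (by positivity), ← ENNReal.ofReal_mul (by positivity),
          ← ENNReal.ofReal_add (by positivity) (by positivity),
          ← ENNReal.ofReal_add (by positivity) (by positivity)]
    _ ≤ _ := by
        refine ENNReal.ofReal_le_ofReal ?_
        have f₁ := h.stepFixedCost_le m l
        have f₂ : B ^ 1 * ((m + n) * l * ((n : ℝ) ^ ε + 0)) ≤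
            B ^ 3 * ((m + n) * l * ((n : ℝ) ^ ε + ν)) :=
          h.pow_mul_le_pow_mul (by norm_num) (by positivity) (by gcongr; linarith)
        have f₃ : B ^ 1 * ((m + 0) * l * ((n : ℝ) ^ ε + 0)) ≤
            B ^ 3 * ((m + n) * l * ((n : ℝ) ^ ε + ν)) :=
          h.pow_mul_le_pow_mul (by norm_num) (by positivity) (by gcongr <;> linarith)
        push_cast
        linarith

end CostBounds

/-! ### Bounds for the cost of the server and the communication -/

/-- The cost of the honest server in the initialization. -/
def setupWork (P : Params) (m : ℕ) : ℕ :=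
  gramCost P P.depth + (basesSize P + gramWords P) +
    (∑ i ∈ Finset.range P.depth, mulCost P.sq m (P.dim i) (P.dim (i + 1)) +
      (m * P.dim 0 + familySize P.depth (fun _ => m) fun i => P.dim (i + 1)))

/-- The number of elements that the client sends in `T` online steps and the initialization. -/
def upWords (P : Params) (m l T : ℕ) : ℕ := basesSize P + m * P.dim 0 + T * (P.dim 0 * l)

/-- The number of elements that the client receives in `T` online steps and the initialization. -/
def downWords (P : Params) (m l T : ℕ) : ℕ :=
  gramWords P + familySize P.depth (fun _ => m) (fun i => P.dim (i + 1)) +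
    T * (m * l + familySize P.depth (fun i => P.dim (i + 1)) fun _ => l)

/-- The order of the cost of multiplying the `L_i` by a matrix with `a` rows or columns. -/
def sideCost (n : ℕ) (δ ω a : ℝ) : ℝ := n * max a (δ * n) * min a (δ * n) ^ (ω - 2)

/-- The order of the cost of the table of products. -/
def tableCost (n : ℕ) (δ ω : ℝ) : ℝ := n * (δ * n) * (δ * n) ^ (ω - 2)

namespace CostBounds

variable {P : Params} {n : ℕ} {δ ε ν ω B : ℝ}

lemma one_le_mul_rpow (h : CostBounds P n δ ε ν ω B) : 1 ≤ B * (δ * n) ^ (ω - 2) :=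
  (Real.one_le_rpow h.one_le_δ (by linarith [h.two_le])).trans (h.rpow_mul_le h.δn_pos.le)

lemma mul_rpow_le_max_mul (h : CostBounds P n δ ε ν ω B) {x y : ℝ} (hx : 0 ≤ x) :
    x * y ^ (ω - 2) ≤ max x y * min x y ^ (ω - 2) := by
  rcases le_total x y with hxy | hxy
  · rw [max_eq_right hxy, min_eq_left hxy]
    have := rpow_mul_le_mul_rpow h.le_three hx hxy
    linarith
  · rw [max_eq_left hxy, min_eq_right hxy]

lemma sideCost_nonneg (h : CostBounds P n δ ε ν ω B) {a : ℝ} (ha : 0 ≤ a) :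
    0 ≤ sideCost n δ ω a := by
  have := h.δn_pos
  have h₁ : 0 ≤ min a (δ * n) := le_min ha this.le
  have h₂ : 0 ≤ max a (δ * n) := le_max_of_le_left ha
  unfold sideCost
  positivity

lemma mul_rpow_le_sideCost (h : CostBounds P n δ ε ν ω B) {a : ℝ} (ha : 0 ≤ a) :
    a * n * (δ * n) ^ (ω - 2) ≤ sideCost n δ ω a := by
  have := mul_le_mul_of_nonneg_left (h.mul_rpow_le_max_mul (y := δ * n) ha)
    (by positivity : (0 : ℝ) ≤ n)
  unfold sideCost
  linarith

lemma rpow_mul_le_sideCost (h : CostBounds P n δ ε ν ω B) (a : ℝ) :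
    a ^ (ω - 2) * n * (δ * n) ≤ sideCost n δ ω a := by
  have := mul_le_mul_of_nonneg_left (h.mul_rpow_le_max_mul (y := a) h.δn_pos.le)
    (by positivity : (0 : ℝ) ≤ n)
  rw [max_comm, min_comm] at this
  unfold sideCost
  linarith

lemma mul_le_sideCost (h : CostBounds P n δ ε ν ω B) {a : ℝ} (ha : 0 ≤ a) :
    a * n ≤ B * sideCost n δ ω a := by
  have h₁ := mul_le_mul_of_nonneg_left (h.mul_rpow_le_sideCost ha) h.B_nonneg
  have h₂ := mul_le_mul_of_nonneg_left h.one_le_mul_rpow (by positivity : 0 ≤ a * n)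
  linarith

lemma mm_level_le (h : CostBounds P n δ ε ν ω B) {a : ℝ} (ha : 0 ≤ a) {i : ℕ} (hi : i < P.depth) :
    mm ω a (P.dim i) (P.dim (i + 1)) ≤ a ^ (ω - 2) * n * P.dim (i + 1) +
      a * (B * (δ * n) ^ (ω - 2)) * P.dim i := by
  have hB := h.B_nonneg
  have h₁ : a * P.dim i * (P.dim (i + 1) : ℝ) ^ (ω - 2) ≤
      a * (B * (δ * n) ^ (ω - 2)) * P.dim i := by
    have := mul_le_mul_of_nonneg_left (h.dim_succ_rpow_le hi)
      (by positivity : (0 : ℝ) ≤ a * P.dim i)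
    linarith
  have h₂ : a * (P.dim i : ℝ) ^ (ω - 2) * P.dim (i + 1) ≤
      a * P.dim i * (P.dim (i + 1) : ℝ) ^ (ω - 2) := by
    have := mul_le_mul_of_nonneg_left (rpow_mul_le_mul_rpow (ω := ω) h.le_three
      (by positivity : (0 : ℝ) ≤ P.dim (i + 1)) (h.dim_succ_le_dim hi)) ha
    linarith
  have h₃ : a ^ (ω - 2) * P.dim i * P.dim (i + 1) ≤ a ^ (ω - 2) * n * P.dim (i + 1) := by
    have := h.dim_le_n hi.le
    gcongr
  have h₄ : 0 ≤ a ^ (ω - 2) * n * P.dim (i + 1) := by positivity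
  have h₅ : 0 ≤ a * (B * (δ * n) ^ (ω - 2)) * P.dim i := by
    have := h.δn_pos
    positivity
  unfold mm
  refine max_le ?_ (max_le ?_ ?_) <;> linarith

lemma sum_mm_le (h : CostBounds P n δ ε ν ω B) {a : ℝ} (ha : 0 ≤ a) :
    ∑ i ∈ Finset.range P.depth, mm ω a (P.dim i) (P.dim (i + 1)) ≤
      2 * B ^ 2 * sideCost n δ ω a := by
  have hB := h.B_nonneg
  have hD : 0 ≤ (δ * n) ^ (ω - 2) := Real.rpow_nonneg h.δn_pos.le _
  have hS := h.sideCost_nonneg ha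
  calc _ ≤ ∑ i ∈ Finset.range P.depth, (a ^ (ω - 2) * n * P.dim (i + 1) +
        a * (B * (δ * n) ^ (ω - 2)) * P.dim i) :=
        Finset.sum_le_sum fun i hi => h.mm_level_le ha (Finset.mem_range.mp hi)
    _ = a ^ (ω - 2) * n * ∑ i ∈ Finset.range P.depth, (P.dim (i + 1) : ℝ) +
        a * (B * (δ * n) ^ (ω - 2)) * ∑ i ∈ Finset.range P.depth, (P.dim i : ℝ) := by
        rw [Finset.sum_add_distrib, Finset.mul_sum, Finset.mul_sum]
    _ ≤ a ^ (ω - 2) * n * (B * (δ * n)) + a * (B * (δ * n) ^ (ω - 2)) * (B * n) := by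
        have := h.sum_dim_succ
        have := h.sum_dim
        gcongr
    _ = B * (a ^ (ω - 2) * n * (δ * n)) + B ^ 2 * (a * n * (δ * n) ^ (ω - 2)) := by ring
    _ ≤ B * sideCost n δ ω a + B ^ 2 * sideCost n δ ω a := by
        have := h.mul_rpow_le_sideCost ha
        have := h.rpow_mul_le_sideCost a
        gcongr
    _ ≤ _ := by
        have : B * sideCost n δ ω a ≤ B ^ 2 * sideCost n δ ω a := by
          refine mul_le_mul_of_nonneg_right ?_ hS
          nlinarith [h.one_le]
        linarith

lemma mul_sum_dim_succ_le (h : CostBounds P n δ ε ν ω B) {a : ℝ} (ha : 0 ≤ a) :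
    a * ∑ i ∈ Finset.range P.depth, (P.dim (i + 1) : ℝ) ≤ B ^ 2 * sideCost n δ ω a := by
  have h₁ := mul_le_mul_of_nonneg_left h.sum_dim_succ' ha
  have h₂ := mul_le_mul_of_nonneg_left (h.mul_le_sideCost ha) h.B_nonneg
  linarith

lemma tableCost_eq (h : CostBounds P n δ ε ν ω B) :
    tableCost n δ ω = (n : ℝ) ^ ω * δ ^ (ω - 1) := by
  have hn : (0 : ℝ) < n := by linarith [h.one_le_n]
  have h₁ : δ ^ (ω - 1) = δ * δ ^ (ω - 2) := by
    rw [mul_comm, ← Real.rpow_add_one h.δ_pos.ne']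
    ring_nf
  have h₂ : (n : ℝ) ^ ω = n * n * (n : ℝ) ^ (ω - 2) := by
    rw [mul_comm, ← pow_two, ← Real.rpow_natCast, ← Real.rpow_add hn]
    norm_num
  unfold tableCost
  rw [Real.mul_rpow h.δ_pos.le hn.le, h₁, h₂]
  ring

lemma tableCost_nonneg (h : CostBounds P n δ ε ν ω B) : 0 ≤ tableCost n δ ω := by
  have := h.δn_pos
  unfold tableCost
  positivity

lemma gramEntryCost_le (h : CostBounds P n δ ε ν ω B) {i j : ℕ} (hi : i + 1 < P.depth)
    (hj : j ≤ i + 1) : (gramEntryCost P j (i + 1) : ℝ) ≤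
      B ^ 2 * (δ * n) ^ (ω - 2) * P.dim (i + 1) * P.dim j := by
  have hB := h.B_nonneg
  have hle : (P.dim (i + 2) : ℝ) ≤ P.dim j := by
    exact_mod_cast h.dim_anti (by omega : j ≤ i + 2) hi
  have h₁ : gramEntryCost P j (i + 1) = mulCost P.sq (P.dim j) (P.dim (i + 1)) (P.dim (i + 2)) := by
    cases j <;> rfl
  rw [h₁]
  calc _ ≤ B * mm ω (P.dim j) (P.dim (i + 1)) (P.dim (i + 2)) := h.mulCost_le _ _ _
    _ = B * (P.dim j * P.dim (i + 1) * (P.dim (i + 2) : ℝ) ^ (ω - 2)) := by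
        rw [mm_eq h.le_three (by positivity) hle (h.dim_succ_le_dim hi)]
    _ ≤ B * (P.dim j * P.dim (i + 1) * (B * (δ * n) ^ (ω - 2))) := by
        have := h.dim_succ_rpow_le hi
        gcongr
    _ = _ := by ring

lemma sum_gramEntryCost_le (h : CostBounds P n δ ε ν ω B) :
    ∑ i ∈ Finset.range P.depth, ∑ j ∈ Finset.range (i + 1), (gramEntryCost P j i : ℝ) ≤
      B ^ 4 * tableCost n δ ω := by
  have hB := h.B_nonneg
  have hD : 0 ≤ (δ * n) ^ (ω - 2) := Real.rpow_nonneg h.δn_pos.le _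
  rcases hd : P.depth with _ | d
  · rw [Finset.sum_range_zero]
    have := h.tableCost_nonneg
    positivity
  · rw [Finset.sum_range_succ']
    have h₀ : ∑ j ∈ Finset.range (0 + 1), (gramEntryCost P j 0 : ℝ) = 0 := by
      simp [gramEntryCost]
    rw [h₀, add_zero]
    calc _ ≤ ∑ i ∈ Finset.range d, B ^ 3 * (δ * n) ^ (ω - 2) * n * (P.dim (i + 1) : ℝ) := by
          refine Finset.sum_le_sum fun i hi => ?_
          have hi' : i + 1 < P.depth := by
            have := Finset.mem_range.mp hi
            omega
          calc _ ≤ ∑ j ∈ Finset.range (i + 1 + 1),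
                B ^ 2 * (δ * n) ^ (ω - 2) * P.dim (i + 1) * (P.dim j : ℝ) :=
                Finset.sum_le_sum fun j hj => h.gramEntryCost_le hi'
                  (Nat.lt_succ_iff.mp (Finset.mem_range.mp hj))
            _ = B ^ 2 * (δ * n) ^ (ω - 2) * P.dim (i + 1) *
                ∑ j ∈ Finset.range (i + 1 + 1), (P.dim j : ℝ) := by rw [Finset.mul_sum]
            _ ≤ B ^ 2 * (δ * n) ^ (ω - 2) * P.dim (i + 1) * (B * n) := by
                refine mul_le_mul_of_nonneg_left (le_trans ?_ h.sum_dim) (by positivity)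
                exact Finset.sum_le_sum_of_subset_of_nonneg
                  (Finset.range_subset_range.mpr (by omega)) fun j _ _ => by positivity
            _ = _ := by ring
      _ = B ^ 3 * (δ * n) ^ (ω - 2) * n * ∑ i ∈ Finset.range d, (P.dim (i + 1) : ℝ) := by
          rw [Finset.mul_sum]
      _ ≤ B ^ 3 * (δ * n) ^ (ω - 2) * n * (B * (δ * n)) := by
          refine mul_le_mul_of_nonneg_left (le_trans ?_ h.sum_dim_succ) (by positivity)
          exact Finset.sum_le_sum_of_subset_of_nonneg
            (Finset.range_subset_range.mpr (by omega)) fun j _ _ => by positivity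
      _ = _ := by
          unfold tableCost
          ring

lemma gramCost_le (h : CostBounds P n δ ε ν ω B) :
    (gramCost P P.depth : ℝ) ≤ 2 * B ^ 4 * tableCost n δ ω := by
  have hB := h.B_nonneg
  have hD : 0 ≤ (δ * n) ^ (ω - 2) := Real.rpow_nonneg h.δn_pos.le _
  have hT := h.tableCost_nonneg
  have h₁ : ∑ i ∈ Finset.range P.depth,
      (mulCost P.sq (P.dim (i + 1)) (P.dim i) (P.dim (i + 1)) : ℝ) ≤ B ^ 3 * tableCost n δ ω := by
    calc _ ≤ ∑ i ∈ Finset.range P.depth,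
          B ^ 2 * (δ * n) ^ (ω - 2) * n * (P.dim (i + 1) : ℝ) := by
          refine Finset.sum_le_sum fun i hi => ?_
          have hi' := Finset.mem_range.mp hi
          calc _ ≤ B * mm ω (P.dim (i + 1)) (P.dim i) (P.dim (i + 1)) := h.mulCost_le _ _ _
            _ = B * (P.dim (i + 1) * P.dim i * (P.dim (i + 1) : ℝ) ^ (ω - 2)) := by
                rw [mm_eq h.le_three (by positivity) le_rfl (h.dim_succ_le_dim hi')]
            _ ≤ B * (P.dim (i + 1) * n * (B * (δ * n) ^ (ω - 2))) := by
                have := h.dim_succ_rpow_le hi'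
                have := h.dim_le_n hi'.le
                gcongr
            _ = _ := by ring
      _ = B ^ 2 * (δ * n) ^ (ω - 2) * n * ∑ i ∈ Finset.range P.depth, (P.dim (i + 1) : ℝ) := by
          rw [Finset.mul_sum]
      _ ≤ B ^ 2 * (δ * n) ^ (ω - 2) * n * (B * (δ * n)) :=
          mul_le_mul_of_nonneg_left h.sum_dim_succ (by positivity)
      _ = _ := by
          unfold tableCost
          ring
  have h₂ := h.sum_gramEntryCost_le
  have h₃ : B ^ 3 * tableCost n δ ω ≤ B ^ 4 * tableCost n δ ω :=
    mul_le_mul_of_nonneg_right (pow_le_pow_right₀ h.one_le (by norm_num)) hT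
  unfold gramCost
  push_cast
  rw [Finset.sum_add_distrib]
  linarith

lemma setupWork_le (h : CostBounds P n δ ε ν ω B) (m : ℕ) :
    (setupWork P m : ℝ) ≤ 5 * B ^ 4 * (tableCost n δ ω + sideCost n δ ω m) := by
  have hB := h.B_nonneg
  have hm : (0 : ℝ) ≤ m := by positivity
  have hT := h.tableCost_nonneg
  have hS := h.sideCost_nonneg hm
  have p : ∀ k ≤ 4, B ^ k ≤ B ^ 4 := fun k hk => pow_le_pow_right₀ h.one_le hk
  have hTk : ∀ k ≤ 4, B ^ k * tableCost n δ ω ≤ B ^ 4 * tableCost n δ ω := fun k hk =>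
    mul_le_mul_of_nonneg_right (p k hk) hT
  have hSk : ∀ k ≤ 4, B ^ k * sideCost n δ ω m ≤ B ^ 4 * sideCost n δ ω m := fun k hk =>
    mul_le_mul_of_nonneg_right (p k hk) hS
  have t₁ := h.gramCost_le
  have e₁ : n * (δ * n) ≤ B * tableCost n δ ω := by
    have := mul_le_mul_of_nonneg_left h.one_le_mul_rpow
      (mul_nonneg (by positivity) h.δn_pos.le : 0 ≤ (n : ℝ) * (δ * n))
    unfold tableCost
    linarith
  have t₂ : (basesSize P : ℝ) ≤ B ^ 4 * tableCost n δ ω := by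
    have := mul_le_mul_of_nonneg_left e₁ hB
    linarith [h.basesSize_le, hTk 2 (by norm_num)]
  have t₃ : (gramWords P : ℝ) ≤ 2 * (B ^ 4 * tableCost n δ ω) := by
    have := mul_le_mul_of_nonneg_left e₁ (by positivity : 0 ≤ 2 * B ^ 2)
    linarith [h.gramWords_le, hTk 3 (by norm_num)]
  have t₄ : ∑ i ∈ Finset.range P.depth, (mulCost P.sq m (P.dim i) (P.dim (i + 1)) : ℝ) ≤
      2 * (B ^ 4 * sideCost n δ ω m) := by
    have h₁ := Finset.sum_le_sum (s := Finset.range P.depth) fun i (_ : i ∈ _) =>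
      h.mulCost_le m (P.dim i) (P.dim (i + 1))
    rw [← Finset.mul_sum] at h₁
    have h₂ := mul_le_mul_of_nonneg_left (h.sum_mm_le hm) hB
    linarith [hSk 3 (by norm_num)]
  have t₅ : (m : ℝ) * n ≤ B ^ 4 * sideCost n δ ω m := by
    linarith [h.mul_le_sideCost hm, hSk 1 (by norm_num)]
  have t₆ : (familySize P.depth (fun _ => m) fun i => P.dim (i + 1) : ℝ) ≤
      B ^ 4 * sideCost n δ ω m := by
    unfold familySize
    push_cast
    rw [← Finset.mul_sum]
    linarith [h.mul_sum_dim_succ_le hm, hSk 2 (by norm_num)]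
  unfold setupWork
  rw [h.dim_zero]
  push_cast
  linarith

lemma stepWork_le (h : CostBounds P n δ ε ν ω B) (m l : ℕ) :
    (stepWork P m l : ℝ) ≤ naiveStep P.sq n m l + 3 * B ^ 4 * sideCost n δ ω l := by
  have hB := h.B_nonneg
  have hl : (0 : ℝ) ≤ l := by positivity
  have hS := h.sideCost_nonneg hl
  have hSk : ∀ k ≤ 4, B ^ k * sideCost n δ ω l ≤ B ^ 4 * sideCost n δ ω l := fun k hk =>
    mul_le_mul_of_nonneg_right (pow_le_pow_right₀ h.one_le hk) hS
  have t₁ : ∑ i ∈ Finset.range P.depth, (mulCost P.sq (P.dim (i + 1)) (P.dim i) l : ℝ) ≤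
      2 * (B ^ 4 * sideCost n δ ω l) := by
    have h₁ : ∑ i ∈ Finset.range P.depth, (mulCost P.sq (P.dim (i + 1)) (P.dim i) l : ℝ) ≤
        ∑ i ∈ Finset.range P.depth, B * mm ω l (P.dim i) (P.dim (i + 1)) := by
      refine Finset.sum_le_sum fun i _ => (h.mulCost_le _ _ _).trans (le_of_eq ?_)
      rw [mm_swap₂₃, mm_swap₁₂, mm_swap₂₃]
    rw [← Finset.mul_sum] at h₁
    have h₂ := mul_le_mul_of_nonneg_left (h.sum_mm_le hl) hB
    linarith [hSk 3 (by norm_num)]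
  have t₂ : (familySize P.depth (fun i => P.dim (i + 1)) fun _ => l : ℝ) ≤
      B ^ 4 * sideCost n δ ω l := by
    unfold familySize
    push_cast
    rw [← Finset.sum_mul, mul_comm]
    linarith [h.mul_sum_dim_succ_le hl, hSk 2 (by norm_num)]
  unfold stepWork naiveStep
  rw [h.dim_zero]
  push_cast
  linarith

lemma upWords_le (h : CostBounds P n δ ε ν ω B) {m : ℕ} (hm : 1 ≤ m) (l T : ℕ) {C : ℝ}
    (hC : B ≤ C) : (upWords P m l T : ℝ) ≤
      (1 + C * (δ * n / (m + T * l))) * inputSize n m l T := by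
  have hm' : (0 : ℝ) < m := by exact_mod_cast hm
  have ht : (0 : ℝ) < m + T * l := by positivity
  have h₁ := h.basesSize_le
  have h₂ := mul_le_mul_of_nonneg_right hC (mul_nonneg (by positivity) h.δn_pos.le :
    0 ≤ (n : ℝ) * (δ * n))
  unfold upWords inputSize
  rw [h.dim_zero]
  push_cast
  have h₃ : (1 + C * (δ * n / (m + T * l))) * (m * n + T * (n * l)) =
      (m * n + T * (n * l)) + C * (n * (δ * n)) := by
    field_simp
  rw [h₃]
  linarith

lemma upWords_add_downWords_le (h : CostBounds P n δ ε ν ω B) {m : ℕ} (hm : 1 ≤ m) (l T : ℕ)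
    {C : ℝ} (hC : 3 * B ^ 2 ≤ C) : (upWords P m l T + downWords P m l T : ℝ) ≤
      inputSize n m l T + outputSize m l T +
        C * (δ + δ * n / (m + T * l)) * inputSize n m l T := by
  have hB := h.B_nonneg
  have hBB : B ≤ B ^ 2 := by nlinarith [h.one_le]
  have hm' : (0 : ℝ) < m := by exact_mod_cast hm
  have ht : (0 : ℝ) < m + T * l := by positivity
  have hnD : 0 ≤ (n : ℝ) * (δ * n) := mul_nonneg (by positivity) h.δn_pos.le
  have h₁ := h.basesSize_le
  have h₂ := h.gramWords_le
  have h₃ := mul_le_mul_of_nonneg_right hC hnD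
  have h₄ := mul_le_mul_of_nonneg_right hBB hnD
  have h₅ := mul_le_mul_of_nonneg_left h.sum_dim_succ ht.le
  have h₆ : B ≤ C := by nlinarith
  have h₇ := mul_le_mul_of_nonneg_right h₆ (mul_nonneg ht.le h.δn_pos.le)
  unfold upWords downWords inputSize outputSize familySize
  rw [h.dim_zero]
  push_cast
  rw [← Finset.mul_sum, ← Finset.sum_mul]
  have e : C * (δ + δ * n / (m + T * l)) * (m * n + T * (n * l)) =
      C * ((m + T * l) * (δ * n)) + C * (n * (δ * n)) := by
    field_simp
  rw [e]
  linarith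

end CostBounds

/-! ### Efficiency -/

namespace CostBounds

variable {P : Params} {n : ℕ} {δ ε ν ω B : ℝ} {R : Type} [CommRing R] [Fintype R]

lemma efficient_of_le (h : CostBounds P n δ ε ν ω B) {m l T : ℕ} {cc cs : ℝ}
    (hc : 35 * B ^ 3 * (n * (m + n) * ((n : ℝ) ^ ε + ν ^ (ω - 2))) +
      T * (21 * B ^ 3 * ((m + n) * l * ((n : ℝ) ^ ε + ν))) ≤ cc * naiveClient n m l T)
    (hs : (setupWork P m : ℝ) + T * stepWork P m l ≤ cs * naiveServer P.sq n m l T) :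
    Efficient R P m l T cc cs := by
  have hB := h.B_nonneg
  have hν := h.one_le_ν
  have hn := h.one_le_n
  intro A B
  rw [h.dim_zero]
  constructor
  · intro srv
    refine (expect_fullRun_le srv A B T).trans ?_
    refine le_trans ?_ (ENNReal.ofReal_le_ofReal hc)
    rw [ENNReal.ofReal_add (by positivity) (by positivity), ENNReal.ofReal_mul (p := (T : ℝ))
      (by positivity), ENNReal.ofReal_natCast]
    gcongr
    · exact h.Ex_setupCost_le m
    · exact h.Ex_stepCost_le m l
  · intro o ho
    have h₁ := (fullRun_ledger A B T o ho).1
    rw [h₁]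
    refine le_trans (le_of_eq ?_) hs
    unfold setupWork
    push_cast
    ring

lemma client_le_naive (h : CostBounds P n δ ε ν ω B) {m : ℕ} (l T : ℕ) {g C : ℝ}
    (hg : 1 ≤ g) (hm : (n : ℝ) ≤ g * m) (hC : 35 * B ^ 3 * (1 + g) ≤ C) :
    35 * B ^ 3 * (n * (m + n) * ((n : ℝ) ^ ε + ν ^ (ω - 2))) +
      T * (21 * B ^ 3 * ((m + n) * l * ((n : ℝ) ^ ε + ν))) ≤
      C * ((n : ℝ) ^ ε + ν) * naiveClient n m l T := by
  have hB := h.B_nonneg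
  have hν := h.one_le_ν
  have hν0 : 0 ≤ ν := by linarith
  have hV := rpow_le_self_of_one_le h.le_three h.one_le_ν
  have h₁ : (m : ℝ) + n ≤ (1 + g) * m := by linarith
  calc _ ≤ 35 * B ^ 3 * (n * ((1 + g) * m) * ((n : ℝ) ^ ε + ν)) +
        T * (35 * B ^ 3 * (((1 + g) * (m + n)) * l * ((n : ℝ) ^ ε + ν))) := by
        have h₂ : (m : ℝ) + n ≤ (1 + g) * (m + n) :=
          le_mul_of_one_le_left (by positivity) (by linarith)
        gcongr
        norm_num
    _ = 35 * B ^ 3 * (1 + g) * (((n : ℝ) ^ ε + ν) * naiveClient n m l T) := by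
        unfold naiveClient inputSize outputSize
        push_cast
        ring
    _ ≤ C * (((n : ℝ) ^ ε + ν) * naiveClient n m l T) := by gcongr
    _ = _ := by ring

lemma sideCost_le (h : CostBounds P n δ ε ν ω B) {a g : ℝ} (ha : 0 ≤ a) (hg : 1 ≤ g)
    (hn : (n : ℝ) ≤ g * a) : sideCost n δ ω a ≤ g * (a * n * (δ * n) ^ (ω - 2)) := by
  have hD := h.δn_pos
  have h₁ : δ * n ≤ n := mul_le_of_le_one_left (by positivity) h.δ_lt.le
  have h₂ : max a (δ * n) ≤ g * a :=
    max_le (le_mul_of_one_le_left ha hg) (h₁.trans hn)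
  have h₃ : min a (δ * n) ^ (ω - 2) ≤ (δ * n) ^ (ω - 2) :=
    Real.rpow_le_rpow (le_min ha hD.le) (min_le_right _ _) (by linarith [h.two_le])
  unfold sideCost
  calc _ ≤ n * (g * a) * (δ * n) ^ (ω - 2) := by
        have : 0 ≤ min a (δ * n) := le_min ha hD.le
        gcongr
    _ = _ := by ring

lemma setupWork_le_of_le (h : CostBounds P n δ ε ν ω B) {m : ℕ} {g : ℝ} (hg : 1 ≤ g)
    (hm : (n : ℝ) ≤ g * m) :
    (setupWork P m : ℝ) ≤ 10 * B ^ 4 * g * (m * n * (δ * n) ^ (ω - 2)) := by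
  have hB := h.B_nonneg
  have hD := h.δn_pos
  have h₁ := h.sideCost_le (by positivity : (0 : ℝ) ≤ m) hg hm
  have h₂ : tableCost n δ ω ≤ g * (m * n * (δ * n) ^ (ω - 2)) := by
    have : δ * n ≤ g * m := (mul_le_of_le_one_left (by positivity) h.δ_lt.le).trans hm
    unfold tableCost
    calc _ ≤ n * (g * m) * (δ * n) ^ (ω - 2) := by gcongr
      _ = _ := by ring
  have h₃ := h.setupWork_le m
  have h₄ := mul_le_mul_of_nonneg_left (add_le_add h₂ h₁) (by positivity : 0 ≤ 5 * B ^ 4)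
  linarith

/-- A bound for the additional work of the server in terms of the multiplications of the
unprotected protocol. -/
lemma server_le_naive (h : CostBounds P n δ ε ν ω B) {m l T : ℕ} {C x c : ℝ}
    (hC : 0 ≤ C) (hx : 0 ≤ x) (hCc : c ≤ C)
    (hle : (setupWork P m : ℝ) + T * (3 * B ^ 4 * sideCost n δ ω l) ≤
      c * x * (T * mulCost P.sq m n l)) :
    (setupWork P m : ℝ) + T * stepWork P m l ≤ (1 + C * x) * naiveServer P.sq n m l T := by
  have h₁ := mul_le_mul_of_nonneg_left (h.stepWork_le m l) (by positivity : (0 : ℝ) ≤ T)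
  have h₂ : (T : ℝ) * mulCost P.sq m n l ≤ naiveServer P.sq n m l T := by
    unfold naiveServer naiveStep
    push_cast
    have h₃ : (0 : ℝ) ≤ m * n := by positivity
    have h₄ : (0 : ℝ) ≤ T * (n * l) := by positivity
    have h₅ : (0 : ℝ) ≤ T * (m * l) := by positivity
    linarith
  have h₆ : c * x * (T * mulCost P.sq m n l) ≤ C * x * naiveServer P.sq n m l T := by
    have : 0 ≤ C * x := by positivity
    calc _ ≤ C * x * (T * mulCost P.sq m n l) := by gcongr
      _ ≤ _ := by gcongr
  have h₇ : (m : ℝ) * n + T * naiveStep P.sq n m l = naiveServer P.sq n m l T := by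
    unfold naiveServer
    push_cast
    ring
  have h₈ : (0 : ℝ) ≤ m * n := by positivity
  linarith

lemma server_matrix_le (h : CostBounds P n δ ε ν ω B) {m l : ℕ} (hm : 1 ≤ m) (hl : 1 ≤ l)
    {g c₁ C : ℝ} (hg : 1 ≤ g) (hgm : (n : ℝ) ≤ g * m) (hgl : (n : ℝ) ≤ g * l) (hc₁ : 0 < c₁)
    (hsq : ∀ k : ℕ, 1 ≤ k → c₁ * (k : ℝ) ^ ω ≤ P.sq k) (hC : 13 * B ^ 4 * g ^ 2 / c₁ ≤ C) :
    (setupWork P m : ℝ) + (1 : ℕ) * stepWork P m l ≤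
      (1 + C * δ ^ (ω - 2)) * naiveServer P.sq n m l 1 := by
  have hB := h.B_nonneg
  have hδ := h.δ_pos
  have hn := h.one_le_n
  refine h.server_le_naive (le_trans (by positivity) hC) (by positivity) hC ?_
  have h₁ := h.setupWork_le_of_le hg hgm
  have h₂ := mul_le_mul_of_nonneg_left (h.sideCost_le (by positivity : (0 : ℝ) ≤ l) hg hgl)
    (by positivity : 0 ≤ 3 * B ^ 4)
  have e : (δ * n) ^ (ω - 2) = δ ^ (ω - 2) * (n : ℝ) ^ (ω - 2) :=
    Real.mul_rpow hδ.le (by positivity)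
  rw [e] at h₁ h₂
  have h₃ : c₁ * (m * (n : ℝ) ^ (ω - 2) * l) ≤ mulCost P.sq m n l := by
    refine le_trans (mul_le_mul_of_nonneg_left ?_ hc₁.le)
      (mm_le_mulCost h.le_three hc₁.le hsq hm h.n_pos hl)
    exact le_max_of_le_right (le_max_left _ _)
  set N := (n : ℝ) ^ (ω - 2) with hN
  have hN0 : 0 ≤ N := by positivity
  set d := δ ^ (ω - 2) with hd
  have h₄ : (m : ℝ) * n * (d * N) ≤ g * d * (m * N * l) := by
    calc (m : ℝ) * n * (d * N) ≤ m * (g * l) * (d * N) := by gcongr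
      _ = _ := by ring
  have h₅ : (l : ℝ) * n * (d * N) ≤ g * d * (m * N * l) := by
    calc (l : ℝ) * n * (d * N) ≤ l * (g * m) * (d * N) := by gcongr
      _ = _ := by ring
  have h₆ := mul_le_mul_of_nonneg_left h₄ (by positivity : 0 ≤ 10 * B ^ 4 * g)
  have h₇ := mul_le_mul_of_nonneg_left h₅ (by positivity : 0 ≤ 3 * B ^ 4 * g)
  have h₈ := mul_le_mul_of_nonneg_left h₃ (by positivity : 0 ≤ 13 * B ^ 4 * g ^ 2 / c₁ * d)
  have e₂ : 13 * B ^ 4 * g ^ 2 / c₁ * d * (c₁ * (m * N * l)) =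
      13 * B ^ 4 * g ^ 2 * d * (m * N * l) := by
    field_simp
  push_cast
  linarith

lemma server_vector_le (h : CostBounds P n δ ε ν ω B) {m l T : ℕ} (hm : 1 ≤ m) (hl : l = 1)
    (hT : 1 ≤ T) {g c₁ C κ x : ℝ} (hg : 1 ≤ g) (hgm : (n : ℝ) ≤ g * m) (hc₁ : 0 < c₁)
    (hsq : ∀ k : ℕ, 1 ≤ k → c₁ * (k : ℝ) ^ ω ≤ P.sq k) (hκ : 0 ≤ κ)
    (hx : δ ^ (ω - 2) + (δ * n) ^ (ω - 2) / T ≤ (1 + κ) * x)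
    (hC : 13 * B ^ 5 * g * (1 + κ) / c₁ ≤ C) :
    (setupWork P m : ℝ) + T * stepWork P m l ≤ (1 + C * x) * naiveServer P.sq n m l T := by
  subst hl
  have hB := h.B_nonneg
  have hB1 := h.one_le
  have hδ := h.δ_pos
  have hn := h.one_le_n
  have hD := h.δn_pos
  have hω := h.two_le
  have hT' : (0 : ℝ) < T := by exact_mod_cast hT
  have hx0 : 0 ≤ x := by
    have : 0 ≤ (1 + κ) * x := le_trans (by positivity) hx
    exact nonneg_of_mul_nonneg_right this (by linarith)
  refine h.server_le_naive (le_trans (by positivity) hC) hx0 hC ?_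
  have h₁ := h.setupWork_le_of_le hg hgm
  have h₂ : sideCost n δ ω (1 : ℕ) ≤ B * g * (m * n * δ ^ (ω - 2)) := by
    have f₁ : max 1 (δ * n) ≤ B * (δ * n) :=
      max_le h.one_le_δ (le_mul_of_one_le_left hD.le h.one_le)
    have f₂ : min 1 (δ * n) ^ (ω - 2) ≤ 1 :=
      Real.rpow_le_one (le_min zero_le_one hD.le) (min_le_left _ _) (by linarith)
    have f₃ : δ ≤ δ ^ (ω - 2) := by
      calc δ = δ ^ (1 : ℝ) := (Real.rpow_one δ).symm
        _ ≤ _ := Real.rpow_le_rpow_of_exponent_ge hδ h.δ_lt.le (by linarith [h.le_three])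
    have f₄ : 0 ≤ min 1 (δ * n) := le_min zero_le_one hD.le
    unfold sideCost
    rw [Nat.cast_one]
    calc _ ≤ n * (B * (δ * n)) * 1 := by gcongr
      _ ≤ n * (B * (δ ^ (ω - 2) * (g * m))) * 1 := by gcongr
      _ = _ := by ring
  have h₃ : c₁ * (m * n) ≤ mulCost P.sq m n 1 := by
    refine le_trans (mul_le_mul_of_nonneg_left ?_ hc₁.le)
      (mm_le_mulCost h.le_three hc₁.le hsq hm h.n_pos le_rfl)
    refine le_max_of_le_right (le_max_of_le_right ?_)
    simp
  set d := δ ^ (ω - 2) with hd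
  set D := (δ * n) ^ (ω - 2) with hDdef
  have hd0 : 0 ≤ d := by positivity
  have hD0 : 0 ≤ D := by positivity
  have hBB : B ^ 4 ≤ B ^ 5 := pow_le_pow_right₀ hB1 (by norm_num)
  have h₄ : 10 * B ^ 4 * g * (m * n * D) ≤ 13 * B ^ 5 * g * (m * n * D) := by gcongr; norm_num
  have h₅ : T * (3 * B ^ 4 * sideCost n δ ω (1 : ℕ)) ≤ T * (13 * B ^ 5 * g * (m * n * d)) := by
    calc _ ≤ T * (3 * B ^ 4 * (B * g * (m * n * d))) := by gcongr
      _ = T * (3 * B ^ 5 * g * (m * n * d)) := by ring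
      _ ≤ _ := by gcongr; norm_num
  have h₆ : 13 * B ^ 5 * g * (m * n * D) + T * (13 * B ^ 5 * g * (m * n * d)) =
      13 * B ^ 5 * g * (m * n) * T * (d + D / T) := by
    field_simp
    ring
  have h₇ := mul_le_mul_of_nonneg_left hx (by positivity : 0 ≤ 13 * B ^ 5 * g * (m * n) * T)
  have h₈ := mul_le_mul_of_nonneg_left h₃
    (by positivity : 0 ≤ 13 * B ^ 5 * g * (1 + κ) / c₁ * x * T)
  have e₂ : 13 * B ^ 5 * g * (1 + κ) / c₁ * x * T * (c₁ * (m * n)) =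
      13 * B ^ 5 * g * (m * n) * T * ((1 + κ) * x) := by
    field_simp
  calc _ ≤ 13 * B ^ 5 * g * (m * n * D) + T * (13 * B ^ 5 * g * (m * n * d)) :=
        add_le_add (h₁.trans h₄) h₅
    _ ≤ 13 * B ^ 5 * g * (1 + κ) / c₁ * x * T * mulCost P.sq m n 1 := by
        rw [h₆]
        exact h₇.trans (e₂ ▸ h₈)
    _ = _ := by ring

lemma amortized_of_rpow_le (h : CostBounds P n δ ε ν ω B) {T : ℕ} {κ : ℝ}
    (hT : (n : ℝ) ^ (ω - 2) ≤ κ * T) :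
    1 ≤ T ∧ δ ^ (ω - 2) + (δ * n) ^ (ω - 2) / T ≤ (1 + κ) * δ ^ (ω - 2) := by
  have hδ := h.δ_pos
  have hn := h.one_le_n
  have h₁ : 1 ≤ (n : ℝ) ^ (ω - 2) := Real.one_le_rpow hn (by linarith [h.two_le])
  have hT1 : 1 ≤ T := by
    rcases Nat.eq_zero_or_pos T with rfl | hT'
    · rw [Nat.cast_zero, mul_zero] at hT
      linarith
    · exact hT'
  have hT' : (0 : ℝ) < T := by exact_mod_cast hT1
  refine ⟨hT1, ?_⟩
  rw [Real.mul_rpow hδ.le (by positivity)]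
  have h₂ : δ ^ (ω - 2) * (n : ℝ) ^ (ω - 2) / T ≤ δ ^ (ω - 2) * κ := by
    rw [div_le_iff₀ hT', mul_assoc]
    gcongr
  linarith

lemma amortized_of_le (h : CostBounds P n δ ε ν ω B) {T : ℕ} {κ : ℝ} (hκ : 0 ≤ κ)
    (hδκ : 1 ≤ κ * δ) (hT : max ((n : ℝ) ^ ε) ((δ * n) ^ (ω - 2)) ≤ T) :
    1 ≤ T ∧ δ ^ (ω - 2) + (δ * n) ^ (ω - 2) / T ≤ (1 + κ) * δ ^ (ω - 2) := by
  have hδ := h.δ_pos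
  have h₁ : (1 : ℝ) ≤ T := h.one_le_rpow.trans ((le_max_left _ _).trans hT)
  refine ⟨by exact_mod_cast h₁, ?_⟩
  have h₂ : (δ * n) ^ (ω - 2) / T ≤ 1 :=
    div_le_one_of_le₀ ((le_max_right _ _).trans hT) (by linarith)
  have f₃ : δ ≤ δ ^ (ω - 2) := by
    calc δ = δ ^ (1 : ℝ) := (Real.rpow_one δ).symm
      _ ≤ _ := Real.rpow_le_rpow_of_exponent_ge hδ h.δ_lt.le (by linarith [h.le_three])
  have := mul_le_mul_of_nonneg_left f₃ hκ
  linarith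

lemma costs (h : CostBounds P n δ ε ν ω B) {m : ℕ} (hm : 1 ≤ m) (l T : ℕ) {C : ℝ}
    (hC : 35 * B ^ 5 ≤ C) (A : Matrix (Fin m) (Fin (P.dim 0)) R)
    (Bs : ℕ → Matrix (Fin (P.dim 0)) (Fin l) R) :
    (∀ srv : Server R P m l, expect (initRun srv A) (fun o => o.2.ledger.client) ≤
      ENNReal.ofReal (C * (n * (m + n) * ((n : ℝ) ^ ε + ν ^ (ω - 2))))) ∧
    (∀ o ∈ (initRun (honestServer R P m l) A).support,
      (o.2.ledger.server : ℝ) ≤ C * ((n : ℝ) ^ ω * δ ^ (ω - 1) +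
        n * max (m : ℝ) (δ * n) * min (m : ℝ) (δ * n) ^ (ω - 2))) ∧
    (∀ (srv : Server R P m l) (k : ℕ),
      expect (stepRun srv A Bs k) (fun o => o.2.ledger.client) ≤
        ENNReal.ofReal (C * ((m + n) * l * ((n : ℝ) ^ ε + ν)))) ∧
    (∀ k : ℕ, ∀ o ∈ (stepRun (honestServer R P m l) A Bs k).support,
      (o.2.ledger.server : ℝ) ≤ naiveStep P.sq n m l +
        C * (n * max (δ * n) (l : ℝ) * min (δ * n) (l : ℝ) ^ (ω - 2))) ∧
    (∀ o ∈ (fullRun (honestServer R P m l) A Bs T).support,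
      (o.2.ledger.up : ℝ) ≤ (1 + C * (δ * n / (m + T * l))) * inputSize n m l T ∧
      (o.2.ledger.up + o.2.ledger.down : ℝ) ≤ inputSize n m l T + outputSize m l T +
        C * (δ + δ * n / (m + T * l)) * inputSize n m l T) := by
  have hB := h.one_le
  have hB0 := h.B_nonneg
  have hB1 : B ≤ B ^ 5 := le_self_pow₀ hB (by norm_num)
  have hB2 : B ^ 2 ≤ B ^ 5 := pow_le_pow_right₀ hB (by norm_num)
  have hB3 : B ^ 3 ≤ B ^ 5 := pow_le_pow_right₀ hB (by norm_num)
  have hB4 : B ^ 4 ≤ B ^ 5 := pow_le_pow_right₀ hB (by norm_num)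
  have hB5 : 0 ≤ B ^ 5 := by positivity
  have hν1 := h.one_le_ν
  have hν0 : 0 ≤ ν := by linarith
  refine ⟨fun srv => ?_, fun o ho => ?_, fun srv k => ?_, fun k o ho => ?_, fun o ho => ?_⟩
  · refine (expect_initRun_le srv A).trans ((h.Ex_setupCost_le m).trans ?_)
    refine ENNReal.ofReal_le_ofReal (mul_le_mul_of_nonneg_right ?_ (by positivity))
    linarith
  · have h₁ : o.2.ledger.server = setupWork P m := initRun_server A o ho
    rw [h₁, ← h.tableCost_eq]
    refine (h.setupWork_le m).trans (mul_le_mul_of_nonneg_right (by linarith) ?_)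
    exact add_nonneg h.tableCost_nonneg (h.sideCost_nonneg (by positivity))
  · refine (expect_stepRun_le srv A Bs k).trans ((h.Ex_stepCost_le m l).trans ?_)
    refine ENNReal.ofReal_le_ofReal (mul_le_mul_of_nonneg_right ?_ (by positivity))
    linarith
  · have h₁ : o.2.ledger.server = stepWork P m l := stepRun_server A Bs k o ho
    rw [h₁, max_comm, min_comm]
    refine (h.stepWork_le m l).trans (add_le_add le_rfl ?_)
    exact mul_le_mul_of_nonneg_right (by linarith) (h.sideCost_nonneg (by positivity))
  · obtain ⟨-, h₁, h₂⟩ := fullRun_ledger A Bs T o ho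
    rw [h₁, h₂]
    exact ⟨h.upWords_le hm l T (by linarith), h.upWords_add_downWords_le hm l T (by linarith)⟩

lemma efficiency (h : CostBounds P n δ ε ν ω B) {m l T : ℕ} (hm : 1 ≤ m) (hl : 1 ≤ l)
    {κ γ c₁ C : ℝ} (hκ : 1 ≤ κ) (hγ : 0 < γ) (hc₁ : 0 < c₁)
    (hsq : ∀ k : ℕ, 1 ≤ k → c₁ * (k : ℝ) ^ ω ≤ P.sq k)
    (hC₁ : 35 * B ^ 3 * (1 + (1 + 1 / γ)) ≤ C) (hC₂ : 13 * B ^ 4 * (1 + 1 / γ) ^ 2 / c₁ ≤ C)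
    (hC₃ : 13 * B ^ 5 * (1 + 1 / γ) * (1 + κ) / c₁ ≤ C) (hγm : γ * n ≤ m) :
    (γ * n ≤ l → Efficient R P m l 1 (C * ((n : ℝ) ^ ε + ν)) (1 + C * δ ^ (ω - 2))) ∧
    (l = 1 → 1 ≤ T → Efficient R P m l T (C * ((n : ℝ) ^ ε + ν))
      (1 + C * (δ ^ (ω - 2) + (δ * n) ^ (ω - 2) / T))) ∧
    (l = 1 → (n : ℝ) ^ (ω - 2) ≤ κ * T →
      Efficient R P m l T (C * ((n : ℝ) ^ ε + ν)) (1 + C * δ ^ (ω - 2))) ∧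
    (l = 1 → 1 ≤ κ * δ → max ((n : ℝ) ^ ε) ((δ * n) ^ (ω - 2)) ≤ T →
      Efficient R P m l T (C * ((n : ℝ) ^ ε + ν)) (1 + C * δ ^ (ω - 2))) := by
  have hg : 1 ≤ 1 + 1 / γ := by
    have : 0 ≤ 1 / γ := by positivity
    linarith
  have hle : ∀ a : ℕ, γ * n ≤ a → (n : ℝ) ≤ (1 + 1 / γ) * a := by
    intro a ha
    have h₁ : (n : ℝ) ≤ a / γ := by
      rw [le_div_iff₀ hγ]
      linarith
    have h₂ : (1 + 1 / γ) * (a : ℝ) = a + a / γ := by ring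
    have h₃ : (0 : ℝ) ≤ a := by positivity
    linarith
  have hvec : ∀ x : ℝ, l = 1 →
      (1 ≤ T ∧ δ ^ (ω - 2) + (δ * n) ^ (ω - 2) / T ≤ (1 + κ) * x) →
      Efficient R P m l T (C * ((n : ℝ) ^ ε + ν)) (1 + C * x) := fun x hl₁ hx =>
    h.efficient_of_le (h.client_le_naive l T hg (hle m hγm) hC₁)
      (h.server_vector_le hm hl₁ hx.1 hg (hle m hγm) hc₁ hsq (by linarith) hx.2 hC₃)
  refine ⟨fun hγl => ?_, fun hl₁ hT => ?_, fun hl₁ hT => ?_, fun hl₁ hκδ hT => ?_⟩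
  · exact h.efficient_of_le (h.client_le_naive l 1 hg (hle m hγm) hC₁)
      (h.server_matrix_le hm hl hg (hle m hγm) (hle l hγl) hc₁ hsq hC₂)
  · refine hvec _ hl₁ ⟨hT, le_mul_of_one_le_left ?_ (by linarith)⟩
    have := h.δn_pos
    have := h.δ_pos
    positivity
  · exact hvec _ hl₁ (h.amortized_of_rpow_le hT)
  · exact hvec _ hl₁ (h.amortized_of_le (by linarith) hκδ hT)

end CostBounds

/-- The constant in the cost estimates, in terms of the one in `CostBounds`. -/
def costConst (B κ γ c₁ : ℝ) : ℝ := 35 * B ^ 5 * (1 + κ) * (2 + 1 / γ) ^ 2 * (1 + 1 / c₁)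

lemma costConst_ge {B κ γ c₁ : ℝ} (hB : 1 ≤ B) (hκ : 1 ≤ κ) (hγ : 0 < γ) (hc₁ : 0 < c₁) :
    35 * B ^ 5 ≤ costConst B κ γ c₁ ∧
      35 * B ^ 3 * (1 + (1 + 1 / γ)) ≤ costConst B κ γ c₁ ∧
      13 * B ^ 4 * (1 + 1 / γ) ^ 2 / c₁ ≤ costConst B κ γ c₁ ∧
      13 * B ^ 5 * (1 + 1 / γ) * (1 + κ) / c₁ ≤ costConst B κ γ c₁ := by
  have hB0 : 0 ≤ B := by linarith
  have hu : 1 ≤ 2 + 1 / γ := by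
    have : 0 ≤ 1 / γ := by positivity
    linarith
  have hv : 1 ≤ 1 + 1 / c₁ := by
    have : 0 ≤ 1 / c₁ := by positivity
    linarith
  have hB3 : B ^ 3 ≤ B ^ 5 := pow_le_pow_right₀ hB (by norm_num)
  have hB4 : B ^ 4 ≤ B ^ 5 := pow_le_pow_right₀ hB (by norm_num)
  have hu2 : 2 + 1 / γ ≤ (2 + 1 / γ) ^ 2 := le_self_pow₀ hu (by norm_num)
  have hg : 1 + 1 / γ ≤ 2 + 1 / γ := by linarith
  have hv' : 1 / c₁ ≤ 1 + 1 / c₁ := by linarith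
  have hκ' : 1 ≤ 1 + κ := by linarith
  unfold costConst
  refine ⟨?_, ?_, ?_, ?_⟩
  · calc 35 * B ^ 5 = 35 * B ^ 5 * 1 * 1 ^ 2 * 1 := by ring
      _ ≤ _ := by gcongr
  · calc 35 * B ^ 3 * (1 + (1 + 1 / γ)) = 35 * B ^ 3 * 1 * (2 + 1 / γ) * 1 := by ring
      _ ≤ _ := by gcongr
  · calc 13 * B ^ 4 * (1 + 1 / γ) ^ 2 / c₁ = 13 * B ^ 4 * 1 * (1 + 1 / γ) ^ 2 * (1 / c₁) := by ring
      _ ≤ _ := by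
        gcongr
        norm_num
  · calc 13 * B ^ 5 * (1 + 1 / γ) * (1 + κ) / c₁ =
          13 * B ^ 5 * (1 + κ) * (1 + 1 / γ) * (1 / c₁) := by ring
      _ ≤ 13 * B ^ 5 * (1 + κ) * (2 + 1 / γ) * (1 / c₁) := by gcongr
      _ ≤ _ := by
        gcongr
        norm_num

end Delegation

end

theorem theorem1 :
    ∃ K : ℕ, ∀ ω c₁ c₂ ε δ₀ κ ρ γ : ℝ,
      2 ≤ ω → ω ≤ 3 → 0 < c₁ → 0 < ε → ε < 1 → δ₀ < 1 → 1 ≤ κ → 0 < γ →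
      ∃ C : ℝ, 0 < C ∧
        ∀ (R : Type) [CommRing R] [Fintype R] [Nontrivial R] (sq : ℕ → ℕ),
          (∀ k, Delegation.CanMultiply R k (sq k)) →
          (∀ k : ℕ, 1 ≤ k → c₁ * (k : ℝ) ^ ω ≤ sq k ∧ (sq k : ℝ) ≤ c₂ * (k : ℝ) ^ ω) →
          Real.logb 2 (Fintype.card R) ≤ ρ * Real.logb 2 (Delegation.minIdealCard R) →
          ∀ δ : ℝ, 0 < δ → δ ≤ δ₀ → Delegation.LPNAssumption R δ ε →
          ∀ lam n m l T s : ℕ, 1 ≤ n → 1 ≤ m → 1 ≤ l →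
            let size : ℕ := (n + m + T * l + lam + s + 2) ^ K
            let t : ℕ := m + T * l
            let ν : ℝ := Delegation.nu R δ ε lam n t size
            let P : Delegation.Params := Delegation.params R sq δ ε lam n t size
            let honest : Delegation.Server R P m l := Delegation.honestServer R P m l
            -- `ι` is well defined
            IsLeast (Delegation.secureDims R δ ε (Delegation.lpnBits δ lam n) t size)
              (Delegation.iota R δ ε (Delegation.lpnBits δ lam n) t size) ∧
            -- security, correctness and rounds
            Delegation.ZeroKnowledge R P m l T s lam ∧
            Delegation.ExactOutput R P m l ∧
            Delegation.SoundInitialization R P m l lam ∧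
            Delegation.TwoPlusOneRounds R P m l ∧
            (ν ≤ κ * (δ * n) →
              ∀ (A : Matrix (Fin m) (Fin n) R) (B : ℕ → Matrix (Fin n) (Fin l) R),
                -- initialization, client and server
                (∀ srv : Delegation.Server R P m l,
                  Delegation.expect (Delegation.initRun srv A) (fun o => o.2.ledger.client) ≤
                    ENNReal.ofReal (C * (n * (m + n) * ((n : ℝ) ^ ε + ν ^ (ω - 2))))) ∧
                (∀ o ∈ (Delegation.initRun honest A).support,
                  (o.2.ledger.server : ℝ) ≤
                    C * ((n : ℝ) ^ ω * δ ^ (ω - 1) +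
                      n * max (m : ℝ) (δ * n) * min (m : ℝ) (δ * n) ^ (ω - 2))) ∧
                -- one online step, client and server
                (∀ (srv : Delegation.Server R P m l) (k : ℕ),
                  Delegation.expect (Delegation.stepRun srv A B k) (fun o => o.2.ledger.client) ≤
                    ENNReal.ofReal (C * ((m + n) * l * ((n : ℝ) ^ ε + ν)))) ∧
                (∀ k : ℕ, ∀ o ∈ (Delegation.stepRun honest A B k).support,
                  (o.2.ledger.server : ℝ) ≤ Delegation.naiveStep sq n m l +
                    C * (n * max (δ * n) (l : ℝ) * min (δ * n) (l : ℝ) ^ (ω - 2))) ∧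
                -- communication: to the server, and in both directions
                (∀ o ∈ (Delegation.fullRun honest A B T).support,
                  (o.2.ledger.up : ℝ) ≤
                    (1 + C * (δ * n / (m + T * l))) * Delegation.inputSize n m l T ∧
                  (o.2.ledger.up + o.2.ledger.down : ℝ) ≤
                    Delegation.inputSize n m l T + Delegation.outputSize m l T +
                      C * (δ + δ * n / (m + T * l)) * Delegation.inputSize n m l T)) ∧
            (ν ≤ κ * (δ * n) → γ * n ≤ m →
              -- Matrix-Matrix
              (γ * n ≤ l →
                Delegation.Efficient R P m l 1 (C * ((n : ℝ) ^ ε + ν)) (1 + C * δ ^ (ω - 2))) ∧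
              -- Matrix-Vectors, amortized over `T` steps
              (l = 1 → 1 ≤ T →
                Delegation.Efficient R P m l T (C * ((n : ℝ) ^ ε + ν))
                  (1 + C * (δ ^ (ω - 2) + (δ * n) ^ (ω - 2) / T))) ∧
              (l = 1 → (n : ℝ) ^ (ω - 2) ≤ κ * T →
                Delegation.Efficient R P m l T (C * ((n : ℝ) ^ ε + ν)) (1 + C * δ ^ (ω - 2))) ∧
              (l = 1 → 1 ≤ κ * δ → max ((n : ℝ) ^ ε) ((δ * n) ^ (ω - 2)) ≤ T →
                Delegation.Efficient R P m l T (C * ((n : ℝ) ^ ε + ν)) (1 + C * δ ^ (ω - 2)))) := by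
  refine ⟨38, fun ω c₁ c₂ ε δ₀ κ ρ γ hω hω' hc₁ hε₀ hε₁ hδ₀₁ hκ hγ => ?_⟩
  set B := Delegation.boundConst δ₀ ε κ (1 / (Real.log 2 * (1 - 2 ^ (ε - 1))) + 1) c₂
  refine ⟨max 1 (Delegation.costConst B κ γ c₁), by positivity, ?_⟩
  set C := max 1 (Delegation.costConst B κ γ c₁) with hC
  intro R _ _ _ sq _ hsq _ δ hδ₀ hδ hLPN lam n m l T s hn hm hl size t ν P honest
  have hδ₁ : δ < 1 := by linarith
  have hc₂ : 0 ≤ c₂ := by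
    have h := hsq 1 le_rfl
    rw [Nat.cast_one, Real.one_rpow, mul_one, mul_one] at h
    linarith
  have hbounds : ν ≤ κ * (δ * n) → Delegation.CostBounds P n δ ε ν ω B := fun hν =>
    Delegation.costBounds_params hω hω' hε₀ hε₁ hδ₀ hδ hδ₀₁ hκ hLPN hc₂ (fun k hk => (hsq k hk).2)
      (Z := n + m + T * l + lam + s + 2) (by omega) (by omega : 0 < t)
      (by omega : m + T * l ≤ _) hn (by omega) (Nat.pow_le_pow_right (by omega) (by norm_num)) hν
  have hconst : 1 ≤ B → 35 * B ^ 5 ≤ C ∧ 35 * B ^ 3 * (1 + (1 + 1 / γ)) ≤ C ∧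
      13 * B ^ 4 * (1 + 1 / γ) ^ 2 / c₁ ≤ C ∧ 13 * B ^ 5 * (1 + 1 / γ) * (1 + κ) / c₁ ≤ C := by
    intro hB
    obtain ⟨h₁, h₂, h₃, h₄⟩ := Delegation.costConst_ge hB hκ hγ hc₁
    have h₅ : Delegation.costConst B κ γ c₁ ≤ C := le_max_right _ _
    exact ⟨h₁.trans h₅, h₂.trans h₅, h₃.trans h₅, h₄.trans h₅⟩
  refine ⟨Delegation.isLeast_iota hδ₀ hδ₁ hLPN t size,
    Delegation.zeroKnowledge_params hδ₀ hδ₁ hε₁ hLPN hn hm le_rfl rfl rfl,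
    Delegation.exactOutput, Delegation.soundInitialization_params hδ₀ hδ₁ m l,
    Delegation.twoPlusOneRounds, fun hν A Bs => ?_, fun hν hγm => ?_⟩
  · have h := hbounds hν
    exact h.costs hm l T (hconst h.one_le).1 A Bs
  · have h := hbounds hν
    obtain ⟨-, hC₁, hC₂, hC₃⟩ := hconst h.one_le
    exact h.efficiency hm hl hκ hγ hc₁ (fun k hk => (hsq k hk).1) hC₁ hC₂ hC₃ hγm
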